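/- **Conventions.** Let $\mathcal B$ be a braided rigid category with braiding $\tau_{X,Y}\colon X\otimes Y\to Y\otimes X$ (associativity and unit constraints are suppressed), and let $(A,m,u,\Delta,\varepsilon,S)$ be a Hopf algebra in $\mathcal B$ with invertible antipode. Write ${}^\vee\!A$ for the dual of $A$ with $\mathrm{ev}\colon {}^\vee\!A\otimes A\to\mathbb 1$ and $\mathrm{coev}\colon \mathbb 1\to A\otimes{}^\vee\!A$, and $1_X$ for an identity. The centre $\mathcal Z(\mathcal C)$ of a monoidal category $\mathcal C$ has as objects the pairs $(M,\sigma)$, with $\sigma_X\colon M\otimes X\to X\otimes M$ a natural isomorphism in $X$ satisfying $\sigma_{X\otimes Y}=(1_X\otimes\sigma_Y)(\sigma_X\otimes 1_Y)$; its braiding is $\tau_{(M,\sigma),(N,\omega)}=\sigma_N$. The category $\mathcal B_A$ of right $A$-modules is monoidal with $(M,r)\otimes(N,s)=(M\otimes N,\ (r\otimes s)(1_M\otimes\tau_{N,A}\otimes 1_A)(1_{M\otimes N}\otimes\Delta))$ and unit $(\mathbb 1,\varepsilon)$. The functor $\mathcal U\colon\mathcal Z(\mathcal B_A)\to\mathcal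 Z(\mathcal B)$ is $\mathcal U((M,r),\gamma)=(M,\{\gamma_{(X,1_X\otimes\varepsilon)}\}_X)$, $\mathcal U(f)=f$; it is strict monoidal. A *Hopf monad* is a monad $T$ together with comonoidal structure $T_2(X,Y)\colon T(X\otimes Y)\to TX\otimes TY$, $T_0\colon T\mathbb 1\to\mathbb 1$ for which the product $\mu$ and the unit $\eta$ are comonoidal, and such that the fusion operators $(1_{TX}\otimes\mu_Y)T_2(X,TY)$ and $(\mu_X\otimes 1_{TY})T_2(TX,Y)$ are invertible. Then the category $\mathcal C^T$ of $T$-modules is monoidal and its forgetful functor $U_T$ is strict monoidal. An *R-matrix* for $T$ is a natural transformation $R_{X,Y}\colon X\otimes Y\to TY\otimes TX$, invertible for convolution, such that $$(\mu_Y\otimes\mu_X)R_{TX,TY}T_2(X,Y)=(\mu_Y\otimes\mu_X)T_2(TY,TX)T(R_{X,Y}),$$ $$(1_{TZ}\otimes T_2(X,Y))R_{X\otimes Y,Z}=(\mu_Z\otimes 1_{TX\otimes TY})(R_{X,TZ}\otimes 1_{TY})(1_X\otimes R_{Y,Z}),$$ $$(T_2(Y,Z)\otimes 1_{TX})R_{X,Y\otimes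 Z}=(1_{TY\otimes TZ}\otimes\mu_X)(1_{TY}\otimes R_{TX,Z})(R_{X,Y}\otimes 1_Z);$$ here convolution invertibility means that there is a natural $R'_{X,Y}\colon Y\otimes X\to TX\otimes TY$ with $(\mu_X\otimes\mu_Y)R'_{TX,TY}R_{X,Y}=\eta_X\otimes\eta_Y$ and $(\mu_Y\otimes\mu_X)R_{TX,TY}R'_{X,Y}=\eta_Y\otimes\eta_X$. It makes $\mathcal C^T$ braided by $\tau_{(M,r),(N,s)}=(s\otimes r)R_{M,N}$. A Hopf monad equipped with an R-matrix is *quasitriangular*. **The endofunctor.** $d_A(M,\sigma)=(M\otimes A\otimes{}^\vee\!A,\varsigma)$ with $\varsigma_X=(\sigma_X\otimes 1_{A\otimes{}^\vee\!A})(1_M\otimes\tau^{-1}_{X,A\otimes{}^\vee\!A})$, and $d_A(f)=f\otimes 1_{A\otimes{}^\vee\!A}$, on $\mathcal Z(\mathcal B)$. **Structural morphisms.** Put $e=(\varepsilon\otimes 1)\mathrm{coev}\colon\mathbb 1\to{}^\vee\!A$. Let $m'\colon{}^\vee\!A\otimes{}^\vee\!A\to{}^\vee\!A$ be the morphism with $\mathrm{ev}(m'\otimes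 1_A)=(\mathrm{ev}\otimes\mathrm{ev})(1\otimes\tau_{{}^\vee\!A,A}\otimes 1)(1\otimes 1\otimes\Delta)$, and let $\Delta'\colon{}^\vee\!A\to{}^\vee\!A\otimes{}^\vee\!A$ be the morphism with $\mathrm{ev}(1\otimes m)=\mathrm{ev}(1\otimes\mathrm{ev}\otimes 1)(\Delta'\otimes 1_{A\otimes A})$. For $(M,\sigma)$ in $\mathcal Z(\mathcal B)$ let $M\otimes A$ carry $\sigma^{M\otimes A}_X=(\sigma_X\otimes 1_A)(1_M\otimes\tau_{X,A}^{-1})$, and set $$\delta_M=(\sigma_A\otimes 1_{{}^\vee\!A})(1_M\otimes\mathrm{coev})\colon M\to A\otimes M\otimes{}^\vee\!A,$$ $$\varphi_M=(m\otimes 1)(1_A\otimes\delta_{M\otimes A})\,\sigma_A^{M\otimes A}(1_M\otimes\Delta)\colon M\otimes A\to A\otimes M\otimes A\otimes{}^\vee\!A,$$ where in $\varphi_M$ the coproduct gives $M\otimes A\otimes A$ and $\sigma^{M\otimes A}_A$ moves the last factor to the front; $$\theta_M=(m\otimes 1)(1_A\otimes\tau_{M\otimes A\otimes{}^\vee\!A,A})(\varphi_M\otimes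 S^{-1})(1_M\otimes\tau_{A,A}^{-1}\Delta)\colon M\otimes A\to A\otimes M\otimes A\otimes{}^\vee\!A,$$ $$\xi_M=(\mathrm{ev}\otimes 1)(1_{{}^\vee\!A}\otimes\theta_M)(\sigma_{{}^\vee\!A}\otimes 1_A)\colon M\otimes{}^\vee\!A\otimes A\to M\otimes A\otimes{}^\vee\!A.$$ The structural morphisms of $d_A$ are $$\mu_{(M,\sigma)}=(1_M\otimes 1_A\otimes m')(1_M\otimes m\otimes 1_{{}^\vee\!A\otimes{}^\vee\!A})(\xi_{M\otimes A}\otimes 1_{{}^\vee\!A}),\qquad \eta_{(M,\sigma)}=1_M\otimes u\otimes e,$$ $$(d_A)_2\bigl((M,\sigma),(N,\omega)\bigr)=(1_{M\otimes A}\otimes\omega^{N\otimes A}_{{}^\vee\!A}\otimes 1_{{}^\vee\!A})(1_{M\otimes A\otimes N\otimes A}\otimes\Delta')(1_M\otimes\tau_{N,A}\otimes 1)(1_{M\otimes N}\otimes\Delta\otimes 1_{{}^\vee\!A}),$$ $$(d_A)_0=\varepsilon\otimes\mathrm{ev}(1_{{}^\vee\!A}\otimes u),$$ $$R_{(M,\sigma),(N,\omega)}=(1_{N\otimes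 A}\otimes e\otimes 1_M\otimes u\otimes 1_{{}^\vee\!A})(\sigma_{N\otimes A}\otimes 1_{{}^\vee\!A})(1_{M\otimes N}\otimes\mathrm{coev}).$$ **Theorem.** The endofunctor $d_A$, with the product $\mu$, unit $\eta$, comonoidal structure $((d_A)_2,(d_A)_0)$ and R-matrix $R$ above, is a quasitriangular Hopf monad on $\mathcal Z(\mathcal B)$ (the *central double* of $A$). The functor $$\Psi\colon\mathcal Z(\mathcal B)^{d_A}\to\mathcal Z(\mathcal B_A),\qquad ((M,\sigma),\rho)\mapsto((M,r),\gamma),\quad f\mapsto f,$$ $$r=\rho(1_M\otimes 1_A\otimes e),\qquad \gamma_{(N,s)}=(s\otimes\rho)(1_{N\otimes A\otimes M}\otimes u\otimes 1_{{}^\vee\!A})(\sigma_{N\otimes A}\otimes 1_{{}^\vee\!A})(1_{M\otimes N}\otimes\mathrm{coev}),$$ is well defined and is a braided strict monoidal isomorphism of categories, where $\mathcal Z(\mathcal B)^{d_A}$ has the braiding defined by $R$. Its inverse is given by $f\mapsto f$ on morphisms and $((M,r),\gamma)\mapsto((M,\sigma),\rho)$ on objects, with $$\sigma_X=\gamma_{(X,1_X\otimes\varepsilon)},\qquad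 \rho=(\mathrm{ev}\,\tau_{{}^\vee\!A,A}^{-1}\otimes 1_M)\,\gamma_{(A\otimes{}^\vee\!A,\alpha)}\,(r\otimes u\otimes 1_{{}^\vee\!A}),\qquad \alpha=(m\otimes 1_{{}^\vee\!A})(1_A\otimes\tau_{{}^\vee\!A,A}).$$ Moreover $\mathcal U\Psi=U_{d_A}$ as monoidal functors. In particular $\mathcal U\colon\mathcal Z(\mathcal B_A)\to\mathcal Z(\mathcal B)$ is monadic. -/

import Mathlib

open CategoryTheory MonoidalCategory

universe v u v₁ u₁ v₂ u₂

noncomputable section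

/-! ## Strict monoidal functors -/

section StrictMonoidal

variable {C : Type u₁} [Category.{v₁} C] [MonoidalCategory C]
  {D : Type u₂} [Category.{v₂} D] [MonoidalCategory D]

/-- A monoidal functor is strict when its structure morphisms `𝟙 ⟶ F 𝟙` and
`F X ⊗ F Y ⟶ F (X ⊗ Y)` are identities (in particular the objects agree). -/
structure IsStrictMonoidal (F : C ⥤ D) [F.Monoidal] : Prop where
  unit : ∃ h : 𝟙_ D = F.obj (𝟙_ C), Functor.LaxMonoidal.ε F = eqToHom h
  tensor : ∀ X Y : C, ∃ h : F.obj X ⊗ F.obj Y = F.obj (X ⊗ Y),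
    Functor.LaxMonoidal.μ F X Y = eqToHom h

/-- Equality of two monoidal functors: equal functors, with equal structure morphisms. -/
structure EqAsMonoidalFunctors (F G : C ⥤ D) [F.Monoidal] [G.Monoidal] : Prop where
  functor_eq : F = G
  unit_eq : Functor.LaxMonoidal.ε F ≍ Functor.LaxMonoidal.ε G
  tensor_eq : ∀ X Y : C, Functor.LaxMonoidal.μ F X Y ≍ Functor.LaxMonoidal.μ G X Y

end StrictMonoidal

/-! ## Bimonads, Hopf monads and R-matrices -/

section HopfMonads

variable {C : Type u₁} [Category.{v₁} C]

/-- The structure of a monad on a given endofunctor `F`. -/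
structure MonadStructureOn (F : C ⥤ C) where
  one : 𝟭 C ⟶ F
  mul : F ⋙ F ⟶ F
  assoc : ∀ X, F.map (mul.app X) ≫ mul.app X = mul.app (F.obj X) ≫ mul.app X
  left_unit : ∀ X, one.app (F.obj X) ≫ mul.app X = 𝟙 (F.obj X)
  right_unit : ∀ X, F.map (one.app X) ≫ mul.app X = 𝟙 (F.obj X)

/-- The corresponding monad. -/
def MonadStructureOn.toMonad {F : C ⥤ C} (S : MonadStructureOn F) : Monad C where
  toFunctor := F
  η := S.one
  μ := S.mul
  assoc := S.assoc
  left_unit := S.left_unit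
  right_unit := S.right_unit

variable [MonoidalCategory C]

/-- A bimonad: a monad whose functor, product and unit are comonoidal. -/
class Bimonad (T : Monad C) extends T.toFunctor.OplaxMonoidal where
  mu_tensor : ∀ X Y : C, T.μ.app (X ⊗ Y) ≫ Functor.OplaxMonoidal.δ T.toFunctor X Y =
    T.map (Functor.OplaxMonoidal.δ T.toFunctor X Y) ≫
      Functor.OplaxMonoidal.δ T.toFunctor (T.obj X) (T.obj Y) ≫ (T.μ.app X ⊗ₘ T.μ.app Y)
  mu_unit : T.μ.app (𝟙_ C) ≫ Functor.OplaxMonoidal.η T.toFunctor =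
    T.map (Functor.OplaxMonoidal.η T.toFunctor) ≫ Functor.OplaxMonoidal.η T.toFunctor
  eta_tensor : ∀ X Y : C, T.η.app (X ⊗ Y) ≫ Functor.OplaxMonoidal.δ T.toFunctor X Y =
    T.η.app X ⊗ₘ T.η.app Y
  eta_unit : T.η.app (𝟙_ C) ≫ Functor.OplaxMonoidal.η T.toFunctor = 𝟙 (𝟙_ C)

namespace Bimonad

variable (T : Monad C) [Bimonad T]

/-- The comonoidal structure `T (X ⊗ Y) ⟶ T X ⊗ T Y` of a bimonad. -/
abbrev comul (X Y : C) : T.obj (X ⊗ Y) ⟶ T.obj X ⊗ T.obj Y :=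
  Functor.OplaxMonoidal.δ T.toFunctor X Y

/-- The comonoidal structure `T 𝟙 ⟶ 𝟙` of a bimonad. -/
abbrev counit : T.obj (𝟙_ C) ⟶ 𝟙_ C := Functor.OplaxMonoidal.η T.toFunctor

/-- The left fusion operator `T (X ⊗ T Y) ⟶ T X ⊗ T Y`. -/
def leftFusion (X Y : C) : T.obj (X ⊗ T.obj Y) ⟶ T.obj X ⊗ T.obj Y :=
  comul T X (T.obj Y) ≫ T.obj X ◁ T.μ.app Y

/-- The right fusion operator `T (T X ⊗ Y) ⟶ T X ⊗ T Y`. -/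
def rightFusion (X Y : C) : T.obj (T.obj X ⊗ Y) ⟶ T.obj X ⊗ T.obj Y :=
  comul T (T.obj X) Y ≫ T.μ.app X ▷ T.obj Y

/-- A Hopf monad is a bimonad with invertible fusion operators. -/
class IsHopfMonad : Prop where
  isIso_leftFusion : ∀ X Y : C, IsIso (leftFusion T X Y)
  isIso_rightFusion : ∀ X Y : C, IsIso (rightFusion T X Y)

variable {T}

/-- The tensor product of two modules over a bimonad. -/
def tensorAlgebra (M N : T.Algebra) : T.Algebra where
  A := M.A ⊗ N.A
  a := comul T M.A N.A ≫ (M.a ⊗ₘ N.a)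
  unit := by
    rw [← Category.assoc, eta_tensor, tensorHom_comp_tensorHom, M.unit, N.unit]
    exact id_tensorHom_id _ _
  assoc := by
    rw [← Category.assoc, mu_tensor]
    simp only [Category.assoc, tensorHom_comp_tensorHom, M.assoc, N.assoc, Functor.map_comp]
    rw [← tensorHom_comp_tensorHom, Functor.OplaxMonoidal.δ_natural_assoc]

/-- The unit module `(𝟙, T₀)` over a bimonad. -/
def unitAlgebra : T.Algebra where
  A := 𝟙_ C
  a := counit T
  unit := eta_unit
  assoc := mu_unit

/-- Tensor product of morphisms of modules. -/
def tensorAlgebraHom {M M' N N' : T.Algebra} (f : M ⟶ M') (g : N ⟶ N') :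
    tensorAlgebra M N ⟶ tensorAlgebra M' N' where
  f := f.f ⊗ₘ g.f
  h := by
    dsimp only [tensorAlgebra]
    rw [← Functor.OplaxMonoidal.δ_natural_assoc, Category.assoc, tensorHom_comp_tensorHom,
      tensorHom_comp_tensorHom, f.h, g.h]

instance : MonoidalCategoryStruct T.Algebra where
  tensorObj := tensorAlgebra
  tensorUnit := unitAlgebra
  tensorHom f g := tensorAlgebraHom f g
  whiskerLeft M _ _ f := tensorAlgebraHom (𝟙 M) f
  whiskerRight f N := tensorAlgebraHom f (𝟙 N)
  associator M N P := Monad.Algebra.isoMk (α_ M.A N.A P.A) (by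
    have h := Functor.OplaxMonoidal.associativity T.toFunctor M.A N.A P.A
    dsimp only [tensorAlgebra, comul] at h ⊢
    rw [← whiskerRight_comp_tensorHom, ← whiskerLeft_comp_tensorHom]
    simp only [Category.assoc]
    rw [associator_naturality, reassoc_of% h])
  leftUnitor M := Monad.Algebra.isoMk (λ_ M.A) (by
    have h := Functor.OplaxMonoidal.left_unitality T.toFunctor M.A
    dsimp only [tensorAlgebra, unitAlgebra, comul, counit] at h ⊢
    rw [MonoidalCategory.tensorHom_def, Category.assoc, Category.assoc, leftUnitor_naturality,
      ← cancel_epi (T.map (λ_ M.A).inv), ← reassoc_of% h, ← Functor.map_comp_assoc,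
      Iso.inv_hom_id, CategoryTheory.Functor.map_id, Iso.inv_hom_id_assoc, Category.id_comp])
  rightUnitor M := Monad.Algebra.isoMk (ρ_ M.A) (by
    have h := Functor.OplaxMonoidal.right_unitality T.toFunctor M.A
    dsimp only [tensorAlgebra, unitAlgebra, comul, counit] at h ⊢
    rw [MonoidalCategory.tensorHom_def', Category.assoc, Category.assoc, rightUnitor_naturality,
      ← cancel_epi (T.map (ρ_ M.A).inv), ← reassoc_of% h, ← Functor.map_comp_assoc,
      Iso.inv_hom_id, CategoryTheory.Functor.map_id, Iso.inv_hom_id_assoc, Category.id_comp])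

instance : MonoidalCategory T.Algebra :=
  Monoidal.induced T.forget
    { μIso := fun M N => Iso.refl (M.A ⊗ N.A)
      εIso := Iso.refl (𝟙_ C)
      whiskerLeft_eq := fun X Y Z f => by
        change 𝟙 _ ⊗ₘ f.f = 𝟙 _ ≫ X.A ◁ f.f ≫ 𝟙 _
        simp
      whiskerRight_eq := fun f X => by
        change f.f ⊗ₘ 𝟙 _ = 𝟙 _ ≫ f.f ▷ X.A ≫ 𝟙 _
        simp
      tensorHom_eq := fun f g => by
        change f.f ⊗ₘ g.f = 𝟙 _ ≫ (f.f ⊗ₘ g.f) ≫ 𝟙 _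
        simp
      associator_eq := fun X Y Z => by
        change (α_ X.A Y.A Z.A).hom =
          (𝟙 _ ≫ (𝟙 _ ⊗ₘ 𝟙 _)) ≫ (α_ X.A Y.A Z.A).hom ≫ (𝟙 _ ⊗ₘ 𝟙 _) ≫ 𝟙 _
        simp
      leftUnitor_eq := fun X => by
        change (λ_ X.A).hom = (𝟙 _ ≫ (𝟙 _ ⊗ₘ 𝟙 _)) ≫ (λ_ X.A).hom
        simp
      rightUnitor_eq := fun X => by
        change (ρ_ X.A).hom = (𝟙 _ ≫ (𝟙 _ ⊗ₘ 𝟙 _)) ≫ (ρ_ X.A).hom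
        simp }

/-- The forgetful functor from modules over a bimonad is (strict) monoidal. -/
instance : T.forget.Monoidal :=
  Functor.CoreMonoidal.toMonoidal
    { εIso := Iso.refl (𝟙_ C)
      μIso := fun M N => Iso.refl (M.A ⊗ N.A)
      μIso_hom_natural_left := fun f X => by
        change f.f ▷ X.A ≫ 𝟙 _ = 𝟙 _ ≫ (f.f ⊗ₘ 𝟙 _)
        simp
      μIso_hom_natural_right := fun X f => by
        change X.A ◁ f.f ≫ 𝟙 _ = 𝟙 _ ≫ (𝟙 _ ⊗ₘ f.f)
        simp
      associativity := fun X Y Z => by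
        change 𝟙 (X.A ⊗ Y.A) ▷ Z.A ≫ 𝟙 _ ≫ (α_ X.A Y.A Z.A).hom =
          (α_ X.A Y.A Z.A).hom ≫ X.A ◁ 𝟙 (Y.A ⊗ Z.A) ≫ 𝟙 _
        simp
      left_unitality := fun X => by
        change (λ_ X.A).hom = 𝟙 (𝟙_ C) ▷ X.A ≫ 𝟙 _ ≫ (λ_ X.A).hom
        simp
      right_unitality := fun X => by
        change (ρ_ X.A).hom = X.A ◁ 𝟙 (𝟙_ C) ≫ 𝟙 _ ≫ (ρ_ X.A).hom
        simp }

end Bimonad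

/-- An R-matrix on a bimonad. -/
structure RMatrix (T : Monad C) [Bimonad T] where
  /-- The natural transformation `X ⊗ Y ⟶ T Y ⊗ T X`. -/
  R : ∀ X Y : C, X ⊗ Y ⟶ T.obj Y ⊗ T.obj X
  naturality : ∀ {X X' Y Y' : C} (f : X ⟶ X') (g : Y ⟶ Y'),
    (f ⊗ₘ g) ≫ R X' Y' = R X Y ≫ (T.map g ⊗ₘ T.map f)
  linear : ∀ X Y : C,
    Bimonad.comul T X Y ≫ R (T.obj X) (T.obj Y) ≫ (T.μ.app Y ⊗ₘ T.μ.app X) =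
      T.map (R X Y) ≫ Bimonad.comul T (T.obj Y) (T.obj X) ≫ (T.μ.app Y ⊗ₘ T.μ.app X)
  tensor_left : ∀ X Y Z : C,
    R (X ⊗ Y) Z ≫ T.obj Z ◁ Bimonad.comul T X Y =
      (α_ X Y Z).hom ≫ X ◁ R Y Z ≫ (α_ X (T.obj Z) (T.obj Y)).inv ≫ R X (T.obj Z) ▷ T.obj Y ≫
        (T.μ.app Z ▷ T.obj X) ▷ T.obj Y ≫ (α_ (T.obj Z) (T.obj X) (T.obj Y)).hom
  tensor_right : ∀ X Y Z : C,
    R X (Y ⊗ Z) ≫ Bimonad.comul T Y Z ▷ T.obj X =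
      (α_ X Y Z).inv ≫ R X Y ▷ Z ≫ (α_ (T.obj Y) (T.obj X) Z).hom ≫ T.obj Y ◁ R (T.obj X) Z ≫
        T.obj Y ◁ T.obj Z ◁ T.μ.app X ≫ (α_ (T.obj Y) (T.obj Z) (T.obj X)).inv
  /-- Invertibility with respect to convolution. -/
  invertible : ∃ R' : ∀ X Y : C, Y ⊗ X ⟶ T.obj X ⊗ T.obj Y,
    (∀ {X X' Y Y' : C} (f : X ⟶ X') (g : Y ⟶ Y'),
      (g ⊗ₘ f) ≫ R' X' Y' = R' X Y ≫ (T.map f ⊗ₘ T.map g)) ∧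
    (∀ X Y : C, R X Y ≫ R' (T.obj X) (T.obj Y) ≫ (T.μ.app X ⊗ₘ T.μ.app Y) =
      (T.η.app X ⊗ₘ T.η.app Y)) ∧
    (∀ X Y : C, R' X Y ≫ R (T.obj X) (T.obj Y) ≫ (T.μ.app Y ⊗ₘ T.μ.app X) =
      (T.η.app Y ⊗ₘ T.η.app X))

namespace RMatrix

variable {T : Monad C} [Bimonad T] (Q : RMatrix T)

/-- The morphism `(s ⊗ r) R_{M,N} : (M, r) ⊗ (N, s) ⟶ (N, s) ⊗ (M, r)`. -/
def braidingHom (M N : T.Algebra) : M ⊗ N ⟶ N ⊗ M where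
  f := Q.R M.A N.A ≫ (N.a ⊗ₘ M.a)
  h := by
    change T.map (Q.R M.A N.A ≫ (N.a ⊗ₘ M.a)) ≫ Bimonad.comul T N.A M.A ≫ (N.a ⊗ₘ M.a) =
      (Bimonad.comul T M.A N.A ≫ (M.a ⊗ₘ N.a)) ≫ Q.R M.A N.A ≫ (N.a ⊗ₘ M.a)
    have h := Q.linear M.A N.A
    rw [Category.assoc, reassoc_of% (Q.naturality M.a N.a), tensorHom_comp_tensorHom, ← M.assoc,
      ← N.assoc, ← tensorHom_comp_tensorHom, reassoc_of% h, Functor.map_comp, Category.assoc,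
      ← Functor.OplaxMonoidal.δ_natural_assoc, tensorHom_comp_tensorHom, tensorHom_comp_tensorHom,
      ← M.assoc, ← N.assoc]

instance (M N : T.Algebra) : IsIso (Q.braidingHom M N) := by
  obtain ⟨R', hn, h₁, h₂⟩ := Q.invertible
  have : IsIso (Q.braidingHom M N).f := by
    refine ⟨R' M.A N.A ≫ (M.a ⊗ₘ N.a), ?_, ?_⟩
    · change (Q.R M.A N.A ≫ (N.a ⊗ₘ M.a)) ≫ R' M.A N.A ≫ (M.a ⊗ₘ N.a) = 𝟙 (M.A ⊗ N.A)
      rw [Category.assoc, reassoc_of% hn, tensorHom_comp_tensorHom, ← M.assoc, ← N.assoc,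
        ← tensorHom_comp_tensorHom, reassoc_of% h₁, tensorHom_comp_tensorHom, M.unit, N.unit]
      exact id_tensorHom_id _ _
    · change (R' M.A N.A ≫ (M.a ⊗ₘ N.a)) ≫ Q.R M.A N.A ≫ (N.a ⊗ₘ M.a) = 𝟙 (N.A ⊗ M.A)
      rw [Category.assoc, reassoc_of% (Q.naturality M.a N.a), tensorHom_comp_tensorHom, ← M.assoc,
        ← N.assoc, ← tensorHom_comp_tensorHom, reassoc_of% h₂, tensorHom_comp_tensorHom, M.unit,
        N.unit]
      exact id_tensorHom_id _ _
  exact Monad.algebra_iso_of_iso _ _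

/-- The braiding on the category of modules over a bimonad defined by an R-matrix. -/
@[reducible]
def braidedCategory : BraidedCategory T.Algebra where
  braiding M N := asIso (Q.braidingHom M N)
  braiding_naturality_right X Y Z f := by
    ext
    change (𝟙 X.A ⊗ₘ f.f) ≫ Q.R X.A Z.A ≫ (Z.a ⊗ₘ X.a) =
      (Q.R X.A Y.A ≫ (Y.a ⊗ₘ X.a)) ≫ (f.f ⊗ₘ 𝟙 X.A)
    rw [reassoc_of% (Q.naturality (𝟙 X.A) f.f), Category.assoc, tensorHom_comp_tensorHom,
      tensorHom_comp_tensorHom, f.h]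
    simp
  braiding_naturality_left {X Y} f Z := by
    ext
    change (f.f ⊗ₘ 𝟙 Z.A) ≫ Q.R Y.A Z.A ≫ (Z.a ⊗ₘ Y.a) =
      (Q.R X.A Z.A ≫ (Z.a ⊗ₘ X.a)) ≫ (𝟙 Z.A ⊗ₘ f.f)
    rw [reassoc_of% (Q.naturality f.f (𝟙 Z.A)), Category.assoc, tensorHom_comp_tensorHom,
      tensorHom_comp_tensorHom, f.h]
    simp
  hexagon_forward X Y Z := by
    ext
    change (α_ X.A Y.A Z.A).hom ≫ (Q.R X.A (Y.A ⊗ Z.A) ≫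
        ((Bimonad.comul T Y.A Z.A ≫ (Y.a ⊗ₘ Z.a)) ⊗ₘ X.a)) ≫ (α_ Y.A Z.A X.A).hom =
      ((Q.R X.A Y.A ≫ (Y.a ⊗ₘ X.a)) ⊗ₘ 𝟙 Z.A) ≫ (α_ Y.A X.A Z.A).hom ≫
        (𝟙 Y.A ⊗ₘ (Q.R X.A Z.A ≫ (Z.a ⊗ₘ X.a)))
    have h := Q.tensor_right X.A Y.A Z.A
    have e₁ : (Y.a ⊗ₘ (X.a ⊗ₘ 𝟙 Z.A)) ≫ (𝟙 Y.A ⊗ₘ (Q.R X.A Z.A ≫ (Z.a ⊗ₘ X.a))) =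
        T.obj Y.A ◁ Q.R (T.obj X.A) Z.A ≫ T.obj Y.A ◁ T.obj Z.A ◁ T.μ.app X.A ≫
          (Y.a ⊗ₘ Z.a ⊗ₘ X.a) := by
      rw [tensorHom_comp_tensorHom, reassoc_of% (Q.naturality X.a (𝟙 Z.A)),
        tensorHom_comp_tensorHom, ← X.assoc]
      simp [← id_tensorHom]
    have e₂ : (Q.R X.A Y.A ≫ (Y.a ⊗ₘ X.a)) ⊗ₘ 𝟙 Z.A =
        Q.R X.A Y.A ▷ Z.A ≫ ((Y.a ⊗ₘ X.a) ⊗ₘ 𝟙 Z.A) := by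
      rw [whiskerRight_comp_tensorHom]
    simp only [e₂, Category.assoc]
    rw [associator_naturality_assoc, e₁, ← whiskerRight_comp_tensorHom,
      Category.assoc, reassoc_of% h]
    simp
  hexagon_reverse X Y Z := by
    ext
    change (α_ X.A Y.A Z.A).inv ≫ (Q.R (X.A ⊗ Y.A) Z.A ≫
        (Z.a ⊗ₘ (Bimonad.comul T X.A Y.A ≫ (X.a ⊗ₘ Y.a)))) ≫ (α_ Z.A X.A Y.A).inv =
      (𝟙 X.A ⊗ₘ (Q.R Y.A Z.A ≫ (Z.a ⊗ₘ Y.a))) ≫ (α_ X.A Z.A Y.A).inv ≫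
        ((Q.R X.A Z.A ≫ (Z.a ⊗ₘ X.a)) ⊗ₘ 𝟙 Y.A)
    have h := Q.tensor_left X.A Y.A Z.A
    have e₁ : ((𝟙 X.A ⊗ₘ Z.a) ⊗ₘ Y.a) ≫ ((Q.R X.A Z.A ≫ (Z.a ⊗ₘ X.a)) ⊗ₘ 𝟙 Y.A) =
        Q.R X.A (T.obj Z.A) ▷ T.obj Y.A ≫ (T.μ.app Z.A ▷ T.obj X.A) ▷ T.obj Y.A ≫
          ((Z.a ⊗ₘ X.a) ⊗ₘ Y.a) := by
      rw [tensorHom_comp_tensorHom, reassoc_of% (Q.naturality (𝟙 X.A) Z.a),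
        tensorHom_comp_tensorHom, ← Z.assoc, whiskerRight_comp_tensorHom,
        whiskerRight_comp_tensorHom, whiskerRight_comp_tensorHom]
      simp
    have e₂ : 𝟙 X.A ⊗ₘ (Q.R Y.A Z.A ≫ (Z.a ⊗ₘ Y.a)) =
        X.A ◁ Q.R Y.A Z.A ≫ (𝟙 X.A ⊗ₘ (Z.a ⊗ₘ Y.a)) := by
      rw [whiskerLeft_comp_tensorHom]
    simp only [e₂, Category.assoc]
    rw [associator_inv_naturality_assoc, e₁, ← whiskerLeft_comp_tensorHom,
      Category.assoc, reassoc_of% h]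
    simp

end RMatrix

end HopfMonads

/-! ## Right modules over a bialgebra in a braided category -/

section RightModules

open scoped MonObj ComonObj

variable {B : Type u} [Category.{v} B] [MonoidalCategory B]

/-- A right module over an algebra `A` in a monoidal category. -/
structure RightModule (A : B) [MonObj A] where
  X : B
  act : X ⊗ A ⟶ X
  act_one : X ◁ η[A] ≫ act = (ρ_ X).hom
  act_mul : X ◁ μ[A] ≫ act = (α_ X A A).inv ≫ act ▷ A ≫ act

namespace RightModule

variable {A : B} [MonObj A]

/-- An `A`-linear morphism of right modules. -/
@[ext]
structure Hom (M N : RightModule A) where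
  hom : M.X ⟶ N.X
  comm : M.act ≫ hom = hom ▷ A ≫ N.act

instance : Category (RightModule A) where
  Hom := Hom
  id M := { hom := 𝟙 M.X, comm := by simp }
  comp f g :=
    { hom := f.hom ≫ g.hom
      comm := by rw [reassoc_of% f.comm, g.comm, comp_whiskerRight, Category.assoc] }

@[ext]
theorem hom_ext {M N : RightModule A} (f g : M ⟶ N) (h : f.hom = g.hom) : f = g :=
  Hom.ext h

@[simp]
theorem id_hom (M : RightModule A) : Hom.hom (𝟙 M) = 𝟙 M.X := rfl

@[simp]
theorem comp_hom {M N P : RightModule A} (f : M ⟶ N) (g : N ⟶ P) :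
    (f ≫ g).hom = f.hom ≫ g.hom := rfl

/-- An isomorphism in the base category which is `A`-linear gives an isomorphism of modules. -/
def isoMk {M N : RightModule A} (e : M.X ≅ N.X) (h : M.act ≫ e.hom = e.hom ▷ A ≫ N.act) :
    M ≅ N where
  hom := { hom := e.hom, comm := h }
  inv :=
    { hom := e.inv
      comm := by rw [← cancel_epi (e.hom ▷ A), ← reassoc_of% h]; simp }

variable (A) in
/-- The forgetful functor from right modules to the base category. -/
def forget : RightModule A ⥤ B where
  obj M := M.X
  map f := f.hom

instance : (forget A).Faithful where
  map_injective h := hom_ext _ _ h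

end RightModule

namespace RightModule

variable [BraidedCategory B] {A : B} [BimonObj A]

/-- The tensor product of right modules over a bialgebra:
`(M, r) ⊗ (N, s) = (M ⊗ N, (r ⊗ s) (id_M ⊗ τ_{N,A} ⊗ id_A) (id_{M ⊗ N} ⊗ Δ))`. -/
def tensorObj (M N : RightModule A) : RightModule A where
  X := M.X ⊗ N.X
  act := (M.X ⊗ N.X) ◁ Δ[A] ≫ tensorμ M.X N.X A A ≫ (M.act ⊗ₘ N.act)
  act_one := by
    have h : (M.X ⊗ N.X) ◁ (η[A] ⊗ₘ η[A]) ≫ tensorμ M.X N.X A A =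
        tensorμ M.X N.X (𝟙_ B) (𝟙_ B) ≫ (M.X ◁ η[A] ⊗ₘ N.X ◁ η[A]) :=
      tensorμ_natural_right _ _ _ _
    rw [← whiskerLeft_comp_assoc, BimonObj.one_comul]
    change (M.X ⊗ N.X) ◁ ((λ_ (𝟙_ B)).inv ≫ (η[A] ⊗ₘ η[A])) ≫ _ = _
    rw [whiskerLeft_comp, Category.assoc, reassoc_of% h, tensorHom_comp_tensorHom, M.act_one,
      N.act_one, ← tensor_right_unitality]
  act_mul := by
    have h₁ := tensor_associativity M.X N.X A A A A
    have h₂ := tensorμ_natural_right M.X N.X μ[A] μ[A]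
    have h₃ := tensorμ_natural_left M.act N.act A A
    rw [← whiskerLeft_comp_assoc, BimonObj.mul_comul]
    simp only [whiskerLeft_comp, comp_whiskerRight, Category.assoc]
    rw [reassoc_of% h₂, tensorHom_comp_tensorHom, M.act_mul, N.act_mul,
      ← tensorHom_comp_tensorHom, ← tensorHom_comp_tensorHom, ← whisker_exchange_assoc,
      reassoc_of% h₃]
    have h₄ : (M.X ⊗ N.X) ◁ tensorμ A A A A ≫ tensorμ M.X N.X (A ⊗ A) (A ⊗ A) ≫
        ((α_ M.X A A).inv ⊗ₘ (α_ N.X A A).inv) =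
        (α_ _ _ _).inv ≫ tensorμ M.X N.X A A ▷ (A ⊗ A) ≫ tensorμ (M.X ⊗ A) (N.X ⊗ A) A A := by
      rw [Iso.eq_inv_comp, ← reassoc_of% h₁, tensorHom_comp_tensorHom, Iso.hom_inv_id,
        Iso.hom_inv_id, id_tensorHom_id, Category.comp_id]
    have h₅ : (M.X ⊗ N.X) ◁ (Δ[A] ⊗ₘ Δ[A]) ≫ (α_ (M.X ⊗ N.X) (A ⊗ A) (A ⊗ A)).inv =
        (α_ (M.X ⊗ N.X) A A).inv ≫ ((M.X ⊗ N.X) ◁ Δ[A]) ▷ A ≫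
          ((M.X ⊗ N.X) ⊗ (A ⊗ A)) ◁ Δ[A] := by
      rw [← MonoidalCategory.tensorHom_def, ← id_tensorHom, ← id_tensorHom,
        associator_inv_naturality]
    rw [reassoc_of% h₄, reassoc_of% h₅, whisker_exchange_assoc]

/-- The trivial module `(X, id_X ⊗ ε)`. -/
def trivialObj (A : B) [BimonObj A] (X : B) : RightModule A where
  X := X
  act := X ◁ ε[A] ≫ (ρ_ X).hom
  act_one := by
    rw [← whiskerLeft_comp_assoc, BimonObj.one_counit]
    simp
  act_mul := by
    rw [← whiskerLeft_comp_assoc, BimonObj.mul_counit]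
    change X ◁ ((ε[A] ⊗ₘ ε[A]) ≫ (λ_ (𝟙_ B)).hom) ≫ _ = _
    simp only [MonoidalCategory.tensorHom_def, whiskerLeft_comp, comp_whiskerRight,
      Category.assoc]
    rw [← whisker_exchange_assoc]
    simp

/-- Tensor product of `A`-linear morphisms. -/
def tensorHom {M M' N N' : RightModule A} (f : M ⟶ M') (g : N ⟶ N') :
    tensorObj M N ⟶ tensorObj M' N' where
  hom := f.hom ⊗ₘ g.hom
  comm := by
    have h := tensorμ_natural_left f.hom g.hom A A
    dsimp only [tensorObj]
    rw [Category.assoc, Category.assoc, tensorHom_comp_tensorHom, f.comm, g.comm,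
      ← tensorHom_comp_tensorHom, ← reassoc_of% h, whisker_exchange_assoc]

instance : MonoidalCategoryStruct (RightModule A) where
  tensorObj := tensorObj
  tensorUnit := trivialObj A (𝟙_ B)
  tensorHom f g := tensorHom f g
  whiskerLeft M _ _ f := tensorHom (𝟙 M) f
  whiskerRight f N := tensorHom f (𝟙 N)
  associator M N P := isoMk (α_ M.X N.X P.X) (by
    have h₁ := tensorμ_natural_right (M.X ⊗ N.X) P.X Δ[A] (𝟙 A)
    have h₂ := tensorμ_natural_right M.X (N.X ⊗ P.X) (𝟙 A) Δ[A]
    have h₃ := associator_monoidal M.X N.X P.X A A A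
    dsimp only [tensorObj]
    have e₁ : ((((M.X ⊗ N.X) ◁ Δ[A] ≫ tensorμ M.X N.X A A ≫ (M.act ⊗ₘ N.act)) ⊗ₘ P.act) :
        ((M.X ⊗ N.X) ⊗ A) ⊗ (P.X ⊗ A) ⟶ _) =
        ((M.X ⊗ N.X) ◁ Δ[A] ⊗ₘ P.X ◁ 𝟙 A) ≫ tensorμ M.X N.X A A ▷ (P.X ⊗ A) ≫
          ((M.act ⊗ₘ N.act) ⊗ₘ P.act) := by
      rw [← tensorHom_id, tensorHom_comp_tensorHom, tensorHom_comp_tensorHom]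
      simp
    have e₂ : ((M.act ⊗ₘ ((N.X ⊗ P.X) ◁ Δ[A] ≫ tensorμ N.X P.X A A ≫ (N.act ⊗ₘ P.act))) :
        (M.X ⊗ A) ⊗ ((N.X ⊗ P.X) ⊗ A) ⟶ _) =
        (M.X ◁ 𝟙 A ⊗ₘ (N.X ⊗ P.X) ◁ Δ[A]) ≫ (M.X ⊗ A) ◁ tensorμ N.X P.X A A ≫
          (M.act ⊗ₘ (N.act ⊗ₘ P.act)) := by
      rw [← id_tensorHom (M.X ⊗ A), tensorHom_comp_tensorHom, tensorHom_comp_tensorHom]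
      simp
    have e₃ : ((M.X ⊗ N.X) ⊗ P.X) ◁ Δ[A] ≫ ((M.X ⊗ N.X) ⊗ P.X) ◁ (Δ[A] ⊗ₘ 𝟙 A) ≫
        ((α_ M.X N.X P.X).hom ⊗ₘ (α_ A A A).hom) =
        (α_ M.X N.X P.X).hom ▷ A ≫ (M.X ⊗ N.X ⊗ P.X) ◁ Δ[A] ≫
          (M.X ⊗ N.X ⊗ P.X) ◁ (𝟙 A ⊗ₘ Δ[A]) := by
      rw [tensorHom_id, id_tensorHom, ← whiskerLeft_comp, ComonObj.comul_assoc,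
        ← whisker_exchange, MonoidalCategory.tensorHom_def']
      simp only [whiskerLeft_comp, Category.assoc]
    rw [e₁, e₂, ← reassoc_of% h₁, ← reassoc_of% h₂]
    simp only [Category.assoc]
    rw [associator_naturality, reassoc_of% h₃, reassoc_of% e₃])
  leftUnitor M := isoMk (λ_ M.X) (by
    have h := tensorμ_natural_right (𝟙_ B) M.X ε[A] (𝟙 A)
    dsimp only [tensorObj, trivialObj]
    have e₁ : (((𝟙_ B ◁ ε[A] ≫ (ρ_ (𝟙_ B)).hom) ⊗ₘ M.act) : (𝟙_ B ⊗ A) ⊗ (M.X ⊗ A) ⟶ _) =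
        (𝟙_ B ◁ ε[A] ⊗ₘ M.X ◁ 𝟙 A) ≫ (λ_ (𝟙_ B)).hom ▷ (M.X ⊗ A) ≫ 𝟙_ B ◁ M.act := by
      rw [← MonoidalCategory.tensorHom_def, tensorHom_comp_tensorHom]
      simp [unitors_equal]
    have e₂ : (𝟙_ B ⊗ M.X) ◁ Δ[A] ≫ (𝟙_ B ⊗ M.X) ◁ (ε[A] ⊗ₘ 𝟙 A) =
        (𝟙_ B ⊗ M.X) ◁ (λ_ A).inv := by
      rw [← whiskerLeft_comp, tensorHom_id, ComonObj.counit_comul]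
    rw [e₁, ← reassoc_of% h, reassoc_of% e₂]
    simp only [Category.assoc]
    rw [leftUnitor_naturality, ← reassoc_of% (leftUnitor_monoidal M.X A),
      MonoidalCategory.tensorHom_def']
    simp)
  rightUnitor M := isoMk (ρ_ M.X) (by
    have h := tensorμ_natural_right M.X (𝟙_ B) (𝟙 A) ε[A]
    dsimp only [tensorObj, trivialObj]
    have e₁ : ((M.act ⊗ₘ (𝟙_ B ◁ ε[A] ≫ (ρ_ (𝟙_ B)).hom)) : (M.X ⊗ A) ⊗ (𝟙_ B ⊗ A) ⟶ _) =
        (M.X ◁ 𝟙 A ⊗ₘ 𝟙_ B ◁ ε[A]) ≫ (M.X ⊗ A) ◁ (λ_ (𝟙_ B)).hom ≫ M.act ▷ 𝟙_ B := by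
      rw [← MonoidalCategory.tensorHom_def', tensorHom_comp_tensorHom]
      simp [unitors_equal]
    have e₂ : (M.X ⊗ 𝟙_ B) ◁ Δ[A] ≫ (M.X ⊗ 𝟙_ B) ◁ (𝟙 A ⊗ₘ ε[A]) =
        (M.X ⊗ 𝟙_ B) ◁ (ρ_ A).inv := by
      rw [← whiskerLeft_comp, id_tensorHom, ComonObj.comul_counit]
    rw [e₁, ← reassoc_of% h, reassoc_of% e₂]
    simp only [Category.assoc]
    rw [rightUnitor_naturality, ← reassoc_of% (rightUnitor_monoidal M.X A),
      MonoidalCategory.tensorHom_def']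
    simp)

instance : MonoidalCategory (RightModule A) :=
  Monoidal.induced (forget A)
    { μIso := fun M N => Iso.refl (M.X ⊗ N.X)
      εIso := Iso.refl (𝟙_ B)
      whiskerLeft_eq := fun X Y Z f => by
        change 𝟙 _ ⊗ₘ f.hom = 𝟙 _ ≫ X.X ◁ f.hom ≫ 𝟙 _
        simp
      whiskerRight_eq := fun f X => by
        change f.hom ⊗ₘ 𝟙 _ = 𝟙 _ ≫ f.hom ▷ X.X ≫ 𝟙 _
        simp
      tensorHom_eq := fun f g => by
        change f.hom ⊗ₘ g.hom = 𝟙 _ ≫ (f.hom ⊗ₘ g.hom) ≫ 𝟙 _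
        simp
      associator_eq := fun X Y Z => by
        change (α_ X.X Y.X Z.X).hom =
          (𝟙 _ ≫ (𝟙 _ ⊗ₘ 𝟙 _)) ≫ (α_ X.X Y.X Z.X).hom ≫ (𝟙 _ ⊗ₘ 𝟙 _) ≫ 𝟙 _
        simp
      leftUnitor_eq := fun X => by
        change (λ_ X.X).hom = (𝟙 _ ≫ (𝟙 _ ⊗ₘ 𝟙 _)) ≫ (λ_ X.X).hom
        simp
      rightUnitor_eq := fun X => by
        change (ρ_ X.X).hom = (𝟙 _ ≫ (𝟙 _ ⊗ₘ 𝟙 _)) ≫ (ρ_ X.X).hom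
        simp }

@[simp]
theorem tensor_X (M N : RightModule A) : (M ⊗ N).X = M.X ⊗ N.X := rfl

theorem tensor_act (M N : RightModule A) :
    (M ⊗ N).act = (M.X ⊗ N.X) ◁ Δ[A] ≫ tensorμ M.X N.X A A ≫ (M.act ⊗ₘ N.act) := rfl

@[simp]
theorem unit_X : (𝟙_ (RightModule A)).X = 𝟙_ B := rfl

theorem whiskerLeft_hom (M : RightModule A) {N N' : RightModule A} (f : N ⟶ N') :
    (M ◁ f).hom = M.X ◁ f.hom := id_tensorHom _ _

theorem whiskerRight_hom {M M' : RightModule A} (f : M ⟶ M') (N : RightModule A) :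
    (f ▷ N).hom = f.hom ▷ N.X := tensorHom_id _ _

/-- A morphism of `B` is linear for the trivial actions. -/
def trivialMap (A : B) [BimonObj A] {X Y : B} (f : X ⟶ Y) :
    trivialObj A X ⟶ trivialObj A Y where
  hom := f
  comm := by
    dsimp only [trivialObj]
    rw [Category.assoc, ← rightUnitor_naturality, whisker_exchange_assoc]

theorem trivialObj_tensor_act (A : B) [BimonObj A] (X Y : B) :
    (trivialObj A X ⊗ trivialObj A Y).act = (trivialObj A (X ⊗ Y)).act := by
  have h := tensorμ_natural_right X Y ε[A] ε[A]
  rw [tensor_act]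
  dsimp only [trivialObj]
  rw [← tensorHom_comp_tensorHom, ← reassoc_of% h, ← whiskerLeft_comp_assoc,
    MonoidalCategory.tensorHom_def, ComonObj.counit_comul_assoc,
    tensor_right_unitality, ← whiskerLeft_comp_assoc, leftUnitor_inv_naturality]

/-- The tensor product of two trivial modules is the trivial module on the tensor product. -/
def trivialTensorIso (A : B) [BimonObj A] (X Y : B) :
    trivialObj A X ⊗ trivialObj A Y ≅ trivialObj A (X ⊗ Y) :=
  isoMk (Iso.refl (X ⊗ Y)) (by
    rw [trivialObj_tensor_act]
    exact (Category.comp_id _).trans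
      ((Category.id_comp _).symm.trans
        (congrArg (· ≫ (trivialObj A (X ⊗ Y)).act) (id_whiskerRight (X ⊗ Y) A).symm)))

/-- The right action `(m ⊗ id) (id_A ⊗ τ_{X,A})` on `A ⊗ X`. -/
def regularTensor (A : B) [BimonObj A] (X : B) : RightModule A where
  X := A ⊗ X
  act := (α_ A X A).hom ≫ A ◁ (β_ X A).hom ≫ (α_ A A X).inv ≫ μ[A] ▷ X
  act_one := by
    have h := BraidedCategory.braiding_naturality_right X η[A]
    have h' : A ◁ η[A] ▷ X ≫ (α_ A A X).inv ≫ μ[A] ▷ X = (α_ A (𝟙_ B) X).inv ≫ (ρ_ A).hom ▷ X := by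
      rw [associator_inv_naturality_middle_assoc, ← comp_whiskerRight, MonObj.mul_one]
    rw [tensor_whiskerLeft]
    simp only [Category.assoc, Iso.inv_hom_id_assoc]
    rw [← whiskerLeft_comp_assoc, h, whiskerLeft_comp, Category.assoc, h']
    simp
  act_mul := by
    have h := BraidedCategory.braiding_naturality_right X μ[A]
    calc
      _ = 𝟙 _ ⊗≫ A ◁ (X ◁ μ[A] ≫ (β_ X A).hom) ⊗≫ μ[A] ▷ X := by monoidal
      _ = 𝟙 _ ⊗≫ A ◁ (β_ X A).hom ▷ A ⊗≫ (A ⊗ A) ◁ (β_ X A).hom ⊗≫ (A ◁ μ[A] ≫ μ[A]) ▷ X := by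
        rw [h, BraidedCategory.braiding_tensor_right_hom]; monoidal
      _ = 𝟙 _ ⊗≫ A ◁ (β_ X A).hom ▷ A ⊗≫ ((A ⊗ A) ◁ (β_ X A).hom ≫ μ[A] ▷ (A ⊗ X)) ⊗≫
          μ[A] ▷ X := by
        rw [MonObj.mul_assoc_flip]; monoidal
      _ = _ := by rw [whisker_exchange]; monoidal

end RightModule

/-! ## The forgetful functor between the centers -/

section ForgetCenter

theorem tensor_half_braiding_aux {M N X : B} (f : M ⊗ X ⟶ X ⊗ M) (g : N ⊗ X ⟶ X ⊗ N) :
    (α_ M N X).hom ≫ (𝟙 M ⊗ₘ g) ≫ (α_ M X N).inv ≫ (f ⊗ₘ 𝟙 N) ≫ (α_ X M N).hom =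
      (α_ M N X).hom ≫ M ◁ g ≫ (α_ M X N).inv ≫ f ▷ N ≫ (α_ X M N).hom := by
  rw [id_tensorHom, tensorHom_id]

variable [BraidedCategory B] (A : B) [BimonObj A]

/-- The half braiding `σ_X = γ_{(X, id_X ⊗ ε)}`. -/
def restrictHalfBraiding {M : RightModule A} (c : HalfBraiding M) : HalfBraiding M.X where
  β X := (RightModule.forget A).mapIso (c.β (RightModule.trivialObj A X))
  monoidal X Y := by
    have h := congrArg RightModule.Hom.hom
      (c.naturality (RightModule.trivialTensorIso A X Y).hom)
    rw [c.monoidal] at h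
    simp only [RightModule.comp_hom, RightModule.whiskerLeft_hom, RightModule.whiskerRight_hom]
      at h
    change M.X ◁ 𝟙 (X ⊗ Y) ≫ (c.β (RightModule.trivialObj A (X ⊗ Y))).hom.hom =
      ((α_ M.X X Y).inv ≫ (c.β (RightModule.trivialObj A X)).hom.hom ▷ Y ≫ (α_ X M.X Y).hom ≫
        X ◁ (c.β (RightModule.trivialObj A Y)).hom.hom ≫ (α_ X Y M.X).inv) ≫
          𝟙 (X ⊗ Y) ▷ M.X at h
    rw [whiskerLeft_id, id_whiskerRight] at h
    exact (Category.id_comp _).symm.trans (h.trans (Category.comp_id _))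
  naturality {X Y} f := by
    have h := congrArg RightModule.Hom.hom (c.naturality (RightModule.trivialMap A f))
    simp only [RightModule.comp_hom, RightModule.whiskerLeft_hom, RightModule.whiskerRight_hom]
      at h
    exact h

/-- The forgetful functor `((M, r), γ) ↦ (M, σ)` with `σ_X = γ_{(X, id_X ⊗ ε)}`, from the center
of the category of right `A`-modules to the center of the base category. -/
def forgetCenter : Center (RightModule A) ⥤ Center B where
  obj P := ⟨P.1.X, restrictHalfBraiding A P.2⟩
  map {P Q} f :=
    { f := f.f.hom
      comm := fun X => by
        have h := congrArg RightModule.Hom.hom (f.comm (RightModule.trivialObj A X))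
        simp only [RightModule.comp_hom, RightModule.whiskerLeft_hom,
          RightModule.whiskerRight_hom] at h
        exact h }

/-- The structure isomorphism `𝟙 ⟶ U 𝟙`, given by the identity. -/
def forgetCenterUnit : 𝟙_ (Center B) ≅ (forgetCenter A).obj (𝟙_ (Center (RightModule A))) where
  hom :=
    { f := 𝟙 (𝟙_ B)
      comm := fun X => by
        change 𝟙 (𝟙_ B) ▷ X ≫ ((λ_ X).hom ≫ (ρ_ X).inv) =
          ((λ_ X).hom ≫ (ρ_ X).inv) ≫ X ◁ 𝟙 (𝟙_ B)
        simp }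
  inv :=
    { f := 𝟙 (𝟙_ B)
      comm := fun X => by
        change 𝟙 (𝟙_ B) ▷ X ≫ ((λ_ X).hom ≫ (ρ_ X).inv) =
          ((λ_ X).hom ≫ (ρ_ X).inv) ≫ X ◁ 𝟙 (𝟙_ B)
        simp }
  hom_inv_id := by ext; exact Category.comp_id _
  inv_hom_id := by ext; exact Category.comp_id _

theorem forgetCenter_tensor (P Q : Center (RightModule A)) (X : B) :
    (((forgetCenter A).obj (P ⊗ Q)).2.β X).hom =
      (((forgetCenter A).obj P ⊗ (forgetCenter A).obj Q).2.β X).hom :=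
  tensor_half_braiding_aux (P.2.β (RightModule.trivialObj A X)).hom.hom
    (Q.2.β (RightModule.trivialObj A X)).hom.hom

/-- The structure isomorphism `U P ⊗ U Q ⟶ U (P ⊗ Q)`, given by the identity. -/
def forgetCenterTensor (P Q : Center (RightModule A)) :
    (forgetCenter A).obj P ⊗ (forgetCenter A).obj Q ≅ (forgetCenter A).obj (P ⊗ Q) where
  hom :=
    { f := 𝟙 (P.1.X ⊗ Q.1.X)
      comm := fun X =>
        (congrArg (· ≫ _) (id_whiskerRight _ _)).trans ((Category.id_comp _).trans
          ((forgetCenter_tensor A P Q X).trans ((Category.comp_id _).symm.trans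
            (congrArg (_ ≫ ·) (whiskerLeft_id _ _).symm)))) }
  inv :=
    { f := 𝟙 (P.1.X ⊗ Q.1.X)
      comm := fun X =>
        (congrArg (· ≫ _) (id_whiskerRight _ _)).trans ((Category.id_comp _).trans
          ((forgetCenter_tensor A P Q X).symm.trans ((Category.comp_id _).symm.trans
            (congrArg (_ ≫ ·) (whiskerLeft_id _ _).symm)))) }
  hom_inv_id := by ext; exact Category.comp_id _
  inv_hom_id := by ext; exact Category.comp_id _

instance : (forgetCenter A).Monoidal :=
  Functor.CoreMonoidal.toMonoidal
    { εIso := forgetCenterUnit A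
      μIso := forgetCenterTensor A
      μIso_hom_natural_left := fun {P P'} f Q => by
        ext
        change f.f.hom ▷ Q.1.X ≫ 𝟙 _ = 𝟙 _ ≫ (f.f.hom ⊗ₘ 𝟙 _)
        simp
      μIso_hom_natural_right := fun {P P'} Q f => by
        ext
        change Q.1.X ◁ f.f.hom ≫ 𝟙 _ = 𝟙 _ ≫ (𝟙 _ ⊗ₘ f.f.hom)
        simp
      associativity := fun P Q R => by
        ext
        change 𝟙 (P.1.X ⊗ Q.1.X) ▷ R.1.X ≫ 𝟙 _ ≫ (α_ P.1.X Q.1.X R.1.X).hom =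
          (α_ P.1.X Q.1.X R.1.X).hom ≫ P.1.X ◁ 𝟙 (Q.1.X ⊗ R.1.X) ≫ 𝟙 _
        simp
      left_unitality := fun P => by
        ext
        change (λ_ P.1.X).hom = 𝟙 (𝟙_ B) ▷ P.1.X ≫ 𝟙 _ ≫ (λ_ P.1.X).hom
        simp
      right_unitality := fun P => by
        ext
        change (ρ_ P.1.X).hom = P.1.X ◁ 𝟙 (𝟙_ B) ≫ 𝟙 _ ≫ (ρ_ P.1.X).hom
        simp }

end ForgetCenter

end RightModules

/-! ## The central double -/

namespace CentralDouble

open scoped MonObj ComonObj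

variable {B : Type u} [Category.{v} B] [MonoidalCategory B] [BraidedCategory B]

/-- An object `X` of a braided category with the half braiding `τ_{U,X}⁻¹ : X ⊗ U ⟶ U ⊗ X`. -/
def mirrorObj (X : B) : Center B :=
  ⟨X,
    { β := fun U => (β_ U X).symm
      monoidal := fun U V => by
        rw [← cancel_mono (β_ (U ⊗ V) X).hom]
        simp
      naturality := fun {U V} f => by
        rw [Iso.symm_hom, Iso.symm_hom, Iso.eq_inv_comp, ← Category.assoc, Iso.comp_inv_eq]
        simp }⟩

variable [RigidCategory B] (A : B)

/-- The endofunctor `d_A` of the center: `d_A (M, σ) = (M ⊗ (A ⊗ ᵛA), ς)` with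
`ς_X = (σ_X ⊗ id_{A ⊗ ᵛA}) (id_M ⊗ τ_{X, A ⊗ ᵛA}⁻¹)`, and `d_A f = f ⊗ id`.
Here `ᵛA` is the dual of `A` with evaluation `ᵛA ⊗ A ⟶ 𝟙` and coevaluation `𝟙 ⟶ A ⊗ ᵛA`,
which Mathlib denotes `Aᘁ`. -/
def dA : Center B ⥤ Center B := tensorRight (mirrorObj (A ⊗ Aᘁ))

theorem dA_obj (M : Center B) : ((dA A).obj M).1 = (M.1 ⊗ (A ⊗ Aᘁ)) := rfl

theorem dA_halfBraiding (M : Center B) (X : B) :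
    (((dA A).obj M).2.β X).hom =
      (α_ M.1 (A ⊗ Aᘁ) X).hom ≫ M.1 ◁ (β_ X (A ⊗ Aᘁ)).inv ≫ (α_ M.1 X (A ⊗ Aᘁ)).inv ≫
        (M.2.β X).hom ▷ (A ⊗ Aᘁ) ≫ (α_ X M.1 (A ⊗ Aᘁ)).hom := rfl

theorem dA_map {M N : Center B} (f : M ⟶ N) :
    ((dA A).map f).f = f.f ▷ (A ⊗ Aᘁ) := rfl

/-- The coevaluation `𝟙 ⟶ A ⊗ ᵛA`. -/
abbrev coev : 𝟙_ B ⟶ A ⊗ Aᘁ := ExactPairing.coevaluation A Aᘁ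

/-- The evaluation `ᵛA ⊗ A ⟶ 𝟙`. -/
abbrev ev : Aᘁ ⊗ A ⟶ 𝟙_ B := ExactPairing.evaluation A Aᘁ

section

variable [HopfObj A]

/-- `e = (ε ⊗ id) coev : 𝟙 ⟶ ᵛA`. -/
def unitDual : 𝟙_ B ⟶ Aᘁ := coev A ≫ ε[A] ▷ Aᘁ ≫ (λ_ Aᘁ).hom

/-- `ev (id ⊗ u) : ᵛA ⟶ 𝟙`. -/
def counitDual : Aᘁ ⟶ 𝟙_ B := (ρ_ Aᘁ).inv ≫ Aᘁ ◁ η[A] ≫ ev A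

/-- The product `ᵛA ⊗ ᵛA ⟶ ᵛA`, characterized by
`ev (m' ⊗ id) = (ev ⊗ ev) (id ⊗ τ_{ᵛA,A} ⊗ id) (id ⊗ id ⊗ Δ)`. -/
def mulDual : Aᘁ ⊗ Aᘁ ⟶ Aᘁ :=
  𝟙 _ ⊗≫ (Aᘁ ⊗ Aᘁ) ◁ coev A ⊗≫ (Aᘁ ⊗ Aᘁ) ◁ Δ[A] ▷ Aᘁ ⊗≫
    Aᘁ ◁ (β_ Aᘁ A).hom ▷ (A ⊗ Aᘁ) ⊗≫ ev A ▷ (Aᘁ ⊗ A ⊗ Aᘁ) ⊗≫ ev A ▷ Aᘁ ⊗≫ 𝟙 _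

/-- The coproduct `ᵛA ⟶ ᵛA ⊗ ᵛA` dual to the product of `A`, equal to
`(ev (id ⊗ m) ⊗ id ⊗ id) (id ⊗ (id ⊗ coev ⊗ id) coev)`. -/
def comulDual : Aᘁ ⟶ Aᘁ ⊗ Aᘁ :=
  𝟙 _ ⊗≫ Aᘁ ◁ coev A ⊗≫ (Aᘁ ⊗ A) ◁ coev A ▷ Aᘁ ⊗≫
    Aᘁ ◁ μ[A] ▷ (Aᘁ ⊗ Aᘁ) ⊗≫ ev A ▷ (Aᘁ ⊗ Aᘁ) ⊗≫ 𝟙 _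

/-- The half braiding of `(M, σ) ⊗ (A, τ_{-,A}⁻¹)`, namely
`X ↦ (σ_X ⊗ id_A) (id_M ⊗ τ_{X,A}⁻¹)`. -/
def sigmaA (M : Center B) (X : B) : (M.1 ⊗ A) ⊗ X ⟶ X ⊗ (M.1 ⊗ A) :=
  ((M ⊗ mirrorObj A).2.β X).hom

/-- `δ_M = (σ_A ⊗ id) (id_M ⊗ coev) : M ⟶ A ⊗ M ⊗ ᵛA`. -/
def delta (M : Center B) : M.1 ⟶ A ⊗ M.1 ⊗ Aᘁ :=
  𝟙 _ ⊗≫ M.1 ◁ coev A ⊗≫ (M.2.β A).hom ▷ Aᘁ ⊗≫ 𝟙 _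

/-- `δ` for the object `(M, σ) ⊗ (A, τ_{-,A}⁻¹)`. -/
def deltaA (M : Center B) : M.1 ⊗ A ⟶ A ⊗ (M.1 ⊗ A) ⊗ Aᘁ := delta A (M ⊗ mirrorObj A)

/-- `φ_M = (m ⊗ id) (id_A ⊗ δ_{M ⊗ A}) σ_A^{M ⊗ A} (id_M ⊗ Δ) : M ⊗ A ⟶ A ⊗ (M ⊗ A ⊗ ᵛA)`. -/
def phi (M : Center B) : M.1 ⊗ A ⟶ A ⊗ M.1 ⊗ A ⊗ Aᘁ :=
  𝟙 _ ⊗≫ M.1 ◁ Δ[A] ⊗≫ sigmaA A M A ⊗≫ A ◁ deltaA A M ⊗≫ μ[A] ▷ (M.1 ⊗ A ⊗ Aᘁ) ⊗≫ 𝟙 _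

end

section

variable [HopfObj A] [IsIso (HopfObj.antipode (X := A))]

/-- `θ_M = (m ⊗ id) (id_A ⊗ τ_{M ⊗ A ⊗ ᵛA, A}) (φ_M ⊗ S⁻¹) (id_M ⊗ τ_{A,A}⁻¹ Δ) :
M ⊗ A ⟶ A ⊗ (M ⊗ A ⊗ ᵛA)`. -/
def theta (M : Center B) : M.1 ⊗ A ⟶ A ⊗ M.1 ⊗ A ⊗ Aᘁ :=
  𝟙 _ ⊗≫ M.1 ◁ (Δ[A] ≫ (β_ A A).inv) ⊗≫ (M.1 ⊗ A) ◁ inv (HopfObj.antipode (X := A)) ⊗≫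
    phi A M ▷ A ⊗≫ A ◁ (β_ (M.1 ⊗ A ⊗ Aᘁ) A).hom ⊗≫ μ[A] ▷ (M.1 ⊗ A ⊗ Aᘁ) ⊗≫ 𝟙 _

/-- `ξ_M = (ev ⊗ id) (id ⊗ θ_M) (σ_{ᵛA} ⊗ id_A) : M ⊗ ᵛA ⊗ A ⟶ M ⊗ A ⊗ ᵛA`. -/
def xi (M : Center B) : (M.1 ⊗ Aᘁ) ⊗ A ⟶ M.1 ⊗ A ⊗ Aᘁ :=
  𝟙 _ ⊗≫ (M.2.β Aᘁ).hom ▷ A ⊗≫ Aᘁ ◁ theta A M ⊗≫ ev A ▷ (M.1 ⊗ A ⊗ Aᘁ) ⊗≫ 𝟙 _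

/-- `ξ` for the object `(M, σ) ⊗ (A, τ_{-,A}⁻¹)`. -/
def xiA (M : Center B) : ((M.1 ⊗ A) ⊗ Aᘁ) ⊗ A ⟶ (M.1 ⊗ A) ⊗ A ⊗ Aᘁ := xi A (M ⊗ mirrorObj A)

/-- The product of `d_A`:
`(id_M ⊗ id_A ⊗ m') (id_M ⊗ m ⊗ id ⊗ id) (ξ_{M ⊗ A} ⊗ id)`. -/
def mul (M : Center B) : (M.1 ⊗ A ⊗ Aᘁ) ⊗ A ⊗ Aᘁ ⟶ M.1 ⊗ A ⊗ Aᘁ :=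
  𝟙 _ ⊗≫ xiA A M ▷ Aᘁ ⊗≫ M.1 ◁ μ[A] ▷ (Aᘁ ⊗ Aᘁ) ⊗≫ (M.1 ⊗ A) ◁ mulDual A ⊗≫ 𝟙 _

end

section

variable [HopfObj A]

/-- The unit `id_M ⊗ u ⊗ e` of `d_A`. -/
def one (M : Center B) : M.1 ⟶ M.1 ⊗ A ⊗ Aᘁ :=
  𝟙 _ ⊗≫ M.1 ◁ (η[A] ⊗ₘ unitDual A) ⊗≫ 𝟙 _

/-- The comonoidal structure of `d_A`:
`(id_{M ⊗ A} ⊗ σ_{ᵛA}^{N ⊗ A} ⊗ id) (id ⊗ id ⊗ id ⊗ id ⊗ Δ') (id_M ⊗ τ_{N,A} ⊗ id ⊗ id)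
(id_M ⊗ id_N ⊗ Δ ⊗ id)`. -/
def comul (M N : Center B) : (M.1 ⊗ N.1) ⊗ A ⊗ Aᘁ ⟶ (M.1 ⊗ A ⊗ Aᘁ) ⊗ N.1 ⊗ A ⊗ Aᘁ :=
  𝟙 _ ⊗≫ (M.1 ⊗ N.1) ◁ Δ[A] ▷ Aᘁ ⊗≫ M.1 ◁ (β_ N.1 A).hom ▷ (A ⊗ Aᘁ) ⊗≫
    (M.1 ⊗ A ⊗ N.1 ⊗ A) ◁ comulDual A ⊗≫ (M.1 ⊗ A) ◁ sigmaA A N Aᘁ ▷ Aᘁ ⊗≫ 𝟙 _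

/-- The comonoidal structure `ε ⊗ ev (id ⊗ u)` of `d_A`. -/
def counit : 𝟙_ B ⊗ A ⊗ Aᘁ ⟶ 𝟙_ B := 𝟙 _ ⊗≫ (ε[A] ⊗ₘ counitDual A) ⊗≫ 𝟙 _

/-- The R-matrix of `d_A`:
`(id_N ⊗ id_A ⊗ e ⊗ id_M ⊗ u ⊗ id) (σ_{N ⊗ A} ⊗ id) (id_M ⊗ id_N ⊗ coev)`. -/
def R (M N : Center B) : M.1 ⊗ N.1 ⟶ (N.1 ⊗ A ⊗ Aᘁ) ⊗ M.1 ⊗ A ⊗ Aᘁ :=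
  𝟙 _ ⊗≫ (M.1 ⊗ N.1) ◁ coev A ⊗≫ (M.2.β (N.1 ⊗ A)).hom ▷ Aᘁ ⊗≫
    (N.1 ⊗ A) ◁ unitDual A ▷ (M.1 ⊗ Aᘁ) ⊗≫ (N.1 ⊗ A ⊗ Aᘁ ⊗ M.1) ◁ η[A] ▷ Aᘁ ⊗≫ 𝟙 _

/-- `r = ρ (id_M ⊗ id_A ⊗ e)`. -/
def actionOf (M : Center B) (ρ : M.1 ⊗ A ⊗ Aᘁ ⟶ M.1) : M.1 ⊗ A ⟶ M.1 :=
  𝟙 _ ⊗≫ (M.1 ⊗ A) ◁ unitDual A ⊗≫ ρ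

/-- `γ_{(N, s)} = (s ⊗ ρ) (id_N ⊗ id_A ⊗ id_M ⊗ u ⊗ id) (σ_{N ⊗ A} ⊗ id) (id_M ⊗ id_N ⊗ coev)`. -/
def gammaOf (M : Center B) (ρ : M.1 ⊗ A ⊗ Aᘁ ⟶ M.1) (N : RightModule A) :
    M.1 ⊗ N.X ⟶ N.X ⊗ M.1 :=
  𝟙 _ ⊗≫ (M.1 ⊗ N.X) ◁ coev A ⊗≫ (M.2.β (N.X ⊗ A)).hom ▷ Aᘁ ⊗≫
    (N.X ⊗ A ⊗ M.1) ◁ η[A] ▷ Aᘁ ⊗≫ (N.act ⊗ₘ ρ)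

/-- The component `γ_{(A ⊗ ᵛA, α)}` of a half braiding on a module, where
`α = (m ⊗ id) (id_A ⊗ τ_{ᵛA,A})`. -/
def gammaAlpha (P : Center (RightModule A)) : P.1.X ⊗ A ⊗ Aᘁ ⟶ (A ⊗ Aᘁ) ⊗ P.1.X :=
  (P.2.β (RightModule.regularTensor A Aᘁ)).hom.hom

/-- `ρ = (ev τ_{ᵛA,A}⁻¹ ⊗ id_M) γ_{(A ⊗ ᵛA, α)} (r ⊗ u ⊗ id)`. -/
def rhoOf (P : Center (RightModule A)) : P.1.X ⊗ A ⊗ Aᘁ ⟶ P.1.X :=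
  𝟙 _ ⊗≫ P.1.act ▷ Aᘁ ⊗≫ P.1.X ◁ η[A] ▷ Aᘁ ⊗≫ gammaAlpha A P ⊗≫
    (β_ Aᘁ A).inv ▷ P.1.X ⊗≫ ev A ▷ P.1.X ⊗≫ 𝟙 _

end

end CentralDouble

end

/-! Everything takes place in the centre `Z(B)`. An object `X` of `B` gives the mirror object `(X,
τ⁻¹)`, and by naturality of `τ⁻¹` every morphism of `B` lifts to mirror objects. On mirror objects
the braiding of the centre is the inverse of `τ`. Hence the mirror `H` of `A` is a Hopf algebra for
the inverse braiding of the centre, the mirror `K` of `ᵛA` is its dual, and `d_A` is simply `M ↦ M ⊗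
H ⊗ K`. Most of the argument is therefore carried out for such an `H` (`MirrorHopfObj`) with dual
`K` in an arbitrary braided category.

An action of `K` on `M` is the same as a left coaction `m ↦ m₋₁ ⊗ m₀` of `H` (`tr`, `unc`). An
action and a coaction of `H` form a Yetter-Drinfeld module when, up to braidings, `m₋₁ h₁ ⊗ m₀ h₂ =
h₂ (m h₁)₋₁ ⊗ (m h₁)₀`. The left side is a convolution against the opposite comultiplication, which
the inverse antipode inverts (`conv`, `convInv`). Solving for `m₋₁ ⊗ m₀ h` yields a rule for
exchanging `K` and `H`: the distributive law `xi`. The composite monad of `- ⊗ H` and `- ⊗ K` is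
`d_A`, and its modules are exactly the Yetter-Drinfeld modules (`isYetterDrinfeld_tr_iff`,
`IsDoubleAction.isYetterDrinfeldModule`).

A coaction on `M` and an action on `N` define `gam : m ⊗ n ↦ n m₋₁ ⊗ m₀`. It is invertible by the
antipode, satisfies the hexagons, and is linear in all modules precisely when `M` is
Yetter-Drinfeld. Conversely, a half braiding on `A`-modules is determined by its values on trivial
modules and on the regular module, because the action is a linear map `N ⊗ A ⟶ N` from a trivial
module tensored with the regular one (`halfBraid_eq_gam`). So Yetter-Drinfeld modules in the centre
of `B` are the objects of the centre of `A`-modules, and this is `Ψ`.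

The comonoidal structure and the R-matrix are obtained from the tensor product and the braiding of
modules by evaluating on free modules (`ModuleTensor`, `ModuleBraiding`). The fusion operators are
inverted by `S` and `S⁻¹`. Finally `U` is, up to `Ψ`, the forgetful functor of a monad, hence
monadic. -/

noncomputable section

set_option linter.unusedSectionVars false

/-! ### Bimonads and R-matrices from tensor products and braidings of modules -/

/-- A tensor product of modules over a monad, lifting the one of the base category. -/
structure ModuleTensor {C : Type u₁} [Category.{v₁} C] [MonoidalCategory C] (T : Monad C) where
  comul : ∀ X Y : C, T.obj (X ⊗ Y) ⟶ T.obj X ⊗ T.obj Y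
  counit : T.obj (𝟙_ C) ⟶ 𝟙_ C
  natural : ∀ {X X' Y Y' : C} (f : X ⟶ X') (g : Y ⟶ Y'),
    T.map (f ⊗ₘ g) ≫ comul X' Y' = comul X Y ≫ (T.map f ⊗ₘ T.map g)
  tensor_unit : ∀ P Q : T.Algebra,
    T.η.app (P.A ⊗ Q.A) ≫ comul P.A Q.A ≫ (P.a ⊗ₘ Q.a) = 𝟙 (P.A ⊗ Q.A)
  tensor_assoc : ∀ P Q : T.Algebra, T.μ.app (P.A ⊗ Q.A) ≫ comul P.A Q.A ≫ (P.a ⊗ₘ Q.a) =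
    T.map (comul P.A Q.A ≫ (P.a ⊗ₘ Q.a)) ≫ comul P.A Q.A ≫ (P.a ⊗ₘ Q.a)
  unit_unit : T.η.app (𝟙_ C) ≫ counit = 𝟙 (𝟙_ C)
  unit_assoc : T.μ.app (𝟙_ C) ≫ counit = T.map counit ≫ counit
  associator : ∀ P Q R : T.Algebra, T.map (α_ P.A Q.A R.A).hom ≫ comul P.A (Q.A ⊗ R.A) ≫
      (P.a ⊗ₘ (comul Q.A R.A ≫ (Q.a ⊗ₘ R.a))) =
    (comul (P.A ⊗ Q.A) R.A ≫ ((comul P.A Q.A ≫ (P.a ⊗ₘ Q.a)) ⊗ₘ R.a)) ≫ (α_ P.A Q.A R.A).hom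
  leftUnitor : ∀ P : T.Algebra, T.map (λ_ P.A).hom ≫ P.a =
    (comul (𝟙_ C) P.A ≫ (counit ⊗ₘ P.a)) ≫ (λ_ P.A).hom
  rightUnitor : ∀ P : T.Algebra, T.map (ρ_ P.A).hom ≫ P.a =
    (comul P.A (𝟙_ C) ≫ (P.a ⊗ₘ counit)) ≫ (ρ_ P.A).hom

namespace ModuleTensor

variable {C : Type u₁} [Category.{v₁} C] [MonoidalCategory C] {T : Monad C} (E : ModuleTensor T)
include E

/-- Tensor products of free modules determine the comonoidal structure. -/
theorem map_comul_mul (X Y : C) : T.map (T.η.app X ⊗ₘ T.η.app Y) ≫ E.comul (T.obj X) (T.obj Y) ≫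
    (T.μ.app X ⊗ₘ T.μ.app Y) = E.comul X Y := by
  rw [reassoc_of% E.natural, tensorHom_comp_tensorHom, T.right_unit, T.right_unit,
    id_tensorHom_id, Category.comp_id]
  rfl

theorem counit_left (X : C) : T.map (𝟙_ C ◁ T.η.app X) ≫ E.comul (𝟙_ C) (T.obj X) ≫
    (E.counit ⊗ₘ T.μ.app X) = E.comul (𝟙_ C) X ≫ E.counit ▷ T.obj X := by
  rw [← id_tensorHom, reassoc_of% E.natural, tensorHom_comp_tensorHom, T.right_unit, T.map_id,
    Category.id_comp, tensorHom_id]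
  rfl

theorem counit_right (X : C) : T.map (T.η.app X ▷ 𝟙_ C) ≫ E.comul (T.obj X) (𝟙_ C) ≫
    (T.μ.app X ⊗ₘ E.counit) = E.comul X (𝟙_ C) ≫ T.obj X ◁ E.counit := by
  rw [← tensorHom_id, reassoc_of% E.natural, tensorHom_comp_tensorHom, T.right_unit, T.map_id,
    Category.id_comp, id_tensorHom]
  rfl

/-- Linearity of the associator on free modules, restricted along the three units: each unit cancels
a multiplication of the monad, and coassociativity is what remains. The counit laws below follow in
the same way from linearity of the unitors. -/
theorem comul_assoc (X Y Z : C) : E.comul (X ⊗ Y) Z ≫ E.comul X Y ▷ T.obj Z ≫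
    (α_ (T.obj X) (T.obj Y) (T.obj Z)).hom =
      T.map (α_ X Y Z).hom ≫ E.comul X (Y ⊗ Z) ≫ T.obj X ◁ E.comul Y Z := by
  have h : T.map (α_ (T.obj X) (T.obj Y) (T.obj Z)).hom ≫
        E.comul (T.obj X) (T.obj Y ⊗ T.obj Z) ≫
        (T.μ.app X ⊗ₘ (E.comul (T.obj Y) (T.obj Z) ≫ (T.μ.app Y ⊗ₘ T.μ.app Z))) =
      (E.comul (T.obj X ⊗ T.obj Y) (T.obj Z) ≫ ((E.comul (T.obj X) (T.obj Y) ≫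
        (T.μ.app X ⊗ₘ T.μ.app Y)) ⊗ₘ T.μ.app Z)) ≫ (α_ (T.obj X) (T.obj Y) (T.obj Z)).hom :=
    E.associator (T.free.obj X) (T.free.obj Y) (T.free.obj Z)
  have e₁ : T.map ((T.η.app X ⊗ₘ T.η.app Y) ⊗ₘ T.η.app Z) ≫
      T.map (α_ (T.obj X) (T.obj Y) (T.obj Z)).hom =
      T.map (α_ X Y Z).hom ≫ T.map (T.η.app X ⊗ₘ T.η.app Y ⊗ₘ T.η.app Z) := by
    rw [← T.map_comp, associator_naturality, T.map_comp]; rfl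
  have h₂ := congrArg (T.map ((T.η.app X ⊗ₘ T.η.app Y) ⊗ₘ T.η.app Z) ≫ ·) h
  simp only [reassoc_of% e₁] at h₂
  rw [reassoc_of% E.natural, tensorHom_comp_tensorHom, E.map_comul_mul, T.right_unit,
    Category.assoc, reassoc_of% E.natural, tensorHom_comp_tensorHom_assoc, E.map_comul_mul,
    T.right_unit] at h₂
  rw [← tensorHom_id, ← id_tensorHom]
  exact h₂.symm

theorem counit_comul (X : C) : T.map (λ_ X).hom =
    E.comul (𝟙_ C) X ≫ E.counit ▷ T.obj X ≫ (λ_ (T.obj X)).hom := by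
  have h : T.map (λ_ (T.obj X)).hom ≫ T.μ.app X =
      (E.comul (𝟙_ C) (T.obj X) ≫ (E.counit ⊗ₘ T.μ.app X)) ≫ (λ_ (T.obj X)).hom :=
    E.leftUnitor (T.free.obj X)
  have e₁ : T.map (𝟙_ C ◁ T.η.app X) ≫ T.map (λ_ (T.obj X)).hom =
      T.map (λ_ X).hom ≫ T.map (T.η.app X) := by
    rw [← T.map_comp, leftUnitor_naturality, T.map_comp]; rfl
  have h₂ := congrArg (T.map (𝟙_ C ◁ T.η.app X) ≫ ·) h
  simp only [reassoc_of% e₁, T.right_unit, Category.assoc, reassoc_of% E.counit_left X] at h₂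
  exact (Category.comp_id _).symm.trans h₂

theorem comul_counit (X : C) : T.map (ρ_ X).hom =
    E.comul X (𝟙_ C) ≫ T.obj X ◁ E.counit ≫ (ρ_ (T.obj X)).hom := by
  have h : T.map (ρ_ (T.obj X)).hom ≫ T.μ.app X =
      (E.comul (T.obj X) (𝟙_ C) ≫ (T.μ.app X ⊗ₘ E.counit)) ≫ (ρ_ (T.obj X)).hom :=
    E.rightUnitor (T.free.obj X)
  have e₁ : T.map (T.η.app X ▷ 𝟙_ C) ≫ T.map (ρ_ (T.obj X)).hom =
      T.map (ρ_ X).hom ≫ T.map (T.η.app X) := by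
    rw [← T.map_comp, rightUnitor_naturality, T.map_comp]; rfl
  have h₂ := congrArg (T.map (T.η.app X ▷ 𝟙_ C) ≫ ·) h
  simp only [reassoc_of% e₁, T.right_unit, Category.assoc, reassoc_of% E.counit_right X] at h₂
  exact (Category.comp_id _).symm.trans h₂

/-- The comonoidal structure defined by a tensor product of modules. -/
@[reducible]
def oplaxMonoidal : T.toFunctor.OplaxMonoidal where
  η := E.counit
  δ := E.comul
  δ_natural_left f Y := by
    have h := E.natural f (𝟙 Y)
    rw [T.map_id, tensorHom_id, tensorHom_id] at h
    exact h.symm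
  δ_natural_right X f := by
    have h := E.natural (𝟙 X) f
    rw [T.map_id, id_tensorHom, id_tensorHom] at h
    exact h.symm
  oplax_associativity := E.comul_assoc
  oplax_left_unitality X := by
    rw [← cancel_mono (λ_ (T.obj X)).hom, Category.assoc, Category.assoc,
      ← E.counit_comul, ← T.map_comp, Iso.inv_hom_id, Iso.inv_hom_id, T.map_id]
  oplax_right_unitality X := by
    rw [← cancel_mono (ρ_ (T.obj X)).hom, Category.assoc, Category.assoc,
      ← E.comul_counit, ← T.map_comp, Iso.inv_hom_id, Iso.inv_hom_id, T.map_id]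

/-- The bimonad defined by a tensor product of modules. -/
@[reducible]
def bimonad : Bimonad T where
  toOplaxMonoidal := E.oplaxMonoidal
  mu_tensor X Y := by
    have h : T.μ.app (T.obj X ⊗ T.obj Y) ≫ E.comul (T.obj X) (T.obj Y) ≫
          (T.μ.app X ⊗ₘ T.μ.app Y) =
        T.map (E.comul (T.obj X) (T.obj Y) ≫ (T.μ.app X ⊗ₘ T.μ.app Y)) ≫
          E.comul (T.obj X) (T.obj Y) ≫ (T.μ.app X ⊗ₘ T.μ.app Y) :=
      E.tensor_assoc (T.free.obj X) (T.free.obj Y)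
    have h₃ : T.map (T.map (T.η.app X ⊗ₘ T.η.app Y)) ≫ T.μ.app (T.obj X ⊗ T.obj Y) =
        T.μ.app (X ⊗ Y) ≫ T.map (T.η.app X ⊗ₘ T.η.app Y) :=
      T.μ.naturality (T.η.app X ⊗ₘ T.η.app Y)
    -- The law `h` lives on free modules; precomposing with the doubled units brings it back to `X`
    -- and `Y`.
    have h₂ := congrArg (T.map (T.map (T.η.app X ⊗ₘ T.η.app Y)) ≫ ·) h
    simp only [reassoc_of% h₃, E.map_comul_mul] at h₂
    rw [← T.map_comp_assoc, E.map_comul_mul] at h₂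
    exact h₂
  mu_unit := E.unit_assoc
  eta_tensor X Y := by
    have h : T.η.app (T.obj X ⊗ T.obj Y) ≫ E.comul (T.obj X) (T.obj Y) ≫
        (T.μ.app X ⊗ₘ T.μ.app Y) = 𝟙 _ := E.tensor_unit (T.free.obj X) (T.free.obj Y)
    have h₃ : (T.η.app X ⊗ₘ T.η.app Y) ≫ T.η.app (T.obj X ⊗ T.obj Y) =
        T.η.app (X ⊗ Y) ≫ T.map (T.η.app X ⊗ₘ T.η.app Y) :=
      T.η.naturality (T.η.app X ⊗ₘ T.η.app Y)
    have h₂ := congrArg ((T.η.app X ⊗ₘ T.η.app Y) ≫ ·) h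
    simp only [reassoc_of% h₃, E.map_comul_mul] at h₂
    exact h₂.trans (Category.comp_id _)
  eta_unit := E.unit_unit

/-- A natural family of morphisms inducing a braiding on modules. -/
structure ModuleBraiding where
  R : ∀ X Y : C, X ⊗ Y ⟶ T.obj Y ⊗ T.obj X
  natural : ∀ {X X' Y Y' : C} (f : X ⟶ X') (g : Y ⟶ Y'),
    (f ⊗ₘ g) ≫ R X' Y' = R X Y ≫ (T.map g ⊗ₘ T.map f)
  linear : ∀ P Q : T.Algebra, (E.comul P.A Q.A ≫ (P.a ⊗ₘ Q.a)) ≫ R P.A Q.A ≫ (Q.a ⊗ₘ P.a) =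
    T.map (R P.A Q.A ≫ (Q.a ⊗ₘ P.a)) ≫ E.comul Q.A P.A ≫ (Q.a ⊗ₘ P.a)
  tensor_left : ∀ P Q S : T.Algebra, R (P.A ⊗ Q.A) S.A ≫
      (S.a ⊗ₘ (E.comul P.A Q.A ≫ (P.a ⊗ₘ Q.a))) =
    (α_ P.A Q.A S.A).hom ≫ P.A ◁ (R Q.A S.A ≫ (S.a ⊗ₘ Q.a)) ≫ (α_ P.A S.A Q.A).inv ≫
      (R P.A S.A ≫ (S.a ⊗ₘ P.a)) ▷ Q.A ≫ (α_ S.A P.A Q.A).hom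
  tensor_right : ∀ P Q S : T.Algebra, R P.A (Q.A ⊗ S.A) ≫
      ((E.comul Q.A S.A ≫ (Q.a ⊗ₘ S.a)) ⊗ₘ P.a) =
    (α_ P.A Q.A S.A).inv ≫ (R P.A Q.A ≫ (Q.a ⊗ₘ P.a)) ▷ S.A ≫ (α_ Q.A P.A S.A).hom ≫
      Q.A ◁ (R P.A S.A ≫ (S.a ⊗ₘ P.a)) ≫ (α_ Q.A S.A P.A).inv
  isIso : ∀ P Q : T.Algebra, IsIso (R P.A Q.A ≫ (Q.a ⊗ₘ P.a))

namespace ModuleBraiding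

variable {E} (F : E.ModuleBraiding)
include F

theorem eta_R_mul (X Y : C) : (T.η.app X ⊗ₘ T.η.app Y) ≫ F.R (T.obj X) (T.obj Y) ≫
    (T.μ.app Y ⊗ₘ T.μ.app X) = F.R X Y := by
  rw [reassoc_of% F.natural, tensorHom_comp_tensorHom, T.right_unit, T.right_unit,
    id_tensorHom_id, Category.comp_id]
  rfl

theorem eta_R_left (X W : C) {V : C} (g : T.obj W ⟶ V) :
    T.η.app X ▷ W ≫ F.R (T.obj X) W ≫ (g ⊗ₘ T.μ.app X) = F.R X W ≫ g ▷ T.obj X := by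
  rw [← tensorHom_id, reassoc_of% F.natural, tensorHom_comp_tensorHom, T.right_unit, T.map_id,
    Category.id_comp, ← tensorHom_id]
  rfl

theorem eta_R_right (X W : C) {V : C} (g : T.obj W ⟶ V) :
    W ◁ T.η.app X ≫ F.R W (T.obj X) ≫ (T.μ.app X ⊗ₘ g) = F.R W X ≫ T.obj X ◁ g := by
  rw [← id_tensorHom, reassoc_of% F.natural, tensorHom_comp_tensorHom, T.right_unit, T.map_id,
    Category.id_comp, ← id_tensorHom]
  rfl

/-- The hexagon for free modules restricted along units. One multiplication survives on the right
because `Z` is braided twice and its unit is used up by the first crossing. -/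
theorem R_tensor_left (X Y Z : C) : F.R (X ⊗ Y) Z ≫ T.obj Z ◁ E.comul X Y =
    (α_ X Y Z).hom ≫ X ◁ F.R Y Z ≫ (α_ X (T.obj Z) (T.obj Y)).inv ≫ F.R X (T.obj Z) ▷ T.obj Y ≫
      (T.μ.app Z ▷ T.obj X) ▷ T.obj Y ≫ (α_ (T.obj Z) (T.obj X) (T.obj Y)).hom := by
  have h : F.R (T.obj X ⊗ T.obj Y) (T.obj Z) ≫
      (T.μ.app Z ⊗ₘ (E.comul (T.obj X) (T.obj Y) ≫ (T.μ.app X ⊗ₘ T.μ.app Y))) =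
      (α_ _ _ _).hom ≫ T.obj X ◁ (F.R (T.obj Y) (T.obj Z) ≫ (T.μ.app Z ⊗ₘ T.μ.app Y)) ≫
        (α_ _ _ _).inv ≫ (F.R (T.obj X) (T.obj Z) ≫ (T.μ.app Z ⊗ₘ T.μ.app X)) ▷ T.obj Y ≫
        (α_ _ _ _).hom := F.tensor_left (T.free.obj X) (T.free.obj Y) (T.free.obj Z)
  have h₂ := congrArg (((T.η.app X ⊗ₘ T.η.app Y) ⊗ₘ T.η.app Z) ≫ ·) h
  simp only [reassoc_of% F.natural, tensorHom_comp_tensorHom, E.map_comul_mul, T.right_unit] at h₂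
  refine ((congrArg (F.R (X ⊗ Y) Z ≫ ·) (id_tensorHom _ _)).symm.trans h₂).trans ?_
  have e₁ : ((T.η.app X ⊗ₘ T.η.app Y) ⊗ₘ T.η.app Z) ≫ (α_ (T.obj X) (T.obj Y) (T.obj Z)).hom =
      (α_ X Y Z).hom ≫ X ◁ (T.η.app Y ⊗ₘ T.η.app Z) ≫ T.η.app X ▷ (T.obj Y ⊗ T.obj Z) := by
    rw [associator_naturality, MonoidalCategory.tensorHom_def' (T.η.app X)]; rfl
  rw [reassoc_of% e₁, ← whisker_exchange_assoc, ← whiskerLeft_comp_assoc, F.eta_R_mul,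
    associator_inv_naturality_left_assoc, ← comp_whiskerRight_assoc (T.η.app X ▷ _),
    F.eta_R_left, comp_whiskerRight_assoc]

theorem R_tensor_right (X Y Z : C) : F.R X (Y ⊗ Z) ≫ E.comul Y Z ▷ T.obj X =
    (α_ X Y Z).inv ≫ F.R X Y ▷ Z ≫ (α_ (T.obj Y) (T.obj X) Z).hom ≫ T.obj Y ◁ F.R (T.obj X) Z ≫
      T.obj Y ◁ T.obj Z ◁ T.μ.app X ≫ (α_ (T.obj Y) (T.obj Z) (T.obj X)).inv := by
  have h : F.R (T.obj X) (T.obj Y ⊗ T.obj Z) ≫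
      ((E.comul (T.obj Y) (T.obj Z) ≫ (T.μ.app Y ⊗ₘ T.μ.app Z)) ⊗ₘ T.μ.app X) =
      (α_ _ _ _).inv ≫ (F.R (T.obj X) (T.obj Y) ≫ (T.μ.app Y ⊗ₘ T.μ.app X)) ▷ T.obj Z ≫
        (α_ _ _ _).hom ≫ T.obj Y ◁ (F.R (T.obj X) (T.obj Z) ≫ (T.μ.app Z ⊗ₘ T.μ.app X)) ≫
        (α_ _ _ _).inv := F.tensor_right (T.free.obj X) (T.free.obj Y) (T.free.obj Z)
  have h₂ := congrArg ((T.η.app X ⊗ₘ (T.η.app Y ⊗ₘ T.η.app Z)) ≫ ·) h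
  simp only [reassoc_of% F.natural, tensorHom_comp_tensorHom, E.map_comul_mul, T.right_unit] at h₂
  refine ((congrArg (F.R X (Y ⊗ Z) ≫ ·) (tensorHom_id _ _)).symm.trans h₂).trans ?_
  have e₁ : (T.η.app X ⊗ₘ (T.η.app Y ⊗ₘ T.η.app Z)) ≫ (α_ (T.obj X) (T.obj Y) (T.obj Z)).inv =
      (α_ X Y Z).inv ≫ (T.η.app X ⊗ₘ T.η.app Y) ▷ Z ≫ (T.obj X ⊗ T.obj Y) ◁ T.η.app Z := by
    rw [associator_inv_naturality, MonoidalCategory.tensorHom_def _ (T.η.app Z)]; rfl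
  rw [reassoc_of% e₁, whisker_exchange_assoc, ← comp_whiskerRight_assoc, F.eta_R_mul,
    associator_naturality_right_assoc, ← whiskerLeft_comp_assoc _ (_ ◁ T.η.app Z),
    F.eta_R_right, whiskerLeft_comp_assoc]

/-- The braiding of free modules. -/
def freeBraiding (X Y : C) : T.obj X ⊗ T.obj Y ⟶ T.obj Y ⊗ T.obj X :=
  F.R (T.obj X) (T.obj Y) ≫ (T.μ.app Y ⊗ₘ T.μ.app X)

instance (X Y : C) : IsIso (F.freeBraiding X Y) := F.isIso (T.free.obj X) (T.free.obj Y)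

/-- The hypotheses say that `f` and `g` are morphisms of free modules. It is applied to morphisms `T
f` and to the multiplications `μ`. -/
theorem freeBraiding_natural {X X' Y Y' : C} {f : T.obj X ⟶ T.obj X'} {g : T.obj Y ⟶ T.obj Y'}
    (hf : T.map f ≫ T.μ.app X' = T.μ.app X ≫ f) (hg : T.map g ≫ T.μ.app Y' = T.μ.app Y ≫ g) :
    inv (F.freeBraiding X Y) ≫ (f ⊗ₘ g) = (g ⊗ₘ f) ≫ inv (F.freeBraiding X' Y') := by
  rw [IsIso.inv_comp_eq, ← Category.assoc, IsIso.eq_comp_inv, freeBraiding, freeBraiding,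
    reassoc_of% F.natural, tensorHom_comp_tensorHom, hf, hg, Category.assoc,
    tensorHom_comp_tensorHom]

/-- The R-matrix defined by a braiding on modules. -/
def rMatrix : @RMatrix C _ _ T E.bimonad :=
  letI := E.bimonad
  { R := F.R
    naturality := F.natural
    linear := fun X Y => by
      have h : (E.comul (T.obj X) (T.obj Y) ≫ (T.μ.app X ⊗ₘ T.μ.app Y)) ≫
          F.R (T.obj X) (T.obj Y) ≫ (T.μ.app Y ⊗ₘ T.μ.app X) =
        T.map (F.R (T.obj X) (T.obj Y) ≫ (T.μ.app Y ⊗ₘ T.μ.app X)) ≫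
          E.comul (T.obj Y) (T.obj X) ≫ (T.μ.app Y ⊗ₘ T.μ.app X) :=
        F.linear (T.free.obj X) (T.free.obj Y)
      have h₂ := congrArg (T.map (T.η.app X ⊗ₘ T.η.app Y) ≫ ·) h
      simp only [Category.assoc, ← T.map_comp_assoc] at h₂
      rw [F.eta_R_mul, reassoc_of% (E.map_comul_mul X Y)] at h₂
      exact h₂
    tensor_left := F.R_tensor_left
    tensor_right := F.R_tensor_right
    invertible := by
      -- The convolution inverse is the inverse braiding of free modules restricted along the units,
      -- just as `R` is the restriction of the braiding.
      refine ⟨fun X Y => (T.η.app Y ⊗ₘ T.η.app X) ≫ inv (F.freeBraiding X Y), ?_, ?_, ?_⟩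
      · intro X X' Y Y' f g
        rw [Category.assoc, F.freeBraiding_natural (T.μ.naturality f) (T.μ.naturality g),
          tensorHom_comp_tensorHom_assoc, tensorHom_comp_tensorHom_assoc]
        exact congrArg (· ≫ _) (congrArg₂ (· ⊗ₘ ·) (T.η.naturality g) (T.η.naturality f))
      · intro X Y
        have h : (T.η.app (T.obj Y) ⊗ₘ T.η.app (T.obj X)) ≫ (T.μ.app Y ⊗ₘ T.μ.app X) = 𝟙 _ := by
          rw [tensorHom_comp_tensorHom, T.left_unit, T.left_unit]
          exact id_tensorHom_id _ _
        have h' : F.R X Y = (T.η.app X ⊗ₘ T.η.app Y) ≫ F.freeBraiding X Y :=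
          (F.eta_R_mul X Y).symm
        -- By associativity `μ` is a morphism of free modules, so the inverse braiding moves past it
        -- and the left unit law removes it.
        rw [Category.assoc, F.freeBraiding_natural (T.assoc X) (T.assoc Y), reassoc_of% h, h',
          Category.assoc]
        exact (congrArg (_ ≫ ·) (IsIso.hom_inv_id (F.freeBraiding X Y))).trans (Category.comp_id _)
      · intro X Y
        rw [Category.assoc]
        exact (congrArg (_ ≫ ·) (IsIso.inv_hom_id (F.freeBraiding X Y))).trans
          (Category.comp_id _) }

end ModuleBraiding

end ModuleTensor

end

/-! ### Hopf algebras for the inverse braiding -/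

noncomputable section

open scoped MonObj ComonObj

set_option linter.unusedSectionVars false

/-- A Hopf monoid for the inverse braiding of `C`, with invertible antipode. -/
class MirrorHopfObj {C : Type u} [Category.{v} C] [MonoidalCategory C] [BraidedCategory C] (H : C)
    extends MonObj H, ComonObj H where
  S : H ⟶ H
  Sinv : H ⟶ H
  one_comul : η[H] ≫ Δ[H] = (λ_ (𝟙_ C)).inv ≫ (η[H] ⊗ₘ η[H])
  mul_counit : μ[H] ≫ ε[H] = (ε[H] ⊗ₘ ε[H]) ≫ (λ_ (𝟙_ C)).hom
  one_counit : η[H] ≫ ε[H] = 𝟙 (𝟙_ C)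
  mul_comul : μ[H] ≫ Δ[H] = Δ[H] ▷ H ⊗≫ (H ⊗ H) ◁ Δ[H] ⊗≫ H ◁ (β_ H H).inv ▷ H ⊗≫
    μ[H] ▷ (H ⊗ H) ⊗≫ H ◁ μ[H]
  S_left : Δ[H] ≫ S ▷ H ≫ μ[H] = ε[H] ≫ η[H]
  S_right : Δ[H] ≫ H ◁ S ≫ μ[H] = ε[H] ≫ η[H]
  -- All that is required of the inverse antipode is to be an antipode for the opposite
  -- comultiplication. Since `H` is a bialgebra for the inverse braiding, that comultiplication is
  -- formed with the braiding itself.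
  Sinv_left : Δ[H] ≫ (β_ H H).hom ≫ Sinv ▷ H ≫ μ[H] = ε[H] ≫ η[H]
  Sinv_right : Δ[H] ≫ (β_ H H).hom ≫ H ◁ Sinv ≫ μ[H] = ε[H] ≫ η[H]

namespace MirrorHopfObj

variable {C : Type u} [Category.{v} C] [MonoidalCategory C] [BraidedCategory C]
  (H : C) [MirrorHopfObj H]

section Basic

/-- Multiplication of the first two tensor factors. -/
def gm (N : C) : H ⊗ H ⊗ N ⟶ H ⊗ N := (α_ H H N).inv ≫ μ ▷ N

/-- Comultiplication of the first tensor factor. -/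
def gd (N : C) : H ⊗ N ⟶ H ⊗ H ⊗ N := Δ ▷ N ≫ (α_ H H N).hom

/-- Counit on the first tensor factor. -/
def ge (N : C) : H ⊗ N ⟶ N := ε ▷ N ≫ (λ_ N).hom

/-- Unit inserted on the left. -/
def gu (N : C) : N ⟶ H ⊗ N := (λ_ N).inv ≫ η ▷ N

/-- Multiplication of the last two tensor factors. -/
def rm (M : C) : (M ⊗ H) ⊗ H ⟶ M ⊗ H := (α_ M H H).hom ≫ M ◁ μ

/-- Comultiplication of the last tensor factor. -/
def rd (M : C) : M ⊗ H ⟶ (M ⊗ H) ⊗ H := M ◁ Δ ≫ (α_ M H H).inv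

/-- Counit on the last tensor factor. -/
def re (M : C) : M ⊗ H ⟶ M := M ◁ ε ≫ (ρ_ M).hom

/-- Unit inserted on the right. -/
def ru (M : C) : M ⟶ M ⊗ H := (ρ_ M).inv ≫ M ◁ η

/-- The opposite comultiplication of the last tensor factor. -/
def psi (M : C) : M ⊗ H ⟶ (M ⊗ H) ⊗ H := M ◁ (Δ ≫ (β_ H H).hom) ≫ (α_ M H H).inv

/-- The opposite comultiplication followed by the inverse antipode. -/
def psiInv (M : C) : M ⊗ H ⟶ (M ⊗ H) ⊗ H :=
  M ◁ (Δ ≫ (β_ H H).hom ≫ H ◁ Sinv) ≫ (α_ M H H).inv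

/-- Right multiplication of the first tensor factor by the last one. -/
def pr (N : C) : (H ⊗ N) ⊗ H ⟶ H ⊗ N := (α_ H N H).hom ≫ H ◁ (β_ H N).inv ≫ gm H N

/-- The exchange of the last two tensor factors. -/
def chi (M : C) : (M ⊗ H) ⊗ H ⟶ (M ⊗ H) ⊗ H := (α_ M H H).hom ≫ M ◁ (β_ H H).hom ≫ (α_ M H H).inv

/-- The exchange of the first two tensor factors. -/
def sw (N : C) : H ⊗ H ⊗ N ⟶ H ⊗ H ⊗ N := (α_ H H N).inv ≫ (β_ H H).inv ▷ N ≫ (α_ H H N).hom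

/-- Comultiply the last tensor factor and move its second half to the front. -/
def lam (M : C) : M ⊗ H ⟶ H ⊗ M ⊗ H := rd H M ≫ (β_ (M ⊗ H) H).hom

variable {H}

theorem gm_nat {N N' : C} (f : N ⟶ N') : H ◁ H ◁ f ≫ gm H N' = gm H N ≫ H ◁ f := by
  rw [gm, gm, associator_inv_naturality_right_assoc, whisker_exchange, Category.assoc]
theorem gd_nat {N N' : C} (f : N ⟶ N') : H ◁ f ≫ gd H N' = gd H N ≫ H ◁ H ◁ f := by
  simp [gd, whisker_exchange_assoc]
theorem ge_nat {N N' : C} (f : N ⟶ N') : H ◁ f ≫ ge H N' = ge H N ≫ f := by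
  simp [ge, whisker_exchange_assoc]
theorem gu_nat {N N' : C} (f : N ⟶ N') : f ≫ gu H N' = gu H N ≫ H ◁ f := by
  simp [gu, ← whisker_exchange]
theorem rm_nat {N N' : C} (f : N ⟶ N') : f ▷ H ▷ H ≫ rm H N' = rm H N ≫ f ▷ H := by
  rw [rm, rm, associator_naturality_left_assoc, ← whisker_exchange, Category.assoc]
theorem rd_nat {N N' : C} (f : N ⟶ N') : f ▷ H ≫ rd H N' = rd H N ≫ f ▷ H ▷ H := by
  simp [rd, ← whisker_exchange_assoc]
theorem re_nat {N N' : C} (f : N ⟶ N') : f ▷ H ≫ re H N' = re H N ≫ f := by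
  simp [re, ← whisker_exchange_assoc]
theorem ru_nat {N N' : C} (f : N ⟶ N') : f ≫ ru H N' = ru H N ≫ f ▷ H := by
  simp [ru, whisker_exchange]
theorem psi_nat {N N' : C} (f : N ⟶ N') : f ▷ H ≫ psi H N' = psi H N ≫ f ▷ H ▷ H := by
  rw [psi, psi, ← whisker_exchange_assoc, Category.assoc, associator_inv_naturality_left]
theorem pr_nat {N N' : C} (f : N ⟶ N') : (H ◁ f) ▷ H ≫ pr H N' = pr H N ≫ H ◁ f := by
  simp only [pr, Category.assoc, ← gm_nat]
  rw [associator_naturality_middle_assoc, ← whiskerLeft_comp_assoc, ← whiskerLeft_comp_assoc,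
    BraidedCategory.braiding_inv_naturality_left]
theorem chi_nat {N N' : C} (f : N ⟶ N') : f ▷ H ▷ H ≫ chi H N' = chi H N ≫ f ▷ H ▷ H := by
  rw [chi, chi, associator_naturality_left_assoc, ← whisker_exchange_assoc, Category.assoc,
    Category.assoc, associator_inv_naturality_left]
theorem sw_nat {N N' : C} (f : N ⟶ N') : H ◁ H ◁ f ≫ sw H N' = sw H N ≫ H ◁ H ◁ f := by
  rw [sw, sw, associator_inv_naturality_right_assoc, whisker_exchange_assoc, Category.assoc,
    Category.assoc, associator_naturality_right]
theorem lam_nat {N N' : C} (f : N ⟶ N') : f ▷ H ≫ lam H N' = lam H N ≫ H ◁ f ▷ H := by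
  rw [lam, lam, reassoc_of% rd_nat, BraidedCategory.braiding_naturality_left, Category.assoc]

theorem gm_gm (N : C) : gm H (H ⊗ N) ≫ gm H N = H ◁ gm H N ≫ gm H N := by
  simp only [gm]
  calc _ = 𝟙 _ ⊗≫ (μ[H] ▷ H ≫ μ) ▷ N := by monoidal
    _ = _ := by rw [MonObj.mul_assoc]; monoidal
theorem rm_rm (N : C) : rm H (N ⊗ H) ≫ rm H N = rm H N ▷ H ≫ rm H N := by
  simp only [rm]
  calc _ = 𝟙 _ ⊗≫ N ◁ (H ◁ μ[H] ≫ μ) := by monoidal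
    _ = _ := by rw [MonObj.mul_assoc_flip]; monoidal
theorem gd_gd (N : C) : gd H N ≫ gd H (H ⊗ N) = gd H N ≫ H ◁ gd H N := by
  simp only [gd]
  calc _ = 𝟙 _ ⊗≫ (Δ[H] ≫ Δ ▷ H) ▷ N ⊗≫ 𝟙 _ := by monoidal
    _ = _ := by rw [ComonObj.comul_assoc_flip]; monoidal
theorem ru_rm (N : C) : ru H (N ⊗ H) ≫ rm H N = 𝟙 _ := by
  simp only [ru, rm]
  calc _ = 𝟙 _ ⊗≫ N ◁ (H ◁ η[H] ≫ μ) := by monoidal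
    _ = _ := by rw [MonObj.mul_one]; monoidal
theorem ru_rm' (N : C) : ru H N ▷ H ≫ rm H N = 𝟙 _ := by
  simp only [ru, rm]
  calc _ = 𝟙 _ ⊗≫ N ◁ (η[H] ▷ H ≫ μ) := by monoidal
    _ = _ := by rw [MonObj.one_mul]; monoidal
theorem gu_gm (N : C) : gu H (H ⊗ N) ≫ gm H N = 𝟙 _ := by
  simp only [gu, gm]
  calc _ = 𝟙 _ ⊗≫ (η[H] ▷ H ≫ μ) ▷ N := by monoidal
    _ = _ := by rw [MonObj.one_mul]; monoidal
theorem gd_ge (N : C) : gd H N ≫ ge H (H ⊗ N) = 𝟙 _ := by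
  simp only [gd, ge]
  calc _ = 𝟙 _ ⊗≫ (Δ[H] ≫ ε ▷ H) ▷ N ⊗≫ 𝟙 _ := by monoidal
    _ = _ := by rw [ComonObj.counit_comul]; monoidal
theorem gd_ge' (N : C) : gd H N ≫ H ◁ ge H N = 𝟙 _ := by
  simp only [gd, ge]
  calc _ = 𝟙 _ ⊗≫ (Δ[H] ≫ H ◁ ε) ▷ N ⊗≫ 𝟙 _ := by monoidal
    _ = _ := by rw [ComonObj.comul_counit]; monoidal
theorem gm_ge (N : C) : gm H N ≫ ge H N = ge H (H ⊗ N) ≫ ge H N := by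
  simp only [gm, ge]
  calc _ = 𝟙 _ ⊗≫ (μ[H] ≫ ε) ▷ N ⊗≫ 𝟙 _ := by monoidal
    _ = 𝟙 _ ⊗≫ (ε[H] ▷ H ⊗≫ ε[H]) ▷ N ⊗≫ 𝟙 _ := by
      rw [mul_counit, MonoidalCategory.tensorHom_def]; monoidal
    _ = _ := by monoidal
theorem gm_assoc (N : C) :
    gm H N ▷ H ≫ (α_ H N H).hom = (α_ H (H ⊗ N) H).hom ≫ H ◁ (α_ H N H).hom ≫ gm H (N ⊗ H) := by
  simp only [gm]; monoidal
theorem gd_assoc (N : C) : gd H N ▷ H ≫ (α_ H (H ⊗ N) H).hom ≫ H ◁ (α_ H N H).hom =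
    (α_ H N H).hom ≫ gd H (N ⊗ H) := by
  simp only [gd]; monoidal
theorem ge_assoc (N Y : C) : ge H N ▷ Y = (α_ H N Y).hom ≫ ge H (N ⊗ Y) := by
  simp only [ge]; monoidal
theorem psi_assoc (N : C) : psi H (H ⊗ N) ≫ (α_ H N H).hom ▷ H ≫ (α_ H (N ⊗ H) H).hom =
    (α_ H N H).hom ≫ H ◁ psi H N := by
  simp only [psi]; monoidal
theorem rd_assoc (N : C) : rd H (H ⊗ N) ≫ (α_ H N H).hom ▷ H ≫ (α_ H (N ⊗ H) H).hom =
    (α_ H N H).hom ≫ H ◁ rd H N := by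
  simp only [rd]; monoidal

end Basic

end MirrorHopfObj

/-! ### Products, coproducts and braidings -/

namespace MirrorHopfObj

variable {C : Type u} [Category.{v} C] [MonoidalCategory C] [BraidedCategory C]
  {H : C} [MirrorHopfObj H]

section Braided

variable (H) in
-- Sliding a comultiplication through the braiding turns either side into an iterated
-- comultiplication followed by the same half twist on three strands, so ordinary coassociativity
-- suffices.
theorem cop_coassoc : (Δ[H] ≫ (β_ H H).hom) ≫ (Δ[H] ≫ (β_ H H).hom) ▷ H ≫ (α_ H H H).hom =
    (Δ[H] ≫ (β_ H H).hom) ≫ H ◁ (Δ[H] ≫ (β_ H H).hom) := by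
  calc _ = 𝟙 _ ⊗≫ Δ[H] ⊗≫ ((β_ H H).hom ≫ Δ[H] ▷ H) ⊗≫ (β_ H H).hom ▷ H ⊗≫ 𝟙 _ := by monoidal
    _ = 𝟙 _ ⊗≫ (Δ[H] ≫ H ◁ Δ[H]) ⊗≫ (β_ H H).hom ▷ H ⊗≫ H ◁ (β_ H H).hom ⊗≫
        (β_ H H).hom ▷ H ⊗≫ 𝟙 _ := by
      rw [← BraidedCategory.braiding_naturality_right, BraidedCategory.braiding_tensor_right_hom]
      monoidal
    _ = 𝟙 _ ⊗≫ Δ[H] ⊗≫ (Δ[H] ≫ (β_ H H).hom) ▷ H ⊗≫ (β_ (H ⊗ H) H).hom ⊗≫ 𝟙 _ := by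
      rw [ComonObj.comul_assoc, BraidedCategory.braiding_tensor_left_hom]
      monoidal
    _ = 𝟙 _ ⊗≫ Δ[H] ⊗≫ ((Δ[H] ≫ (β_ H H).hom) ▷ H ≫ (β_ (H ⊗ H) H).hom) ⊗≫ 𝟙 _ := by monoidal
    _ = _ := by
      rw [BraidedCategory.braiding_naturality_left]
      monoidal

variable (H) in
theorem cop_counit_left : (Δ[H] ≫ (β_ H H).hom) ≫ ε[H] ▷ H = (λ_ H).inv := by
  rw [Category.assoc, ← BraidedCategory.braiding_naturality_right, ComonObj.comul_counit_assoc]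
  simp

variable (H) in
theorem cop_counit_right : (Δ[H] ≫ (β_ H H).hom) ≫ H ◁ ε[H] = (ρ_ H).inv := by
  rw [Category.assoc, ← BraidedCategory.braiding_naturality_left, ComonObj.counit_comul_assoc]
  simp

theorem psi_psi (M : C) : psi H M ≫ psi H M ▷ H = psi H M ≫ psi H (M ⊗ H) := by
  simp only [psi]
  have h := cop_coassoc H
  calc _ = 𝟙 _ ⊗≫ M ◁ ((Δ[H] ≫ (β_ H H).hom) ≫ (Δ[H] ≫ (β_ H H).hom) ▷ H ≫ (α_ H H H).hom) ⊗≫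
        𝟙 _ := by monoidal
    _ = _ := by rw [h]; monoidal

theorem psi_re (M : C) : psi H M ≫ re H (M ⊗ H) = 𝟙 _ := by
  simp only [psi, re]
  have h := cop_counit_right H
  calc _ = 𝟙 _ ⊗≫ M ◁ ((Δ[H] ≫ (β_ H H).hom) ≫ H ◁ ε[H]) ⊗≫ 𝟙 _ := by monoidal
    _ = _ := by rw [h]; monoidal

/-- Up to multiplication of the two new factors, `psi` and `psiInv` are mutually inverse: this is
the antipode axiom for the opposite comultiplication. With `psi_psiInv` it makes `conv` bijective.
-/
theorem psiInv_psi (M : C) :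
    psiInv H M ≫ psi H M ▷ H ≫ rm H (M ⊗ H) = ru H (M ⊗ H) := by
  simp only [psi, psiInv, rm, ru]
  have h := cop_coassoc H
  calc _ = 𝟙 _ ⊗≫ M ◁ ((Δ[H] ≫ (β_ H H).hom) ≫ (H ◁ Sinv ≫ (Δ[H] ≫ (β_ H H).hom) ▷ H)) ⊗≫
        (M ⊗ H) ◁ μ := by monoidal
    _ = 𝟙 _ ⊗≫ M ◁ ((Δ[H] ≫ (β_ H H).hom) ≫ (Δ[H] ≫ (β_ H H).hom) ▷ H ≫ (α_ H H H).hom) ⊗≫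
        (M ⊗ H) ◁ (H ◁ Sinv ≫ μ) := by rw [whisker_exchange]; monoidal
    _ = 𝟙 _ ⊗≫ M ◁ (Δ[H] ≫ (β_ H H).hom) ⊗≫
        (M ⊗ H) ◁ (Δ[H] ≫ (β_ H H).hom ≫ H ◁ Sinv ≫ μ) ⊗≫ 𝟙 _ := by rw [h]; monoidal
    _ = 𝟙 _ ⊗≫ M ◁ ((Δ[H] ≫ (β_ H H).hom) ≫ H ◁ ε[H]) ⊗≫ (M ⊗ H) ◁ η[H] := by
      rw [Sinv_right]; monoidal
    _ = _ := by rw [cop_counit_right]; monoidal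

theorem psi_psiInv (M : C) :
    psi H M ≫ psiInv H M ▷ H ≫ rm H (M ⊗ H) = ru H (M ⊗ H) := by
  simp only [psi, psiInv, rm, ru]
  have h := cop_coassoc H
  have h' := Sinv_left (H := H)
  calc _ = 𝟙 _ ⊗≫ M ◁ ((Δ[H] ≫ (β_ H H).hom) ≫ (Δ[H] ≫ (β_ H H).hom) ▷ H ≫ (α_ H H H).hom) ⊗≫
        (M ⊗ H) ◁ (Sinv ▷ H ≫ μ) ⊗≫ 𝟙 _ := by monoidal
    _ = 𝟙 _ ⊗≫ M ◁ (Δ[H] ≫ (β_ H H).hom) ⊗≫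
        (M ⊗ H) ◁ (Δ[H] ≫ (β_ H H).hom ≫ Sinv ▷ H ≫ μ) ⊗≫ 𝟙 _ := by rw [h]; monoidal
    _ = 𝟙 _ ⊗≫ M ◁ ((Δ[H] ≫ (β_ H H).hom) ≫ H ◁ ε[H]) ⊗≫ (M ⊗ H) ◁ η[H] := by
      rw [h']; monoidal
    _ = _ := by rw [cop_counit_right]; monoidal

theorem pr_pr (N : C) : pr H N ▷ H ≫ pr H N = rm H (H ⊗ N) ≫ pr H N := by
  simp only [pr, rm, gm]
  symm
  calc _ = 𝟙 _ ⊗≫ H ◁ (N ◁ μ[H] ≫ (β_ H N).inv) ⊗≫ μ[H] ▷ N := by monoidal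
    _ = 𝟙 _ ⊗≫ H ◁ (β_ H N).inv ▷ H ⊗≫ (H ⊗ H) ◁ (β_ H N).inv ⊗≫ (H ◁ μ[H] ≫ μ) ▷ N := by
      rw [BraidedCategory.braiding_inv_naturality_right, BraidedCategory.braiding_tensor_left_inv]
      monoidal
    _ = 𝟙 _ ⊗≫ H ◁ (β_ H N).inv ▷ H ⊗≫ ((H ⊗ H) ◁ (β_ H N).inv ≫ μ[H] ▷ (H ⊗ N)) ⊗≫ μ[H] ▷ N := by
      rw [MonObj.mul_assoc_flip]; monoidal
    _ = _ := by rw [whisker_exchange]; monoidal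

theorem ru_pr (N : C) : ru H (H ⊗ N) ≫ pr H N = 𝟙 _ := by
  simp only [ru, pr, gm]
  calc _ = 𝟙 _ ⊗≫ H ◁ (N ◁ η[H] ≫ (β_ H N).inv) ⊗≫ μ[H] ▷ N := by monoidal
    _ = 𝟙 _ ⊗≫ (H ◁ η[H] ≫ μ) ▷ N := by
      rw [BraidedCategory.braiding_inv_naturality_right, braiding_inv_tensorUnit_left]; monoidal
    _ = _ := by rw [MonObj.mul_one]; monoidal

theorem gm_pr (N : C) :
    gm H N ▷ H ≫ pr H N = (α_ H (H ⊗ N) H).hom ≫ H ◁ pr H N ≫ gm H N := by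
  simp only [pr, gm]
  calc _ = 𝟙 _ ⊗≫ (μ[H] ▷ (N ⊗ H) ≫ H ◁ (β_ H N).inv) ⊗≫ μ[H] ▷ N := by monoidal
    _ = 𝟙 _ ⊗≫ (H ⊗ H) ◁ (β_ H N).inv ⊗≫ (μ[H] ▷ H ≫ μ) ▷ N := by
      rw [← whisker_exchange]; monoidal
    _ = _ := by rw [MonObj.mul_assoc]; monoidal

theorem pr_ge (N : C) : pr H N ≫ ge H N = ge H N ▷ H ≫ re H N := by
  simp only [pr, gm, ge, re]
  calc _ = 𝟙 _ ⊗≫ H ◁ (β_ H N).inv ⊗≫ (μ[H] ≫ ε[H]) ▷ N ⊗≫ 𝟙 _ := by monoidal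
    _ = 𝟙 _ ⊗≫ H ◁ ((β_ H N).inv ≫ ε[H] ▷ N) ⊗≫ ε[H] ▷ N ⊗≫ 𝟙 _ := by
      rw [mul_counit, MonoidalCategory.tensorHom_def']; monoidal
    _ = 𝟙 _ ⊗≫ (H ◁ (N ◁ ε[H]) ≫ ε[H] ▷ (N ⊗ 𝟙_ C)) ⊗≫ 𝟙 _ := by
      rw [← BraidedCategory.braiding_inv_naturality_right, braiding_inv_tensorUnit_left]; monoidal
    _ = _ := by rw [whisker_exchange]; monoidal

theorem lam_ge (N : C) : lam H N ≫ ge H (N ⊗ H) = 𝟙 _ := by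
  simp only [lam, rd, ge, Category.assoc]
  rw [← BraidedCategory.braiding_naturality_right_assoc]
  calc _ = 𝟙 _ ⊗≫ N ◁ (Δ[H] ≫ H ◁ ε) ⊗≫ (β_ (N ⊗ H) (𝟙_ C)).hom ⊗≫ 𝟙 _ := by monoidal
    _ = _ := by rw [ComonObj.comul_counit, braiding_tensorUnit_right]; monoidal

theorem ru_rd (M : C) : ru H M ≫ rd H M = ru H M ≫ ru H (M ⊗ H) := by
  simp only [ru, rd]
  calc _ = 𝟙 _ ⊗≫ M ◁ (η[H] ≫ Δ) ⊗≫ 𝟙 _ := by monoidal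
    _ = _ := by rw [one_comul, MonoidalCategory.tensorHom_def]; monoidal

theorem ru_psi (M : C) : ru H M ≫ psi H M = ru H M ≫ ru H (M ⊗ H) := by
  simp only [ru, psi]
  calc _ = 𝟙 _ ⊗≫ M ◁ ((η[H] ≫ Δ) ≫ (β_ H H).hom) ⊗≫ 𝟙 _ := by monoidal
    _ = 𝟙 _ ⊗≫ M ◁ ((λ_ (𝟙_ C)).inv ≫ (η[H] ⊗ₘ η[H])) ⊗≫ 𝟙 _ := by
      rw [one_comul, Category.assoc, BraidedCategory.braiding_naturality]; simp [unitors_inv_equal]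
    _ = _ := by rw [MonoidalCategory.tensorHom_def]; monoidal

theorem ru_lam (M : C) : ru H M ≫ lam H M = ru H M ≫ gu H (M ⊗ H) := by
  rw [lam, reassoc_of% ru_rd]
  congr 1
  rw [ru, Category.assoc, BraidedCategory.braiding_naturality_right, braiding_tensorUnit_right, gu]
  simp

/-- Multiplicativity of `Δ` with the second half moved to the front. The inverse braiding in
`mul_comul` cancels against one of the crossings produced by the hexagons when the product is pulled
through the braiding. -/
theorem rm_lam (M : C) : rm H M ≫ lam H M =
    lam H M ▷ H ≫ (α_ H (M ⊗ H) H).hom ≫ H ◁ lam H (M ⊗ H) ≫ gm H _ ≫ H ◁ rm H M := by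
  simp only [rm, lam, rd, gm]
  calc _ = 𝟙 _ ⊗≫ M ◁ (μ[H] ≫ Δ[H]) ⊗≫ (β_ (M ⊗ H) H).hom := by monoidal
    _ = 𝟙 _ ⊗≫ M ◁ Δ[H] ▷ H ⊗≫ (M ⊗ H ⊗ H) ◁ Δ[H] ⊗≫ (M ⊗ H) ◁ (β_ H H).inv ▷ H ⊗≫
        M ◁ μ[H] ▷ (H ⊗ H) ⊗≫ ((M ⊗ H) ◁ μ[H] ≫ (β_ (M ⊗ H) H).hom) := by
      rw [mul_comul]; monoidal
    _ = 𝟙 _ ⊗≫ M ◁ Δ[H] ▷ H ⊗≫ (M ⊗ H ⊗ H) ◁ Δ[H] ⊗≫ (M ⊗ H) ◁ (β_ H H).inv ▷ H ⊗≫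
        (((M ◁ μ[H]) ▷ (H ⊗ H)) ≫ (β_ (M ⊗ H) (H ⊗ H)).hom) ⊗≫ μ[H] ▷ (M ⊗ H) := by
      rw [BraidedCategory.braiding_naturality_right]; monoidal
    _ = 𝟙 _ ⊗≫ M ◁ Δ[H] ▷ H ⊗≫ (M ⊗ H ⊗ H) ◁ Δ[H] ⊗≫ (M ⊗ H) ◁ (β_ H H).inv ▷ H ⊗≫
        (((α_ M H H).inv ▷ (H ⊗ H)) ≫ (β_ ((M ⊗ H) ⊗ H) (H ⊗ H)).hom) ⊗≫
        ((H ⊗ H) ◁ (M ◁ μ[H]) ≫ μ[H] ▷ (M ⊗ H)) := by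
      rw [BraidedCategory.braiding_naturality_left, BraidedCategory.braiding_naturality_left]
      monoidal
    _ = 𝟙 _ ⊗≫ M ◁ Δ[H] ▷ H ⊗≫ (M ⊗ H ⊗ H) ◁ Δ[H] ⊗≫
        (M ⊗ H) ◁ ((β_ H H).inv ≫ (β_ H H).hom) ▷ H ⊗≫
        ((M ⊗ H) ⊗ H) ◁ (β_ H H).hom ⊗≫ (β_ (M ⊗ H) H).hom ▷ (H ⊗ H) ⊗≫
        H ◁ (β_ (M ⊗ H) H).hom ▷ H ⊗≫
        (μ[H] ▷ (M ⊗ H ⊗ H) ≫ H ◁ (M ◁ μ[H])) := by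
      rw [BraidedCategory.braiding_tensor_left_hom (M ⊗ H) H (H ⊗ H),
        BraidedCategory.braiding_tensor_right_hom H H H,
        BraidedCategory.braiding_tensor_right_hom (M ⊗ H) H H, ← whisker_exchange]
      monoidal
    _ = 𝟙 _ ⊗≫ M ◁ Δ[H] ▷ H ⊗≫ ((M ⊗ H ⊗ H) ◁ (Δ[H] ≫ (β_ H H).hom) ≫
        ((α_ M H H).inv ≫ (β_ (M ⊗ H) H).hom) ▷ (H ⊗ H)) ⊗≫
        H ◁ (β_ (M ⊗ H) H).hom ▷ H ⊗≫
        (μ[H] ▷ (M ⊗ H ⊗ H) ≫ H ◁ (M ◁ μ[H])) := by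
      rw [Iso.inv_hom_id]; monoidal
    _ = _ := by
      rw [whisker_exchange, BraidedCategory.braiding_tensor_left_hom (M ⊗ H) H H]; monoidal

/-- Multiplicativity of the opposite comultiplication, by the same cancellation of crossings. -/
theorem rm_psi (M : C) : rm H M ≫ psi H M =
    psi H (M ⊗ H) ≫ psi H M ▷ H ▷ H ≫ chi H (M ⊗ H) ▷ H ≫ rm H M ▷ H ▷ H ≫ rm H (M ⊗ H) := by
  simp only [rm, psi, chi]
  calc _ = 𝟙 _ ⊗≫ M ◁ (μ[H] ≫ Δ[H]) ⊗≫ M ◁ (β_ H H).hom ⊗≫ 𝟙 _ := by monoidal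
    _ = 𝟙 _ ⊗≫ M ◁ Δ[H] ▷ H ⊗≫ (M ⊗ H ⊗ H) ◁ Δ[H] ⊗≫ (M ⊗ H) ◁ (β_ H H).inv ▷ H ⊗≫
        M ◁ μ[H] ▷ (H ⊗ H) ⊗≫ M ◁ (H ◁ μ[H] ≫ (β_ H H).hom) ⊗≫ 𝟙 _ := by
      rw [mul_comul]; monoidal
    _ = 𝟙 _ ⊗≫ M ◁ Δ[H] ▷ H ⊗≫ (M ⊗ H ⊗ H) ◁ Δ[H] ⊗≫ (M ⊗ H) ◁ (β_ H H).inv ▷ H ⊗≫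
        M ◁ (μ[H] ▷ (H ⊗ H) ≫ (β_ H (H ⊗ H)).hom) ⊗≫ M ◁ μ[H] ▷ H ⊗≫ 𝟙 _ := by
      rw [BraidedCategory.braiding_naturality_right]; monoidal
    _ = 𝟙 _ ⊗≫ M ◁ Δ[H] ▷ H ⊗≫ (M ⊗ H ⊗ H) ◁ Δ[H] ⊗≫
        M ◁ H ◁ ((β_ H H).inv ≫ (β_ H H).hom) ▷ H ⊗≫ ((M ⊗ H ⊗ H) ◁ (β_ H H).hom ≫
        (M ◁ (β_ H H).hom) ▷ (H ⊗ H)) ⊗≫ (M ⊗ H) ◁ (β_ H H).hom ▷ H ⊗≫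
        M ◁ ((H ⊗ H) ◁ μ[H] ≫ μ[H] ▷ H) ⊗≫ 𝟙 _ := by
      rw [BraidedCategory.braiding_naturality_left, BraidedCategory.braiding_tensor_left_hom,
        BraidedCategory.braiding_tensor_right_hom]
      monoidal
    _ = 𝟙 _ ⊗≫ ((M ◁ Δ[H]) ▷ H ≫ (M ⊗ H ⊗ H) ◁ (Δ[H] ≫ (β_ H H).hom)) ⊗≫
        M ◁ (β_ H H).hom ▷ (H ⊗ H) ⊗≫ (M ⊗ H) ◁ (β_ H H).hom ▷ H ⊗≫
        M ◁ (μ[H] ▷ (H ⊗ H) ≫ H ◁ μ[H]) ⊗≫ 𝟙 _ := by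
      rw [Iso.inv_hom_id, whisker_exchange μ[H] μ[H]]; monoidal
    _ = _ := by rw [← whisker_exchange]; monoidal

theorem chi_pr (X : C) :
    chi H (H ⊗ X) ≫ (α_ H X H).hom ▷ H ≫ pr H (X ⊗ H) = pr H X ▷ H ≫ (α_ H X H).hom := by
  simp only [chi, pr, gm]
  rw [BraidedCategory.braiding_tensor_right_inv]
  calc _ = 𝟙 _ ⊗≫ (H ⊗ X) ◁ ((β_ H H).hom ≫ (β_ H H).inv) ⊗≫ H ◁ (β_ H X).inv ▷ H ⊗≫
        μ[H] ▷ (X ⊗ H) := by monoidal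
    _ = _ := by rw [Iso.hom_inv_id]; monoidal

theorem psi_rd (M : C) :
    psi H M ≫ rd H M ▷ H = rd H M ≫ psi H M ▷ H ≫ chi H (M ⊗ H) := by
  simp only [psi, rd, chi]
  calc _ = 𝟙 _ ⊗≫ M ◁ Δ[H] ⊗≫ M ◁ ((β_ H H).hom ≫ Δ[H] ▷ H) ⊗≫ 𝟙 _ := by monoidal
    _ = 𝟙 _ ⊗≫ M ◁ (Δ[H] ≫ H ◁ Δ[H]) ⊗≫ M ◁ (β_ H H).hom ▷ H ⊗≫ (M ⊗ H) ◁ (β_ H H).hom ⊗≫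
        𝟙 _ := by
      rw [← BraidedCategory.braiding_naturality_right, BraidedCategory.braiding_tensor_right_hom]
      monoidal
    _ = _ := by rw [ComonObj.comul_assoc]; monoidal

theorem gm_gd (N : C) : gm H N ≫ gd H N =
    gd H (H ⊗ N) ≫ H ◁ H ◁ gd H N ≫ H ◁ sw H (H ⊗ N) ≫ gm H (H ⊗ H ⊗ N) ≫ H ◁ gm H N := by
  simp only [gm, gd, sw]
  calc _ = 𝟙 _ ⊗≫ (μ[H] ≫ Δ[H]) ▷ N ⊗≫ 𝟙 _ := by monoidal
    _ = _ := by rw [mul_comul]; monoidal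

theorem rd_lam (M : C) :
    rd H M ≫ lam H M ▷ H ≫ (α_ H (M ⊗ H) H).hom ≫ H ◁ (β_ (M ⊗ H) H).hom =
      lam H M ≫ gd H (M ⊗ H) := by
  simp only [lam, gd, Category.assoc]
  rw [← BraidedCategory.braiding_naturality_right_assoc, BraidedCategory.braiding_tensor_right_hom]
  simp only [rd]
  calc _ = 𝟙 _ ⊗≫ M ◁ (Δ[H] ≫ Δ[H] ▷ H) ⊗≫ (β_ (M ⊗ H) H).hom ▷ H ⊗≫ H ◁ (β_ (M ⊗ H) H).hom := by
        monoidal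
    _ = _ := by rw [ComonObj.comul_assoc_flip]; monoidal

theorem braiding_sw (Z : C) :
    (β_ (H ⊗ Z) H).hom ≫ sw H Z = (α_ H Z H).hom ≫ H ◁ (β_ Z H).hom := by
  rw [sw, BraidedCategory.braiding_tensor_left_hom]
  calc _ = 𝟙 _ ⊗≫ H ◁ (β_ Z H).hom ⊗≫ ((β_ H H).hom ≫ (β_ H H).inv) ▷ Z ⊗≫ 𝟙 _ := by monoidal
    _ = _ := by rw [Iso.hom_inv_id]; monoidal

/-- Up to braidings this is `Δ(x h) = x₁ h₁ ⊗ x₂ h₂`. The opposite comultiplication delivers `h₂`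
first, for the inner factor, and `h₁` last, for the outer one; this is why convolution uses it. -/
theorem pr_gd (N : C) : pr H N ≫ gd H N =
    psi H (H ⊗ N) ≫ (gd H N ▷ H ≫ (α_ H (H ⊗ N) H).hom ≫ H ◁ pr H N) ▷ H ≫ pr H (H ⊗ N) := by
  simp only [pr, gm, gd, psi]
  symm
  calc _ = 𝟙 _ ⊗≫ (H ⊗ N) ◁ (Δ[H] ≫ (β_ H H).hom) ⊗≫ Δ[H] ▷ (N ⊗ H ⊗ H) ⊗≫
        (H ⊗ H) ◁ (β_ H N).inv ▷ H ⊗≫ H ◁ (((μ[H] ▷ N) ▷ H) ≫ (β_ H (H ⊗ N)).inv) ⊗≫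
        μ[H] ▷ (H ⊗ N) := by monoidal
    _ = 𝟙 _ ⊗≫ (H ⊗ N) ◁ (Δ[H] ≫ (β_ H H).hom) ⊗≫ Δ[H] ▷ (N ⊗ H ⊗ H) ⊗≫
        H ◁ (((H ◁ (β_ H N).inv) ▷ H ≫ (α_ H H N).inv ▷ H) ≫ (β_ H ((H ⊗ H) ⊗ N)).inv) ⊗≫
        H ◁ H ◁ μ[H] ▷ N ⊗≫ μ[H] ▷ (H ⊗ N) := by
      rw [BraidedCategory.braiding_inv_naturality_left]; monoidal
    _ = 𝟙 _ ⊗≫ (H ⊗ N) ◁ (Δ[H] ≫ (β_ H H).hom) ⊗≫ Δ[H] ▷ (N ⊗ H ⊗ H) ⊗≫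
        H ◁ (β_ H (H ⊗ N ⊗ H)).inv ⊗≫ (H ⊗ H ⊗ H) ◁ (β_ H N).inv ⊗≫
        (H ⊗ H) ◁ μ[H] ▷ N ⊗≫ μ[H] ▷ (H ⊗ N) := by
      rw [← comp_whiskerRight, BraidedCategory.braiding_inv_naturality_left]; monoidal
    _ = 𝟙 _ ⊗≫ (H ⊗ N) ◁ (Δ[H] ≫ (β_ H H).hom) ⊗≫
        (Δ[H] ▷ (N ⊗ H ⊗ H) ≫ (H ⊗ H) ◁ (N ◁ (β_ H H).inv)) ⊗≫
        (H ⊗ H) ◁ (β_ H N).inv ▷ H ⊗≫ (H ◁ (β_ H H).inv ▷ (N ⊗ H) ⊗≫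
        (H ⊗ H ⊗ H) ◁ (β_ H N).inv) ⊗≫ (H ⊗ H) ◁ μ[H] ▷ N ⊗≫ μ[H] ▷ (H ⊗ N) := by
      rw [BraidedCategory.braiding_tensor_right_inv, BraidedCategory.braiding_tensor_right_inv]
      monoidal
    _ = 𝟙 _ ⊗≫ (H ⊗ N) ◁ (Δ[H] ≫ (β_ H H).hom ≫ (β_ H H).inv) ⊗≫ Δ[H] ▷ (N ⊗ H ⊗ H) ⊗≫
        (H ⊗ H) ◁ (β_ H N).inv ▷ H ⊗≫ ((H ◁ (β_ H H).inv) ▷ (N ⊗ H) ≫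
        (H ⊗ H ⊗ H) ◁ (β_ H N).inv) ⊗≫ ((H ⊗ H) ◁ (μ[H] ▷ N) ≫ μ[H] ▷ (H ⊗ N)) := by
      rw [← whisker_exchange]
      monoidal
    _ = 𝟙 _ ⊗≫ (H ◁ (N ◁ Δ[H]) ≫ Δ[H] ▷ (N ⊗ H ⊗ H)) ⊗≫
        (H ⊗ H) ◁ (β_ H N).inv ▷ H ⊗≫ (H ⊗ H ⊗ H) ◁ (β_ H N).inv ⊗≫ H ◁ (β_ H H).inv ▷ (H ⊗ N) ⊗≫
        μ[H] ▷ (H ⊗ H ⊗ N) ⊗≫ H ◁ μ[H] ▷ N := by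
      rw [Iso.hom_inv_id, ← whisker_exchange, whisker_exchange μ[H] (μ[H] ▷ N)]
      monoidal
    _ = 𝟙 _ ⊗≫ Δ[H] ▷ (N ⊗ H) ⊗≫ (H ⊗ H) ◁ (N ◁ Δ[H] ≫ (β_ (H ⊗ H) N).inv) ⊗≫
        H ◁ (β_ H H).inv ▷ (H ⊗ N) ⊗≫ μ[H] ▷ (H ⊗ H ⊗ N) ⊗≫ H ◁ μ[H] ▷ N := by
      rw [whisker_exchange, BraidedCategory.braiding_tensor_left_inv]
      monoidal
    _ = 𝟙 _ ⊗≫ (Δ[H] ▷ (N ⊗ H) ≫ (H ⊗ H) ◁ (β_ H N).inv) ⊗≫ (H ⊗ H) ◁ (Δ[H] ▷ N) ⊗≫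
        H ◁ (β_ H H).inv ▷ (H ⊗ N) ⊗≫ μ[H] ▷ (H ⊗ H ⊗ N) ⊗≫ H ◁ μ[H] ▷ N := by
      rw [BraidedCategory.braiding_inv_naturality_right]
      monoidal
    _ = 𝟙 _ ⊗≫ H ◁ (β_ H N).inv ⊗≫ (Δ[H] ▷ H ⊗≫ (H ⊗ H) ◁ Δ[H] ⊗≫ H ◁ (β_ H H).inv ▷ H ⊗≫
        μ[H] ▷ (H ⊗ H) ⊗≫ H ◁ μ[H]) ▷ N ⊗≫ 𝟙 _ := by
      rw [← whisker_exchange]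
      monoidal
    _ = _ := by
      rw [← mul_comul]
      monoidal

end Braided

end MirrorHopfObj

/-! ### Convolution against the opposite comultiplication -/

namespace MirrorHopfObj

variable {C : Type u} [Category.{v} C] [MonoidalCategory C] [BraidedCategory C]
  (H : C) [MirrorHopfObj H]

section Convolution

variable {H}

/-- `x ⊗ a ↦ g(x, a₂) a₁`, where `g` takes values in `H ⊗ N`. -/
def conv {X N : C} (g : X ⊗ H ⟶ H ⊗ N) : X ⊗ H ⟶ H ⊗ N := psi H X ≫ g ▷ H ≫ pr H N

/-- `x ⊗ a ↦ g(x, a₂) S⁻¹(a₁)`, where `g` takes values in `H ⊗ N`. -/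
def convInv {X N : C} (g : X ⊗ H ⟶ H ⊗ N) : X ⊗ H ⟶ H ⊗ N := psiInv H X ≫ g ▷ H ≫ pr H N

/-- Right multiplication `pr` is an action, so the two convolutions merge the factors coming from
`psi` and `psiInv` into a single one, which is the unit. -/
theorem conv_convInv {X N : C} (g : X ⊗ H ⟶ H ⊗ N) : conv (convInv g) = g := by
  simp only [conv, convInv, comp_whiskerRight, Category.assoc]
  rw [pr_pr, reassoc_of% rm_nat, reassoc_of% psi_psiInv, ← reassoc_of% ru_nat, ru_pr,
    Category.comp_id]

theorem convInv_conv {X N : C} (g : X ⊗ H ⟶ H ⊗ N) : convInv (conv g) = g := by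
  simp only [conv, convInv, comp_whiskerRight, Category.assoc]
  rw [pr_pr, reassoc_of% rm_nat, reassoc_of% psiInv_psi, ← reassoc_of% ru_nat, ru_pr,
    Category.comp_id]

theorem conv_injective {X N : C} {g g' : X ⊗ H ⟶ H ⊗ N} (h : conv g = conv g') : g = g' := by
  rw [← convInv_conv g, h, convInv_conv]

theorem conv_comp {X N N' : C} (g : X ⊗ H ⟶ H ⊗ N) (f : N ⟶ N') :
    conv (g ≫ H ◁ f) = conv g ≫ H ◁ f := by
  simp only [conv, comp_whiskerRight, Category.assoc, pr_nat]

theorem comp_conv {X X' N : C} (g : X ⊗ H ⟶ H ⊗ N) (f : X' ⟶ X) :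
    conv (f ▷ H ≫ g) = f ▷ H ≫ conv g := by
  simp only [conv, comp_whiskerRight, Category.assoc, reassoc_of% psi_nat]

theorem conv_gm {X N : C} (g : X ⊗ H ⟶ H ⊗ N) :
    conv ((α_ H X H).hom ≫ H ◁ g ≫ gm H N) = (α_ H X H).hom ≫ H ◁ conv g ≫ gm H N := by
  simp only [conv, comp_whiskerRight, Category.assoc, whiskerLeft_comp, gm_pr]
  rw [associator_naturality_middle_assoc, reassoc_of% psi_assoc]

theorem conv_ge {X N : C} (g : X ⊗ H ⟶ H ⊗ N) : conv g ≫ ge H N = g ≫ ge H N := by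
  simp only [conv, Category.assoc, pr_ge]
  rw [re_nat, reassoc_of% re_nat, reassoc_of% psi_re]

theorem ru_conv {X N : C} (g : X ⊗ H ⟶ H ⊗ N) : ru H X ≫ conv g = ru H X ≫ g := by
  simp only [conv]
  rw [reassoc_of% ru_psi, ← reassoc_of% ru_nat, ru_pr, Category.comp_id]

/-- Convolution in the second factor of `H ⊗ H ⊗ N`. -/
def conv₂ {X N : C} (g : X ⊗ H ⟶ H ⊗ H ⊗ N) : X ⊗ H ⟶ H ⊗ H ⊗ N :=
  psi H X ≫ g ▷ H ≫ (α_ H (H ⊗ N) H).hom ≫ H ◁ pr H N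

/-- Convolving the second factor with the inverse antipode is a left inverse, by the argument for
`convInv_conv`. -/
theorem conv₂_injective {X N : C} {g g' : X ⊗ H ⟶ H ⊗ H ⊗ N} (h : conv₂ g = conv₂ g') :
    g = g' := by
  have key : ∀ f : X ⊗ H ⟶ H ⊗ H ⊗ N,
      psiInv H X ≫ conv₂ f ▷ H ≫ (α_ H (H ⊗ N) H).hom ≫ H ◁ pr H N = f := by
    intro f
    have h₁ : H ◁ pr H N ▷ H ≫ H ◁ pr H N = H ◁ rm H (H ⊗ N) ≫ H ◁ pr H N := by
      rw [← whiskerLeft_comp, pr_pr, whiskerLeft_comp]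
    have h₂ : ((α_ H (H ⊗ N) H).hom ▷ H) ≫ (α_ H ((H ⊗ N) ⊗ H) H).hom ≫ H ◁ rm H (H ⊗ N) =
        rm H (H ⊗ H ⊗ N) ≫ (α_ H (H ⊗ N) H).hom := by
      simp only [rm]; monoidal
    have h₃ : ru H (H ⊗ H ⊗ N) ≫ (α_ H (H ⊗ N) H).hom = H ◁ ru H (H ⊗ N) := by
      simp only [ru]; monoidal
    simp only [conv₂, comp_whiskerRight, Category.assoc]
    rw [associator_naturality_middle_assoc, h₁, reassoc_of% h₂, reassoc_of% rm_nat,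
      reassoc_of% psiInv_psi,
      ← reassoc_of% ru_nat, reassoc_of% h₃, ← whiskerLeft_comp, ru_pr, whiskerLeft_id,
        Category.comp_id]
  rw [← key g, h, key]

/-- Comultiplying a convolution splits it into one convolution for each copy of `H`, by `pr_gd`.
This reduces identities involving the product of `K` to convolved ones. -/
theorem conv_conv₂_gd {X N : C} (g : X ⊗ H ⟶ H ⊗ N) :
    conv (conv₂ (g ≫ gd H N)) = conv g ≫ gd H N := by
  simp only [conv, conv₂, comp_whiskerRight, Category.assoc]
  rw [pr_gd, reassoc_of% psi_nat, ← reassoc_of% psi_psi]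
  simp only [comp_whiskerRight, Category.assoc]

/-- Convolution in the first of two copies of `H`. -/
def convFst {X N : C} (g : (X ⊗ H) ⊗ H ⟶ H ⊗ N) : (X ⊗ H) ⊗ H ⟶ H ⊗ N :=
  psi H X ▷ H ≫ chi H (X ⊗ H) ≫ g ▷ H ≫ pr H N

theorem convFst_injective {X N : C} {g g' : (X ⊗ H) ⊗ H ⟶ H ⊗ N} (h : convFst g = convFst g') :
    g = g' := by
  have key : ∀ f : (X ⊗ H) ⊗ H ⟶ H ⊗ N,
      psiInv H X ▷ H ≫ chi H (X ⊗ H) ≫ convFst f ▷ H ≫ pr H N = f := by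
    intro f
    have h₁ : chi H (X ⊗ H) ≫ psi H X ▷ H ▷ H = psi H X ▷ H ▷ H ≫ chi H ((X ⊗ H) ⊗ H) :=
      (chi_nat _).symm
    have h₂ : chi H ((X ⊗ H) ⊗ H) ≫ chi H (X ⊗ H) ▷ H ≫ rm H _ =
        rm H (X ⊗ H) ▷ H ≫ chi H (X ⊗ H) := by
      simp only [chi, rm]
      symm
      calc _ = 𝟙 _ ⊗≫ (X ⊗ H) ◁ (μ[H] ▷ H ≫ (β_ H H).hom) ⊗≫ 𝟙 _ := by monoidal
        _ = _ := by
          rw [BraidedCategory.braiding_naturality_left, BraidedCategory.braiding_tensor_left_hom]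
          monoidal
    have h₃ : ru H (X ⊗ H) ▷ H ≫ chi H (X ⊗ H) = ru H ((X ⊗ H) ⊗ H) := by
      simp only [chi, ru]
      calc _ = 𝟙 _ ⊗≫ (X ⊗ H) ◁ (η[H] ▷ H ≫ (β_ H H).hom) ⊗≫ 𝟙 _ := by monoidal
        _ = _ := by
          rw [BraidedCategory.braiding_naturality_left, braiding_tensorUnit_left]
          monoidal
    simp only [convFst, comp_whiskerRight, Category.assoc]
    rw [pr_pr, reassoc_of% rm_nat, reassoc_of% h₁, reassoc_of% h₂, ← comp_whiskerRight_assoc,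
      ← comp_whiskerRight_assoc, Category.assoc, psiInv_psi, reassoc_of% h₃, ← reassoc_of% ru_nat,
        ru_pr,
      Category.comp_id]
  rw [← key g, h, key]

/-- Convolution over a product of two arguments is convolution over each of them, by
multiplicativity of the opposite comultiplication. -/
theorem conv_convFst_rm {X N : C} (g : X ⊗ H ⟶ H ⊗ N) :
    conv (convFst (rm H X ≫ g)) = rm H X ≫ conv g := by
  simp only [conv, convFst, comp_whiskerRight, Category.assoc]
  rw [pr_pr, reassoc_of% rm_nat, reassoc_of% rm_psi]

theorem convFst_comp {X Y N : C} (g : X ⊗ H ⟶ H ⊗ Y) (f : Y ⊗ H ⟶ N) :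
    convFst (g ▷ H ≫ (α_ H Y H).hom ≫ H ◁ f) = conv g ▷ H ≫ (α_ H Y H).hom ≫ H ◁ f := by
  simp only [conv, convFst, comp_whiskerRight, Category.assoc]
  rw [pr_nat, ← reassoc_of% chi_nat, reassoc_of% chi_pr]

end Convolution

/-! ### Transposition along the duality of `H` and `K` -/

section Adjunction

variable (K : C) [ExactPairing H K]

/-- `x ↦ ∑ eᵢ ⊗ x ⊗ eⁱ`. -/
def dl (M : C) : M ⟶ H ⊗ M ⊗ K :=
  (ρ_ M).inv ≫ M ◁ η_ H K ≫ (α_ M H K).inv ≫ (β_ M H).hom ▷ K ≫ (α_ H M K).hom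

/-- The map `M ⊗ K ⟶ N` corresponding to `M ⟶ H ⊗ N`. -/
def unc {M N : C} (g : M ⟶ H ⊗ N) : M ⊗ K ⟶ N :=
  (β_ M K).hom ≫ K ◁ g ≫ (α_ K H N).inv ≫ ε_ H K ▷ N ≫ (λ_ N).hom

variable {H K}

theorem dl_nat {M N : C} (f : M ⟶ N) : f ≫ dl H K N = dl H K M ≫ H ◁ f ▷ K := by
  have h : f ▷ H ▷ K ≫ (β_ N H).hom ▷ K = (β_ M H).hom ▷ K ≫ (H ◁ f) ▷ K := by
    rw [← comp_whiskerRight, BraidedCategory.braiding_naturality_left, comp_whiskerRight]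
  simp only [dl, Category.assoc]
  rw [rightUnitor_inv_naturality_assoc, ← whisker_exchange_assoc,
    associator_inv_naturality_left_assoc, reassoc_of% h, associator_naturality_middle]

/-- The crossings of `M` with `H` and with `K` combine into one crossing with `H ⊗ K`, through which
the coevaluation slides; a zigzag identity finishes. The companion statements below use the same
argument. -/
theorem dl_unc {M N : C} (g : M ⟶ H ⊗ N) : dl H K M ≫ H ◁ unc H K g = g := by
  simp only [dl, unc]
  calc _ = 𝟙 _ ⊗≫ M ◁ η_ H K ⊗≫ ((α_ M H K).inv ≫ (β_ M H).hom ▷ K ≫ (α_ H M K).hom ≫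
        H ◁ (β_ M K).hom ≫ (α_ H K M).inv) ⊗≫ H ◁ K ◁ g ⊗≫ H ◁ ε_ H K ▷ N ⊗≫ 𝟙 _ := by monoidal
    _ = 𝟙 _ ⊗≫ (M ◁ η_ H K ≫ (β_ M (H ⊗ K)).hom) ⊗≫ H ◁ K ◁ g ⊗≫ H ◁ ε_ H K ▷ N ⊗≫ 𝟙 _ := by
      rw [← BraidedCategory.braiding_tensor_right_hom]; monoidal
    _ = 𝟙 _ ⊗≫ (η_ H K ▷ M ≫ (H ⊗ K) ◁ g) ⊗≫ H ◁ ε_ H K ▷ N ⊗≫ 𝟙 _ := by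
      rw [BraidedCategory.braiding_naturality_right, braiding_tensorUnit_right]; monoidal
    _ = g ⊗≫ (η_ H K ▷ H ⊗≫ H ◁ ε_ H K) ▷ N ⊗≫ 𝟙 _ := by
      rw [← whisker_exchange]; monoidal
    _ = _ := by rw [ExactPairing.evaluation_coevaluation'']; monoidal

theorem unc_dl {M N : C} (f : M ⊗ K ⟶ N) : unc H K (dl H K M ≫ H ◁ f) = f := by
  simp only [dl, unc]
  calc _ = 𝟙 _ ⊗≫ ((β_ M K).hom ≫ K ◁ (ρ_ M).inv) ⊗≫ K ◁ M ◁ η_ H K ⊗≫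
        K ◁ (β_ M H).hom ▷ K ⊗≫ ((K ⊗ H) ◁ f ≫ ε_ H K ▷ N) ⊗≫ 𝟙 _ := by monoidal
    _ = 𝟙 _ ⊗≫ ((β_ M K).hom ▷ 𝟙_ C ≫ (K ⊗ M) ◁ η_ H K) ⊗≫
        K ◁ (β_ M H).hom ▷ K ⊗≫ ε_ H K ▷ (M ⊗ K) ⊗≫ f := by
      rw [whisker_exchange]; monoidal
    _ = 𝟙 _ ⊗≫ (M ⊗ K) ◁ η_ H K ⊗≫ ((α_ M K H).inv ≫ (β_ M K).hom ▷ H ≫ (α_ K M H).hom ≫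
        K ◁ (β_ M H).hom ≫ (α_ K H M).inv) ▷ K ⊗≫ ε_ H K ▷ (M ⊗ K) ⊗≫ f := by
      rw [← whisker_exchange]; monoidal
    _ = 𝟙 _ ⊗≫ (M ⊗ K) ◁ η_ H K ⊗≫ ((β_ M (K ⊗ H)).hom ≫ ε_ H K ▷ M) ▷ K ⊗≫ f := by
      rw [← BraidedCategory.braiding_tensor_right_hom]; monoidal
    _ = 𝟙 _ ⊗≫ M ◁ (K ◁ η_ H K ⊗≫ ε_ H K ▷ K) ⊗≫ f := by
      rw [← BraidedCategory.braiding_naturality_right, braiding_tensorUnit_right]; monoidal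
    _ = _ := by rw [ExactPairing.coevaluation_evaluation'']; monoidal

theorem dl_injective {M N : C} {f f' : M ⊗ K ⟶ N} (h : dl H K M ≫ H ◁ f = dl H K M ≫ H ◁ f') :
    f = f' := by
  rw [← unc_dl (H := H) f, h, unc_dl]

/-- Transposition of maps `(M ⊗ K) ⊗ Y ⟶ N`. -/
def cur {M Y N : C} (f : (M ⊗ K) ⊗ Y ⟶ N) : M ⊗ Y ⟶ H ⊗ N :=
  dl H K M ▷ Y ≫ (α_ H (M ⊗ K) Y).hom ≫ H ◁ f

theorem cur_comp {M Y N N' : C} (f : (M ⊗ K) ⊗ Y ⟶ N) (g : N ⟶ N') :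
    cur (H := H) (f ≫ g) = cur f ≫ H ◁ g := by
  simp only [cur, whiskerLeft_comp, Category.assoc]

theorem comp_cur {M M' Y N : C} (f : (M ⊗ K) ⊗ Y ⟶ N) (g : M' ⟶ M) :
    cur (H := H) (g ▷ K ▷ Y ≫ f) = g ▷ Y ≫ cur f := by
  simp only [cur, whiskerLeft_comp]
  rw [← comp_whiskerRight_assoc, dl_nat, comp_whiskerRight_assoc,
    associator_naturality_middle_assoc]

/-- The map `(M ⊗ K) ⊗ Y ⟶ N` corresponding to `M ⊗ Y ⟶ H ⊗ N`. -/
def uncur {M Y N : C} (g : M ⊗ Y ⟶ H ⊗ N) : (M ⊗ K) ⊗ Y ⟶ N :=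
  (β_ M K).hom ▷ Y ≫ (α_ K M Y).hom ≫ K ◁ g ≫ (α_ K H N).inv ≫ ε_ H K ▷ N ≫ (λ_ N).hom

theorem cur_uncur {M Y N : C} (g : M ⊗ Y ⟶ H ⊗ N) : cur (K := K) (uncur g) = g := by
  simp only [cur, uncur, dl]
  calc _ = 𝟙 _ ⊗≫ M ◁ η_ H K ▷ Y ⊗≫ ((α_ M H K).inv ≫ (β_ M H).hom ▷ K ≫ (α_ H M K).hom ≫
        H ◁ (β_ M K).hom ≫ (α_ H K M).inv) ▷ Y ⊗≫ H ◁ K ◁ g ⊗≫ H ◁ ε_ H K ▷ N ⊗≫ 𝟙 _ := by monoidal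
    _ = 𝟙 _ ⊗≫ (M ◁ η_ H K ≫ (β_ M (H ⊗ K)).hom) ▷ Y ⊗≫ H ◁ K ◁ g ⊗≫ H ◁ ε_ H K ▷ N ⊗≫ 𝟙 _ := by
      rw [← BraidedCategory.braiding_tensor_right_hom]; monoidal
    _ = 𝟙 _ ⊗≫ (η_ H K ▷ (M ⊗ Y) ≫ (H ⊗ K) ◁ g) ⊗≫ H ◁ ε_ H K ▷ N ⊗≫ 𝟙 _ := by
      rw [BraidedCategory.braiding_naturality_right, braiding_tensorUnit_right]; monoidal
    _ = g ⊗≫ (η_ H K ▷ H ⊗≫ H ◁ ε_ H K) ▷ N ⊗≫ 𝟙 _ := by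
      rw [← whisker_exchange]; monoidal
    _ = _ := by rw [ExactPairing.evaluation_coevaluation'']; monoidal

theorem uncur_cur {M Y N : C} (f : (M ⊗ K) ⊗ Y ⟶ N) : uncur (cur (H := H) f) = f := by
  simp only [cur, uncur, dl]
  calc _ = 𝟙 _ ⊗≫ ((β_ M K).hom ≫ K ◁ (ρ_ M).inv) ▷ Y ⊗≫ K ◁ M ◁ η_ H K ▷ Y ⊗≫
        K ◁ (β_ M H).hom ▷ (K ⊗ Y) ⊗≫ ((K ⊗ H) ◁ f ≫ ε_ H K ▷ N) ⊗≫ 𝟙 _ := by monoidal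
    _ = 𝟙 _ ⊗≫ ((β_ M K).hom ▷ 𝟙_ C ≫ (K ⊗ M) ◁ η_ H K) ▷ Y ⊗≫
        K ◁ (β_ M H).hom ▷ (K ⊗ Y) ⊗≫ ε_ H K ▷ ((M ⊗ K) ⊗ Y) ⊗≫ f := by
      rw [whisker_exchange]; monoidal
    _ = 𝟙 _ ⊗≫ (M ⊗ K) ◁ η_ H K ▷ Y ⊗≫ ((α_ M K H).inv ≫ (β_ M K).hom ▷ H ≫ (α_ K M H).hom ≫
        K ◁ (β_ M H).hom ≫ (α_ K H M).inv) ▷ (K ⊗ Y) ⊗≫ ε_ H K ▷ ((M ⊗ K) ⊗ Y) ⊗≫ f := by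
      rw [← whisker_exchange]; monoidal
    _ = 𝟙 _ ⊗≫ (M ⊗ K) ◁ η_ H K ▷ Y ⊗≫ ((β_ M (K ⊗ H)).hom ≫ ε_ H K ▷ M) ▷ (K ⊗ Y) ⊗≫ f := by
      rw [← BraidedCategory.braiding_tensor_right_hom]; monoidal
    _ = 𝟙 _ ⊗≫ M ◁ (K ◁ η_ H K ⊗≫ ε_ H K ▷ K) ▷ Y ⊗≫ f := by
      rw [← BraidedCategory.braiding_naturality_right, braiding_tensorUnit_right]; monoidal
    _ = _ := by rw [ExactPairing.coevaluation_evaluation'']; monoidal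

theorem cur_injective {M Y N : C} {f f' : (M ⊗ K) ⊗ Y ⟶ N} (h : cur (H := H) f = cur f') :
    f = f' := by
  rw [← uncur_cur (H := H) f, h, uncur_cur]

theorem cur_ge {M Y N : C} (f : (M ⊗ K) ⊗ Y ⟶ N) :
    cur f ≫ ge H N = (dl H K M ≫ ge H (M ⊗ K)) ▷ Y ≫ f := by
  simp only [cur, Category.assoc, ge_nat, comp_whiskerRight]
  rw [ge_assoc, Category.assoc]

end Adjunction

end MirrorHopfObj

/-! ### The distributive law between the two actions -/

namespace MirrorHopfObj

variable {C : Type u} [Category.{v} C] [MonoidalCategory C] [BraidedCategory C]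
  (H : C) [MirrorHopfObj H] (K : C) [ExactPairing H K]

section Distributive

/-- The product on the dual of `H`. -/
def dualMul : K ⊗ K ⟶ K :=
  𝟙 _ ⊗≫ (K ⊗ K) ◁ η_ H K ⊗≫ (K ⊗ K) ◁ Δ[H] ▷ K ⊗≫
    K ◁ (β_ H K).inv ▷ (H ⊗ K) ⊗≫ ε_ H K ▷ (K ⊗ H ⊗ K) ⊗≫ ε_ H K ▷ K ⊗≫ 𝟙 _

/-- The unit of the dual of `H`. -/
def dualOne : 𝟙_ C ⟶ K := η_ H K ≫ ε[H] ▷ K ≫ (λ_ K).hom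

/-- Multiplication of the last two factors. -/
def lm (M : C) : (M ⊗ K) ⊗ K ⟶ M ⊗ K := (α_ M K K).hom ≫ M ◁ dualMul H K

/-- Unit inserted on the right. -/
def lu (M : C) : M ⟶ M ⊗ K := (ρ_ M).inv ≫ M ◁ dualOne H K

variable {H K}

theorem lm_nat {M N : C} (f : M ⟶ N) : f ▷ K ▷ K ≫ lm H K N = lm H K M ≫ f ▷ K := by
  rw [lm, lm, associator_naturality_left_assoc, ← whisker_exchange, Category.assoc]

theorem lu_nat {M N : C} (f : M ⟶ N) : f ≫ lu H K N = lu H K M ≫ f ▷ K := by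
  rw [lu, lu, rightUnitor_inv_naturality_assoc, ← whisker_exchange, Category.assoc]

theorem dl_ge (M : C) : dl H K M ≫ ge H (M ⊗ K) = lu H K M := by
  simp only [dl, ge, lu, dualOne]
  calc _ = 𝟙 _ ⊗≫ M ◁ η_ H K ⊗≫ ((β_ M H).hom ≫ ε[H] ▷ M) ▷ K ⊗≫ 𝟙 _ := by monoidal
    _ = _ := by
      rw [← BraidedCategory.braiding_naturality_right, braiding_tensorUnit_right]; monoidal

variable (H K) in
-- The product of `K` is dual to `Δ`: two coevaluations whose `K`-factors are multiplied amount to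
-- one coevaluation whose `H`-factor is comultiplied.
theorem coev_dualMul : η_ H K ⊗≫ (H ⊗ K) ◁ η_ H K ⊗≫ H ◁ (β_ K H).hom ▷ K ⊗≫
    (H ⊗ H) ◁ dualMul H K = η_ H K ≫ Δ[H] ▷ K ⊗≫ 𝟙 ((H ⊗ H) ⊗ K) := by
  -- The outer `K` and `H` are evaluated on each other across a coevaluation inserted between them;
  -- by naturality of the braiding the two crossings cancel.
  have slide : 𝟙 (K ⊗ H) ⊗≫ K ◁ η_ H K ▷ H ⊗≫ (β_ K H).hom ▷ (K ⊗ H) ⊗≫ (H ⊗ K) ◁ (β_ H K).inv ⊗≫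
      H ◁ ε_ H K ▷ K ⊗≫ 𝟙 (H ⊗ K) = ε_ H K ≫ η_ H K := by
    have h₁ : (β_ K H).hom ▷ H ⊗≫ H ◁ ε_ H K =
        𝟙 _ ⊗≫ K ◁ (β_ H H).inv ⊗≫ ε_ H K ▷ H ⊗≫ 𝟙 _ := by
      have h := BraidedCategory.braiding_naturality_left (ε_ H K) H
      rw [BraidedCategory.braiding_tensor_left_hom, braiding_tensorUnit_left] at h
      calc _ = 𝟙 _ ⊗≫ K ◁ (β_ H H).inv ⊗≫ (((α_ K H H).hom ≫ K ◁ (β_ H H).hom ≫ (α_ K H H).inv ≫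
            (β_ K H).hom ▷ H ≫ (α_ H K H).hom) ≫ H ◁ ε_ H K) ⊗≫ 𝟙 _ := by
            simp [monoidalComp]
        _ = _ := by rw [← h]; monoidal
    calc _ = 𝟙 _ ⊗≫ K ◁ η_ H K ▷ H ⊗≫ ((β_ K H).hom ▷ (K ⊗ H) ≫ (H ⊗ K) ◁ (β_ H K).inv) ⊗≫
          H ◁ ε_ H K ▷ K ⊗≫ 𝟙 _ := by monoidal
      _ = 𝟙 _ ⊗≫ K ◁ η_ H K ▷ H ⊗≫ (K ⊗ H) ◁ (β_ H K).inv ⊗≫ ((β_ K H).hom ▷ H ⊗≫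
          H ◁ ε_ H K) ▷ K ⊗≫ 𝟙 _ := by rw [← whisker_exchange]; monoidal
      _ = 𝟙 _ ⊗≫ K ◁ (η_ H K ▷ H ≫ (β_ H (H ⊗ K)).inv) ⊗≫ ε_ H K ▷ (H ⊗ K) ⊗≫ 𝟙 _ := by
        rw [h₁, BraidedCategory.braiding_tensor_right_inv]; monoidal
      _ = 𝟙 _ ⊗≫ ((K ⊗ H) ◁ η_ H K ≫ ε_ H K ▷ (H ⊗ K)) ⊗≫ 𝟙 _ := by
        rw [BraidedCategory.braiding_inv_naturality_left, braiding_inv_tensorUnit_right]; monoidal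
      _ = _ := by rw [whisker_exchange]; monoidal
  have zigzag : η_ H K ▷ H ⊗≫ H ◁ ε_ H K = 𝟙 _ ⊗≫ 𝟙 _ := by
    rw [ExactPairing.evaluation_coevaluation'']; monoidal
  simp only [dualMul]
  calc _ = η_ H K ⊗≫ (H ⊗ K) ◁ η_ H K ⊗≫ ((H ◁ (β_ K H).hom ▷ K) ▷ 𝟙_ C ≫
        (H ⊗ (H ⊗ K) ⊗ K) ◁ (η_ H K ≫ Δ[H] ▷ K)) ⊗≫ (H ⊗ H ⊗ K) ◁ (β_ H K).inv ▷ (H ⊗ K) ⊗≫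
        (H ⊗ H) ◁ ε_ H K ▷ (K ⊗ H ⊗ K) ⊗≫ (H ⊗ H) ◁ ε_ H K ▷ K ⊗≫ 𝟙 ((H ⊗ H) ⊗ K) := by monoidal
    _ = η_ H K ⊗≫ (((H ⊗ K) ◁ η_ H K) ▷ 𝟙_ C ≫ ((H ⊗ K) ⊗ (H ⊗ K)) ◁ (η_ H K ≫ Δ[H] ▷ K)) ⊗≫
        H ◁ (β_ K H).hom ▷ (K ⊗ H ⊗ H ⊗ K) ⊗≫ (H ⊗ H ⊗ K) ◁ (β_ H K).inv ▷ (H ⊗ K) ⊗≫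
        (H ⊗ H) ◁ ε_ H K ▷ (K ⊗ H ⊗ K) ⊗≫ (H ⊗ H) ◁ ε_ H K ▷ K ⊗≫ 𝟙 ((H ⊗ H) ⊗ K) := by
      rw [← whisker_exchange]; monoidal
    _ = η_ H K ⊗≫ (H ⊗ K) ◁ (η_ H K ≫ Δ[H] ▷ K) ⊗≫ H ◁ (𝟙 (K ⊗ H) ⊗≫ K ◁ η_ H K ▷ H ⊗≫
        (β_ K H).hom ▷ (K ⊗ H) ⊗≫ (H ⊗ K) ◁ (β_ H K).inv ⊗≫ H ◁ ε_ H K ▷ K ⊗≫ 𝟙 (H ⊗ K)) ▷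
        (H ⊗ K) ⊗≫ (H ⊗ H) ◁ ε_ H K ▷ K ⊗≫ 𝟙 ((H ⊗ H) ⊗ K) := by
      rw [← whisker_exchange]; monoidal
    _ = 𝟙 _ ⊗≫ (η_ H K ▷ 𝟙_ C ≫ (H ⊗ K) ◁ (η_ H K ≫ Δ[H] ▷ K)) ⊗≫
        H ◁ (ε_ H K ≫ η_ H K) ▷ (H ⊗ K) ⊗≫ (H ⊗ H) ◁ ε_ H K ▷ K ⊗≫ 𝟙 ((H ⊗ H) ⊗ K) := by
      rw [slide]; monoidal
    _ = 𝟙 _ ⊗≫ η_ H K ⊗≫ Δ[H] ▷ K ⊗≫ (η_ H K ▷ H ⊗≫ H ◁ ε_ H K) ▷ (H ⊗ K) ⊗≫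
        H ◁ (η_ H K ▷ H ⊗≫ H ◁ ε_ H K) ▷ K ⊗≫ 𝟙 ((H ⊗ H) ⊗ K) := by
      rw [← whisker_exchange]; monoidal
    _ = _ := by rw [zigzag]; monoidal

/-- This is `coev_dualMul` carried past `M` by the braiding. Through it, the product of `K` becomes
the comultiplication of `H` under transposition. -/
theorem dl_dl_lm (M : C) :
    dl H K M ≫ H ◁ dl H K (M ⊗ K) ≫ H ◁ H ◁ lm H K M = dl H K M ≫ gd H (M ⊗ K) := by
  have h := coev_dualMul H K
  simp only [dl, gd, lm, Category.assoc]
  symm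
  calc _ = 𝟙 _ ⊗≫ M ◁ η_ H K ⊗≫ ((β_ M H).hom ≫ Δ[H] ▷ M) ▷ K ⊗≫ 𝟙 _ := by monoidal
    _ = 𝟙 _ ⊗≫ M ◁ (η_ H K ≫ Δ[H] ▷ K ⊗≫ 𝟙 ((H ⊗ H) ⊗ K)) ⊗≫ (β_ M (H ⊗ H)).hom ▷ K ⊗≫ 𝟙 _ := by
      rw [← BraidedCategory.braiding_naturality_right]; monoidal
    _ = 𝟙 _ ⊗≫ M ◁ η_ H K ⊗≫ (M ⊗ H ⊗ K) ◁ η_ H K ⊗≫ M ◁ H ◁ (β_ K H).hom ▷ K ⊗≫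
        ((M ⊗ (H ⊗ H)) ◁ dualMul H K ≫ (β_ M (H ⊗ H)).hom ▷ K) ⊗≫ 𝟙 _ := by
      rw [← h]; monoidal
    _ = 𝟙 _ ⊗≫ M ◁ η_ H K ⊗≫ (M ⊗ H ⊗ K) ◁ η_ H K ⊗≫ (((M ⊗ H) ◁ (β_ K H).hom) ≫
        (β_ M H).hom ▷ (H ⊗ K)) ▷ K ⊗≫ H ◁ (β_ M H).hom ▷ (K ⊗ K) ⊗≫
        ((H ⊗ H) ⊗ M) ◁ dualMul H K ⊗≫ 𝟙 _ := by
      rw [whisker_exchange, BraidedCategory.braiding_tensor_right_hom]; monoidal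
    _ = 𝟙 _ ⊗≫ M ◁ η_ H K ⊗≫ ((M ⊗ H) ◁ (K ◁ η_ H K) ≫
        (β_ M H).hom ▷ (K ⊗ H ⊗ K)) ⊗≫ H ◁ (M ◁ (β_ K H).hom ⊗≫ (β_ M H).hom ▷ K) ▷ K ⊗≫
        (H ⊗ H ⊗ M) ◁ dualMul H K ⊗≫ 𝟙 _ := by
      rw [whisker_exchange]; monoidal
    _ = 𝟙 _ ⊗≫ M ◁ η_ H K ⊗≫ (β_ M H).hom ▷ K ⊗≫ H ◁ (M ⊗ K) ◁ η_ H K ⊗≫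
        H ◁ (β_ (M ⊗ K) H).hom ▷ K ⊗≫ (H ⊗ H ⊗ M) ◁ dualMul H K ⊗≫ 𝟙 _ := by
      rw [whisker_exchange, BraidedCategory.braiding_tensor_left_hom]; monoidal
    _ = _ := by monoidal

variable (H K)

/-- `M ⊗ H ⟶ H ⊗ (M ⊗ H) ⊗ K`. -/
def phi (M : C) : M ⊗ H ⟶ H ⊗ (M ⊗ H) ⊗ K :=
  lam H M ≫ H ◁ dl H K (M ⊗ H) ≫ gm H ((M ⊗ H) ⊗ K)

/-- The solution of `conv (theta M) = phi M`. -/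
def theta (M : C) : M ⊗ H ⟶ H ⊗ (M ⊗ H) ⊗ K := convInv (phi H K M)

/-- The distributive law between the actions of `K` and `H`. -/
def xi (M : C) : (M ⊗ K) ⊗ H ⟶ (M ⊗ H) ⊗ K := uncur (theta H K M)

variable {H K}

theorem conv_theta (M : C) : conv (theta H K M) = phi H K M := conv_convInv _

theorem cur_xi (M : C) : cur (xi H K M) = theta H K M := cur_uncur _

theorem phi_nat {M N : C} (f : M ⟶ N) : f ▷ H ≫ phi H K N = phi H K M ≫ H ◁ f ▷ H ▷ K := by
  simp only [phi, Category.assoc]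
  rw [reassoc_of% lam_nat, ← whiskerLeft_comp_assoc, dl_nat, whiskerLeft_comp_assoc, gm_nat]

/-- Since `conv` is injective, it is enough to compare after convolving, where `theta` becomes the
explicit `phi`. Identities for `xi` are reduced to `theta` by transposition and then treated in this
way. -/
theorem theta_nat {M N : C} (f : M ⟶ N) :
    f ▷ H ≫ theta H K N = theta H K M ≫ H ◁ f ▷ H ▷ K := by
  apply conv_injective
  rw [comp_conv, conv_comp, conv_theta, conv_theta, phi_nat]

theorem xi_nat {M N : C} (f : M ⟶ N) :
    f ▷ K ▷ H ≫ xi H K N = xi H K M ≫ f ▷ H ▷ K := by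
  apply cur_injective (H := H)
  rw [comp_cur, cur_comp, cur_xi, cur_xi, theta_nat]

/-- The unit of `K` is seen on a transpose as the counit of `H`, and the counit does not notice
convolution, so `theta` may be replaced by `phi`. -/
theorem lu_xi (M : C) : lu H K M ▷ H ≫ xi H K M = lu H K (M ⊗ H) := by
  rw [← dl_ge, ← cur_ge, cur_xi, ← conv_ge, conv_theta, phi, Category.assoc, Category.assoc, gm_ge,
    reassoc_of% ge_nat, reassoc_of% lam_ge, dl_ge]

/-- On the unit of `H` convolution does nothing, so `theta` may again be replaced by `phi`, and
`phi` becomes the coevaluation `dl`. -/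
theorem ru_xi (M : C) : ru H (M ⊗ K) ≫ xi H K M = ru H M ▷ K := by
  apply dl_injective (H := H)
  have h : dl H K M ≫ H ◁ ru H (M ⊗ K) = ru H M ≫ dl H K M ▷ H ≫ (α_ H (M ⊗ K) H).hom := by
    rw [← reassoc_of% ru_nat]
    congr 1
    simp only [ru]; monoidal
  rw [whiskerLeft_comp, reassoc_of% h]
  change ru H M ≫ cur (xi H K M) = _
  rw [cur_xi, ← ru_conv, conv_theta, phi, reassoc_of% ru_lam, ← reassoc_of% gu_nat, gu_gm,
    Category.comp_id,
    dl_nat]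

theorem rm_phi (M : C) : rm H M ≫ phi H K M = lam H M ▷ H ≫ (α_ H (M ⊗ H) H).hom ≫
    H ◁ (phi H K (M ⊗ H) ≫ H ◁ rm H M ▷ K) ≫ gm H _ := by
  simp only [phi, whiskerLeft_comp, Category.assoc]
  rw [reassoc_of% rm_lam, ← whiskerLeft_comp_assoc H (rm H M), dl_nat, whiskerLeft_comp_assoc,
    gm_nat,
    ← reassoc_of% gm_nat, reassoc_of% gm_gm, ← gm_nat]

/-- After transposition there are two arguments in `H`. Convolving in both of them is injective and
turns the claim into `rm_phi`, that is, into the multiplicativity of `lam`. -/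
theorem rm_xi (M : C) : rm H (M ⊗ K) ≫ xi H K M =
    xi H K M ▷ H ≫ xi H K (M ⊗ H) ≫ rm H M ▷ K := by
  have h₁ : dl H K M ▷ H ▷ H ≫ (α_ H (M ⊗ K) H).hom ▷ H ≫ (α_ H ((M ⊗ K) ⊗ H) H).hom =
      (α_ M H H).hom ≫ dl H K M ▷ (H ⊗ H) ≫ (α_ H (M ⊗ K) (H ⊗ H)).hom ≫
        H ◁ (α_ (M ⊗ K) H H).inv := by monoidal
  have e₁ : ∀ {N : C} (f : ((M ⊗ K) ⊗ H) ⊗ H ⟶ N), cur (H := H) ((α_ (M ⊗ K) H H).inv ≫ f) =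
      (α_ M H H).inv ≫ dl H K M ▷ H ▷ H ≫ (α_ H (M ⊗ K) H).hom ▷ H ≫
        (α_ H ((M ⊗ K) ⊗ H) H).hom ≫ H ◁ f := by
    intro N f
    rw [reassoc_of% h₁, Iso.inv_hom_id_assoc, cur, whiskerLeft_comp]
  rw [← cancel_epi (α_ (M ⊗ K) H H).inv]
  apply cur_injective (H := H)
  rw [e₁, e₁, cancel_epi (α_ M H H).inv]
  have lhs : dl H K M ▷ H ▷ H ≫ (α_ H (M ⊗ K) H).hom ▷ H ≫
      (α_ H ((M ⊗ K) ⊗ H) H).hom ≫ H ◁ (rm H (M ⊗ K) ≫ xi H K M) = rm H M ≫ theta H K M := by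
    rw [← cur_xi, cur]
    simp only [rm, Category.assoc, whiskerLeft_comp]
    rw [whisker_exchange_assoc]
    monoidal
  have rhs : dl H K M ▷ H ▷ H ≫ (α_ H (M ⊗ K) H).hom ▷ H ≫ (α_ H ((M ⊗ K) ⊗ H) H).hom ≫
      H ◁ (xi H K M ▷ H ≫ xi H K (M ⊗ H) ≫ rm H M ▷ K) =
      theta H K M ▷ H ≫ (α_ H ((M ⊗ H) ⊗ K) H).hom ≫ H ◁ (xi H K (M ⊗ H) ≫ rm H M ▷ K) := by
    rw [← cur_xi, cur]
    simp only [comp_whiskerRight, Category.assoc, whiskerLeft_comp,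
      associator_naturality_middle_assoc]
  rw [lhs, rhs]
  -- On the left both convolutions together are one convolution over the product; on the right each
  -- of them turns one `theta` into a `phi`.
  apply convFst_injective
  apply conv_injective
  rw [conv_convFst_rm, conv_theta, rm_phi, convFst_comp, conv_theta]
  have h₄ : phi H K M ▷ H ≫ (α_ H ((M ⊗ H) ⊗ K) H).hom ≫ H ◁ (xi H K (M ⊗ H) ≫ rm H M ▷ K) =
      lam H M ▷ H ≫ (α_ H (M ⊗ H) H).hom ≫
        H ◁ (cur (xi H K (M ⊗ H)) ≫ H ◁ rm H M ▷ K) ≫ gm H _ := by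
    simp only [phi, cur, comp_whiskerRight, whiskerLeft_comp, Category.assoc]
    rw [reassoc_of% gm_assoc, associator_naturality_middle_assoc, gm_nat, reassoc_of% gm_nat]
  rw [h₄, comp_conv, conv_gm, conv_comp, cur_xi, conv_theta]

end Distributive

end MirrorHopfObj

namespace MirrorHopfObj

variable {C : Type u} [Category.{v} C] [MonoidalCategory C] [BraidedCategory C]
  {H : C} [MirrorHopfObj H] {K : C} [ExactPairing H K]

section Distributive

theorem cur_cur_lm {M N : C} (f : (M ⊗ K) ⊗ H ⟶ N) :
    cur (H := H) (cur (H := H) (lm H K M ▷ H ≫ f)) = cur f ≫ gd H N := by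
  simp only [cur, whiskerLeft_comp, Category.assoc]
  rw [gd_nat, ← reassoc_of% gd_assoc, ← comp_whiskerRight_assoc, ← dl_dl_lm]
  monoidal

theorem conv₂_cur {M N : C} (g : (M ⊗ K) ⊗ H ⟶ H ⊗ N) : conv₂ (cur g) = cur (conv g) := by
  simp only [conv₂, conv, cur, comp_whiskerRight, Category.assoc, whiskerLeft_comp]
  rw [associator_naturality_middle_assoc, ← reassoc_of% psi_nat, reassoc_of% psi_assoc]

theorem conv_rd {X Y N : C} (g : X ⊗ H ⟶ H ⊗ Y) (f : Y ⊗ H ⟶ N) :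
    conv (rd H X ≫ g ▷ H ≫ (α_ H Y H).hom ≫ H ◁ f) =
      rd H X ≫ conv g ▷ H ≫ (α_ H Y H).hom ≫ H ◁ f := by
  simp only [conv, comp_whiskerRight, Category.assoc]
  rw [pr_nat, reassoc_of% psi_rd, ← reassoc_of% chi_nat, reassoc_of% chi_pr]

theorem cur_rd {M Y N : C} (g : (M ⊗ K) ⊗ H ⟶ Y) (f : Y ⊗ H ⟶ N) :
    cur (H := H) (rd H (M ⊗ K) ≫ g ▷ H ≫ f) =
      rd H M ≫ cur g ▷ H ≫ (α_ H Y H).hom ≫ H ◁ f := by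
  simp only [cur, comp_whiskerRight, Category.assoc, whiskerLeft_comp]
  rw [← reassoc_of% rd_assoc, reassoc_of% rd_nat, associator_naturality_middle_assoc]

/-- The two copies of `K` are transposed one after the other, which turns their product into `gd`.
Convolutions in both resulting copies of `H` then replace every `theta` by `phi`, and what remains
is the multiplicativity of `Δ`. -/
theorem lm_xi (M : C) : lm H K M ▷ H ≫ xi H K M =
    xi H K (M ⊗ K) ≫ xi H K M ▷ K ≫ lm H K (M ⊗ H) := by
  apply cur_injective (H := H)
  apply cur_injective (H := H)
  rw [cur_cur_lm, cur_comp, cur_xi, cur_xi]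
  apply conv₂_injective
  apply conv_injective
  rw [conv_conv₂_gd, conv₂_cur, conv_comp, conv_theta, conv_theta]
  have e₁ : phi H K (M ⊗ K) ≫ H ◁ (xi H K M ▷ K ≫ lm H K (M ⊗ H)) =
      rd H (M ⊗ K) ≫ xi H K M ▷ H ≫ (β_ ((M ⊗ H) ⊗ K) H).hom ≫
        H ◁ (dl H K ((M ⊗ H) ⊗ K) ≫ H ◁ lm H K (M ⊗ H)) ≫ gm H _ := by
    rw [BraidedCategory.braiding_naturality_left_assoc]
    simp only [phi, lam, Category.assoc]
    rw [← gm_nat, ← whiskerLeft_comp_assoc H (xi H K M), ← Category.assoc (xi H K M), dl_nat]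
    simp only [whiskerLeft_comp, Category.assoc]
  rw [e₁, cur_rd, conv_rd, cur_xi, conv_theta]
  symm
  have e₂ : (dl H K (M ⊗ H) ≫ H ◁ (dl H K ((M ⊗ H) ⊗ K) ≫ H ◁ lm H K (M ⊗ H))) =
      dl H K (M ⊗ H) ≫ gd H _ := by
    rw [whiskerLeft_comp, dl_dl_lm]
  -- The crossing of `H` with the factor created by `dl` is isolated as `sw`; it is the crossing
  -- that occurs in the multiplicativity of `Δ`, used below as `gm_gd`.
  have e₃ : dl H K (M ⊗ H) ▷ H ≫ (α_ H ((M ⊗ H) ⊗ K) H).hom ≫ H ◁ (β_ ((M ⊗ H) ⊗ K) H).hom =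
      (β_ (M ⊗ H) H).hom ≫ H ◁ dl H K (M ⊗ H) ≫ sw H _ := by
    rw [← braiding_sw, BraidedCategory.braiding_naturality_left_assoc]
  calc _ = rd H M ≫ lam H M ▷ H ≫ (α_ _ _ _).hom ≫ H ◁ (dl H K (M ⊗ H) ▷ H ≫
        (α_ H ((M ⊗ H) ⊗ K) H).hom ≫ H ◁ (β_ ((M ⊗ H) ⊗ K) H).hom) ≫
        H ◁ H ◁ H ◁ (dl H K ((M ⊗ H) ⊗ K) ≫ H ◁ lm H K (M ⊗ H)) ≫ H ◁ H ◁ gm H _ ≫ gm H _ := by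
        simp only [phi, comp_whiskerRight, Category.assoc, whiskerLeft_comp]
        rw [reassoc_of% gm_assoc, associator_naturality_middle_assoc]
        simp only [← gm_nat, ← reassoc_of% gm_nat]
    _ = lam H M ≫ gd H _ ≫ H ◁ H ◁ (dl H K (M ⊗ H) ≫
        H ◁ (dl H K ((M ⊗ H) ⊗ K) ≫ H ◁ lm H K (M ⊗ H))) ≫ H ◁ sw H _ ≫ gm H _ ≫ H ◁ gm H _ := by
        rw [e₃, gm_nat, ← reassoc_of% rd_lam]
        simp only [← whiskerLeft_comp_assoc, Category.assoc]
        rw [← sw_nat]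
        simp only [whiskerLeft_comp, Category.assoc]
    _ = _ := by
        rw [e₂, phi, Category.assoc, Category.assoc, gm_gd, whiskerLeft_comp, whiskerLeft_comp,
          reassoc_of% gd_nat]
        simp only [Category.assoc]

/-- The map `M ⟶ H ⊗ N` corresponding to `M ⊗ K ⟶ N`. -/
def tr {M N : C} (k : M ⊗ K ⟶ N) : M ⟶ H ⊗ N := dl H K M ≫ H ◁ k

theorem tr_injective {M N : C} {k k' : M ⊗ K ⟶ N} (h : tr (H := H) k = tr k') : k = k' :=
  dl_injective (H := H) h

theorem tr_unc {M N : C} (g : M ⟶ H ⊗ N) : tr (unc H K g) = g := dl_unc g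

theorem unc_tr {M N : C} (k : M ⊗ K ⟶ N) : unc H K (tr k) = k := unc_dl k

theorem tr_comp {M N N' : C} (k : M ⊗ K ⟶ N) (f : N ⟶ N') :
    tr (H := H) (k ≫ f) = tr k ≫ H ◁ f := by
  simp only [tr, whiskerLeft_comp, Category.assoc]

theorem comp_tr {M M' N : C} (k : M ⊗ K ⟶ N) (f : M' ⟶ M) :
    tr (H := H) (f ▷ K ≫ k) = f ≫ tr k := by
  simp only [tr, whiskerLeft_comp, reassoc_of% dl_nat]

theorem lu_comp {M N : C} (k : M ⊗ K ⟶ N) : lu H K M ≫ k = tr k ≫ ge H N := by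
  rw [tr, Category.assoc, ge_nat, ← dl_ge, Category.assoc]

theorem tr_tr_lm_comp {M N : C} (k : M ⊗ K ⟶ N) :
    tr (H := H) (tr (H := H) (lm H K M ≫ k)) = tr k ≫ gd H N := by
  rw [tr, tr, tr, Category.assoc, gd_nat, ← reassoc_of% dl_dl_lm]
  simp only [whiskerLeft_comp]

theorem tr_tr_lm (M : C) :
    tr (H := H) (tr (H := H) (lm H K M)) = dl H K M ≫ gd H (M ⊗ K) := by
  rw [tr, tr, ← dl_dl_lm, whiskerLeft_comp]

/-- Associativity of a `K`-action transposes, once for each copy of `K`, to coassociativity of the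
corresponding coaction. -/
theorem lm_comp_iff {M : C} (k : M ⊗ K ⟶ M) :
    lm H K M ≫ k = k ▷ K ≫ k ↔ tr k ≫ gd H M = tr k ≫ H ◁ tr k := by
  rw [← tr_tr_lm_comp, ← tr_comp, ← comp_tr]
  exact ⟨fun h => by rw [h], fun h => tr_injective (tr_injective h)⟩

/-- Associativity of the product of `K` is coassociativity of `Δ`, seen after three transpositions.
-/
theorem lm_lm (M : C) : lm H K (M ⊗ K) ≫ lm H K M = lm H K M ▷ K ≫ lm H K M := by
  rw [lm_comp_iff]
  apply tr_injective (H := H)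
  rw [tr_comp, tr_tr_lm, tr_comp, tr_tr_lm, Category.assoc, Category.assoc, ← gd_nat]
  have h := tr_tr_lm (H := H) (K := K) M
  rw [tr] at h
  rw [reassoc_of% h, gd_gd]

theorem lu_lm (M : C) : lu H K (M ⊗ K) ≫ lm H K M = 𝟙 _ := by
  apply tr_injective (H := H)
  rw [lu_comp, tr_comp, tr_tr_lm, Category.assoc, gd_ge', tr, whiskerLeft_id]

theorem lu_lm' (M : C) : lu H K M ▷ K ≫ lm H K M = 𝟙 _ := by
  apply tr_injective (H := H)
  rw [comp_tr, lu_comp, tr_tr_lm, Category.assoc, gd_ge, tr, whiskerLeft_id]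

/-- The compatibility of an action and a coaction of `H` on `M`. -/
def IsYetterDrinfeld {M : C} (r : M ⊗ H ⟶ M) (κ : M ⟶ H ⊗ M) : Prop :=
  conv (κ ▷ H ≫ (α_ H M H).hom ≫ H ◁ r) = lam H M ≫ H ◁ r ≫ H ◁ κ ≫ gm H M

/-- The reason for the definition of `xi`. Transposing and then convolving is injective; it takes
the left side of the exchange rule to the left side of the Yetter-Drinfeld condition, and the right
side to the right side. -/
theorem isYetterDrinfeld_tr_iff {M : C} (r : M ⊗ H ⟶ M) (k : M ⊗ K ⟶ M) :
    IsYetterDrinfeld r (tr k) ↔ k ▷ H ≫ r = xi H K M ≫ r ▷ K ≫ k := by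
  have h₁ : tr (H := H) k ▷ H ≫ (α_ H M H).hom ≫ H ◁ r = cur (k ▷ H ≫ r) := by
    simp only [tr, cur, comp_whiskerRight, Category.assoc, whiskerLeft_comp]
    rw [associator_naturality_middle_assoc]
  have h₂ : conv (cur (H := H) (xi H K M ≫ r ▷ K ≫ k)) = lam H M ≫ H ◁ r ≫ H ◁ tr k ≫ gm H M := by
    rw [cur_comp, cur_xi, conv_comp, conv_theta, phi]
    simp only [tr, whiskerLeft_comp, Category.assoc, gm_nat]
    rw [← whiskerLeft_comp_assoc H r, dl_nat, whiskerLeft_comp_assoc, ← reassoc_of% gm_nat]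
  rw [IsYetterDrinfeld, h₁, ← h₂]
  exact ⟨fun h => cur_injective (conv_injective h), fun h => by rw [h]⟩

end Distributive

end MirrorHopfObj

/-! ### Modules over the composite monad as Yetter-Drinfeld modules -/

namespace MirrorHopfObj

variable {C : Type u} [Category.{v} C] [MonoidalCategory C] [BraidedCategory C]
  {H : C} [MirrorHopfObj H] {K : C} [ExactPairing H K]

section DoubleActions

/-- Right actions of `H`. -/
structure IsAction {M : C} (r : M ⊗ H ⟶ M) : Prop where
  one : ru H M ≫ r = 𝟙 M
  mul : rm H M ≫ r = r ▷ H ≫ r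

/-- Left coactions of `H`. -/
structure IsCoaction {M : C} (κ : M ⟶ H ⊗ M) : Prop where
  counit : κ ≫ ge H M = 𝟙 M
  comul : κ ≫ gd H M = κ ≫ H ◁ κ

/-- Yetter-Drinfeld structures. -/
structure IsYetterDrinfeldModule {M : C} (r : M ⊗ H ⟶ M) (κ : M ⟶ H ⊗ M) : Prop where
  action : IsAction r
  coaction : IsCoaction κ
  compat : IsYetterDrinfeld r κ

variable (H K) in
/-- The action of `H` on the free double module. -/
def freeAct (M : C) : ((M ⊗ H) ⊗ K) ⊗ H ⟶ (M ⊗ H) ⊗ K := xi H K (M ⊗ H) ≫ rm H M ▷ K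

variable (H K) in
/-- The product of the monad `M ↦ M ⊗ H ⊗ K`. -/
def doubleMul (M : C) : (((M ⊗ H) ⊗ K) ⊗ H) ⊗ K ⟶ (M ⊗ H) ⊗ K :=
  freeAct H K M ▷ K ≫ lm H K (M ⊗ H)

variable (H K) in
/-- The unit of the monad `M ↦ M ⊗ H ⊗ K`. -/
def doubleOne (M : C) : M ⟶ (M ⊗ H) ⊗ K := ru H M ≫ lu H K (M ⊗ H)

/-- Modules over the monad `M ↦ M ⊗ H ⊗ K`. -/
structure IsDoubleAction {M : C} (ρ : (M ⊗ H) ⊗ K ⟶ M) : Prop where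
  one : doubleOne H K M ≫ ρ = 𝟙 M
  mul : doubleMul H K M ≫ ρ = ρ ▷ H ▷ K ≫ ρ

theorem freeAct_nat {M N : C} (f : M ⟶ N) :
    f ▷ H ▷ K ▷ H ≫ freeAct H K N = freeAct H K M ≫ f ▷ H ▷ K := by
  simp only [freeAct, Category.assoc, reassoc_of% xi_nat, ← comp_whiskerRight, rm_nat]

theorem doubleMul_nat {M N : C} (f : M ⟶ N) :
    f ▷ H ▷ K ▷ H ▷ K ≫ doubleMul H K N = doubleMul H K M ≫ f ▷ H ▷ K := by
  simp only [doubleMul, Category.assoc, ← comp_whiskerRight_assoc, freeAct_nat]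
  simp only [comp_whiskerRight, Category.assoc, lm_nat]

theorem doubleOne_nat {M N : C} (f : M ⟶ N) :
    f ≫ doubleOne H K N = doubleOne H K M ≫ f ▷ H ▷ K := by
  rw [doubleOne, doubleOne, reassoc_of% ru_nat, lu_nat (f ▷ H), Category.assoc]

theorem isCoaction_tr_iff {M : C} (k : M ⊗ K ⟶ M) :
    IsCoaction (tr (H := H) k) ↔ lu H K M ≫ k = 𝟙 M ∧ lm H K M ≫ k = k ▷ K ≫ k := by
  rw [lu_comp, lm_comp_iff]
  exact ⟨fun h => ⟨h.1, h.2⟩, fun h => ⟨h.1, h.2⟩⟩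

/-- Beck's correspondence for a distributive law: two actions satisfying the exchange rule `h₃`
compose to an action of the composite monad. -/
theorem IsYetterDrinfeldModule.isDoubleAction {M : C} {r : M ⊗ H ⟶ M} {k : M ⊗ K ⟶ M}
    (h : IsYetterDrinfeldModule r (tr k)) : IsDoubleAction (r ▷ K ≫ k) := by
  obtain ⟨h₁, h₂⟩ := (isCoaction_tr_iff k).1 h.coaction
  have h₃ := (isYetterDrinfeld_tr_iff r k).1 h.compat
  constructor
  · rw [doubleOne, Category.assoc, ← reassoc_of% lu_nat, h₁, Category.comp_id, h.action.one]
  · simp only [doubleMul, freeAct, comp_whiskerRight, Category.assoc]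
    rw [← reassoc_of% lm_nat, h₂, ← comp_whiskerRight_assoc (rm H M ▷ K),
      ← comp_whiskerRight (rm H M),
      h.action.mul, comp_whiskerRight, comp_whiskerRight_assoc,
        ← comp_whiskerRight_assoc (xi H K _),
      ← xi_nat, ← comp_whiskerRight_assoc (_ ≫ xi H K M), ← comp_whiskerRight_assoc (_ ≫ _)]
    simp only [Category.assoc]
    rw [← h₃]
    simp only [comp_whiskerRight, Category.assoc]

variable (H K) in
theorem freeAct_isAction (M : C) : IsAction (freeAct H K M) where
  one := by rw [freeAct, reassoc_of% ru_xi, ← comp_whiskerRight, ru_rm, id_whiskerRight]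
  mul := by
    simp only [freeAct, comp_whiskerRight, Category.assoc]
    rw [reassoc_of% rm_xi, reassoc_of% xi_nat, ← comp_whiskerRight, rm_rm, comp_whiskerRight]

variable (H K) in
-- The exchange rule on the free module is `lm_xi`. Consequently associativity and the left unit law
-- of the composite monad are an instance of `isDoubleAction`.
theorem freeAct_isYetterDrinfeldModule (M : C) :
    IsYetterDrinfeldModule (freeAct H K M) (tr (lm H K (M ⊗ H))) where
  action := freeAct_isAction H K M
  coaction := (isCoaction_tr_iff _).2 ⟨lu_lm _, lm_lm _⟩
  compat := (isYetterDrinfeld_tr_iff _ _).2 (by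
    simp only [freeAct, comp_whiskerRight, Category.assoc]
    rw [reassoc_of% lm_xi, lm_nat])

variable (H K) in
theorem doubleMul_isDoubleAction (M : C) : IsDoubleAction (doubleMul H K M) :=
  (freeAct_isYetterDrinfeldModule H K M).isDoubleAction

variable (H K) in
theorem doubleOne_doubleMul (M : C) :
    doubleOne H K M ▷ H ▷ K ≫ doubleMul H K M = 𝟙 _ := by
  simp only [doubleOne, doubleMul, freeAct, ← comp_whiskerRight_assoc]
  simp only [comp_whiskerRight, Category.assoc]
  rw [← comp_whiskerRight_assoc (lu H K _ ▷ H), lu_xi, lm_nat, reassoc_of% lu_lm',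
    ← comp_whiskerRight, ru_rm', id_whiskerRight]

namespace IsDoubleAction

variable {M : C} {ρ : (M ⊗ H) ⊗ K ⟶ M} (h : IsDoubleAction ρ)
include h

/-- Units are inserted in the inner `K` and the outer `H`, where `xi` is trivial. The other choices
of units, in both copies of `K`, in both copies of `H`, or in the inner `H` and the outer `K`, give
the action law, the coaction law and the exchange rule in the next two results. -/
theorem decomp : (lu H K (M ⊗ H) ≫ ρ) ▷ K ≫ ru H M ▷ K ≫ ρ = ρ := by
  rw [← comp_whiskerRight_assoc, Category.assoc, ru_nat, comp_whiskerRight, comp_whiskerRight,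
    Category.assoc, Category.assoc, ← h.mul]
  simp only [doubleMul, freeAct, comp_whiskerRight, Category.assoc]
  rw [← comp_whiskerRight_assoc (ru H _), ru_xi, reassoc_of% lm_nat, reassoc_of% lm_nat,
    reassoc_of% lu_lm',
    ← comp_whiskerRight_assoc, ru_rm, id_whiskerRight, Category.id_comp]

theorem isAction : IsAction (lu H K (M ⊗ H) ≫ ρ) where
  one := by have := h.one; rwa [doubleOne, Category.assoc] at this
  mul := by
    rw [comp_whiskerRight, Category.assoc, reassoc_of% (lu_nat (ρ ▷ H)), ← h.mul]
    simp only [doubleMul, freeAct, comp_whiskerRight, Category.assoc]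
    rw [← reassoc_of% (lu_nat (xi H K _)), reassoc_of% lu_xi, reassoc_of% lm_nat,
      reassoc_of% lu_lm, reassoc_of% lu_nat]

theorem isYetterDrinfeldModule :
    IsYetterDrinfeldModule (lu H K (M ⊗ H) ≫ ρ) (tr (ru H M ▷ K ≫ ρ)) where
  action := h.isAction
  coaction := (isCoaction_tr_iff _).2 (by
    constructor
    · rw [← reassoc_of% lu_nat, ← Category.assoc]; exact h.one
    · simp only [comp_whiskerRight, Category.assoc]
      rw [← comp_whiskerRight_assoc ρ, ru_nat, comp_whiskerRight_assoc, ← h.mul]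
      simp only [doubleMul, freeAct, comp_whiskerRight, Category.assoc]
      rw [← comp_whiskerRight_assoc (ru H _), ru_xi, reassoc_of% (lm_nat (rm H M)),
        reassoc_of% (lm_nat (ru H _)),
        ← comp_whiskerRight_assoc, ru_rm, id_whiskerRight, Category.id_comp, reassoc_of% lm_nat])
  compat := (isYetterDrinfeld_tr_iff _ _).2 (by
    rw [h.decomp, comp_whiskerRight, Category.assoc, reassoc_of% lu_nat, ← h.mul]
    simp only [doubleMul, freeAct, comp_whiskerRight, Category.assoc]
    rw [← reassoc_of% lu_nat, ← reassoc_of% lu_nat, reassoc_of% lu_lm, reassoc_of% xi_nat,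
      ← comp_whiskerRight_assoc, ru_rm',
      id_whiskerRight, Category.id_comp])

end IsDoubleAction

end DoubleActions

end MirrorHopfObj

/-! ### Half braidings defined by coactions -/

namespace MirrorHopfObj

variable {C : Type u} [Category.{v} C] [MonoidalCategory C] [BraidedCategory C]
  {H : C} [MirrorHopfObj H]

section HalfBraidings

variable (H) in
/-- Distribution of the comultiplication of `H` over a tensor product. -/
def hst (M N : C) : (M ⊗ N) ⊗ H ⟶ (M ⊗ H) ⊗ N ⊗ H :=
  (M ⊗ N) ◁ Δ[H] ≫ (α_ M N (H ⊗ H)).hom ≫ M ◁ (α_ N H H).inv ≫ M ◁ (β_ H N).inv ▷ H ≫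
    M ◁ (α_ H N H).hom ≫ (α_ M H (N ⊗ H)).inv

/-- The tensor product of two actions. -/
def actTensor {M N : C} (r : M ⊗ H ⟶ M) (s : N ⊗ H ⟶ N) : (M ⊗ N) ⊗ H ⟶ M ⊗ N :=
  hst H M N ≫ (r ⊗ₘ s)

/-- The half braiding `m ⊗ n ↦ n m₋₁ ⊗ m₀` defined by a coaction on `M` and an action on `N`. -/
def gam {M N : C} (κ : M ⟶ H ⊗ M) (s : N ⊗ H ⟶ N) : M ⊗ N ⟶ N ⊗ M :=
  (β_ M N).hom ≫ N ◁ κ ≫ (α_ N H M).inv ≫ s ▷ M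

theorem gam_nat {M N N' : C} (κ : M ⟶ H ⊗ M) {s : N ⊗ H ⟶ N} {s' : N' ⊗ H ⟶ N'} (f : N ⟶ N')
    (hf : s ≫ f = f ▷ H ≫ s') : M ◁ f ≫ gam κ s' = gam κ s ≫ f ▷ M := by
  simp only [gam, Category.assoc]
  rw [BraidedCategory.braiding_naturality_right_assoc, ← comp_whiskerRight, hf,
    ← whisker_exchange_assoc]
  simp

/-- Coassociativity lets `κ` be applied twice, once for each module. Inserting a trivial crossing
completes the braiding of `M` with `N'` to one of `H ⊗ M`, past which `κ` slides; the leftover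
inverse crossing is the one in `hst`. -/
theorem gam_tensor {M N N' : C} {κ : M ⟶ H ⊗ M} (hκ : IsCoaction κ) (s : N ⊗ H ⟶ N)
    (s' : N' ⊗ H ⟶ N') : gam κ (actTensor s s') = (α_ M N N').inv ≫ gam κ s ▷ N' ≫
      (α_ N M N').hom ≫ N ◁ gam κ s' ≫ (α_ N N' M).inv := by
  have h := hκ.comul
  simp only [gd] at h
  simp only [gam, actTensor, hst]
  symm
  calc _ = 𝟙 _ ⊗≫ (β_ M N).hom ▷ N' ⊗≫ N ◁ κ ▷ N' ⊗≫ (s ▷ (M ⊗ N') ≫ N ◁ (β_ M N').hom) ⊗≫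
        (N ⊗ N') ◁ κ ⊗≫ N ◁ s' ▷ M ⊗≫ 𝟙 _ := by monoidal
    _ = 𝟙 _ ⊗≫ (β_ M N).hom ▷ N' ⊗≫ N ◁ κ ▷ N' ⊗≫ (N ⊗ H) ◁ (β_ M N').hom ⊗≫ (s ▷ (N' ⊗ M) ≫
        N ◁ (N' ◁ κ)) ⊗≫ N ◁ s' ▷ M ⊗≫ 𝟙 _ := by
      rw [← whisker_exchange]; monoidal
    _ = 𝟙 _ ⊗≫ (β_ M N).hom ▷ N' ⊗≫ N ◁ κ ▷ N' ⊗≫ N ◁ (H ◁ (β_ M N').hom ⊗≫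
          ((β_ H N').hom ≫ (β_ H N').inv) ▷ M) ⊗≫ N ◁ H ◁ (N' ◁ κ) ⊗≫
          s ▷ (N' ⊗ H ⊗ M) ⊗≫ N ◁ s' ▷ M ⊗≫ 𝟙 _ := by
      rw [← whisker_exchange, Iso.hom_inv_id]; monoidal
    _ = 𝟙 _ ⊗≫ (β_ M N).hom ▷ N' ⊗≫ N ◁ (κ ▷ N' ≫ (β_ (H ⊗ M) N').hom) ⊗≫
          N ◁ ((β_ H N').inv ▷ M ≫ (H ⊗ N') ◁ κ) ⊗≫
          s ▷ (N' ⊗ H ⊗ M) ⊗≫ N ◁ s' ▷ M ⊗≫ 𝟙 _ := by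
      rw [BraidedCategory.braiding_tensor_left_hom]; monoidal
    _ = 𝟙 _ ⊗≫ (β_ M N).hom ▷ N' ⊗≫ N ◁ (β_ M N').hom ⊗≫ (N ⊗ N') ◁ (κ ≫ H ◁ κ) ⊗≫
          N ◁ (β_ H N').inv ▷ (H ⊗ M) ⊗≫
          s ▷ (N' ⊗ H ⊗ M) ⊗≫ N ◁ s' ▷ M ⊗≫ 𝟙 _ := by
      rw [BraidedCategory.braiding_naturality_left, ← whisker_exchange]; monoidal
    _ = _ := by
      rw [← h, BraidedCategory.braiding_tensor_right_hom, MonoidalCategory.tensorHom_def]; monoidal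

/-- On a trivial module only the counit of the coaction survives. This is what makes `U Ψ` the
forgetful functor. -/
theorem gam_trivial {M : C} {κ : M ⟶ H ⊗ M} (hκ : IsCoaction κ) (N : C) :
    gam κ (N ◁ ε[H] ≫ (ρ_ N).hom) = (β_ M N).hom := by
  have h := hκ.counit
  simp only [ge] at h
  simp only [gam]
  calc _ = (β_ M N).hom ≫ N ◁ (κ ≫ ε[H] ▷ M ≫ (λ_ M).hom) := by monoidal
    _ = _ := by rw [h]; simp

/-- The coaction is recovered from the half braiding with the regular module by evaluating at the
unit. -/
theorem ru_gam {M : C} (κ : M ⟶ H ⊗ M) : ru H M ≫ gam κ μ[H] = κ := by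
  simp only [gam, ru, Category.assoc]
  rw [BraidedCategory.braiding_naturality_right_assoc, braiding_tensorUnit_right]
  calc _ = 𝟙 _ ⊗≫ (η[H] ▷ M ≫ H ◁ κ) ⊗≫ μ[H] ▷ M := by monoidal
    _ = κ ⊗≫ (η[H] ▷ H ≫ μ[H]) ▷ M := by rw [← whisker_exchange]; monoidal
    _ = _ := by rw [MonObj.one_mul]; monoidal

/-- `gam` for an action is determined by `gam` for the regular action. -/
theorem actTensor_mul {M : C} (r : M ⊗ H ⟶ M) :
    actTensor μ[H] r = conv ((α_ H M H).hom ≫ H ◁ r) := by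
  simp only [actTensor, hst, conv, pr, psi, gm]
  symm
  calc _ = 𝟙 _ ⊗≫ (H ⊗ M) ◁ (Δ[H] ≫ (β_ H H).hom) ⊗≫ H ◁ (r ▷ H ≫ (β_ H M).inv) ⊗≫
        μ[H] ▷ M := by monoidal
    _ = 𝟙 _ ⊗≫ (H ⊗ M) ◁ Δ[H] ⊗≫ (H ⊗ M) ◁ ((β_ H H).hom ≫ (β_ H H).inv) ⊗≫
        H ◁ (β_ H M).inv ▷ H ⊗≫ ((H ⊗ H) ◁ r ≫ μ[H] ▷ M) := by
      rw [BraidedCategory.braiding_inv_naturality_left, BraidedCategory.braiding_tensor_right_inv]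
      monoidal
    _ = _ := by
      rw [Iso.hom_inv_id, whisker_exchange, MonoidalCategory.tensorHom_def]; monoidal

theorem isYetterDrinfeld_iff {M : C} (r : M ⊗ H ⟶ M) (κ : M ⟶ H ⊗ M) :
    IsYetterDrinfeld r κ ↔
      κ ▷ H ≫ actTensor μ[H] r = lam H M ≫ H ◁ r ≫ H ◁ κ ≫ gm H M := by
  rw [IsYetterDrinfeld, actTensor_mul, comp_conv]

/-- Together with `gam_actTensor`, this expresses both sides of the linearity of `gam` by one common
expression applied to the two sides of the Yetter-Drinfeld condition. The dependence on `N` is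
removed by associativity of `s`. -/
theorem actTensor_gam {M N : C} (r : M ⊗ H ⟶ M) (κ : M ⟶ H ⊗ M) {s : N ⊗ H ⟶ N}
    (hs : IsAction s) : actTensor r s ≫ gam κ s = (β_ M N).hom ▷ H ≫ (α_ N M H).hom ≫
      N ◁ (lam H M ≫ H ◁ r ≫ H ◁ κ ≫ gm H M) ≫ (α_ N H M).inv ≫ s ▷ M := by
  have h := hs.mul
  simp only [rm] at h
  simp only [actTensor, gam, hst, lam, gm, rd]
  calc _ = 𝟙 _ ⊗≫ (M ⊗ N) ◁ Δ[H] ⊗≫ M ◁ (β_ H N).inv ▷ H ⊗≫ ((r ⊗ₘ s) ≫ (β_ M N).hom) ⊗≫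
        N ◁ κ ⊗≫ s ▷ M := by monoidal
    _ = 𝟙 _ ⊗≫ (M ⊗ N) ◁ Δ[H] ⊗≫ M ◁ (β_ H N).inv ▷ H ⊗≫ (β_ (M ⊗ H) (N ⊗ H)).hom ⊗≫
        (N ⊗ H) ◁ r ⊗≫ (s ▷ M ≫ N ◁ κ) ⊗≫ s ▷ M := by
      rw [BraidedCategory.braiding_naturality, MonoidalCategory.tensorHom_def']; monoidal
    _ = 𝟙 _ ⊗≫ (M ⊗ N) ◁ Δ[H] ⊗≫ M ◁ (β_ H N).inv ▷ H ⊗≫ (β_ (M ⊗ H) N).hom ▷ H ⊗≫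
        N ◁ (β_ (M ⊗ H) H).hom ⊗≫ (N ⊗ H) ◁ r ⊗≫ (N ⊗ H) ◁ κ ⊗≫ (s ▷ H ≫ s) ▷ M := by
      rw [← whisker_exchange, BraidedCategory.braiding_tensor_right_hom]; monoidal
    _ = 𝟙 _ ⊗≫ (M ⊗ N) ◁ Δ[H] ⊗≫ M ◁ ((β_ H N).inv ≫ (β_ H N).hom) ▷ H ⊗≫ (β_ M N).hom ▷ (H ⊗ H) ⊗≫
        N ◁ (β_ (M ⊗ H) H).hom ⊗≫ (N ⊗ H) ◁ r ⊗≫ (N ⊗ H) ◁ κ ⊗≫ N ◁ μ[H] ▷ M ⊗≫ s ▷ M := by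
      rw [← h, BraidedCategory.braiding_tensor_left_hom M H N]; monoidal
    _ = 𝟙 _ ⊗≫ ((M ⊗ N) ◁ Δ[H] ≫ (β_ M N).hom ▷ (H ⊗ H)) ⊗≫
        N ◁ (β_ (M ⊗ H) H).hom ⊗≫ (N ⊗ H) ◁ r ⊗≫ (N ⊗ H) ◁ κ ⊗≫ N ◁ μ[H] ▷ M ⊗≫ s ▷ M := by
      rw [Iso.inv_hom_id]; monoidal
    _ = _ := by rw [whisker_exchange]; monoidal

theorem gam_actTensor {M N : C} (r : M ⊗ H ⟶ M) (κ : M ⟶ H ⊗ M) {s : N ⊗ H ⟶ N}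
    (hs : IsAction s) : gam κ s ▷ H ≫ actTensor s r = (β_ M N).hom ▷ H ≫ (α_ N M H).hom ≫
      N ◁ (κ ▷ H ≫ actTensor μ[H] r) ≫ (α_ N H M).inv ≫ s ▷ M := by
  have h := hs.mul
  simp only [rm] at h
  simp only [actTensor, gam, hst]
  calc _ = 𝟙 _ ⊗≫ (β_ M N).hom ▷ H ⊗≫ N ◁ κ ▷ H ⊗≫ (s ▷ (M ⊗ H) ≫ N ◁ (M ◁ Δ[H])) ⊗≫
        N ◁ (β_ H M).inv ▷ H ⊗≫ (s ⊗ₘ r) := by monoidal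
    _ = 𝟙 _ ⊗≫ (β_ M N).hom ▷ H ⊗≫ N ◁ κ ▷ H ⊗≫ (N ⊗ H ⊗ M) ◁ Δ[H] ⊗≫ (s ▷ (M ⊗ H ⊗ H) ≫
        N ◁ ((α_ M H H).inv ≫ (β_ H M).inv ▷ H)) ⊗≫ (s ⊗ₘ r) := by
      rw [← whisker_exchange]; monoidal
    _ = 𝟙 _ ⊗≫ (β_ M N).hom ▷ H ⊗≫ N ◁ κ ▷ H ⊗≫ (N ⊗ H ⊗ M) ◁ Δ[H] ⊗≫ 
        N ◁ H ◁ (β_ H M).inv ▷ H ⊗≫ (s ▷ H ≫ s) ▷ (M ⊗ H) ⊗≫ N ◁ r := by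
      rw [← whisker_exchange, MonoidalCategory.tensorHom_def]; monoidal
    _ = 𝟙 _ ⊗≫ (β_ M N).hom ▷ H ⊗≫ N ◁ κ ▷ H ⊗≫ (N ⊗ H ⊗ M) ◁ Δ[H] ⊗≫ 
        N ◁ H ◁ (β_ H M).inv ▷ H ⊗≫ N ◁ μ[H] ▷ (M ⊗ H) ⊗≫ (s ▷ (M ⊗ H) ≫ N ◁ r) := by
      rw [← h]; monoidal
    _ = _ := by rw [← whisker_exchange, MonoidalCategory.tensorHom_def]; monoidal

theorem IsYetterDrinfeld.linear {M N : C} {r : M ⊗ H ⟶ M} {κ : M ⟶ H ⊗ M}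
    (h : IsYetterDrinfeld r κ) {s : N ⊗ H ⟶ N} (hs : IsAction s) :
    actTensor r s ≫ gam κ s = gam κ s ▷ H ≫ actTensor s r := by
  rw [actTensor_gam r κ hs, gam_actTensor r κ hs, (isYetterDrinfeld_iff r κ).1 h]

variable (H) in
theorem mul_isAction : IsAction μ[H] where
  one := by rw [ru, Category.assoc, MonObj.mul_one, Iso.inv_hom_id]
  mul := by rw [rm, Category.assoc, MonObj.mul_assoc]

/-- Linearity on the regular module already suffices: evaluating its `H`-factor at the unit recovers
the Yetter-Drinfeld condition. -/
theorem isYetterDrinfeld_of_linear {M : C} {r : M ⊗ H ⟶ M} {κ : M ⟶ H ⊗ M}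
    (h : actTensor r μ[H] ≫ gam κ μ[H] = gam κ μ[H] ▷ H ≫ actTensor μ[H] r) :
    IsYetterDrinfeld r κ := by
  rw [actTensor_gam r κ (mul_isAction H), gam_actTensor r κ (mul_isAction H)] at h
  -- The unit of the regular module undoes the passage from `f` to the expression common to both
  -- sides.
  have key : ∀ f : M ⊗ H ⟶ H ⊗ M, ru H M ▷ H ≫ (β_ M H).hom ▷ H ≫ (α_ H M H).hom ≫
      H ◁ f ≫ (α_ H H M).inv ≫ μ[H] ▷ M = f := by
    intro f
    simp only [ru]
    rw [← comp_whiskerRight_assoc, Category.assoc, BraidedCategory.braiding_naturality_right,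
      braiding_tensorUnit_right]
    calc _ = 𝟙 _ ⊗≫ (η[H] ▷ (M ⊗ H) ≫ H ◁ f) ⊗≫ μ[H] ▷ M := by monoidal
      _ = f ⊗≫ (η[H] ▷ H ≫ μ[H]) ▷ M := by rw [← whisker_exchange]; monoidal
      _ = _ := by rw [MonObj.one_mul]; monoidal
  rw [isYetterDrinfeld_iff, ← key (κ ▷ H ≫ _), ← h, key]

/-- After the braiding is split off, the map `n ⊗ m ↦ n m₋₁ ⊗ m₀` remains; its inverse is `n ⊗ m ↦ n
S(m₋₁) ⊗ m₀`. -/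
theorem gam_isIso {M N : C} {κ : M ⟶ H ⊗ M} (hκ : IsCoaction κ) {s : N ⊗ H ⟶ N}
    (hs : IsAction s) : IsIso (gam κ s) := by
  have h₁ := hs.one
  have h₂ := hs.mul
  have h₃ := hκ.counit
  have h₄ := hκ.comul
  simp only [ru, rm, ge, gd] at h₁ h₂ h₃ h₄
  -- Stated for two endomorphisms so that both composites are covered, by taking one of them to be
  -- `S` and the other the identity.
  have key : ∀ {f g : H ⟶ H}, Δ[H] ≫ (f ⊗ₘ g) ≫ μ[H] = ε[H] ≫ η[H] →
      (N ◁ κ ≫ (α_ N H M).inv ≫ (N ◁ f ≫ s) ▷ M) ≫ N ◁ κ ≫ (α_ N H M).inv ≫ (N ◁ g ≫ s) ▷ M =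
        𝟙 (N ⊗ M) := by
    intro f g hfg
    calc _ = 𝟙 _ ⊗≫ N ◁ κ ⊗≫ N ◁ f ▷ M ⊗≫ (s ▷ M ≫ N ◁ (κ ≫ g ▷ M)) ⊗≫ s ▷ M := by monoidal
      _ = 𝟙 _ ⊗≫ N ◁ κ ⊗≫ N ◁ (f ▷ M ≫ H ◁ (κ ≫ g ▷ M)) ⊗≫ (s ▷ H ≫ s) ▷ M := by
        rw [← whisker_exchange]; monoidal
      _ = 𝟙 _ ⊗≫ N ◁ (κ ≫ H ◁ κ) ⊗≫ N ◁ (H ◁ g ≫ f ▷ H) ▷ M ⊗≫ N ◁ μ[H] ▷ M ⊗≫ s ▷ M := by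
        rw [← whisker_exchange, ← h₂]; monoidal
      _ = 𝟙 _ ⊗≫ N ◁ κ ⊗≫ N ◁ (Δ[H] ≫ (f ⊗ₘ g) ≫ μ[H]) ▷ M ⊗≫ s ▷ M := by
        rw [← h₄, MonoidalCategory.tensorHom_def']; monoidal
      _ = 𝟙 _ ⊗≫ N ◁ (κ ≫ ε[H] ▷ M ≫ (λ_ M).hom) ⊗≫ ((ρ_ N).inv ≫ N ◁ η[H] ≫ s) ▷ M := by
        rw [hfg]; monoidal
      _ = _ := by
        rw [h₃, ← Category.assoc (ρ_ N).inv, h₁]; monoidal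
  have hS : IsIso (N ◁ κ ≫ (α_ N H M).inv ≫ s ▷ M) := by
    refine ⟨N ◁ κ ≫ (α_ N H M).inv ≫ (N ◁ S ≫ s) ▷ M, ?_, ?_⟩
    · have := key (f := 𝟙 H) (g := S) (by rw [id_tensorHom, S_right])
      rwa [whiskerLeft_id, Category.id_comp] at this
    · have := key (f := S) (g := 𝟙 H) (by rw [tensorHom_id, S_left])
      rwa [whiskerLeft_id, Category.id_comp] at this
  rw [gam]
  infer_instance

end HalfBraidings

end MirrorHopfObj

/-! ### The comonoidal structure -/

namespace MirrorHopfObj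

variable {C : Type u} [Category.{v} C] [MonoidalCategory C] [BraidedCategory C]
  {H : C} [MirrorHopfObj H] {K : C} [ExactPairing H K]

section Comonoidal

variable (H K) in
/-- The coproduct on the dual of `H`. -/
def dualComul : K ⟶ K ⊗ K :=
  𝟙 _ ⊗≫ K ◁ η_ H K ⊗≫ (K ⊗ H) ◁ η_ H K ▷ K ⊗≫ K ◁ μ[H] ▷ (K ⊗ K) ⊗≫ ε_ H K ▷ (K ⊗ K) ⊗≫ 𝟙 _

variable (H K) in
/-- The right action of `H` on its dual. -/
def dualAct : K ⊗ H ⟶ K :=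
  𝟙 _ ⊗≫ (K ⊗ H) ◁ η_ H K ⊗≫ K ◁ μ[H] ▷ K ⊗≫ ε_ H K ▷ K ⊗≫ 𝟙 _

variable (H K) in
theorem zigzag_left : η_ H K ▷ H ⊗≫ H ◁ ε_ H K = 𝟙 _ ⊗≫ 𝟙 _ := by
  rw [ExactPairing.evaluation_coevaluation'']; monoidal

variable (H K) in
theorem zigzag_right : K ◁ η_ H K ⊗≫ ε_ H K ▷ K = 𝟙 _ ⊗≫ 𝟙 _ := by
  rw [ExactPairing.coevaluation_evaluation'']; monoidal

variable (H K) in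
-- The action of `H` on `K` is adjoint to left multiplication of `H`, by a zigzag identity.
theorem dualAct_eval : dualAct H K ▷ H ≫ ε_ H K = 𝟙 _ ⊗≫ K ◁ μ[H] ≫ ε_ H K := by
  simp only [dualAct]
  calc _ = 𝟙 _ ⊗≫ (K ⊗ H) ◁ η_ H K ▷ H ⊗≫ K ◁ μ[H] ▷ (K ⊗ H) ⊗≫
        (ε_ H K ▷ (K ⊗ H) ≫ 𝟙_ C ◁ ε_ H K) ⊗≫ 𝟙 _ := by monoidal
    _ = 𝟙 _ ⊗≫ (K ⊗ H) ◁ η_ H K ▷ H ⊗≫ K ◁ (μ[H] ▷ (K ⊗ H) ≫ H ◁ ε_ H K) ⊗≫ ε_ H K := by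
      rw [← whisker_exchange]; monoidal
    _ = 𝟙 _ ⊗≫ (K ⊗ H) ◁ (η_ H K ▷ H ⊗≫ H ◁ ε_ H K) ⊗≫ K ◁ μ[H] ⊗≫ ε_ H K := by
      rw [← whisker_exchange]; monoidal
    _ = _ := by rw [zigzag_left]; monoidal

variable (H K) in
theorem dualAct_isAction : IsAction (dualAct H K) where
  one := by
    simp only [ru, dualAct]
    calc _ = 𝟙 _ ⊗≫ (K ◁ η[H] ▷ 𝟙_ C ≫ K ◁ H ◁ η_ H K) ⊗≫ K ◁ μ[H] ▷ K ⊗≫ ε_ H K ▷ K ⊗≫ 𝟙 _ := by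
          monoidal
      _ = 𝟙 _ ⊗≫ K ◁ η_ H K ⊗≫ K ◁ (η[H] ▷ H ≫ μ[H]) ▷ K ⊗≫ ε_ H K ▷ K ⊗≫ 𝟙 _ := by
        rw [← whiskerLeft_comp, ← whisker_exchange]; monoidal
      _ = 𝟙 _ ⊗≫ (K ◁ η_ H K ⊗≫ ε_ H K ▷ K) ⊗≫ 𝟙 _ := by rw [MonObj.one_mul]; monoidal
      _ = _ := by rw [zigzag_right]; monoidal
  mul := by
    simp only [rm, dualAct]
    calc _ = 𝟙 _ ⊗≫ K ◁ (μ[H] ▷ 𝟙_ C ≫ H ◁ η_ H K) ⊗≫ K ◁ μ[H] ▷ K ⊗≫ ε_ H K ▷ K ⊗≫ 𝟙 _ := by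
          monoidal
      _ = 𝟙 _ ⊗≫ (K ⊗ H ⊗ H) ◁ η_ H K ⊗≫ K ◁ (μ[H] ▷ H ≫ μ[H]) ▷ K ⊗≫ ε_ H K ▷ K ⊗≫ 𝟙 _ := by
        rw [← whisker_exchange]; monoidal
      _ = 𝟙 _ ⊗≫ (K ⊗ H ⊗ H) ◁ η_ H K ⊗≫ K ◁ H ◁ μ[H] ▷ K ⊗≫
          (𝟙 ((K ⊗ H) ⊗ H) ⊗≫ K ◁ μ[H] ≫ ε_ H K) ▷ K ⊗≫ 𝟙 _ := by
        rw [MonObj.mul_assoc]; monoidal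
      _ = 𝟙 _ ⊗≫ (K ⊗ H ⊗ H) ◁ η_ H K ⊗≫ ((K ⊗ H) ◁ μ[H] ≫ dualAct H K ▷ H) ▷ K ⊗≫
          ε_ H K ▷ K ⊗≫ 𝟙 _ := by
        rw [← dualAct_eval]; monoidal
      _ = 𝟙 _ ⊗≫ (((K ⊗ H) ◁ (H ◁ η_ H K)) ≫ dualAct H K ▷ (H ⊗ H ⊗ K)) ⊗≫ K ◁ μ[H] ▷ K ⊗≫
          ε_ H K ▷ K ⊗≫ 𝟙 _ := by
        rw [whisker_exchange]; monoidal
      _ = _ := by rw [whisker_exchange]; simp only [dualAct]; monoidal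

variable (H K) in
theorem dualComul_eq : dualComul H K = 𝟙 _ ⊗≫ K ◁ η_ H K ⊗≫ dualAct H K ▷ K := by
  simp only [dualComul, dualAct]; monoidal

variable (H K) in
theorem coev_dualComul : η_ H K ≫ H ◁ dualComul H K =
    η_ H K ⊗≫ H ◁ η_ H K ▷ K ⊗≫ μ[H] ▷ (K ⊗ K) ⊗≫ 𝟙 _ := by
  simp only [dualComul]
  calc _ = 𝟙 _ ⊗≫ (η_ H K ▷ 𝟙_ C ≫ (H ⊗ K) ◁ (η_ H K ⊗≫ H ◁ η_ H K ▷ K ⊗≫ μ[H] ▷ (K ⊗ K))) ⊗≫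
        H ◁ ε_ H K ▷ (K ⊗ K) ⊗≫ 𝟙 _ := by monoidal
    _ = 𝟙 _ ⊗≫ η_ H K ⊗≫ H ◁ η_ H K ▷ K ⊗≫ μ[H] ▷ (K ⊗ K) ⊗≫
        (η_ H K ▷ H ⊗≫ H ◁ ε_ H K) ▷ (K ⊗ K) ⊗≫ 𝟙 _ := by
      rw [← whisker_exchange]; monoidal
    _ = _ := by rw [zigzag_left]; monoidal

variable (H K) in
/-- Distribution of the comultiplication of the dual of `H` over a tensor product. -/
def kst (M N : C) : (M ⊗ N) ⊗ K ⟶ (M ⊗ K) ⊗ N ⊗ K :=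
  (M ⊗ N) ◁ dualComul H K ≫ (α_ M N (K ⊗ K)).hom ≫ M ◁ (α_ N K K).inv ≫ M ◁ (β_ N K).hom ▷ K ≫
    M ◁ (α_ K N K).hom ≫ (α_ M K (N ⊗ K)).inv

variable (H K) in
/-- The comonoidal structure of `M ↦ M ⊗ H ⊗ K`. -/
def doubleComul (M N : C) : ((M ⊗ N) ⊗ H) ⊗ K ⟶ ((M ⊗ H) ⊗ K) ⊗ (N ⊗ H) ⊗ K :=
  hst H M N ▷ K ≫ kst H K (M ⊗ H) (N ⊗ H)

theorem kst_nat {M M' N N' : C} (f : M ⟶ M') (g : N ⟶ N') :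
    (f ⊗ₘ g) ▷ K ≫ kst H K M' N' = kst H K M N ≫ (f ▷ K ⊗ₘ g ▷ K) := by
  rw [MonoidalCategory.tensorHom_def, MonoidalCategory.tensorHom_def' (f ▷ K)]
  simp only [kst]
  calc _ = 𝟙 _ ⊗≫ f ▷ (N ⊗ K) ⊗≫ M' ◁ (g ▷ K ≫ N' ◁ dualComul H K) ⊗≫
        M' ◁ (β_ N' K).hom ▷ K ⊗≫ 𝟙 _ := by monoidal
    _ = 𝟙 _ ⊗≫ f ▷ (N ⊗ K) ⊗≫ M' ◁ N ◁ dualComul H K ⊗≫ M' ◁ (g ▷ K ≫ (β_ N' K).hom) ▷ K ⊗≫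
        𝟙 _ := by rw [← whisker_exchange]; monoidal
    _ = 𝟙 _ ⊗≫ (f ▷ (N ⊗ K) ≫ M' ◁ (N ◁ dualComul H K ⊗≫ (β_ N K).hom ▷ K ⊗≫ K ◁ g ▷ K)) ⊗≫
        𝟙 _ := by rw [BraidedCategory.braiding_naturality_left]; monoidal
    _ = _ := by rw [← whisker_exchange]; monoidal

theorem hst_nat {M M' N N' : C} (f : M ⟶ M') (g : N ⟶ N') :
    (f ⊗ₘ g) ▷ H ≫ hst H M' N' = hst H M N ≫ (f ▷ H ⊗ₘ g ▷ H) := by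
  rw [MonoidalCategory.tensorHom_def, MonoidalCategory.tensorHom_def' (f ▷ H)]
  simp only [hst]
  calc _ = 𝟙 _ ⊗≫ f ▷ (N ⊗ H) ⊗≫ M' ◁ (g ▷ H ≫ N' ◁ Δ[H]) ⊗≫
        M' ◁ (β_ H N').inv ▷ H ⊗≫ 𝟙 _ := by monoidal
    _ = 𝟙 _ ⊗≫ f ▷ (N ⊗ H) ⊗≫ M' ◁ N ◁ Δ[H] ⊗≫ M' ◁ (g ▷ H ≫ (β_ H N').inv) ▷ H ⊗≫
        𝟙 _ := by rw [← whisker_exchange]; monoidal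
    _ = 𝟙 _ ⊗≫ (f ▷ (N ⊗ H) ≫ M' ◁ (N ◁ Δ[H] ⊗≫ (β_ H N).inv ▷ H ⊗≫ H ◁ g ▷ H)) ⊗≫
        𝟙 _ := by rw [BraidedCategory.braiding_inv_naturality_left]; monoidal
    _ = _ := by rw [← whisker_exchange]; monoidal

theorem doubleComul_nat {M M' N N' : C} (f : M ⟶ M') (g : N ⟶ N') :
    (f ⊗ₘ g) ▷ H ▷ K ≫ doubleComul H K M' N' =
      doubleComul H K M N ≫ (f ▷ H ▷ K ⊗ₘ g ▷ H ▷ K) := by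
  rw [doubleComul, doubleComul, ← comp_whiskerRight_assoc, hst_nat, comp_whiskerRight,
    Category.assoc, Category.assoc, kst_nat]

/-- The part of the left fusion operator that concerns `K` is the half braiding of the comodule `N`
with `K`, regarded as an `H`-module through `dualAct`; its invertibility is then known. -/
theorem kst_whiskerLeft {M N : C} (k : N ⊗ K ⟶ N) : kst H K M N ≫ (M ⊗ K) ◁ k =
    (α_ M N K).hom ≫ M ◁ gam (tr k) (dualAct H K) ≫ (α_ M K N).inv := by
  have h : gam (tr k) (dualAct H K) = N ◁ dualComul H K ≫ (α_ N K K).inv ≫ (β_ N K).hom ▷ K ≫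
      (α_ K N K).hom ≫ K ◁ k := by
    have h₁ : dualComul H K ▷ N ⊗≫ (K ⊗ K) ◁ tr (H := H) k ⊗≫ K ◁ ε_ H K ▷ N =
        𝟙 _ ⊗≫ K ◁ tr (H := H) k ⊗≫ dualAct H K ▷ N ⊗≫ 𝟙 _ := by
      rw [dualComul_eq]
      calc _ = 𝟙 _ ⊗≫ K ◁ η_ H K ▷ N ⊗≫ (dualAct H K ▷ (K ⊗ N) ≫ K ◁ (K ◁ tr (H := H) k ⊗≫
            ε_ H K ▷ N)) := by monoidal
        _ = 𝟙 _ ⊗≫ K ◁ (η_ H K ▷ N ≫ (H ⊗ K) ◁ tr (H := H) k) ⊗≫ K ◁ H ◁ ε_ H K ▷ N ⊗≫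
            dualAct H K ▷ N ⊗≫ 𝟙 _ := by rw [← whisker_exchange]; monoidal
        _ = 𝟙 _ ⊗≫ K ◁ tr (H := H) k ⊗≫ K ◁ (η_ H K ▷ H ⊗≫ H ◁ ε_ H K) ▷ N ⊗≫
            dualAct H K ▷ N ⊗≫ 𝟙 _ := by rw [← whisker_exchange]; monoidal
        _ = _ := by rw [zigzag_left]; monoidal
    symm
    conv_lhs => rw [← unc_tr (H := H) k]
    simp only [unc, gam]
    calc _ = 𝟙 _ ⊗≫ N ◁ dualComul H K ⊗≫ ((α_ N K K).inv ≫ (β_ N K).hom ▷ K ≫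
          (α_ K N K).hom ≫ K ◁ (β_ N K).hom ≫ (α_ K K N).inv) ⊗≫ (K ⊗ K) ◁ tr (H := H) k ⊗≫
          K ◁ ε_ H K ▷ N ⊗≫ 𝟙 _ := by monoidal
      _ = 𝟙 _ ⊗≫ (N ◁ dualComul H K ≫ (β_ N (K ⊗ K)).hom) ⊗≫ (K ⊗ K) ◁ tr (H := H) k ⊗≫
          K ◁ ε_ H K ▷ N ⊗≫ 𝟙 _ := by
        rw [← BraidedCategory.braiding_tensor_right_hom]; monoidal
      _ = 𝟙 _ ⊗≫ (β_ N K).hom ⊗≫ (dualComul H K ▷ N ⊗≫ (K ⊗ K) ◁ tr (H := H) k ⊗≫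
          K ◁ ε_ H K ▷ N) ⊗≫ 𝟙 _ := by
        rw [BraidedCategory.braiding_naturality_right]; monoidal
      _ = _ := by rw [h₁]; monoidal
  rw [h, kst]
  monoidal

/-- The coaction on a tensor product. -/
def coactTensor {M N : C} (κ : M ⟶ H ⊗ M) (κ' : N ⟶ H ⊗ N) : M ⊗ N ⟶ H ⊗ M ⊗ N :=
  M ◁ κ' ≫ (α_ M H N).inv ≫ gam κ μ[H] ▷ N ≫ (α_ H M N).hom

/-- The coproduct of `K` is dual to the product of `H`, so a tensor product of `K`-actions
transposes to the coaction `coactTensor`, in which the two coefficients are multiplied. -/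
theorem kst_tensor {M N : C} (k : M ⊗ K ⟶ M) (k' : N ⊗ K ⟶ N) :
    kst H K M N ≫ (k ⊗ₘ k') = unc H K (coactTensor (tr k) (tr (H := H) k')) := by
  rw [MonoidalCategory.tensorHom_def', ← Category.assoc, kst_whiskerLeft, coactTensor]
  conv_lhs => rw [← unc_tr (H := H) k]
  simp only [gam, unc]
  calc _ = 𝟙 _ ⊗≫ M ◁ (β_ N K).hom ⊗≫ M ◁ K ◁ tr (H := H) k' ⊗≫ (M ◁ dualAct H K ≫
    (β_ M K).hom) ▷ N ⊗≫
        K ◁ tr (H := H) k ▷ N ⊗≫ ε_ H K ▷ (M ⊗ N) ⊗≫ 𝟙 _ := by monoidal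
    _ = 𝟙 _ ⊗≫ M ◁ (β_ N K).hom ⊗≫ M ◁ K ◁ tr (H := H) k' ⊗≫ (β_ M (K ⊗ H)).hom ▷ N ⊗≫
        (dualAct H K ▷ M ≫ K ◁ tr (H := H) k) ▷ N ⊗≫ ε_ H K ▷ (M ⊗ N) ⊗≫ 𝟙 _ := by
      rw [BraidedCategory.braiding_naturality_right]; monoidal
    _ = 𝟙 _ ⊗≫ M ◁ (β_ N K).hom ⊗≫ M ◁ K ◁ tr (H := H) k' ⊗≫ (β_ M (K ⊗ H)).hom ▷ N ⊗≫
        (K ⊗ H) ◁ tr (H := H) k ▷ N ⊗≫ (dualAct H K ▷ H ≫ ε_ H K) ▷ (M ⊗ N) ⊗≫ 𝟙 _ := by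
      rw [← whisker_exchange]; monoidal
    _ = 𝟙 _ ⊗≫ M ◁ (β_ N K).hom ⊗≫ (M ◁ (K ◁ tr (H := H) k') ⊗≫ (β_ M K).hom ▷ (H ⊗ N)) ⊗≫
        K ◁ (β_ M H).hom ▷ N ⊗≫
        (K ⊗ H) ◁ tr (H := H) k ▷ N ⊗≫ K ◁ μ[H] ▷ (M ⊗ N) ⊗≫ ε_ H K ▷ (M ⊗ N) ⊗≫ 𝟙 _ := by
      rw [dualAct_eval, BraidedCategory.braiding_tensor_right_hom]; monoidal
    _ = 𝟙 _ ⊗≫ M ◁ (β_ N K).hom ⊗≫ ((M ⊗ K) ◁ tr (H := H) k' ≫ (β_ M K).hom ▷ (H ⊗ N)) ⊗≫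
        K ◁ (β_ M H).hom ▷ N ⊗≫
        (K ⊗ H) ◁ tr (H := H) k ▷ N ⊗≫ K ◁ μ[H] ▷ (M ⊗ N) ⊗≫ ε_ H K ▷ (M ⊗ N) ⊗≫ 𝟙 _ := by
      monoidal
    _ = _ := by
      rw [whisker_exchange, BraidedCategory.braiding_tensor_left_hom]; monoidal

theorem doubleComul_tensor {M N : C} (r : M ⊗ H ⟶ M) (k : M ⊗ K ⟶ M) (s : N ⊗ H ⟶ N)
    (l : N ⊗ K ⟶ N) : doubleComul H K M N ≫ ((r ▷ K ≫ k) ⊗ₘ (s ▷ K ≫ l)) =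
      actTensor r s ▷ K ≫ unc H K (coactTensor (tr k) (tr l)) := by
  rw [doubleComul, ← tensorHom_comp_tensorHom, Category.assoc, ← reassoc_of% kst_nat, kst_tensor,
    actTensor, comp_whiskerRight, Category.assoc]

/-- The source of the formula for `ρ`: the `K`-action is the half braiding with `H ⊗ K`, acted on by
`pr`, evaluated at the unit of `H` and then contracted. -/
theorem unc_gam {M : C} (κ : M ⟶ H ⊗ M) : M ◁ ((λ_ K).inv ≫ η[H] ▷ K) ≫ gam κ (pr H K) ≫
    (β_ H K).hom ▷ M ≫ ε_ H K ▷ M ≫ (λ_ M).hom = unc H K κ := by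
  simp only [gam, unc, Category.assoc]
  rw [BraidedCategory.braiding_naturality_right_assoc]
  have h : ((λ_ K).inv ≫ η[H] ▷ K) ▷ H ≫ pr H K ≫ (β_ H K).hom = 𝟙 _ := by
    simp only [pr, gm]
    calc _ = 𝟙 _ ⊗≫ (η[H] ▷ (K ⊗ H) ≫ H ◁ (β_ H K).inv) ⊗≫ μ[H] ▷ K ⊗≫ (β_ H K).hom := by monoidal
      _ = 𝟙 _ ⊗≫ (β_ H K).inv ⊗≫ (η[H] ▷ H ≫ μ[H]) ▷ K ⊗≫ (β_ H K).hom := by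
        rw [← whisker_exchange]; monoidal
      _ = (β_ H K).inv ⊗≫ (β_ H K).hom := by rw [MonObj.one_mul]; monoidal
      _ = _ := by simp [monoidalComp]
  calc _ = 𝟙 _ ⊗≫ (β_ M K).hom ⊗≫ (((λ_ K).inv ≫ η[H] ▷ K) ▷ M ≫ (H ⊗ K) ◁ κ) ⊗≫ pr H K ▷ M ⊗≫
        (β_ H K).hom ▷ M ⊗≫ ε_ H K ▷ M ⊗≫ 𝟙 _ := by monoidal
    _ = 𝟙 _ ⊗≫ (β_ M K).hom ⊗≫ K ◁ κ ⊗≫ (((λ_ K).inv ≫ η[H] ▷ K) ▷ H ≫ pr H K ≫ 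
        (β_ H K).hom) ▷ M ⊗≫ ε_ H K ▷ M ⊗≫ 𝟙 _ := by rw [← whisker_exchange]; monoidal
    _ = _ := by rw [h]; monoidal

/-- The source of the formula for `γ`: transposing `k` introduces a coevaluation, and the two
crossings of `M` merge by a hexagon. -/
theorem gam_tr {M N : C} (k : M ⊗ K ⟶ M) (s : N ⊗ H ⟶ N) : gam (tr (H := H) k) s =
    𝟙 _ ⊗≫ (M ⊗ N) ◁ η_ H K ⊗≫ (β_ M (N ⊗ H)).hom ▷ K ⊗≫ (s ⊗ₘ k) := by
  simp only [gam, tr, dl]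
  calc _ = 𝟙 _ ⊗≫ ((β_ M N).hom ▷ 𝟙_ C ≫ (N ⊗ M) ◁ η_ H K) ⊗≫ N ◁ (β_ M H).hom ▷ K ⊗≫
        ((N ⊗ H) ◁ k ≫ s ▷ M) := by monoidal
    _ = _ := by
      rw [← whisker_exchange, BraidedCategory.braiding_tensor_right_hom,
        MonoidalCategory.tensorHom_def']; monoidal

end Comonoidal

end MirrorHopfObj

/-! ### Invertibility of the fusion operators -/

namespace MirrorHopfObj

variable {C : Type u} [Category.{v} C] [MonoidalCategory C] [BraidedCategory C]
  {H : C} [MirrorHopfObj H] {K : C} [ExactPairing H K]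

section Fusion

/-- The map `m ⊗ h ↦ m h₁ ⊗ h₂` is inverted by `m ⊗ h ↦ m T(h₁) ⊗ h₂`. The comultiplication `D` is
left free in order to cover both `Δ` with `S` and the opposite comultiplication with `Sinv`. -/
theorem fusion_isIso {M : C} {r : M ⊗ H ⟶ M} (hr : IsAction r) (D : H ⟶ H ⊗ H) (T : H ⟶ H)
    (h₁ : D ≫ D ▷ H ≫ (α_ H H H).hom = D ≫ H ◁ D) (h₂ : D ≫ ε[H] ▷ H = (λ_ H).inv)
    (h₃ : D ≫ H ◁ T ≫ μ[H] = ε[H] ≫ η[H]) (h₄ : D ≫ T ▷ H ≫ μ[H] = ε[H] ≫ η[H]) :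
    IsIso (M ◁ D ≫ (α_ M H H).inv ≫ r ▷ H) := by
  have a₁ := hr.one
  have a₂ := hr.mul
  simp only [ru, rm] at a₁ a₂
  have key : ∀ {f g : H ⟶ H}, D ≫ (f ⊗ₘ g) ≫ μ[H] = ε[H] ≫ η[H] →
      (M ◁ D ≫ (α_ M H H).inv ≫ (M ◁ f ≫ r) ▷ H) ≫ M ◁ D ≫ (α_ M H H).inv ≫ (M ◁ g ≫ r) ▷ H =
        𝟙 (M ⊗ H) := by
    intro f g hfg
    calc _ = 𝟙 _ ⊗≫ M ◁ D ⊗≫ M ◁ f ▷ H ⊗≫ (r ▷ H ≫ M ◁ (D ≫ g ▷ H)) ⊗≫ r ▷ H := by monoidal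
      _ = 𝟙 _ ⊗≫ M ◁ D ⊗≫ M ◁ (f ▷ H ≫ H ◁ (D ≫ g ▷ H)) ⊗≫ (r ▷ H ≫ r) ▷ H := by
        rw [← whisker_exchange]; monoidal
      _ = 𝟙 _ ⊗≫ M ◁ (D ≫ H ◁ D) ⊗≫ M ◁ (H ◁ g ≫ f ▷ H) ▷ H ⊗≫ M ◁ μ[H] ▷ H ⊗≫ r ▷ H := by
        rw [← whisker_exchange, ← a₂]; monoidal
      _ = 𝟙 _ ⊗≫ M ◁ D ⊗≫ M ◁ (D ≫ (f ⊗ₘ g) ≫ μ[H]) ▷ H ⊗≫ r ▷ H := by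
        rw [← h₁, MonoidalCategory.tensorHom_def']; monoidal
      _ = 𝟙 _ ⊗≫ M ◁ (D ≫ ε[H] ▷ H) ⊗≫ ((ρ_ M).inv ≫ M ◁ η[H] ≫ r) ▷ H := by
        rw [hfg]; monoidal
      _ = _ := by
        rw [h₂, ← Category.assoc (ρ_ M).inv, a₁]; monoidal
  refine ⟨M ◁ D ≫ (α_ M H H).inv ≫ (M ◁ T ≫ r) ▷ H, ?_, ?_⟩
  · have := key (f := 𝟙 H) (g := T) (by rwa [id_tensorHom])
    rwa [whiskerLeft_id, Category.id_comp] at this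
  · have := key (f := T) (g := 𝟙 H) (by rwa [tensorHom_id])
    rwa [whiskerLeft_id, Category.id_comp] at this

/-- Up to a crossing, this is the fusion map of the opposite comultiplication, so the inverse
antipode is what inverts it. -/
theorem hst_whiskerLeft_isIso {M N : C} {s : N ⊗ H ⟶ N} (hs : IsAction s) :
    IsIso (hst H M N ≫ (M ⊗ H) ◁ s) := by
  have h := fusion_isIso hs (Δ[H] ≫ (β_ H H).hom) Sinv (cop_coassoc H) (cop_counit_left H)
    (by rw [Category.assoc, Sinv_right]) (by rw [Category.assoc, Sinv_left])
  have e : hst H M N ≫ (M ⊗ H) ◁ s = (α_ M N H).hom ≫ M ◁ ((N ◁ (Δ[H] ≫ (β_ H H).hom) ≫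
      (α_ N H H).inv ≫ s ▷ H) ≫ (β_ H N).inv) ≫ (α_ M H N).inv := by
    simp only [hst]
    symm
    calc _ = 𝟙 _ ⊗≫ M ◁ (N ◁ (Δ[H] ≫ (β_ H H).hom) ⊗≫ (s ▷ H ≫ (β_ H N).inv)) ⊗≫ 𝟙 _ := by
          monoidal
      _ = 𝟙 _ ⊗≫ M ◁ (N ◁ (Δ[H] ≫ (β_ H H).hom ≫ (β_ H H).inv) ⊗≫ (β_ H N).inv ▷ H ⊗≫ H ◁ s) ⊗≫
          𝟙 _ := by
        rw [BraidedCategory.braiding_inv_naturality_left, BraidedCategory.braiding_tensor_right_inv]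
        monoidal
      _ = _ := by rw [Iso.hom_inv_id]; monoidal
  rw [e]
  infer_instance

theorem hst_whiskerRight_isIso {M N : C} {r : M ⊗ H ⟶ M} (hr : IsAction r) :
    IsIso (hst H M N ≫ r ▷ (N ⊗ H)) := by
  have h := fusion_isIso hr Δ[H] S (ComonObj.comul_assoc H).symm (ComonObj.counit_comul H)
    S_right S_left
  have e : hst H M N ≫ r ▷ (N ⊗ H) = (α_ M N H).hom ≫ M ◁ (β_ H N).inv ≫ (α_ M H N).inv ≫
      (M ◁ Δ[H] ≫ (α_ M H H).inv ≫ r ▷ H) ▷ N ≫ (α_ M H N).hom ≫ M ◁ (β_ H N).hom := by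
    simp only [hst]
    symm
    calc _ = 𝟙 _ ⊗≫ M ◁ ((β_ H N).inv ≫ Δ[H] ▷ N) ⊗≫ (r ▷ (H ⊗ N) ≫ M ◁ (β_ H N).hom) := by
          monoidal
      _ = 𝟙 _ ⊗≫ M ◁ N ◁ Δ[H] ⊗≫ M ◁ (β_ H N).inv ▷ H ⊗≫ (M ⊗ H) ◁ ((β_ H N).inv ≫ (β_ H N).hom) ⊗≫
          r ▷ (N ⊗ H) := by
        rw [← BraidedCategory.braiding_inv_naturality_right, ← whisker_exchange,
          BraidedCategory.braiding_tensor_left_inv]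
        monoidal
      _ = _ := by rw [Iso.inv_hom_id]; monoidal
  rw [e]
  infer_instance

theorem kst_whiskerLeft_isIso {M N : C} {k : N ⊗ K ⟶ N} (hk : IsCoaction (tr (H := H) k)) :
    IsIso (kst H K M N ≫ (M ⊗ K) ◁ k) := by
  have := gam_isIso hk (dualAct_isAction H K)
  rw [kst_whiskerLeft]
  infer_instance

/-- The map `M ⊗ K ⟶ N ⊗ K`, `m ⊗ f ↦ ⟨f', m₋₁⟩ m₀ ⊗ f''`, defined by `M ⟶ H ⊗ N`. -/
def mate {M N : C} (g : M ⟶ H ⊗ N) : M ⊗ K ⟶ N ⊗ K :=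
  unc H K (dl H K M ≫ H ◁ (g ▷ K ≫ (α_ H N K).hom) ≫ gm H (N ⊗ K))

variable (H) in
/-- The exchange of the first two tensor factors, by the braiding. -/
def swap (N : C) : H ⊗ H ⊗ N ⟶ H ⊗ H ⊗ N := (α_ H H N).inv ≫ (β_ H H).hom ▷ N ≫ (α_ H H N).hom

theorem swap_nat {N N' : C} (f : N ⟶ N') :
    H ◁ H ◁ f ≫ swap H N' = swap H N ≫ H ◁ H ◁ f := by
  rw [swap, swap, associator_inv_naturality_right_assoc, whisker_exchange_assoc, Category.assoc,
    Category.assoc, associator_naturality_right]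

theorem gm_swap_gm (N : C) : H ◁ gm H N ≫ swap H N ≫ gm H N =
    swap H (H ⊗ N) ≫ H ◁ swap H N ≫ H ◁ gm H N ≫ gm H N := by
  simp only [gm, swap]
  calc _ = 𝟙 _ ⊗≫ (H ◁ μ[H] ≫ (β_ H H).hom) ▷ N ⊗≫ μ[H] ▷ N := by monoidal
    _ = 𝟙 _ ⊗≫ (β_ H (H ⊗ H)).hom ▷ N ⊗≫ (μ[H] ▷ H ≫ μ[H]) ▷ N := by
      rw [BraidedCategory.braiding_naturality_right]; monoidal
    _ = _ := by rw [MonObj.mul_assoc, BraidedCategory.braiding_tensor_right_hom]; monoidal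

theorem gm_swap (N : C) : gm H (H ⊗ N) ≫ swap H N =
    H ◁ swap H N ≫ swap H (H ⊗ N) ≫ H ◁ gm H N := by
  simp only [gm, swap]
  calc _ = 𝟙 _ ⊗≫ (μ[H] ▷ H ≫ (β_ H H).hom) ▷ N ⊗≫ 𝟙 _ := by monoidal
    _ = _ := by
      rw [BraidedCategory.braiding_naturality_left, BraidedCategory.braiding_tensor_left_hom]
      monoidal

theorem swap_swap_swap (N : C) : H ◁ swap H N ≫ swap H (H ⊗ N) ≫ H ◁ swap H N =
    swap H (H ⊗ N) ≫ H ◁ swap H N ≫ swap H (H ⊗ N) := by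
  have h := BraidedCategory.yang_baxter H H H
  simp only [swap]
  calc _ = 𝟙 _ ⊗≫ (H ◁ (β_ H H).hom ≫ (α_ H H H).inv ≫ (β_ H H).hom ▷ H ≫ (α_ H H H).hom ≫
        H ◁ (β_ H H).hom) ▷ N ⊗≫ 𝟙 _ := by monoidal
    _ = 𝟙 _ ⊗≫ ((α_ H H H).inv ≫ (β_ H H).hom ▷ H ≫ (α_ H H H).hom ≫ H ◁ (β_ H H).hom ≫
        (α_ H H H).inv ≫ (β_ H H).hom ▷ H ≫ (α_ H H H).hom) ▷ N ⊗≫ 𝟙 _ := by rw [h]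
    _ = _ := by monoidal

theorem dl_tensor (N : C) : dl H K (H ⊗ N) ≫ H ◁ (α_ H N K).hom = H ◁ dl H K N ≫
  swap H (N ⊗ K) := by
  simp only [dl, swap]
  rw [BraidedCategory.braiding_tensor_left_hom]
  monoidal

theorem tr_mate {M N : C} (g : M ⟶ H ⊗ N) : tr (H := H) (mate (K := K) g) =
    dl H K M ≫ H ◁ (g ▷ K ≫ (α_ H N K).hom) ≫ gm H (N ⊗ K) := tr_unc _

theorem tr_mate' {M N : C} (g : M ⟶ H ⊗ N) : tr (H := H) (mate (K := K) g) =
    g ≫ H ◁ dl H K N ≫ swap H (N ⊗ K) ≫ gm H (N ⊗ K) := by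
  rw [tr_mate, whiskerLeft_comp, Category.assoc, ← reassoc_of% dl_nat, reassoc_of% (dl_tensor N)]

/-- Composites of mates multiply their coefficients in the opposite order, because the coproduct of
`K` is dual to the product of `H`. -/
theorem mate_comp {M N P : C} (g : M ⟶ H ⊗ N) (g' : N ⟶ H ⊗ P) :
    mate (K := K) g ≫ mate g' = mate (g ≫ H ◁ g' ≫ swap H P ≫ gm H P) := by
  apply tr_injective (H := H)
  have h := tr_mate' (K := K) g'
  rw [tr] at h
  rw [tr_comp, tr_mate', tr_mate']
  simp only [Category.assoc]
  rw [← gm_nat, ← reassoc_of% swap_nat, ← whiskerLeft_comp_assoc, h, ← reassoc_of% gm_nat,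
    ← reassoc_of% swap_nat,
    reassoc_of% gm_swap]
  simp only [whiskerLeft_comp, Category.assoc]
  rw [gm_swap_gm, reassoc_of% swap_swap_swap]

theorem mate_gu (M : C) : mate (K := K) (gu H M) = 𝟙 (M ⊗ K) := by
  apply tr_injective (H := H)
  rw [tr_mate]
  simp only [gu, gm, tr, whiskerLeft_id, Category.comp_id]
  calc _ = dl H K M ⊗≫ (H ◁ η[H] ≫ μ[H]) ▷ (M ⊗ K) := by monoidal
    _ = _ := by rw [MonObj.mul_one]; monoidal

/-- Transposing the coproduct of `K` gives two coevaluations with multiplied `H`-factors; letting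
`k` act on the first one replaces it by the coaction. -/
theorem whiskerRight_eq_mate {M : C} (k : M ⊗ K ⟶ M) :
    M ◁ dualComul H K ≫ (α_ M K K).inv ≫ k ▷ K = mate (tr (H := H) k) := by
  apply tr_injective (H := H)
  rw [tr_mate]
  have h := coev_dualComul H K
  have e : dl H K M ≫ H ◁ (M ◁ dualComul H K ≫ (α_ M K K).inv) =
      dl H K M ≫ H ◁ (dl H K M ▷ K ≫ (α_ H (M ⊗ K) K).hom) ≫ gm H _ := by
    simp only [dl, gm]
    calc _ = 𝟙 _ ⊗≫ M ◁ η_ H K ⊗≫ ((β_ M H).hom ▷ K ≫ (H ⊗ M) ◁ dualComul H K) ⊗≫ 𝟙 _ := by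
          monoidal
      _ = 𝟙 _ ⊗≫ M ◁ (η_ H K ≫ H ◁ dualComul H K) ⊗≫ (β_ M H).hom ▷ (K ⊗ K) ⊗≫ 𝟙 _ := by
        rw [← whisker_exchange]; monoidal
      _ = 𝟙 _ ⊗≫ M ◁ η_ H K ⊗≫ (M ⊗ H) ◁ η_ H K ▷ K ⊗≫ (M ◁ μ[H] ≫ (β_ M H).hom) ▷ (K ⊗ K) ⊗≫
          𝟙 _ := by rw [h]; monoidal
      _ = 𝟙 _ ⊗≫ M ◁ η_ H K ⊗≫ ((M ⊗ H) ◁ η_ H K ≫ (β_ M H).hom ▷ (H ⊗ K)) ▷ K ⊗≫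
          H ◁ (β_ M H).hom ▷ (K ⊗ K) ⊗≫ μ[H] ▷ (M ⊗ K ⊗ K) ⊗≫ 𝟙 _ := by
        rw [BraidedCategory.braiding_naturality_right, BraidedCategory.braiding_tensor_right_hom]
        monoidal
      _ = _ := by rw [whisker_exchange]; monoidal
  have e' : H ◁ (dl H K M ▷ K ≫ (α_ H (M ⊗ K) K).hom) ≫ gm H _ ≫ H ◁ (k ▷ K) =
      H ◁ (tr (H := H) k ▷ K ≫ (α_ H M K).hom) ≫ gm H _ := by
    rw [← gm_nat, tr]
    simp
  rw [← e', ← reassoc_of% e, tr]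
  simp

theorem mate_isIso {M : C} {κ : M ⟶ H ⊗ M} (hκ : IsCoaction κ) : IsIso (mate (K := K) κ) := by
  have h₃ := hκ.counit
  have h₄ := hκ.comul
  simp only [ge, gd] at h₃ h₄
  have key : ∀ {f g : H ⟶ H}, Δ[H] ≫ (f ⊗ₘ g) ≫ (β_ H H).hom ≫ μ[H] = ε[H] ≫ η[H] →
      mate (K := K) (κ ≫ f ▷ M) ≫ mate (κ ≫ g ▷ M) = 𝟙 (M ⊗ K) := by
    intro f g hfg
    rw [mate_comp, ← mate_gu (H := H)]
    congr 1
    simp only [swap, gm, gu]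
    calc _ = 𝟙 _ ⊗≫ κ ⊗≫ (f ▷ M ≫ H ◁ (κ ≫ g ▷ M)) ⊗≫ (β_ H H).hom ▷ M ⊗≫ μ[H] ▷ M := by monoidal
      _ = 𝟙 _ ⊗≫ (κ ≫ H ◁ κ) ⊗≫ ((H ◁ g ≫ f ▷ H) ≫ (β_ H H).hom) ▷ M ⊗≫ μ[H] ▷ M := by
        rw [← whisker_exchange]; monoidal
      _ = 𝟙 _ ⊗≫ κ ⊗≫ (Δ[H] ≫ (f ⊗ₘ g) ≫ (β_ H H).hom ≫ μ[H]) ▷ M := by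
        rw [← h₄, MonoidalCategory.tensorHom_def']; monoidal
      _ = (κ ≫ ε[H] ▷ M ≫ (λ_ M).hom) ⊗≫ η[H] ▷ M := by rw [hfg]; monoidal
      _ = _ := by rw [h₃]; monoidal
  -- The coefficients multiply in the opposite order, so the antipode that inverts is `Sinv`.
  refine ⟨mate (κ ≫ Sinv ▷ M), ?_, ?_⟩
  · have := key (f := 𝟙 H) (g := Sinv) (by
      rw [id_tensorHom, BraidedCategory.braiding_naturality_right_assoc, Sinv_left])
    rwa [id_whiskerRight, Category.comp_id] at this
  · have := key (f := Sinv) (g := 𝟙 H) (by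
      rw [tensorHom_id, BraidedCategory.braiding_naturality_left_assoc, Sinv_right])
    rwa [id_whiskerRight, Category.comp_id] at this

theorem kst_whiskerRight_isIso {M N : C} {k : M ⊗ K ⟶ M} (hk : IsCoaction (tr (H := H) k)) :
    IsIso (kst H K M N ≫ k ▷ (N ⊗ K)) := by
  have := mate_isIso (K := K) hk
  rw [← whiskerRight_eq_mate] at this
  have e : kst H K M N ≫ k ▷ (N ⊗ K) = (α_ M N K).hom ≫ M ◁ (β_ N K).hom ≫ (α_ M K N).inv ≫
      (M ◁ dualComul H K ≫ (α_ M K K).inv ≫ k ▷ K) ▷ N ≫ (α_ M K N).hom ≫ M ◁ (β_ N K).inv := by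
    simp only [kst]
    symm
    calc _ = 𝟙 _ ⊗≫ M ◁ ((β_ N K).hom ≫ dualComul H K ▷ N) ⊗≫ (k ▷ (K ⊗ N) ≫
          M ◁ (β_ N K).inv) := by monoidal
      _ = 𝟙 _ ⊗≫ M ◁ N ◁ dualComul H K ⊗≫ M ◁ (β_ N K).hom ▷ K ⊗≫
          (M ⊗ K) ◁ ((β_ N K).hom ≫ (β_ N K).inv) ⊗≫ k ▷ (N ⊗ K) := by
        rw [← BraidedCategory.braiding_naturality_right, ← whisker_exchange,
          BraidedCategory.braiding_tensor_right_hom]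
        monoidal
      _ = _ := by rw [Iso.hom_inv_id]; monoidal
  rw [e]
  infer_instance

theorem doubleComul_whiskerLeft_isIso {M N : C} {r : N ⊗ H ⟶ N} {k : N ⊗ K ⟶ N}
    (hr : IsAction r) (hk : IsCoaction (tr (H := H) k)) :
    IsIso (doubleComul H K M N ≫ ((M ⊗ H) ⊗ K) ◁ (r ▷ K ≫ k)) := by
  have h₁ := hst_whiskerLeft_isIso (M := M) hr
  have h₂ := kst_whiskerLeft_isIso (M := M ⊗ H) hk
  have h := kst_nat (H := H) (K := K) (𝟙 (M ⊗ H)) r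
  simp only [id_tensorHom, id_whiskerRight] at h
  have e : doubleComul H K M N ≫ ((M ⊗ H) ⊗ K) ◁ (r ▷ K ≫ k) =
      (hst H M N ≫ (M ⊗ H) ◁ r) ▷ K ≫ kst H K (M ⊗ H) N ≫ ((M ⊗ H) ⊗ K) ◁ k := by
    rw [doubleComul, whiskerLeft_comp, Category.assoc, ← reassoc_of% h, comp_whiskerRight,
      Category.assoc]
  rw [e]
  infer_instance

theorem doubleComul_whiskerRight_isIso {M N : C} {r : M ⊗ H ⟶ M} {k : M ⊗ K ⟶ M}
    (hr : IsAction r) (hk : IsCoaction (tr (H := H) k)) :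
    IsIso (doubleComul H K M N ≫ (r ▷ K ≫ k) ▷ ((N ⊗ H) ⊗ K)) := by
  have h₁ := hst_whiskerRight_isIso (N := N) hr
  have h₂ := kst_whiskerRight_isIso (N := N ⊗ H) hk
  have h := kst_nat (H := H) (K := K) r (𝟙 (N ⊗ H))
  simp only [tensorHom_id, id_whiskerRight] at h
  have e : doubleComul H K M N ≫ (r ▷ K ≫ k) ▷ ((N ⊗ H) ⊗ K) =
      (hst H M N ≫ r ▷ (N ⊗ H)) ▷ K ≫ kst H K M (N ⊗ H) ≫ k ▷ ((N ⊗ H) ⊗ K) := by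
    rw [doubleComul, comp_whiskerRight, Category.assoc, ← reassoc_of% h, comp_whiskerRight,
      Category.assoc]
  rw [e]
  infer_instance

end Fusion

end MirrorHopfObj

/-! ### Mirror objects in the centre -/

namespace CentralDouble

variable {B : Type u} [Category.{v} B] [MonoidalCategory B] [BraidedCategory B]

section Mirror

theorem braiding_hom_f (X Y : Center B) : Center.Hom.f (β_ X Y).hom = (X.2.β Y.1).hom := rfl

theorem braiding_inv_f (X Y : Center B) : Center.Hom.f (β_ X Y).inv = (X.2.β Y.1).inv := by
  apply Iso.inv_ext'
  rw [← braiding_hom_f, ← Center.comp_f, Iso.hom_inv_id]; rfl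

theorem mirror_β_inv (X U : B) : ((mirrorObj X).2.β U).inv = (β_ U X).hom := rfl

theorem mirror_tensor_β (X Y U : B) :
    ((mirrorObj X ⊗ mirrorObj Y).2.β U).hom = (β_ U (X ⊗ Y)).inv := by
  rw [BraidedCategory.braiding_tensor_right_inv]
  exact (Category.assoc _ _ _).symm.trans (by simp [mirrorObj])

theorem mirror_unit_β (U : B) : ((𝟙_ (Center B)).2.β U).hom = (β_ U (𝟙_ B)).inv := by
  rw [braiding_inv_tensorUnit_right]; rfl

/-- Naturality of the inverse braiding lets every morphism of `B` lift unchanged to mirror objects,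
in particular all the structure of `A` and its duality with `ᵛA`. -/
theorem mirror_comm {X Y : B} (f : X ⟶ Y) (U : B) :
    f ▷ U ≫ (β_ U Y).inv = (β_ U X).inv ≫ U ◁ f :=
  BraidedCategory.braiding_inv_naturality_left f U

/-- A morphism of `B` as a morphism between mirror objects. -/
def mirrorMap {X Y : B} (f : X ⟶ Y) : mirrorObj X ⟶ mirrorObj Y where
  f := f
  comm U := mirror_comm f U

/-- A morphism of `B` as a morphism from a tensor product of mirror objects. -/
def mirrorMul {X Y Z : B} (f : X ⊗ Y ⟶ Z) : mirrorObj X ⊗ mirrorObj Y ⟶ mirrorObj Z where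
  f := f
  comm U := by rw [mirror_tensor_β]; exact mirror_comm f U

/-- A morphism of `B` as a morphism to a tensor product of mirror objects. -/
def mirrorComul {X Y Z : B} (f : Z ⟶ X ⊗ Y) : mirrorObj Z ⟶ mirrorObj X ⊗ mirrorObj Y where
  f := f
  comm U := by rw [mirror_tensor_β]; exact mirror_comm f U

/-- A morphism of `B` as a morphism from the unit to a mirror object. -/
def mirrorOne {X : B} (f : 𝟙_ B ⟶ X) : 𝟙_ (Center B) ⟶ mirrorObj X where
  f := f
  comm U := by rw [mirror_unit_β]; exact mirror_comm f U

/-- A morphism of `B` as a morphism from a mirror object to the unit. -/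
def mirrorCounit {X : B} (f : X ⟶ 𝟙_ B) : mirrorObj X ⟶ 𝟙_ (Center B) where
  f := f
  comm U := by rw [mirror_unit_β]; exact mirror_comm f U

/-- A morphism of `B` as a morphism from the unit to a tensor product of mirror objects. -/
def mirrorCoev {X Y : B} (f : 𝟙_ B ⟶ X ⊗ Y) : 𝟙_ (Center B) ⟶ mirrorObj X ⊗ mirrorObj Y where
  f := f
  comm U := by rw [mirror_unit_β, mirror_tensor_β]; exact mirror_comm f U

/-- A morphism of `B` as a morphism from a tensor product of mirror objects to the unit. -/
def mirrorEv {X Y : B} (f : X ⊗ Y ⟶ 𝟙_ B) : mirrorObj X ⊗ mirrorObj Y ⟶ 𝟙_ (Center B) where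
  f := f
  comm U := by rw [mirror_unit_β, mirror_tensor_β]; exact mirror_comm f U

instance mirrorExactPairing (X Y : B) [ExactPairing X Y] :
    ExactPairing (mirrorObj X) (mirrorObj Y) where
  coevaluation' := mirrorCoev (η_ X Y)
  evaluation' := mirrorEv (ε_ X Y)
  coevaluation_evaluation' := by
    apply Center.ext
    simp only [Center.comp_f, Center.associator_inv_f, Center.leftUnitor_inv_f]
    exact ExactPairing.coevaluation_evaluation X Y
  evaluation_coevaluation' := by
    apply Center.ext
    simp only [Center.comp_f, Center.rightUnitor_inv_f]
    exact ExactPairing.evaluation_coevaluation X Y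

/-- The antipode is invertible and antimultiplicative; composing with it reduces the identity to the
antipode axiom of `A`. -/
theorem comul_braiding_inv_antipode (A : B) [HopfObj A] [IsIso (HopfObj.antipode (X := A))] :
    Δ[A] ≫ (β_ A A).inv ≫ inv (HopfObj.antipode (X := A)) ▷ A ≫ μ[A] = ε[A] ≫ η[A] := by
  rw [← cancel_mono (HopfObj.antipode (X := A))]
  simp only [Category.assoc, HopfObj.mul_antipode, HopfObj.one_antipode]
  rw [← HopfObj.antipode_right A, ← tensorHom_id, tensorHom_comp_tensorHom_assoc,
    IsIso.inv_hom_id, Category.id_comp, id_tensorHom,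
    BraidedCategory.braiding_naturality_right_assoc, Iso.inv_hom_id_assoc, HopfObj.antipode_left,
    HopfObj.antipode_right]

theorem comul_braiding_inv_antipode' (A : B) [HopfObj A] [IsIso (HopfObj.antipode (X := A))] :
    Δ[A] ≫ (β_ A A).inv ≫ A ◁ inv (HopfObj.antipode (X := A)) ≫ μ[A] = ε[A] ≫ η[A] := by
  rw [← cancel_mono (HopfObj.antipode (X := A))]
  simp only [Category.assoc, HopfObj.mul_antipode, HopfObj.one_antipode]
  rw [← HopfObj.antipode_right A, ← id_tensorHom, tensorHom_comp_tensorHom_assoc,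
    IsIso.inv_hom_id, Category.id_comp, tensorHom_id,
    BraidedCategory.braiding_naturality_left_assoc, Iso.inv_hom_id_assoc]

theorem tensorμ_comp_eq {C : Type u} [Category.{v} C] [MonoidalCategory C] {H : C} (m : H ⊗ H ⟶ H)
    (d : H ⟶ H ⊗ H) (c : H ⊗ H ⟶ H ⊗ H) :
    (d ⊗ₘ d) ≫ (α_ _ _ _).hom ≫ H ◁ (α_ _ _ _).inv ≫ H ◁ c ▷ H ≫ H ◁ (α_ _ _ _).hom ≫
      (α_ _ _ _).inv ≫ (m ⊗ₘ m) =
    d ▷ H ⊗≫ (H ⊗ H) ◁ d ⊗≫ H ◁ c ▷ H ⊗≫ m ▷ (H ⊗ H) ⊗≫ H ◁ m := by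
  rw [MonoidalCategory.tensorHom_def, MonoidalCategory.tensorHom_def]
  monoidal

/-- The braiding of the centre between mirror objects is `τ⁻¹`. Hence the bialgebra axiom of `A` for
`τ` is the axiom for the inverse braiding of the centre, and `S⁻¹` is an antipode for `τ⁻¹ Δ`. -/
instance mirrorHopfObj (A : B) [HopfObj A] [IsIso (HopfObj.antipode (X := A))] :
    MirrorHopfObj (mirrorObj A) where
  one := mirrorOne η[A]
  mul := mirrorMul μ[A]
  one_mul := Center.ext _ _ (MonObj.one_mul A)
  mul_one := Center.ext _ _ (MonObj.mul_one A)
  mul_assoc := Center.ext _ _ (MonObj.mul_assoc A)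
  counit := mirrorCounit ε[A]
  comul := mirrorComul Δ[A]
  counit_comul := by
    apply Center.ext
    rw [Center.leftUnitor_inv_f]
    exact ComonObj.counit_comul A
  comul_counit := by
    apply Center.ext
    rw [Center.rightUnitor_inv_f]
    exact ComonObj.comul_counit A
  comul_assoc := Center.ext _ _ (ComonObj.comul_assoc A)
  S := mirrorMap HopfObj.antipode
  Sinv := mirrorMap (inv HopfObj.antipode)
  one_comul := by
    apply Center.ext
    rw [Center.comp_f, Center.comp_f, Center.leftUnitor_inv_f]
    exact BimonObj.one_comul A
  mul_counit := Center.ext _ _ (BimonObj.mul_counit A)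
  one_counit := Center.ext _ _ (BimonObj.one_counit A)
  mul_comul := by
    let m : mirrorObj A ⊗ mirrorObj A ⟶ mirrorObj A := mirrorMul μ[A]
    let d : mirrorObj A ⟶ mirrorObj A ⊗ mirrorObj A := mirrorComul Δ[A]
    have h : m ≫ d = (d ⊗ₘ d) ≫ (α_ _ _ _).hom ≫ mirrorObj A ◁ (α_ _ _ _).inv ≫
        mirrorObj A ◁ (β_ (mirrorObj A) (mirrorObj A)).inv ▷ mirrorObj A ≫
        mirrorObj A ◁ (α_ _ _ _).hom ≫ (α_ _ _ _).inv ≫ (m ⊗ₘ m) := by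
      apply Center.ext
      simp only [Center.comp_f, Center.associator_inv_f, Center.whiskerLeft_f,
        Center.whiskerRight_f, braiding_inv_f, mirror_β_inv]
      refine (BimonObj.mul_comul A).trans ?_
      simp only [tensorμ, Category.assoc]
      rfl
    exact h.trans (tensorμ_comp_eq m d _)
  S_left := Center.ext _ _ (HopfObj.antipode_left A)
  S_right := Center.ext _ _ (HopfObj.antipode_right A)
  Sinv_left := Center.ext _ _ (comul_braiding_inv_antipode A)
  Sinv_right := Center.ext _ _ (comul_braiding_inv_antipode' A)

end Mirror

end CentralDouble

/-! ### The structural morphisms of the central double -/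

namespace MirrorHopfObj

variable {C : Type u} [Category.{v} C] [MonoidalCategory C] [BraidedCategory C]
  (H : C) [MirrorHopfObj H] (K : C) [ExactPairing H K]

/-- All coherence isomorphisms are written out so that underlying morphisms in `B` can be taken
factor by factor. -/
theorem dualMul_eq : dualMul H K = (ρ_ (K ⊗ K)).inv ≫ (K ⊗ K) ◁ η_ H K ≫ (K ⊗ K) ◁ (Δ[H] ▷ K) ≫
    (K ⊗ K) ◁ (α_ H H K).hom ≫ (α_ K K (H ⊗ H ⊗ K)).hom ≫ K ◁ (α_ K H (H ⊗ K)).inv ≫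
    K ◁ (β_ H K).inv ▷ (H ⊗ K) ≫ K ◁ (α_ H K (H ⊗ K)).hom ≫ (α_ K H (K ⊗ H ⊗ K)).inv ≫
    ε_ H K ▷ (K ⊗ H ⊗ K) ≫ (λ_ _).hom ≫ (α_ K H K).inv ≫ ε_ H K ▷ K ≫ (λ_ _).hom := by
  simp only [dualMul]; monoidal

theorem dualComul_eq_comp : dualComul H K = (ρ_ K).inv ≫ K ◁ η_ H K ≫
    K ◁ (ρ_ H).inv ▷ K ≫ K ◁ (H ◁ η_ H K) ▷ K ≫ K ◁ (α_ H H K).inv ▷ K ≫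
    K ◁ (μ[H] ▷ K) ▷ K ≫ K ◁ (α_ H K K).hom ≫ (α_ K H (K ⊗ K)).inv ≫ ε_ H K ▷ (K ⊗ K) ≫
    (λ_ _).hom := by
  simp only [dualComul]; monoidal

end MirrorHopfObj

namespace CentralDouble

variable {B : Type u} [Category.{v} B] [MonoidalCategory B] [BraidedCategory B] [RigidCategory B]
  (A : B) [HopfObj A] [IsIso (HopfObj.antipode (X := A))]

open MirrorHopfObj (gm gd ge gu rm rd re ru psi psiInv pr chi sw lam dl tr unc dualMul dualOne
  dualComul lm lu hst kst gam doubleMul doubleOne doubleComul freeAct conv convInv uncur)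

local notation "𝐇" => mirrorObj A
local notation "𝐊" => mirrorObj (Aᘁ)

theorem one_f : Center.Hom.f η[𝐇] = η[A] := rfl
theorem mul_f : Center.Hom.f μ[𝐇] = μ[A] := rfl
theorem comul_f : Center.Hom.f Δ[𝐇] = Δ[A] := rfl
theorem coev_f : Center.Hom.f (η_ 𝐇 𝐊) = coev A := rfl
theorem ev_f : Center.Hom.f (ε_ 𝐇 𝐊) = ev A := rfl
theorem dualMul_f : Center.Hom.f (dualMul 𝐇 𝐊) = mulDual A := by
  rw [MirrorHopfObj.dualMul_eq]
  simp only [Center.comp_f, Center.whiskerLeft_f, Center.whiskerRight_f, Center.associator_hom_f,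
    Center.associator_inv_f, Center.leftUnitor_hom_f, Center.rightUnitor_inv_f, braiding_inv_f,
    mirror_β_inv, comul_f, coev_f, ev_f]
  simp only [mulDual]
  change (ρ_ (Aᘁ ⊗ Aᘁ)).inv ≫ (Aᘁ ⊗ Aᘁ) ◁ coev A ≫ (Aᘁ ⊗ Aᘁ) ◁ (Δ[A] ▷ Aᘁ) ≫
    (Aᘁ ⊗ Aᘁ) ◁ (α_ A A Aᘁ).hom ≫ (α_ Aᘁ Aᘁ (A ⊗ A ⊗ Aᘁ)).hom ≫ Aᘁ ◁ (α_ Aᘁ A (A ⊗ Aᘁ)).inv ≫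
    Aᘁ ◁ (β_ Aᘁ A).hom ▷ (A ⊗ Aᘁ) ≫ Aᘁ ◁ (α_ A Aᘁ (A ⊗ Aᘁ)).hom ≫ (α_ Aᘁ A (Aᘁ ⊗ A ⊗ Aᘁ)).inv ≫
    ev A ▷ (Aᘁ ⊗ A ⊗ Aᘁ) ≫ (λ_ _).hom ≫ (α_ Aᘁ A Aᘁ).inv ≫ ev A ▷ Aᘁ ≫ (λ_ _).hom = _
  monoidal

theorem dualOne_f : Center.Hom.f (dualOne 𝐇 𝐊) = unitDual A := rfl

theorem dualComul_f : Center.Hom.f (dualComul 𝐇 𝐊) = comulDual A := by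
  rw [MirrorHopfObj.dualComul_eq_comp]
  simp only [Center.comp_f, Center.whiskerLeft_f, Center.whiskerRight_f, Center.associator_hom_f,
    Center.associator_inv_f, Center.leftUnitor_hom_f, Center.rightUnitor_inv_f]
  simp only [comulDual]
  change (ρ_ Aᘁ).inv ≫ Aᘁ ◁ coev A ≫
    Aᘁ ◁ (ρ_ A).inv ▷ Aᘁ ≫ Aᘁ ◁ (A ◁ coev A) ▷ Aᘁ ≫ Aᘁ ◁ (α_ A A Aᘁ).inv ▷ Aᘁ ≫
    Aᘁ ◁ (μ[A] ▷ Aᘁ) ▷ Aᘁ ≫ Aᘁ ◁ (α_ A Aᘁ Aᘁ).hom ≫ (α_ Aᘁ A (Aᘁ ⊗ Aᘁ)).inv ≫ ev A ▷ (Aᘁ ⊗ Aᘁ) ≫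
    (λ_ _).hom = _
  monoidal

/-- The half braiding of a tensor product with `A`. -/
theorem delta_eq (M : Center B) : delta A M = Center.Hom.f (dl 𝐇 𝐊 M) := by
  simp only [dl, Center.comp_f, Center.rightUnitor_inv_f, Center.associator_inv_f]
  change _ = (ρ_ M.1).inv ≫ M.1 ◁ coev A ≫ (α_ M.1 A Aᘁ).inv ≫ (M.2.β A).hom ▷ Aᘁ ≫
    (α_ A M.1 Aᘁ).hom
  simp only [delta]
  monoidal

theorem phi_eq (M : Center B) :
    phi A M = Center.Hom.f (MirrorHopfObj.phi 𝐇 𝐊 M) ≫ A ◁ (α_ M.1 A Aᘁ).hom := by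
  simp only [phi, deltaA, delta_eq, MirrorHopfObj.phi, lam, rd, gm, Center.comp_f,
    Center.associator_inv_f]
  change _ = (((M.1 ◁ Δ[A] ≫ (α_ M.1 A A).inv) ≫ sigmaA A M A) ≫
    A ◁ Center.Hom.f (dl 𝐇 𝐊 (M ⊗ mirrorObj A)) ≫ (α_ A A ((M.1 ⊗ A) ⊗ Aᘁ)).inv ≫
      μ[A] ▷ ((M.1 ⊗ A) ⊗ Aᘁ)) ≫ A ◁ (α_ M.1 A Aᘁ).hom
  generalize Center.Hom.f (dl 𝐇 𝐊 (M ⊗ mirrorObj A)) = d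
  change M.1 ⊗ A ⟶ A ⊗ (M.1 ⊗ A) ⊗ Aᘁ at d
  monoidal

theorem theta_eq (M : Center B) :
    theta A M = Center.Hom.f (MirrorHopfObj.theta 𝐇 𝐊 M) ≫ A ◁ (α_ M.1 A Aᘁ).hom := by
  simp only [theta, phi_eq, MirrorHopfObj.theta, convInv, psiInv, pr, gm, Center.comp_f,
    Center.associator_inv_f, Center.whiskerLeft_f, Center.whiskerRight_f, braiding_inv_f,
    mirror_β_inv]
  change _ = ((M.1 ◁ (Δ[A] ≫ (β_ A A).inv ≫ A ◁ inv (HopfObj.antipode (X := A))) ≫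
    (α_ M.1 A A).inv) ≫ Center.Hom.f (MirrorHopfObj.phi 𝐇 𝐊 M) ▷ A ≫
      (α_ A ((M.1 ⊗ A) ⊗ Aᘁ) A).hom ≫ A ◁ (β_ ((M.1 ⊗ A) ⊗ Aᘁ) A).hom ≫
      (α_ A A ((M.1 ⊗ A) ⊗ Aᘁ)).inv ≫ μ[A] ▷ ((M.1 ⊗ A) ⊗ Aᘁ)) ≫ A ◁ (α_ M.1 A Aᘁ).hom
  generalize Center.Hom.f (MirrorHopfObj.phi 𝐇 𝐊 M) = d
  change M.1 ⊗ A ⟶ A ⊗ (M.1 ⊗ A) ⊗ Aᘁ at d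
  change 𝟙 _ ⊗≫ M.1 ◁ (Δ[A] ≫ (β_ A A).inv) ⊗≫ (M.1 ⊗ A) ◁ inv (HopfObj.antipode (X := A)) ⊗≫
    (d ≫ A ◁ (α_ M.1 A Aᘁ).hom) ▷ A ⊗≫ A ◁ (β_ (M.1 ⊗ A ⊗ Aᘁ) A).hom ⊗≫
      μ[A] ▷ (M.1 ⊗ A ⊗ Aᘁ) ⊗≫ 𝟙 _ = _
  calc _ = 𝟙 _ ⊗≫ M.1 ◁ (Δ[A] ≫ (β_ A A).inv) ⊗≫ (M.1 ⊗ A) ◁ inv (HopfObj.antipode (X := A)) ⊗≫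
        d ▷ A ⊗≫ A ◁ ((α_ M.1 A Aᘁ).hom ▷ A ≫ (β_ (M.1 ⊗ A ⊗ Aᘁ) A).hom) ⊗≫
        μ[A] ▷ (M.1 ⊗ A ⊗ Aᘁ) ⊗≫ 𝟙 _ := by monoidal
    _ = _ := by rw [BraidedCategory.braiding_naturality_left]; monoidal

theorem xi_eq (M : Center B) :
    xi A M = Center.Hom.f (MirrorHopfObj.xi 𝐇 𝐊 M) ≫ (α_ M.1 A Aᘁ).hom := by
  simp only [xi, theta_eq, MirrorHopfObj.xi, uncur, Center.comp_f, Center.associator_inv_f]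
  change _ = ((M.2.β Aᘁ).hom ▷ A ≫ (α_ Aᘁ M.1 A).hom ≫
    Aᘁ ◁ Center.Hom.f (MirrorHopfObj.theta 𝐇 𝐊 M) ≫ (α_ Aᘁ A ((M.1 ⊗ A) ⊗ Aᘁ)).inv ≫
      ev A ▷ ((M.1 ⊗ A) ⊗ Aᘁ) ≫ (λ_ _).hom) ≫ (α_ M.1 A Aᘁ).hom
  generalize Center.Hom.f (MirrorHopfObj.theta 𝐇 𝐊 M) = d
  change M.1 ⊗ A ⟶ A ⊗ (M.1 ⊗ A) ⊗ Aᘁ at d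
  change 𝟙 _ ⊗≫ (M.2.β Aᘁ).hom ▷ A ⊗≫ Aᘁ ◁ (d ≫ A ◁ (α_ M.1 A Aᘁ).hom) ⊗≫
    ev A ▷ (M.1 ⊗ A ⊗ Aᘁ) ⊗≫ 𝟙 _ = _
  monoidal

theorem doubleMul_f (M : Center B) : mul A M = (α_ (M.1 ⊗ A ⊗ Aᘁ) A Aᘁ).inv ≫
    (α_ M.1 A Aᘁ).inv ▷ A ▷ Aᘁ ≫ Center.Hom.f (doubleMul 𝐇 𝐊 M) ≫ (α_ M.1 A Aᘁ).hom := by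
  simp only [mul, xiA, xi_eq, doubleMul, freeAct, lm, rm, Center.comp_f, Center.whiskerLeft_f,
    Center.whiskerRight_f, dualMul_f, mul_f, Center.associator_hom_f]
  generalize Center.Hom.f (MirrorHopfObj.xi 𝐇 𝐊 (M ⊗ mirrorObj A)) = d
  change ((M.1 ⊗ A) ⊗ Aᘁ) ⊗ A ⟶ ((M.1 ⊗ A) ⊗ A) ⊗ Aᘁ at d
  change 𝟙 _ ⊗≫ (d ≫ (α_ (M.1 ⊗ A) A Aᘁ).hom) ▷ Aᘁ ⊗≫ M.1 ◁ μ[A] ▷ (Aᘁ ⊗ Aᘁ) ⊗≫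
    (M.1 ⊗ A) ◁ mulDual A ⊗≫ 𝟙 _ = (α_ (M.1 ⊗ A ⊗ Aᘁ) A Aᘁ).inv ≫
    (α_ M.1 A Aᘁ).inv ▷ A ▷ Aᘁ ≫ ((d ≫ ((α_ M.1 A A).hom ≫ M.1 ◁ μ[A]) ▷ Aᘁ) ▷ Aᘁ ≫
      (α_ (M.1 ⊗ A) Aᘁ Aᘁ).hom ≫ (M.1 ⊗ A) ◁ mulDual A) ≫ (α_ M.1 A Aᘁ).hom
  monoidal

theorem doubleOne_f (M : Center B) :
    one A M = Center.Hom.f (doubleOne 𝐇 𝐊 M) ≫ (α_ M.1 A Aᘁ).hom := by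
  simp only [one, doubleOne, ru, lu, Center.comp_f, Center.whiskerLeft_f, Center.rightUnitor_inv_f,
    one_f, dualOne_f]
  change 𝟙 _ ⊗≫ M.1 ◁ (η[A] ⊗ₘ unitDual A) ⊗≫ 𝟙 _ = (((ρ_ M.1).inv ≫ M.1 ◁ η[A]) ≫
    (ρ_ (M.1 ⊗ A)).inv ≫ (M.1 ⊗ A) ◁ unitDual A) ≫ (α_ M.1 A Aᘁ).hom
  rw [MonoidalCategory.tensorHom_def]
  monoidal

theorem doubleComul_f (M N : Center B) : comul A M N =
    (α_ (M.1 ⊗ N.1) A Aᘁ).inv ≫ Center.Hom.f (doubleComul 𝐇 𝐊 M N) ≫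
      ((α_ M.1 A Aᘁ).hom ⊗ₘ (α_ N.1 A Aᘁ).hom) := by
  simp only [comul, doubleComul, hst, kst, Center.comp_f, Center.whiskerLeft_f,
    Center.whiskerRight_f, dualComul_f, comul_f, Center.associator_hom_f, Center.associator_inv_f,
    braiding_inv_f, mirror_β_inv]
  change 𝟙 _ ⊗≫ (M.1 ⊗ N.1) ◁ Δ[A] ▷ Aᘁ ⊗≫ M.1 ◁ (β_ N.1 A).hom ▷ (A ⊗ Aᘁ) ⊗≫
    (M.1 ⊗ A ⊗ N.1 ⊗ A) ◁ comulDual A ⊗≫ (M.1 ⊗ A) ◁ sigmaA A N Aᘁ ▷ Aᘁ ⊗≫ 𝟙 _ =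
    (α_ (M.1 ⊗ N.1) A Aᘁ).inv ≫ (((M.1 ⊗ N.1) ◁ Δ[A] ≫ (α_ M.1 N.1 (A ⊗ A)).hom ≫
    M.1 ◁ (α_ N.1 A A).inv ≫ M.1 ◁ (β_ N.1 A).hom ▷ A ≫
    M.1 ◁ (α_ A N.1 A).hom ≫ (α_ M.1 A (N.1 ⊗ A)).inv) ▷ Aᘁ ≫ ((M.1 ⊗ A) ⊗ N.1 ⊗ A) ◁ comulDual A ≫
    (α_ (M.1 ⊗ A) (N.1 ⊗ A) (Aᘁ ⊗ Aᘁ)).hom ≫ (M.1 ⊗ A) ◁ (α_ (N.1 ⊗ A) Aᘁ Aᘁ).inv ≫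
    (M.1 ⊗ A) ◁ sigmaA A N Aᘁ ▷ Aᘁ ≫
    (M.1 ⊗ A) ◁ (α_ Aᘁ (N.1 ⊗ A) Aᘁ).hom ≫ (α_ (M.1 ⊗ A) Aᘁ ((N.1 ⊗ A) ⊗ Aᘁ)).inv) ≫
    ((α_ M.1 A Aᘁ).hom ⊗ₘ (α_ N.1 A Aᘁ).hom)
  rw [MonoidalCategory.tensorHom_def]
  generalize sigmaA A N Aᘁ = d
  monoidal

end CentralDouble

/-! ### Tensor products of coactions -/

namespace MirrorHopfObj

variable {C : Type u} [Category.{v} C] [MonoidalCategory C] [BraidedCategory C]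
  {H : C} [MirrorHopfObj H] {K : C} [ExactPairing H K]

section Coactions

theorem gam_free {M : C} (κ : M ⟶ H ⊗ M) (P : C) :
    gam κ ((α_ P H H).hom ≫ P ◁ μ[H]) = (α_ M P H).inv ≫ (β_ M P).hom ▷ H ≫ (α_ P M H).hom ≫
      P ◁ gam κ μ[H] ≫ (α_ P H M).inv := by
  simp only [gam]
  rw [BraidedCategory.braiding_tensor_right_hom]
  monoidal

/-- Hexagon identity for the half braiding of a tensor product of comodules. -/
theorem gam_coactTensor {M N P : C} (κ : M ⟶ H ⊗ M) (κ' : N ⟶ H ⊗ N) {s : P ⊗ H ⟶ P}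
    (hs : IsAction s) : gam (coactTensor κ κ') s = (α_ M N P).hom ≫ M ◁ gam κ' s ≫
      (α_ M P N).inv ≫ gam κ s ▷ N ≫ (α_ P M N).hom := by
  have h := gam_nat κ (s := (α_ P H H).hom ≫ P ◁ μ[H]) (s' := s) s (by
    rw [← hs.mul, rm])
  symm
  calc _ = 𝟙 _ ⊗≫ M ◁ (β_ N P).hom ⊗≫ M ◁ P ◁ κ' ⊗≫ (M ◁ s ≫ gam κ s) ▷ N ⊗≫ 𝟙 _ := by
        rw [gam.eq_def κ' s]; monoidal
    _ = 𝟙 _ ⊗≫ M ◁ (β_ N P).hom ⊗≫ ((M ⊗ P) ◁ κ' ≫ (β_ M P).hom ▷ (H ⊗ N)) ⊗≫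
        P ◁ gam κ μ[H] ▷ N ⊗≫ s ▷ (M ⊗ N) := by
      rw [h, gam_free]; monoidal
    _ = _ := by
      rw [whisker_exchange, gam.eq_def (coactTensor κ κ'), coactTensor,
        BraidedCategory.braiding_tensor_left_hom]; monoidal

theorem comul_actTensor : μ[H] ≫ Δ[H] = Δ[H] ▷ H ≫ actTensor μ[H] μ[H] := by
  rw [mul_comul, actTensor, hst, MonoidalCategory.tensorHom_def]
  monoidal

/-- The counit and the comultiplication are linear maps out of the regular module. Both laws follow
from naturality of `gam κ` along them, together with its values on trivial modules and on tensor
products. -/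
theorem coactTensor_isCoaction {M N : C} {κ : M ⟶ H ⊗ M} {κ' : N ⟶ H ⊗ N} (h : IsCoaction κ)
    (h' : IsCoaction κ') : IsCoaction (coactTensor κ κ') where
  counit := by
    have h₁ := gam_nat κ (s := μ[H]) (s' := 𝟙_ C ◁ ε[H] ≫ (ρ_ (𝟙_ C)).hom) ε[H] (by
      rw [mul_counit, MonoidalCategory.tensorHom_def, unitors_equal, Category.assoc])
    rw [gam_trivial h, braiding_tensorUnit_right] at h₁
    have h₂ := h'.counit
    simp only [ge] at h₂
    simp only [coactTensor, ge]
    calc _ = 𝟙 _ ⊗≫ M ◁ κ' ⊗≫ (gam κ μ[H] ≫ ε[H] ▷ M) ▷ N ⊗≫ 𝟙 _ := by monoidal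
      _ = M ◁ (κ' ≫ ε[H] ▷ N ≫ (λ_ N).hom) := by rw [← h₁]; monoidal
      _ = _ := by rw [h₂, whiskerLeft_id]
  comul := by
    have h₁ := gam_nat κ (s := μ[H]) (s' := actTensor μ[H] μ[H]) Δ[H] comul_actTensor
    rw [gam_tensor h] at h₁
    have h₂ := h'.comul
    simp only [gd] at h₂
    simp only [coactTensor, gd]
    calc _ = 𝟙 _ ⊗≫ M ◁ κ' ⊗≫ (gam κ μ[H] ≫ Δ[H] ▷ M) ▷ N ⊗≫ 𝟙 _ := by monoidal
      _ = 𝟙 _ ⊗≫ M ◁ (κ' ≫ Δ[H] ▷ N ≫ (α_ H H N).hom) ⊗≫ gam κ μ[H] ▷ (H ⊗ N) ⊗≫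
          H ◁ gam κ μ[H] ▷ N ⊗≫ 𝟙 _ := by rw [← h₁]; monoidal
      _ = 𝟙 _ ⊗≫ M ◁ κ' ⊗≫ ((M ⊗ H) ◁ κ' ≫ gam κ μ[H] ▷ (H ⊗ N)) ⊗≫
          H ◁ gam κ μ[H] ▷ N ⊗≫ 𝟙 _ := by rw [h₂]; monoidal
      _ = _ := by rw [whisker_exchange]; monoidal

/-- This is the hexagon `gam_coactTensor` for the regular module. -/
theorem coactTensor_assoc {M N P : C} (κ : M ⟶ H ⊗ M) (κ' : N ⟶ H ⊗ N) (κ'' : P ⟶ H ⊗ P) :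
    coactTensor (coactTensor κ κ') κ'' ≫ H ◁ (α_ M N P).hom =
      (α_ M N P).hom ≫ coactTensor κ (coactTensor κ' κ'') := by
  rw [coactTensor, gam_coactTensor κ κ' (mul_isAction H), coactTensor, coactTensor]
  monoidal

theorem gam_gu {N : C} {s : N ⊗ H ⟶ N} (hs : IsAction s) :
    gam (gu H (𝟙_ C)) s = (β_ (𝟙_ C) N).hom := by
  have h := hs.one
  rw [ru] at h
  rw [gam]
  calc _ = (β_ (𝟙_ C) N).hom ≫ ((ρ_ N).inv ≫ N ◁ η[H] ≫ s) ▷ 𝟙_ C := by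
        rw [gu, unitors_inv_equal]; monoidal
    _ = _ := by rw [← Category.assoc (ρ_ N).inv, h, id_whiskerRight, Category.comp_id]

theorem coactTensor_leftUnitor {M : C} (κ : M ⟶ H ⊗ M) :
    coactTensor (gu H (𝟙_ C)) κ ≫ H ◁ (λ_ M).hom = (λ_ M).hom ≫ κ := by
  rw [coactTensor, gam_gu (mul_isAction H), braiding_tensorUnit_left]
  monoidal

theorem coactTensor_rightUnitor {M : C} (κ : M ⟶ H ⊗ M) :
    coactTensor κ (gu H (𝟙_ C)) ≫ H ◁ (ρ_ M).hom = (ρ_ M).hom ≫ κ := by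
  have h := ru_gam κ
  rw [ru] at h
  rw [coactTensor, gu]
  calc _ = (ρ_ M).hom ≫ ((ρ_ M).inv ≫ M ◁ η[H]) ≫ gam κ μ[H] := by monoidal
    _ = _ := by rw [h]

variable (H) in
theorem gu_isCoaction : IsCoaction (gu H (𝟙_ C)) where
  counit := by
    rw [gu, ge, Category.assoc, ← comp_whiskerRight_assoc, one_counit]; simp
  comul := by
    rw [gu, gd]
    calc _ = 𝟙 _ ⊗≫ (η[H] ≫ Δ[H]) ▷ 𝟙_ C ⊗≫ 𝟙 _ := by monoidal
      _ = 𝟙 _ ⊗≫ (η[H] ▷ 𝟙_ C ≫ H ◁ η[H]) ▷ 𝟙_ C ⊗≫ 𝟙 _ := by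
        rw [one_comul, MonoidalCategory.tensorHom_def]; monoidal
      _ = _ := by monoidal

/-- The half braiding of Yetter-Drinfeld structures is colinear. -/
theorem gam_colinear {M N : C} {κ : M ⟶ H ⊗ M} (hκ : IsCoaction κ) {s : N ⊗ H ⟶ N}
    {κ' : N ⟶ H ⊗ N} (h : IsYetterDrinfeld s κ') :
    coactTensor κ κ' ≫ H ◁ gam κ s = gam κ s ≫ coactTensor κ' κ := by
  -- By the Yetter-Drinfeld condition, the half braiding of `N` with the regular module is itself
  -- linear, so `gam κ` is natural along it. Evaluating the regular factor at the unit then produces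
  -- the coactions.
  have h₁ := gam_nat κ (gam κ' μ[H]) (h.linear (mul_isAction H))
  rw [gam_tensor hκ, gam_tensor hκ] at h₁
  have h₂ := ru_gam κ'
  have h₃ := ru_gam κ
  simp only [ru] at h₂ h₃
  calc _ = 𝟙 _ ⊗≫ M ◁ (((ρ_ N).inv ≫ N ◁ η[H]) ≫ gam κ' μ[H]) ⊗≫ gam κ μ[H] ▷ N ⊗≫
        H ◁ gam κ s ⊗≫ 𝟙 _ := by rw [h₂, coactTensor]; monoidal
    _ = 𝟙 _ ⊗≫ M ◁ N ◁ η[H] ⊗≫ (M ◁ gam κ' μ[H] ≫ (α_ M H N).inv ≫ gam κ μ[H] ▷ N ≫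
        (α_ H M N).hom ≫ H ◁ gam κ s ≫ (α_ H N M).inv) ⊗≫ 𝟙 _ := by monoidal
    _ = 𝟙 _ ⊗≫ ((M ⊗ N) ◁ η[H] ≫ gam κ s ▷ H) ⊗≫ N ◁ gam κ μ[H] ⊗≫ gam κ' μ[H] ▷ M ⊗≫ 𝟙 _ := by
      rw [h₁]; monoidal
    _ = gam κ s ⊗≫ N ◁ (((ρ_ M).inv ≫ M ◁ η[H]) ≫ gam κ μ[H]) ⊗≫ gam κ' μ[H] ▷ M ⊗≫ 𝟙 _ := by
      rw [whisker_exchange]; monoidal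
    _ = _ := by rw [h₃, coactTensor]; monoidal

theorem linear_whiskerLeft {M N N' : C} (r : M ⊗ H ⟶ M) {s : N ⊗ H ⟶ N} {s' : N' ⊗ H ⟶ N'}
    {f : N ⟶ N'} (hf : s ≫ f = f ▷ H ≫ s') :
    actTensor r s ≫ M ◁ f = (M ◁ f) ▷ H ≫ actTensor r s' := by
  rw [← id_tensorHom, actTensor, actTensor, reassoc_of% hst_nat, Category.assoc,
    tensorHom_comp_tensorHom, tensorHom_comp_tensorHom, hf]
  simp

theorem linear_whiskerRight {M M' N : C} {r : M ⊗ H ⟶ M} {r' : M' ⊗ H ⟶ M'} (s : N ⊗ H ⟶ N)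
    {f : M ⟶ M'} (hf : r ≫ f = f ▷ H ≫ r') :
    actTensor r s ≫ f ▷ N = (f ▷ N) ▷ H ≫ actTensor r' s := by
  rw [← tensorHom_id, actTensor, actTensor, reassoc_of% hst_nat, Category.assoc,
    tensorHom_comp_tensorHom, tensorHom_comp_tensorHom, hf]
  simp

theorem linear_inv {M N : C} {r : M ⊗ H ⟶ M} {s : N ⊗ H ⟶ N} {f : M ≅ N}
    (hf : r ≫ f.hom = f.hom ▷ H ≫ s) : s ≫ f.inv = f.inv ▷ H ≫ r := by
  rw [Iso.comp_inv_eq, Category.assoc, hf, ← comp_whiskerRight_assoc, Iso.inv_hom_id]; simp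

theorem linear_comp {M N P : C} {r : M ⊗ H ⟶ M} {s : N ⊗ H ⟶ N} {t : P ⊗ H ⟶ P} {f : M ⟶ N}
    {g : N ⟶ P} (hf : r ≫ f = f ▷ H ≫ s) (hg : s ≫ g = g ▷ H ≫ t) :
    r ≫ f ≫ g = (f ≫ g) ▷ H ≫ t := by
  rw [reassoc_of% hf, hg, comp_whiskerRight, Category.assoc]

end Coactions

end MirrorHopfObj

/-! ### Tensor products of Yetter-Drinfeld modules in the centre -/

namespace CentralDouble

variable {B : Type u} [Category.{v} B] [MonoidalCategory B] [BraidedCategory B]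
  {A : B} [HopfObj A] [IsIso (HopfObj.antipode (X := A))]

open MirrorHopfObj

section Modules

/-- An action of the mirror object of `A` on `M` as a right `A`-module. -/
def toModule {M : Center B} (r : M ⊗ mirrorObj A ⟶ M) (hr : IsAction r) : RightModule A where
  X := M.1
  act := r.f
  act_one := by
    have h := congrArg Center.Hom.f hr.one
    rw [ru, Center.comp_f, Center.comp_f, Center.rightUnitor_inv_f] at h
    exact (Iso.inv_comp_eq _).1 ((Category.assoc _ _ _).symm.trans h)|>.trans (Category.comp_id _)
  act_mul := by
    have h := congrArg Center.Hom.f hr.mul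
    exact (Iso.eq_inv_comp _).2 ((Category.assoc _ _ _).symm.trans h)

/-- A right `A`-module as an action on a mirror object. -/
def mirrorAct (N : RightModule A) : mirrorObj N.X ⊗ mirrorObj A ⟶ mirrorObj N.X := mirrorMul N.act

theorem mirrorAct_isAction (N : RightModule A) : IsAction (mirrorAct N) where
  one := by
    apply Center.ext
    rw [ru, Center.comp_f, Center.comp_f, Center.rightUnitor_inv_f]
    exact (Category.assoc _ _ _).trans ((Iso.inv_comp_eq _).2
      (N.act_one.trans (Category.comp_id _).symm))
  mul := Center.ext _ _ ((Category.assoc _ _ _).trans ((Iso.eq_inv_comp _).1 N.act_mul))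

theorem actTensor_f {M N : Center B} (r : M ⊗ mirrorObj A ⟶ M) (s : N ⊗ mirrorObj A ⟶ N) :
    (actTensor r s).f = (M.1 ⊗ N.1) ◁ Δ[A] ≫ tensorμ M.1 N.1 A A ≫ (r.f ⊗ₘ s.f) := by
  simp only [actTensor, hst, Center.comp_f, Center.associator_inv_f, Center.whiskerLeft_f,
    Center.whiskerRight_f, braiding_inv_f, mirror_β_inv, tensorμ, Category.assoc]
  rfl

theorem gam_f {M N : Center B} (κ : M ⟶ mirrorObj A ⊗ M) (s : N ⊗ mirrorObj A ⟶ N) :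
    (gam κ s).f = (M.2.β N.1).hom ≫ N.1 ◁ κ.f ≫ (α_ N.1 A M.1).inv ≫ s.f ▷ M.1 := by
  simp only [gam, Center.comp_f, Center.associator_inv_f]
  rfl

theorem toModule_tensor_act {M N : Center B} {r : M ⊗ mirrorObj A ⟶ M} (hr : IsAction r)
    {s : N ⊗ mirrorObj A ⟶ N} (hs : IsAction s) :
    (toModule r hr ⊗ toModule s hs).act = (actTensor r s).f :=
  (actTensor_f r s).symm

/-- On underlying morphisms `actTensor` is the tensor product of right `A`-modules in `B`, and the
centre is faithful over `B`. The module laws and the linearity of the coherence isomorphisms are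
therefore inherited from `RightModule A`. -/
theorem actTensor_isAction {M N : Center B} {r : M ⊗ mirrorObj A ⟶ M} (hr : IsAction r)
    {s : N ⊗ mirrorObj A ⟶ N} (hs : IsAction s) : IsAction (actTensor r s) where
  one := by
    apply Center.ext
    rw [ru, Center.comp_f, Center.comp_f, Center.rightUnitor_inv_f, actTensor_f]
    exact (Category.assoc _ _ _).trans ((Iso.inv_comp_eq _).2
      ((toModule r hr ⊗ toModule s hs).act_one.trans (Category.comp_id _).symm))
  mul := by
    apply Center.ext
    simp only [Center.comp_f, rm, Center.whiskerRight_f, actTensor_f]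
    exact ((Category.assoc _ _ _).trans ((Iso.eq_inv_comp _).1
      (toModule r hr ⊗ toModule s hs).act_mul))

theorem actTensor_associator {M N P : Center B} {r : M ⊗ mirrorObj A ⟶ M} (hr : IsAction r)
    {s : N ⊗ mirrorObj A ⟶ N} (hs : IsAction s) {t : P ⊗ mirrorObj A ⟶ P} (ht : IsAction t) :
    actTensor (actTensor r s) t ≫ (α_ M N P).hom =
      (α_ M N P).hom ▷ mirrorObj A ≫ actTensor r (actTensor s t) := by
  apply Center.ext
  simp only [Center.comp_f, Center.whiskerRight_f, actTensor_f]
  exact (α_ (toModule r hr) (toModule s hs) (toModule t ht)).hom.comm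

variable (A) in
/-- The action of the mirror object of `A` on the unit object. -/
def unitAct : 𝟙_ (Center B) ⊗ mirrorObj A ⟶ 𝟙_ (Center B) :=
  𝟙_ (Center B) ◁ ε[mirrorObj A] ≫ (ρ_ (𝟙_ (Center B))).hom

variable (A) in
theorem unitAct_isAction : IsAction (unitAct A) where
  one := by
    apply Center.ext
    rw [ru, Center.comp_f, Center.comp_f, Center.rightUnitor_inv_f]
    exact (Category.assoc _ _ _).trans ((Iso.inv_comp_eq _).2
      ((𝟙_ (RightModule A)).act_one.trans (Category.comp_id _).symm))
  mul := Center.ext _ _ ((Category.assoc _ _ _).trans ((Iso.eq_inv_comp _).1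
      (𝟙_ (RightModule A)).act_mul))

theorem actTensor_leftUnitor {M : Center B} {r : M ⊗ mirrorObj A ⟶ M} (hr : IsAction r) :
    actTensor (unitAct A) r ≫ (λ_ M).hom = (λ_ M).hom ▷ mirrorObj A ≫ r := by
  apply Center.ext
  simp only [Center.comp_f, Center.whiskerRight_f, actTensor_f]
  exact (λ_ (toModule r hr)).hom.comm

theorem actTensor_rightUnitor {M : Center B} {r : M ⊗ mirrorObj A ⟶ M} (hr : IsAction r) :
    actTensor r (unitAct A) ≫ (ρ_ M).hom = (ρ_ M).hom ▷ mirrorObj A ≫ r := by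
  apply Center.ext
  simp only [Center.comp_f, Center.whiskerRight_f, actTensor_f]
  exact (ρ_ (toModule r hr)).hom.comm

/-- Linearity with the regular module is enough, and the hexagon writes the half braiding of the
tensor product as a composite of linear maps. -/
theorem tensor_isYetterDrinfeldModule {M N : Center B} {r : M ⊗ mirrorObj A ⟶ M}
    {κ : M ⟶ mirrorObj A ⊗ M} (h : IsYetterDrinfeldModule r κ) {s : N ⊗ mirrorObj A ⟶ N}
    {κ' : N ⟶ mirrorObj A ⊗ N} (h' : IsYetterDrinfeldModule s κ') :
    IsYetterDrinfeldModule (actTensor r s) (coactTensor κ κ') where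
  action := actTensor_isAction h.action h'.action
  coaction := coactTensor_isCoaction h.coaction h'.coaction
  compat := by
    have hm := mul_isAction (mirrorObj A)
    apply isYetterDrinfeld_of_linear
    rw [gam_coactTensor κ κ' hm]
    exact linear_comp (actTensor_associator h.action h'.action hm)
      (linear_comp (linear_whiskerLeft r (h'.compat.linear hm))
        (linear_comp (linear_inv (actTensor_associator h.action hm h'.action))
          (linear_comp (linear_whiskerRight s (h.compat.linear hm))
            (actTensor_associator hm h.action h'.action))))

variable (A) in
theorem unit_isYetterDrinfeldModule :
    IsYetterDrinfeldModule (unitAct A) (gu (mirrorObj A) (𝟙_ (Center B))) where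
  action := unitAct_isAction A
  coaction := gu_isCoaction _
  compat := by
    have hm := mul_isAction (mirrorObj A)
    apply isYetterDrinfeld_of_linear
    rw [gam_gu hm, braiding_tensorUnit_left]
    exact linear_comp (actTensor_leftUnitor hm) (linear_inv (actTensor_rightUnitor hm))

end Modules

end CentralDouble

/-! ### Double actions and the universal braiding -/

namespace MirrorHopfObj

variable {C : Type u} [Category.{v} C] [MonoidalCategory C] [BraidedCategory C]
  {H : C} [MirrorHopfObj H] {K : C} [ExactPairing H K]

section DoubleActions

theorem whiskerRight_whiskerRight_comp {M N P : C} (f : M ⟶ N) (g : N ⟶ P) (X Y : C) :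
    f ▷ X ▷ Y ≫ g ▷ X ▷ Y = (f ≫ g) ▷ X ▷ Y := by
  rw [comp_whiskerRight, comp_whiskerRight]

variable (K) in
/-- The double action defined by an action and a coaction. -/
def doubleAct {M : C} (r : M ⊗ H ⟶ M) (κ : M ⟶ H ⊗ M) : (M ⊗ H) ⊗ K ⟶ M := r ▷ K ≫ unc H K κ

theorem IsYetterDrinfeldModule.doubleAct {M : C} {r : M ⊗ H ⟶ M} {κ : M ⟶ H ⊗ M}
    (h : IsYetterDrinfeldModule r κ) : IsDoubleAction (doubleAct K r κ) :=
  IsYetterDrinfeldModule.isDoubleAction (by rwa [tr_unc])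

theorem lu_doubleAct {M : C} (r : M ⊗ H ⟶ M) {κ : M ⟶ H ⊗ M} (h : IsCoaction κ) :
    lu H K (M ⊗ H) ≫ doubleAct K r κ = r := by
  rw [doubleAct, ← reassoc_of% lu_nat, lu_comp, tr_unc, h.counit, Category.comp_id]

theorem tr_ru_doubleAct {M : C} {r : M ⊗ H ⟶ M} (h : IsAction r) (κ : M ⟶ H ⊗ M) :
    tr (ru H M ▷ K ≫ doubleAct K r κ) = κ := by
  rw [doubleAct, ← comp_whiskerRight_assoc, h.one, id_whiskerRight, Category.id_comp, tr_unc]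

theorem IsDoubleAction.doubleAct {M : C} {ρ : (M ⊗ H) ⊗ K ⟶ M} (h : IsDoubleAction ρ) :
    doubleAct K (lu H K (M ⊗ H) ≫ ρ) (tr (ru H M ▷ K ≫ ρ)) = ρ := by
  rw [MirrorHopfObj.doubleAct, unc_tr, h.decomp]

theorem unc_comp {M N N' : C} (g : M ⟶ H ⊗ N) (f : N ⟶ N') :
    unc H K g ≫ f = unc H K (g ≫ H ◁ f) := by
  apply tr_injective (H := H)
  rw [tr_comp, tr_unc, tr_unc]

theorem comp_unc {M M' N : C} (g : M ⟶ H ⊗ N) (f : M' ⟶ M) :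
    f ▷ K ≫ unc H K g = unc H K (f ≫ g) := by
  apply tr_injective (H := H)
  rw [comp_tr, tr_unc, tr_unc]

theorem doubleAct_comp {M N : C} {r : M ⊗ H ⟶ M} {κ : M ⟶ H ⊗ M} {s : N ⊗ H ⟶ N}
    {κ' : N ⟶ H ⊗ N} {f : M ⟶ N} (hf : r ≫ f = f ▷ H ≫ s) (hf' : κ ≫ H ◁ f = f ≫ κ') :
    doubleAct K r κ ≫ f = f ▷ H ▷ K ≫ doubleAct K s κ' := by
  rw [doubleAct, doubleAct, Category.assoc, unc_comp, hf', ← comp_unc, ← comp_whiskerRight_assoc,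
    ← comp_whiskerRight_assoc, hf]

theorem doubleComul_doubleAct {M N : C} (r : M ⊗ H ⟶ M) (κ : M ⟶ H ⊗ M) (s : N ⊗ H ⟶ N)
    (κ' : N ⟶ H ⊗ N) : doubleComul H K M N ≫ (doubleAct K r κ ⊗ₘ doubleAct K s κ') =
      doubleAct K (actTensor r s) (coactTensor κ κ') := by
  rw [doubleAct, doubleAct, doubleComul_tensor, tr_unc, tr_unc, doubleAct]

variable (H K) in
/-- The universal braiding of double modules. -/
def doubleR (M N : C) : M ⊗ N ⟶ ((N ⊗ H) ⊗ K) ⊗ (M ⊗ H) ⊗ K :=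
  (ρ_ (M ⊗ N)).inv ≫ (M ⊗ N) ◁ η_ H K ≫ (α_ (M ⊗ N) H K).inv ≫ (α_ M N H).hom ▷ K ≫
    (β_ M (N ⊗ H)).hom ▷ K ≫ (α_ (N ⊗ H) M K).hom ≫ (lu H K (N ⊗ H) ⊗ₘ ru H M ▷ K)

theorem doubleR_nat {M M' N N' : C} (f : M ⟶ M') (g : N ⟶ N') :
    (f ⊗ₘ g) ≫ doubleR H K M' N' = doubleR H K M N ≫ (g ▷ H ▷ K ⊗ₘ f ▷ H ▷ K) := by
  simp only [doubleR, Category.assoc]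
  rw [tensorHom_comp_tensorHom, ← comp_whiskerRight, ← ru_nat, ← lu_nat, comp_whiskerRight,
    ← tensorHom_comp_tensorHom, rightUnitor_inv_naturality_assoc, ← whisker_exchange_assoc,
    associator_inv_naturality_left_assoc, ← comp_whiskerRight_assoc, ← tensorHom_id (f ⊗ₘ g) H,
    associator_naturality, comp_whiskerRight_assoc, tensorHom_id,
    ← comp_whiskerRight_assoc (f ⊗ₘ g ▷ H), BraidedCategory.braiding_naturality,
    comp_whiskerRight_assoc, ← tensorHom_id (g ▷ H ⊗ₘ f) K, associator_naturality_assoc,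
    tensorHom_id]

/-- The units in `doubleR` extract the coaction from `α` and the action from `β`, so `doubleR`
induces the half braiding `gam` on all modules. -/
theorem doubleR_comp {M N : C} (α : (M ⊗ H) ⊗ K ⟶ M) (β : (N ⊗ H) ⊗ K ⟶ N) :
    doubleR H K M N ≫ (β ⊗ₘ α) = gam (tr (ru H M ▷ K ≫ α)) (lu H K (N ⊗ H) ≫ β) := by
  rw [gam_tr, ← tensorHom_comp_tensorHom, doubleR]
  monoidal

theorem unc_gu : unc H K (gu H (𝟙_ C)) = (λ_ K).hom ≫ (ρ_ K).inv ≫ K ◁ η[H] ≫ ε_ H K := by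
  rw [unc, gu, braiding_tensorUnit_left]
  calc _ = (λ_ K).hom ≫ 𝟙 _ ⊗≫ K ◁ η[H] ▷ 𝟙_ C ⊗≫ ε_ H K ▷ 𝟙_ C ⊗≫ 𝟙 _ := by monoidal
    _ = _ := by monoidal

end DoubleActions

end MirrorHopfObj

/-! ### The monad on the centre -/

namespace CentralDouble

variable {B : Type u} [Category.{v} B] [MonoidalCategory B] [BraidedCategory B] [RigidCategory B]
  (A : B)

open MirrorHopfObj

local notation "𝐇" => mirrorObj A
local notation "𝐊" => mirrorObj (Aᘁ)

section Comparison

theorem mirrorMul_comp_mirrorComul (X Y : B) :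
    mirrorMul (𝟙 (X ⊗ Y)) ≫ mirrorComul (𝟙 (X ⊗ Y)) = 𝟙 (mirrorObj X ⊗ mirrorObj Y) :=
  Center.ext _ _ (Category.comp_id _)

theorem mirrorComul_comp_mirrorMul (X Y : B) :
    mirrorComul (𝟙 (X ⊗ Y)) ≫ mirrorMul (𝟙 (X ⊗ Y)) = 𝟙 (mirrorObj (X ⊗ Y)) :=
  Center.ext _ _ (Category.comp_id _)

/-- The object `M ⊗ A ⊗ ᵛA` as an iterated tensor product in the center. -/
def mirrorTensorIso (M : Center B) : (M ⊗ 𝐇) ⊗ 𝐊 ≅ M ⊗ mirrorObj (A ⊗ Aᘁ) where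
  hom := (α_ M 𝐇 𝐊).hom ≫ M ◁ mirrorMul (𝟙 (A ⊗ Aᘁ))
  inv := M ◁ mirrorComul (𝟙 (A ⊗ Aᘁ)) ≫ (α_ M 𝐇 𝐊).inv
  hom_inv_id := by
    rw [Category.assoc, ← whiskerLeft_comp_assoc, mirrorMul_comp_mirrorComul]; simp
  inv_hom_id := by
    rw [Category.assoc, Iso.inv_hom_id_assoc, ← whiskerLeft_comp, mirrorComul_comp_mirrorMul,
      whiskerLeft_id]

theorem mirrorTensorIso_nat {M N : Center B} (f : M ⟶ N) : f ▷ 𝐇 ▷ 𝐊 ≫ (mirrorTensorIso A N).hom =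
    (mirrorTensorIso A M).hom ≫ f ▷ mirrorObj (A ⊗ Aᘁ) := by
  simp only [mirrorTensorIso]
  rw [associator_naturality_left_assoc, ← whisker_exchange, Category.assoc]

theorem mirrorTensorIso_inv_f (M : Center B) :
    (mirrorTensorIso A M).inv.f = (α_ M.1 A Aᘁ).inv := by
  simp only [mirrorTensorIso, Center.comp_f, Center.associator_inv_f]
  exact (congrArg (· ≫ (α_ M.1 A Aᘁ).inv) (whiskerLeft_id M.1 (A ⊗ Aᘁ))).trans (Category.id_comp _)

/-- The functor `d_A` as an iterated tensor product in the center. -/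
def dAIso (M : Center B) : (M ⊗ 𝐇) ⊗ 𝐊 ≅ (dA A).obj M := mirrorTensorIso A M

theorem dAIso_hom_f (M : Center B) : (dAIso A M).hom.f = (α_ M.1 A Aᘁ).hom :=
  (congrArg ((α_ M.1 A Aᘁ).hom ≫ ·) (whiskerLeft_id M.1 (A ⊗ Aᘁ))).trans (Category.comp_id _)

theorem dAIso_inv_f (M : Center B) : (dAIso A M).inv.f = (α_ M.1 A Aᘁ).inv :=
  mirrorTensorIso_inv_f A M

theorem dAIso_hom_nat {M N : Center B} (f : M ⟶ N) :
    f ▷ 𝐇 ▷ 𝐊 ≫ (dAIso A N).hom = (dAIso A M).hom ≫ (dA A).map f := mirrorTensorIso_nat A f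

theorem dAIso_inv_nat {M N : Center B} (f : M ⟶ N) :
    (dA A).map f ≫ (dAIso A N).inv = (dAIso A M).inv ≫ f ▷ 𝐇 ▷ 𝐊 := by
  rw [Iso.comp_inv_eq, Category.assoc, dAIso_hom_nat, Iso.inv_hom_id_assoc]

end Comparison

variable [HopfObj A] [IsIso (HopfObj.antipode (X := A))]

section MonadStructure

/-- The unit of the central double. -/
def dAOne (M : Center B) : M ⟶ (dA A).obj M := doubleOne 𝐇 𝐊 M ≫ (dAIso A M).hom

/-- The product of the central double. -/
def dAMul (M : Center B) : (dA A).obj ((dA A).obj M) ⟶ (dA A).obj M :=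
  (dAIso A _).inv ≫ (dAIso A M).inv ▷ 𝐇 ▷ 𝐊 ≫ doubleMul 𝐇 𝐊 M ≫ (dAIso A M).hom

variable {A}

theorem dAMul_comp {M : Center B} {α : (dA A).obj M ⟶ M}
    (h : IsDoubleAction ((dAIso A M).hom ≫ α)) : dAMul A M ≫ α = (dA A).map α ≫ α := by
  rw [dAMul, Category.assoc, Category.assoc, Category.assoc, h.mul,
    reassoc_of% whiskerRight_whiskerRight_comp, Iso.inv_hom_id_assoc, reassoc_of% dAIso_hom_nat,
    Iso.inv_hom_id_assoc]

theorem isDoubleAction_iff {M : Center B} (α : (dA A).obj M ⟶ M) :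
    IsDoubleAction ((dAIso A M).hom ≫ α) ↔
      dAOne A M ≫ α = 𝟙 M ∧ dAMul A M ≫ α = (dA A).map α ≫ α := by
  constructor
  · exact fun h => ⟨by rw [dAOne, Category.assoc, h.one], dAMul_comp h⟩
  · rintro ⟨h₁, h₂⟩
    refine ⟨by rw [← h₁, dAOne, Category.assoc], ?_⟩
    have h₃ := congrArg ((dAIso A M).hom ▷ 𝐇 ▷ 𝐊 ≫ (dAIso A _).hom ≫ ·) h₂
    simp only [dAMul, Category.assoc, Iso.hom_inv_id_assoc] at h₃
    rw [reassoc_of% whiskerRight_whiskerRight_comp, Iso.hom_inv_id, id_whiskerRight,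
      id_whiskerRight, Category.id_comp, ← reassoc_of% dAIso_hom_nat,
      reassoc_of% whiskerRight_whiskerRight_comp] at h₃
    exact h₃

theorem dAMul_isDoubleAction (M : Center B) : IsDoubleAction
    ((dAIso A ((dA A).obj M)).hom ≫ dAMul A M) := by
  have h := doubleMul_isDoubleAction 𝐇 𝐊 M
  constructor
  · rw [dAMul, Iso.hom_inv_id_assoc, ← reassoc_of% doubleOne_nat, reassoc_of% h.one, Iso.inv_hom_id]
  · simp only [dAMul, Iso.hom_inv_id_assoc]
    rw [← reassoc_of% doubleMul_nat, reassoc_of% h.mul]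
    simp only [← whiskerRight_whiskerRight_comp, Category.assoc]
    rw [reassoc_of% (whiskerRight_whiskerRight_comp (dAIso A M).hom), Iso.hom_inv_id,
      id_whiskerRight, id_whiskerRight, Category.id_comp]

variable (A)

/-- The monad structure of the central double. -/
def monadStructure : MonadStructureOn (dA A) where
  one :=
    { app := dAOne A
      naturality := fun M N f => by
        change f ≫ dAOne A N = dAOne A M ≫ (dA A).map f
        rw [dAOne, dAOne, reassoc_of% doubleOne_nat, Category.assoc, dAIso_hom_nat] }
  mul :=
    { app := dAMul A
      naturality := fun M N f => by
        simp only [Functor.comp_map, dAMul, Category.assoc]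
        rw [reassoc_of% dAIso_inv_nat, reassoc_of% whiskerRight_whiskerRight_comp, dAIso_inv_nat,
          ← reassoc_of% whiskerRight_whiskerRight_comp, reassoc_of% doubleMul_nat, dAIso_hom_nat] }
  -- Associativity and the left unit law say that the product is a module structure on the free
  -- object; only the right unit law needs a computation.
  assoc M := (dAMul_comp (dAMul_isDoubleAction M)).symm
  left_unit M := ((isDoubleAction_iff _).1 (dAMul_isDoubleAction M)).1
  right_unit M := by
    change (dA A).map (dAOne A M) ≫ dAMul A M = 𝟙 ((dA A).obj M)
    rw [dAMul, reassoc_of% dAIso_inv_nat, reassoc_of% whiskerRight_whiskerRight_comp, dAOne,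
      Category.assoc, Iso.hom_inv_id, Category.comp_id, reassoc_of% doubleOne_doubleMul,
        Iso.inv_hom_id]

theorem dAMul_f (M : Center B) : (dAMul A M).f = mul A M := by
  rw [doubleMul_f, dAMul]
  simp only [Center.comp_f, Center.whiskerRight_f, dAIso_hom_f, dAIso_inv_f]
  rfl

theorem dAOne_f (M : Center B) : (dAOne A M).f = one A M := by
  rw [doubleOne_f, dAOne]
  simp only [Center.comp_f, dAIso_hom_f]
  rfl

end MonadStructure

end CentralDouble

/-! ### Tensor product and braiding of modules over the central double -/

namespace CentralDouble

variable {B : Type u} [Category.{v} B] [MonoidalCategory B] [BraidedCategory B] [RigidCategory B]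
  (A : B) [HopfObj A] [IsIso (HopfObj.antipode (X := A))]

open MirrorHopfObj

local notation "𝐇" => mirrorObj A
local notation "𝐊" => mirrorObj (Aᘁ)

section Algebras

/-- The monad of the central double. -/
abbrev monad : Monad (Center B) := (monadStructure A).toMonad

variable {A}

/-- The structure morphism of a module over the central double. -/
def strMap (P : (monad A).Algebra) : (dA A).obj P.A ⟶ P.A := P.a

/-- The action of `A` underlying a module over the central double. -/
def actionMap {M : Center B} (α : (dA A).obj M ⟶ M) : M ⊗ 𝐇 ⟶ M :=
  lu 𝐇 𝐊 (M ⊗ 𝐇) ≫ (dAIso A M).hom ≫ α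

/-- The coaction of `A` underlying a module over the central double. -/
def coactionMap {M : Center B} (α : (dA A).obj M ⟶ M) : M ⟶ 𝐇 ⊗ M :=
  tr (ru 𝐇 M ▷ 𝐊 ≫ (dAIso A M).hom ≫ α)

/-- The module over the central double defined by an action and a coaction. -/
def moduleMap {M : Center B} (r : M ⊗ 𝐇 ⟶ M) (κ : M ⟶ 𝐇 ⊗ M) : (dA A).obj M ⟶ M :=
  (dAIso A M).inv ≫ doubleAct 𝐊 r κ

theorem algebra_isDoubleAction (P : (monad A).Algebra) :
    IsDoubleAction ((dAIso A P.A).hom ≫ strMap P) :=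
  (isDoubleAction_iff _).2 ⟨P.unit, P.assoc⟩

theorem algebra_isYetterDrinfeldModule (P : (monad A).Algebra) :
    IsYetterDrinfeldModule (actionMap (strMap P)) (coactionMap (strMap P)) :=
  (algebra_isDoubleAction P).isYetterDrinfeldModule

theorem moduleMap_algebra (P : (monad A).Algebra) :
    moduleMap (actionMap (strMap P)) (coactionMap (strMap P)) = strMap P := by
  rw [moduleMap, actionMap, coactionMap, (algebra_isDoubleAction P).doubleAct,
    Iso.inv_hom_id_assoc]

theorem actionMap_moduleMap {M : Center B} (r : M ⊗ 𝐇 ⟶ M) {κ : M ⟶ 𝐇 ⊗ M} (h : IsCoaction κ) :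
    actionMap (moduleMap r κ) = r := by
  rw [actionMap, moduleMap, Iso.hom_inv_id_assoc, lu_doubleAct r h]

theorem coactionMap_moduleMap {M : Center B} {r : M ⊗ 𝐇 ⟶ M} (h : IsAction r) (κ : M ⟶ 𝐇 ⊗ M) :
    coactionMap (moduleMap r κ) = κ := by
  rw [coactionMap, moduleMap, Iso.hom_inv_id_assoc, tr_ru_doubleAct h]

theorem moduleMap_laws {M : Center B} {r : M ⊗ 𝐇 ⟶ M} {κ : M ⟶ 𝐇 ⊗ M}
    (h : IsYetterDrinfeldModule r κ) : dAOne A M ≫ moduleMap r κ = 𝟙 M ∧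
      dAMul A M ≫ moduleMap r κ = (dA A).map (moduleMap r κ) ≫ moduleMap r κ := by
  apply (isDoubleAction_iff _).1
  rw [moduleMap, Iso.hom_inv_id_assoc]
  exact h.doubleAct

/-- A Yetter-Drinfeld module as a module over the central double. -/
def algebraOf {M : Center B} {r : M ⊗ 𝐇 ⟶ M} {κ : M ⟶ 𝐇 ⊗ M}
    (h : IsYetterDrinfeldModule r κ) : (monad A).Algebra where
  A := M
  a := moduleMap r κ
  unit := (moduleMap_laws h).1
  assoc := (moduleMap_laws h).2

theorem moduleMap_comp {M N : Center B} {r : M ⊗ 𝐇 ⟶ M} {κ : M ⟶ 𝐇 ⊗ M} {s : N ⊗ 𝐇 ⟶ N}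
    {κ' : N ⟶ 𝐇 ⊗ N} {f : M ⟶ N} (hf : r ≫ f = f ▷ 𝐇 ≫ s) (hf' : κ ≫ 𝐇 ◁ f = f ≫ κ') :
    (dA A).map f ≫ moduleMap s κ' = moduleMap r κ ≫ f := by
  rw [moduleMap, moduleMap, Category.assoc, doubleAct_comp hf hf', reassoc_of% dAIso_inv_nat]

theorem actionMap_comp {M N : Center B} {α : (dA A).obj M ⟶ M} {β : (dA A).obj N ⟶ N} {f : M ⟶ N}
    (hf : (dA A).map f ≫ β = α ≫ f) : actionMap α ≫ f = f ▷ 𝐇 ≫ actionMap β := by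
  rw [actionMap, actionMap, Category.assoc, Category.assoc, ← hf, reassoc_of% (lu_nat (f ▷ 𝐇)),
    reassoc_of% dAIso_hom_nat]

theorem coactionMap_comp {M N : Center B} {α : (dA A).obj M ⟶ M} {β : (dA A).obj N ⟶ N}
    {f : M ⟶ N} (hf : (dA A).map f ≫ β = α ≫ f) :
    coactionMap α ≫ 𝐇 ◁ f = f ≫ coactionMap β := by
  rw [coactionMap, coactionMap, ← tr_comp, ← comp_tr, ← comp_whiskerRight_assoc, ru_nat,
    comp_whiskerRight_assoc, reassoc_of% dAIso_hom_nat, hf, Category.assoc, Category.assoc]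

end Algebras

section TensorStructure

/-- The comonoidal structure of the central double. -/
def dAComul (M N : Center B) : (dA A).obj (M ⊗ N) ⟶ (dA A).obj M ⊗ (dA A).obj N :=
  (dAIso A (M ⊗ N)).inv ≫ doubleComul 𝐇 𝐊 M N ≫ ((dAIso A M).hom ⊗ₘ (dAIso A N).hom)

/-- The counit of the central double. -/
def dACounit : (dA A).obj (𝟙_ (Center B)) ⟶ 𝟙_ (Center B) :=
  moduleMap (unitAct A) (gu 𝐇 (𝟙_ (Center B)))

/-- The R-matrix of the central double. -/
def dAR (M N : Center B) : M ⊗ N ⟶ (dA A).obj N ⊗ (dA A).obj M :=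
  doubleR 𝐇 𝐊 M N ≫ ((dAIso A N).hom ⊗ₘ (dAIso A M).hom)

variable {A}

theorem dAComul_moduleMap {M N : Center B} (r : M ⊗ 𝐇 ⟶ M) (κ : M ⟶ 𝐇 ⊗ M) (s : N ⊗ 𝐇 ⟶ N)
    (κ' : N ⟶ 𝐇 ⊗ N) : dAComul A M N ≫ (moduleMap r κ ⊗ₘ moduleMap s κ') =
      moduleMap (actTensor r s) (coactTensor κ κ') := by
  rw [moduleMap, moduleMap, dAComul, moduleMap, Category.assoc, Category.assoc,
    tensorHom_comp_tensorHom, Iso.hom_inv_id_assoc, Iso.hom_inv_id_assoc, doubleComul_doubleAct]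

/-- The axioms of `ModuleTensor` and `ModuleBraiding` are checked by replacing module structures
with Yetter-Drinfeld data, for which the tensor product is known. -/
theorem dAComul_algebra (P Q : (monad A).Algebra) : dAComul A P.A Q.A ≫ (strMap P ⊗ₘ strMap Q) =
    moduleMap (actTensor (actionMap (strMap P)) (actionMap (strMap Q)))
      (coactTensor (coactionMap (strMap P)) (coactionMap (strMap Q))) := by
  rw [← dAComul_moduleMap, moduleMap_algebra, moduleMap_algebra]

theorem dAR_comp {M N : Center B} (α : (dA A).obj M ⟶ M) (β : (dA A).obj N ⟶ N) :
    dAR A M N ≫ (β ⊗ₘ α) = gam (coactionMap α) (actionMap β) := by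
  rw [dAR, Category.assoc, tensorHom_comp_tensorHom, doubleR_comp, coactionMap, actionMap]

theorem tensor_algebra_isYetterDrinfeldModule (P Q : (monad A).Algebra) : IsYetterDrinfeldModule
    (actTensor (actionMap (strMap P)) (actionMap (strMap Q)))
    (coactTensor (coactionMap (strMap P)) (coactionMap (strMap Q))) :=
  tensor_isYetterDrinfeldModule (algebra_isYetterDrinfeldModule P)
    (algebra_isYetterDrinfeldModule Q)

variable (A)

/-- The tensor product of modules over the central double. -/
def moduleTensor : ModuleTensor (monad A) where
  comul := dAComul A
  counit := dACounit A
  natural {X X' Y Y'} f g := by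
    change (dA A).map (f ⊗ₘ g) ≫ dAComul A X' Y' =
      dAComul A X Y ≫ ((dA A).map f ⊗ₘ (dA A).map g)
    rw [dAComul, dAComul, reassoc_of% dAIso_inv_nat, reassoc_of% doubleComul_nat,
      tensorHom_comp_tensorHom,
      dAIso_hom_nat, dAIso_hom_nat, ← tensorHom_comp_tensorHom, Category.assoc, Category.assoc]
  tensor_unit P Q := by
    change dAOne A (P.A ⊗ Q.A) ≫ dAComul A P.A Q.A ≫ (strMap P ⊗ₘ strMap Q) = 𝟙 _
    rw [dAComul_algebra]
    exact (moduleMap_laws (tensor_algebra_isYetterDrinfeldModule P Q)).1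
  tensor_assoc P Q := by
    change dAMul A (P.A ⊗ Q.A) ≫ dAComul A P.A Q.A ≫ (strMap P ⊗ₘ strMap Q) =
      (dA A).map (dAComul A P.A Q.A ≫ (strMap P ⊗ₘ strMap Q)) ≫ dAComul A P.A Q.A ≫
        (strMap P ⊗ₘ strMap Q)
    rw [dAComul_algebra]
    exact (moduleMap_laws (tensor_algebra_isYetterDrinfeldModule P Q)).2
  unit_unit := (moduleMap_laws (unit_isYetterDrinfeldModule A)).1
  unit_assoc := (moduleMap_laws (unit_isYetterDrinfeldModule A)).2
  associator P Q R := by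
    change (dA A).map (α_ P.A Q.A R.A).hom ≫ dAComul A P.A (Q.A ⊗ R.A) ≫
        (strMap P ⊗ₘ (dAComul A Q.A R.A ≫ (strMap Q ⊗ₘ strMap R))) = (dAComul A (P.A ⊗ Q.A) R.A ≫
        ((dAComul A P.A Q.A ≫ (strMap P ⊗ₘ strMap Q)) ⊗ₘ strMap R)) ≫ (α_ P.A Q.A R.A).hom
    rw [dAComul_algebra, dAComul_algebra, ← moduleMap_algebra P, ← moduleMap_algebra R,
      dAComul_moduleMap, dAComul_moduleMap, moduleMap_algebra, moduleMap_algebra]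
    exact moduleMap_comp (actTensor_associator (algebra_isYetterDrinfeldModule P).action
      (algebra_isYetterDrinfeldModule Q).action (algebra_isYetterDrinfeldModule R).action)
      (coactTensor_assoc _ _ _)
  leftUnitor P := by
    change (dA A).map (λ_ P.A).hom ≫ strMap P =
      (dAComul A (𝟙_ _) P.A ≫ (dACounit A ⊗ₘ strMap P)) ≫ (λ_ P.A).hom
    rw [← moduleMap_algebra P, dACounit, dAComul_moduleMap]
    exact moduleMap_comp (actTensor_leftUnitor (algebra_isYetterDrinfeldModule P).action)
      (coactTensor_leftUnitor (coactionMap (strMap P)))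
  rightUnitor P := by
    change (dA A).map (ρ_ P.A).hom ≫ strMap P =
      (dAComul A P.A (𝟙_ _) ≫ (strMap P ⊗ₘ dACounit A)) ≫ (ρ_ P.A).hom
    rw [← moduleMap_algebra P, dACounit, dAComul_moduleMap]
    exact moduleMap_comp (actTensor_rightUnitor (algebra_isYetterDrinfeldModule P).action)
      (coactTensor_rightUnitor (coactionMap (strMap P)))

/-- The braiding of modules over the central double. -/
def moduleBraiding : (moduleTensor A).ModuleBraiding where
  R := dAR A
  natural {X X' Y Y'} f g := by
    change (f ⊗ₘ g) ≫ dAR A X' Y' = dAR A X Y ≫ ((dA A).map g ⊗ₘ (dA A).map f)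
    rw [dAR, dAR, reassoc_of% doubleR_nat, tensorHom_comp_tensorHom, dAIso_hom_nat, dAIso_hom_nat,
      ← tensorHom_comp_tensorHom, Category.assoc]
  linear P Q := by
    change (dAComul A P.A Q.A ≫ (strMap P ⊗ₘ strMap Q)) ≫ dAR A P.A Q.A ≫ (strMap Q ⊗ₘ strMap P) =
      (dA A).map (dAR A P.A Q.A ≫ (strMap Q ⊗ₘ strMap P)) ≫ dAComul A Q.A P.A ≫
        (strMap Q ⊗ₘ strMap P)
    rw [dAComul_algebra, dAComul_algebra, dAR_comp]
    exact (moduleMap_comp ((algebra_isYetterDrinfeldModule P).compat.linear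
      (algebra_isYetterDrinfeldModule Q).action)
      (gam_colinear (algebra_isYetterDrinfeldModule P).coaction
        (algebra_isYetterDrinfeldModule Q).compat)).symm
  tensor_left P Q S := by
    change dAR A (P.A ⊗ Q.A) S.A ≫ (strMap S ⊗ₘ (dAComul A P.A Q.A ≫ (strMap P ⊗ₘ strMap Q))) =
      (α_ P.A Q.A S.A).hom ≫ P.A ◁ (dAR A Q.A S.A ≫ (strMap S ⊗ₘ strMap Q)) ≫ (α_ P.A S.A Q.A).inv ≫
      (dAR A P.A S.A ≫ (strMap S ⊗ₘ strMap P)) ▷ Q.A ≫ (α_ S.A P.A Q.A).hom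
    rw [dAComul_algebra, dAR_comp, dAR_comp, dAR_comp,
      coactionMap_moduleMap (tensor_algebra_isYetterDrinfeldModule P Q).action,
      gam_coactTensor _ _ (algebra_isYetterDrinfeldModule S).action]
  tensor_right P Q S := by
    change dAR A P.A (Q.A ⊗ S.A) ≫ ((dAComul A Q.A S.A ≫ (strMap Q ⊗ₘ strMap S)) ⊗ₘ strMap P) =
      (α_ P.A Q.A S.A).inv ≫ (dAR A P.A Q.A ≫ (strMap Q ⊗ₘ strMap P)) ▷ S.A ≫ (α_ Q.A P.A S.A).hom ≫
      Q.A ◁ (dAR A P.A S.A ≫ (strMap S ⊗ₘ strMap P)) ≫ (α_ Q.A S.A P.A).inv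
    rw [dAComul_algebra, dAR_comp, dAR_comp, dAR_comp,
      actionMap_moduleMap _ (tensor_algebra_isYetterDrinfeldModule Q S).coaction,
      gam_tensor (algebra_isYetterDrinfeldModule P).coaction]
  isIso P Q := by
    change IsIso (dAR A P.A Q.A ≫ (strMap Q ⊗ₘ strMap P))
    rw [dAR_comp]
    exact gam_isIso (algebra_isYetterDrinfeldModule P).coaction
      (algebra_isYetterDrinfeldModule Q).action

instance bimonad : Bimonad (monad A) := (moduleTensor A).bimonad

/-- The R-matrix of the central double. -/
def rMatrix : RMatrix (monad A) := (moduleBraiding A).rMatrix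

variable {A}

theorem algebra_decomp (P : (monad A).Algebra) : (dAIso A P.A).hom ≫ strMap P =
    actionMap (strMap P) ▷ 𝐊 ≫ ru 𝐇 P.A ▷ 𝐊 ≫ (dAIso A P.A).hom ≫ strMap P :=
  (algebra_isDoubleAction P).decomp.symm

/-- The action and the coaction of `P` contribute one invertible factor each. The left fusion
operators are the case where `P` is free. -/
theorem dAComul_whiskerLeft_isIso (X : Center B) (P : (monad A).Algebra) :
    IsIso (dAComul A X P.A ≫ (dA A).obj X ◁ strMap P) := by
  have h := doubleComul_whiskerLeft_isIso (H := 𝐇) (K := 𝐊) (M := X)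
    (algebra_isYetterDrinfeldModule P).action (algebra_isYetterDrinfeldModule P).coaction
  rw [← algebra_decomp] at h
  have e : dAComul A X P.A ≫ (dA A).obj X ◁ strMap P = (dAIso A (X ⊗ P.A)).inv ≫
      (doubleComul 𝐇 𝐊 X P.A ≫ ((X ⊗ 𝐇) ⊗ 𝐊) ◁ ((dAIso A P.A).hom ≫ strMap P)) ≫
        (dAIso A X).hom ▷ P.A := by
    rw [dAComul, MonoidalCategory.tensorHom_def', whiskerLeft_comp]
    simp only [Category.assoc]
    rw [whisker_exchange]
  rw [e]
  infer_instance

theorem dAComul_whiskerRight_isIso (P : (monad A).Algebra) (Y : Center B) :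
    IsIso (dAComul A P.A Y ≫ strMap P ▷ (dA A).obj Y) := by
  have h := doubleComul_whiskerRight_isIso (H := 𝐇) (K := 𝐊) (N := Y)
    (algebra_isYetterDrinfeldModule P).action (algebra_isYetterDrinfeldModule P).coaction
  rw [← algebra_decomp] at h
  have e : dAComul A P.A Y ≫ strMap P ▷ (dA A).obj Y = (dAIso A (P.A ⊗ Y)).inv ≫
      (doubleComul 𝐇 𝐊 P.A Y ≫ ((dAIso A P.A).hom ≫ strMap P) ▷ ((Y ⊗ 𝐇) ⊗ 𝐊)) ≫
        P.A ◁ (dAIso A Y).hom := by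
    rw [dAComul, MonoidalCategory.tensorHom_def, comp_whiskerRight]
    simp only [Category.assoc]
    rw [← whisker_exchange]
  rw [e]
  infer_instance

instance isHopfMonad : Bimonad.IsHopfMonad (monad A) where
  isIso_leftFusion X Y := dAComul_whiskerLeft_isIso X ((monad A).free.obj Y)
  isIso_rightFusion X Y := dAComul_whiskerRight_isIso ((monad A).free.obj X) Y

end TensorStructure

/-! ### Agreement with the given formulas -/

section Formulas

theorem dAComul_f (M N : Center B) : (dAComul A M N).f = comul A M N := by
  rw [doubleComul_f, dAComul]
  simp only [Center.comp_f, dAIso_inv_f]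
  rw [← dAIso_hom_f, ← dAIso_hom_f]
  rfl

theorem dACounit_f : (dACounit A).f = counit A := by
  rw [dACounit, moduleMap, doubleAct, unc_gu]
  simp only [Center.comp_f, dAIso_inv_f, Center.rightUnitor_inv_f]
  change (α_ (𝟙_ B) A Aᘁ).inv ≫ (𝟙_ B ◁ ε[A] ≫ (ρ_ (𝟙_ B)).hom) ▷ Aᘁ ≫ (λ_ Aᘁ).hom ≫ (ρ_ Aᘁ).inv ≫
    Aᘁ ◁ η[A] ≫ ev A = _
  simp only [counit, counitDual]
  rw [MonoidalCategory.tensorHom_def, unitors_equal.symm]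
  monoidal

theorem dAR_f (M N : Center B) : (dAR A M N).f = R A M N := by
  simp only [dAR, doubleR, lu, ru, Center.comp_f, Center.rightUnitor_inv_f,
    Center.associator_inv_f, Center.tensor_f, Center.whiskerRight_f]
  change ((ρ_ (M.1 ⊗ N.1)).inv ≫ (M.1 ⊗ N.1) ◁ coev A ≫ (α_ (M.1 ⊗ N.1) A Aᘁ).inv ≫
    (α_ M.1 N.1 A).hom ▷ Aᘁ ≫ (M.2.β (N.1 ⊗ A)).hom ▷ Aᘁ ≫ (α_ (N.1 ⊗ A) M.1 Aᘁ).hom ≫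
    (((ρ_ (N.1 ⊗ A)).inv ≫ (N.1 ⊗ A) ◁ unitDual A) ⊗ₘ ((ρ_ M.1).inv ≫ M.1 ◁ η[A]) ▷ Aᘁ)) ≫
    ((dAIso A N).hom.f ⊗ₘ (dAIso A M).hom.f) = _
  rw [dAIso_hom_f, dAIso_hom_f, R]
  change (_ ≫ _ ≫ _ ≫ _ ≫ _ ≫ _ ≫ _) ≫ ((α_ N.1 A Aᘁ).hom ⊗ₘ (α_ M.1 A Aᘁ).hom) = _
  rw [MonoidalCategory.tensorHom_def, MonoidalCategory.tensorHom_def]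
  generalize (M.2.β (N.1 ⊗ A)).hom = b
  monoidal

end Formulas

end CentralDouble

/-! ### Yetter-Drinfeld modules from half braidings -/

namespace MirrorHopfObj

variable {C : Type u} [Category.{v} C] [MonoidalCategory C] [BraidedCategory C]
  {H : C} [MirrorHopfObj H] {K : C} [ExactPairing H K]

/-- The hypotheses are what naturality of a half braiding along `ε` and `Δ` gives on the regular
module. Restricting to the grouplike unit turns them into the coaction laws. -/
theorem isCoaction_of_braiding {M : C} {g : M ⊗ H ⟶ H ⊗ M} (h₁ : g ≫ ge H M = re H M)
    (h₂ : g ≫ Δ[H] ▷ M = M ◁ Δ[H] ≫ (α_ M H H).inv ≫ g ▷ H ≫ (α_ H M H).hom ≫ H ◁ g ≫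
      (α_ H H M).inv) : IsCoaction (ru H M ≫ g) where
  counit := by
    rw [Category.assoc, h₁, ru, re]
    simp only [Category.assoc, ← whiskerLeft_comp_assoc, one_counit]
    simp
  comul := by
    simp only [gd, ru, Category.assoc]
    rw [reassoc_of% h₂]
    calc _ = 𝟙 _ ⊗≫ M ◁ (η[H] ≫ Δ[H]) ⊗≫ g ▷ H ⊗≫ H ◁ g ⊗≫ 𝟙 _ := by monoidal
      _ = 𝟙 _ ⊗≫ M ◁ η[H] ⊗≫ ((M ⊗ H) ◁ η[H] ≫ g ▷ H) ⊗≫ H ◁ g ⊗≫ 𝟙 _ := by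
        rw [one_comul, MonoidalCategory.tensorHom_def]; monoidal
      _ = _ := by rw [whisker_exchange]; monoidal

theorem gam_whiskerRight {M M' N : C} {κ : M ⟶ H ⊗ M} {κ' : M' ⟶ H ⊗ M'} (s : N ⊗ H ⟶ N)
    {f : M ⟶ M'} (hf : κ ≫ H ◁ f = f ≫ κ') : f ▷ N ≫ gam κ' s = gam κ s ≫ N ◁ f := by
  simp only [gam, Category.assoc]
  rw [BraidedCategory.braiding_naturality_left_assoc, ← whiskerLeft_comp_assoc, ← hf,
    whiskerLeft_comp_assoc, associator_inv_naturality_right_assoc, whisker_exchange]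

theorem gam_tr_eq {M N : C} (k : M ⊗ K ⟶ M) (s : N ⊗ H ⟶ N) :
    gam (tr (H := H) k) s = (ρ_ (M ⊗ N)).inv ≫ (M ⊗ N) ◁ η_ H K ≫ (α_ _ H K).inv ≫
      (α_ M N H).hom ▷ K ≫ (β_ M (N ⊗ H)).hom ▷ K ≫ (α_ (N ⊗ H) M K).hom ≫ (s ⊗ₘ k) := by
  rw [gam_tr]
  monoidal

end MirrorHopfObj

namespace CentralDouble

variable {B : Type u} [Category.{v} B] [MonoidalCategory B] [BraidedCategory B]
  {A : B} [HopfObj A]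

open MirrorHopfObj

local notation "𝐇" => mirrorObj A

section ModulesInBase

variable (A) in
/-- The regular right module. -/
def regular : RightModule A where
  X := A
  act := μ[A]
  act_one := MonObj.mul_one A
  act_mul := by rw [MonObj.mul_assoc, Iso.inv_hom_id_assoc]

theorem tensor_trivialObj_act (N : RightModule A) (U : B) : (N ⊗ RightModule.trivialObj A U).act =
    (α_ N.X U A).hom ≫ N.X ◁ (β_ U A).hom ≫ (α_ N.X A U).inv ≫ N.act ▷ U := by
  rw [RightModule.tensor_act]
  simp only [RightModule.trivialObj, tensorμ]
  calc _ = 𝟙 _ ⊗≫ (N.X ⊗ U) ◁ Δ[A] ⊗≫ N.X ◁ (β_ U A).hom ▷ A ⊗≫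
        ((N.X ⊗ A) ◁ (U ◁ ε[A] ≫ (ρ_ U).hom) ≫ N.act ▷ U) := by
        rw [MonoidalCategory.tensorHom_def']; monoidal
    _ = 𝟙 _ ⊗≫ (N.X ⊗ U) ◁ Δ[A] ⊗≫ N.X ◁ ((β_ U A).hom ▷ A ≫ (A ⊗ U) ◁ ε[A]) ⊗≫ N.act ▷ U := by
      monoidal
    _ = 𝟙 _ ⊗≫ (N.X ⊗ U) ◁ (Δ[A] ≫ A ◁ ε[A]) ⊗≫ N.X ◁ (β_ U A).hom ⊗≫ N.act ▷ U := by
      rw [← whisker_exchange]; monoidal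
    _ = _ := by rw [ComonObj.comul_counit]; monoidal

theorem trivialObj_tensor_act' (U : B) (N : RightModule A) :
    (RightModule.trivialObj A U ⊗ N).act = (α_ U N.X A).hom ≫ U ◁ N.act := by
  rw [RightModule.tensor_act]
  simp only [RightModule.trivialObj, tensorμ]
  calc _ = 𝟙 _ ⊗≫ (U ⊗ N.X) ◁ Δ[A] ⊗≫ U ◁ (β_ N.X A).hom ▷ A ⊗≫
        U ◁ ε[A] ▷ (N.X ⊗ A) ⊗≫ U ◁ N.act := by
        rw [MonoidalCategory.tensorHom_def]; monoidal
    _ = 𝟙 _ ⊗≫ (U ⊗ N.X) ◁ Δ[A] ⊗≫ U ◁ ((β_ N.X A).hom ≫ ε[A] ▷ N.X) ▷ A ⊗≫ U ◁ N.act := by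
      monoidal
    _ = 𝟙 _ ⊗≫ (U ⊗ N.X) ◁ (Δ[A] ≫ ε[A] ▷ A) ⊗≫ U ◁ N.act := by
      rw [← BraidedCategory.braiding_naturality_right, braiding_tensorUnit_right]; monoidal
    _ = _ := by rw [ComonObj.counit_comul]; monoidal

variable (A) in
/-- The braiding of a trivial module with the regular one. -/
def trivialRegular (U : B) : RightModule.trivialObj A U ⊗ regular A ⟶
    regular A ⊗ RightModule.trivialObj A U where
  hom := (β_ U A).hom
  comm := by
    rw [trivialObj_tensor_act', tensor_trivialObj_act]
    have h := BraidedCategory.braiding_naturality_right U μ[A]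
    rw [BraidedCategory.braiding_tensor_right_hom] at h
    change ((α_ U A A).hom ≫ U ◁ μ[A]) ≫ (β_ U A).hom = (β_ U A).hom ▷ A ≫ (α_ A U A).hom ≫
      A ◁ (β_ U A).hom ≫ (α_ A A U).inv ≫ μ[A] ▷ U
    rw [Category.assoc, h]
    simp

/-- The action as a morphism from a free module. -/
def actHom (N : RightModule A) : RightModule.trivialObj A N.X ⊗ regular A ⟶ N where
  hom := N.act
  comm := by
    rw [trivialObj_tensor_act']
    change ((α_ N.X A A).hom ≫ N.X ◁ μ[A]) ≫ N.act = N.act ▷ A ≫ N.act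
    rw [Category.assoc, N.act_mul, Iso.hom_inv_id_assoc]

variable (A) in
/-- The comultiplication as a morphism of regular modules. -/
def comulHom : regular A ⟶ regular A ⊗ regular A where
  hom := Δ[A]
  comm := by
    rw [RightModule.tensor_act]
    change μ[A] ≫ Δ[A] = Δ[A] ▷ A ≫ (A ⊗ A) ◁ Δ[A] ≫ tensorμ A A A A ≫ (μ[A] ⊗ₘ μ[A])
    rw [BimonObj.mul_comul, MonoidalCategory.tensorHom_def, Category.assoc]

variable (A) in
/-- The counit as a morphism from the regular module. -/
def counitHom : regular A ⟶ 𝟙_ (RightModule A) where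
  hom := ε[A]
  comm := by
    change μ[A] ≫ ε[A] = ε[A] ▷ A ≫ 𝟙_ B ◁ ε[A] ≫ (ρ_ (𝟙_ B)).hom
    rw [BimonObj.mul_counit, ← unitors_equal]
    exact (congrArg (· ≫ _) (MonoidalCategory.tensorHom_def _ _)).trans (Category.assoc _ _ _)

end ModulesInBase

section HalfBraidings

/-- A component of the half braiding of an object of the center of `A`-modules. -/
def halfBraid (P : Center (RightModule A)) (N : RightModule A) : P.1.X ⊗ N.X ⟶ N.X ⊗ P.1.X :=
  (P.2.β N).hom.hom

theorem halfBraid_trivialObj (P : Center (RightModule A)) (U : B) :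
    halfBraid P (RightModule.trivialObj A U) = (((forgetCenter A).obj P).2.β U).hom := rfl

theorem halfBraid_nat (P : Center (RightModule A)) {N N' : RightModule A} (f : N ⟶ N') :
    P.1.X ◁ f.hom ≫ halfBraid P N' = halfBraid P N ≫ f.hom ▷ P.1.X := by
  have h := congrArg RightModule.Hom.hom (P.2.naturality f)
  rw [RightModule.comp_hom, RightModule.comp_hom, RightModule.whiskerLeft_hom,
    RightModule.whiskerRight_hom] at h
  exact h

theorem halfBraid_tensor (P : Center (RightModule A)) (N N' : RightModule A) :
    halfBraid P (N ⊗ N') = (α_ P.1.X N.X N'.X).inv ≫ halfBraid P N ▷ N'.X ≫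
      (α_ N.X P.1.X N'.X).hom ≫ N.X ◁ halfBraid P N' ≫ (α_ N.X N'.X P.1.X).inv := by
  have h := congrArg RightModule.Hom.hom (P.2.monoidal N N')
  simp only [RightModule.comp_hom, RightModule.whiskerLeft_hom, RightModule.whiskerRight_hom] at h
  exact h

theorem halfBraid_linear (P : Center (RightModule A)) (N : RightModule A) :
    (P.1 ⊗ N).act ≫ halfBraid P N = halfBraid P N ▷ A ≫ (N ⊗ P.1).act :=
  (P.2.β N).hom.comm

theorem halfBraid_unit (P : Center (RightModule A)) :
    halfBraid P (𝟙_ (RightModule A)) = (ρ_ P.1.X).hom ≫ (λ_ P.1.X).inv := by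
  have h := congrArg Center.Hom.f (braiding_tensorUnit_right P)
  rw [Center.comp_f, Center.leftUnitor_inv_f] at h
  exact congrArg RightModule.Hom.hom h

theorem act_comm_aux {X M U : B} (r : M ⊗ X ⟶ M) (σ : M ⊗ U ⟶ U ⊗ M) (b : U ⊗ X ≅ X ⊗ U)
    (h : ((α_ M U X).hom ≫ M ◁ b.hom ≫ (α_ M X U).inv ≫ r ▷ U) ≫ σ =
      σ ▷ X ≫ (α_ U M X).hom ≫ U ◁ r) :
    r ▷ U ≫ σ = ((α_ M X U).hom ≫ M ◁ b.inv ≫ (α_ M U X).inv ≫ σ ▷ X ≫ (α_ U M X).hom) ≫ U ◁ r := by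
  simp only [Category.assoc, ← h]
  simp

theorem braid_comm_aux {X M U : B} (g : M ⊗ X ⟶ X ⊗ M) (σ : M ⊗ U ⟶ U ⊗ M) (b : U ⊗ X ≅ X ⊗ U)
    (h : M ◁ b.hom ≫ (α_ M X U).inv ≫ g ▷ U ≫ (α_ X M U).hom ≫ X ◁ σ ≫ (α_ X U M).inv =
      ((α_ M U X).inv ≫ σ ▷ X ≫ (α_ U M X).hom ≫ U ◁ g ≫ (α_ U X M).inv) ≫ b.hom ▷ M) :
    g ▷ U ≫ (α_ X M U).hom ≫ X ◁ σ ≫ (α_ X U M).inv ≫ b.inv ▷ M ≫ (α_ U X M).hom =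
      ((α_ M X U).hom ≫ M ◁ b.inv ≫ (α_ M U X).inv ≫ σ ▷ X ≫ (α_ U M X).hom) ≫ U ◁ g := by
  rw [← cancel_epi (M ◁ b.hom ≫ (α_ M X U).inv)]
  simp only [Category.assoc]
  rw [reassoc_of% h]
  simp

/-- Linearity of the half braiding with a trivial module says exactly that the action is a morphism
of the centre of `B`. -/
theorem act_comm (P : Center (RightModule A)) (U : B) :
    P.1.act ▷ U ≫ (((forgetCenter A).obj P).2.β U).hom =
      sigmaA A ((forgetCenter A).obj P) U ≫ U ◁ P.1.act := by
  have h := halfBraid_linear P (RightModule.trivialObj A U)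
  rw [tensor_trivialObj_act, trivialObj_tensor_act', halfBraid_trivialObj] at h
  exact act_comm_aux P.1.act (((forgetCenter A).obj P).2.β U).hom (β_ U A) h

/-- The action of `A` on an object of the center of `A`-modules. -/
def centerAct (P : Center (RightModule A)) :
    (forgetCenter A).obj P ⊗ 𝐇 ⟶ (forgetCenter A).obj P where
  f := P.1.act
  comm U := act_comm P U

/-- The braiding of a trivial module with the regular one is linear; naturality of the half braiding
along it lifts the component at the regular module to the centre of `B`. -/
theorem regular_comm (P : Center (RightModule A)) (U : B) :
    halfBraid P (regular A) ▷ U ≫ (α_ A P.1.X U).hom ≫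
      A ◁ (((forgetCenter A).obj P).2.β U).hom ≫ (α_ A U P.1.X).inv ≫ (β_ U A).inv ▷ P.1.X ≫
      (α_ U A P.1.X).hom = sigmaA A ((forgetCenter A).obj P) U ≫ U ◁ halfBraid P (regular A) := by
  have h := halfBraid_nat P (trivialRegular A U)
  rw [halfBraid_tensor, halfBraid_tensor, halfBraid_trivialObj] at h
  exact braid_comm_aux (halfBraid P (regular A)) (((forgetCenter A).obj P).2.β U).hom (β_ U A) h

/-- The half braiding with the regular module. -/
def centerBraid (P : Center (RightModule A)) :
    (forgetCenter A).obj P ⊗ 𝐇 ⟶ 𝐇 ⊗ (forgetCenter A).obj P where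
  f := halfBraid P (regular A)
  comm U := regular_comm P U

variable [IsIso (HopfObj.antipode (X := A))]

/-- The coaction of `A` on an object of the center of `A`-modules. -/
def centerCoact (P : Center (RightModule A)) :
    (forgetCenter A).obj P ⟶ 𝐇 ⊗ (forgetCenter A).obj P :=
  ru 𝐇 ((forgetCenter A).obj P) ≫ centerBraid P

theorem centerAct_isAction (P : Center (RightModule A)) : IsAction (centerAct P) where
  one := by
    apply Center.ext
    rw [ru, Center.comp_f, Center.comp_f, Center.rightUnitor_inv_f]
    exact (Category.assoc _ _ _).trans ((Iso.inv_comp_eq _).2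
      (P.1.act_one.trans (Category.comp_id _).symm))
  mul := Center.ext _ _ ((Category.assoc _ _ _).trans ((Iso.eq_inv_comp _).1 P.1.act_mul))

theorem centerCoact_isCoaction (P : Center (RightModule A)) : IsCoaction (centerCoact P) := by
  apply isCoaction_of_braiding
  · apply Center.ext
    have h := halfBraid_nat P (counitHom A)
    rw [halfBraid_unit] at h
    have h' : halfBraid P (regular A) ≫ ε[A] ▷ P.1.X ≫ (λ_ P.1.X).hom =
        P.1.X ◁ ε[A] ≫ (ρ_ P.1.X).hom := by
      refine (Category.assoc _ _ _).symm.trans ((congrArg (· ≫ _) h).symm.trans ?_)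
      exact (Category.assoc _ _ _).trans (congrArg (_ ≫ ·) ((Category.assoc _ _ _).trans
        ((congrArg (_ ≫ ·) (Iso.inv_hom_id _)).trans (Category.comp_id _))))
    exact h'
  · apply Center.ext
    have h := halfBraid_nat P (comulHom A)
    rw [halfBraid_tensor] at h
    simp only [Center.comp_f, Center.associator_inv_f]
    exact h.symm

/-- The action is a linear map `N ⊗ A ⟶ N` from a trivial module tensored with the regular one, and
it is split in `B` by the unit. Naturality along it determines the component at `N` from the half
braiding `σ` and the coaction. -/
theorem halfBraid_eq_gam (P : Center (RightModule A)) (N : RightModule A) :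
    halfBraid P N = (gam (centerCoact P) (mirrorAct N)).f := by
  have h := halfBraid_nat P (actHom N)
  rw [halfBraid_tensor, halfBraid_trivialObj] at h
  rw [gam_f, centerCoact, ru, Center.comp_f, Center.comp_f, Center.rightUnitor_inv_f]
  have key : ∀ {M N X : B} (g : M ⊗ X ⟶ X ⊗ M) (σ : M ⊗ N ⟶ N ⊗ M) (s : N ⊗ X ⟶ N)
      (e : 𝟙_ B ⟶ X) (c : M ⊗ N ⟶ N ⊗ M) (_ : N ◁ e ≫ s = (ρ_ N).hom) (_ : M ◁ s ≫ c =
        ((α_ M N X).inv ≫ σ ▷ X ≫ (α_ N M X).hom ≫ N ◁ g ≫ (α_ N X M).inv) ≫ s ▷ M),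
      c = σ ≫ N ◁ (((ρ_ M).inv ≫ M ◁ e) ≫ g) ≫ (α_ N X M).inv ≫ s ▷ M := by
    intro M N X g σ s e c h₁ h₂
    calc c = M ◁ (ρ_ N).inv ≫ M ◁ (N ◁ e ≫ s) ≫ c := by rw [h₁]; simp
      _ = M ◁ (ρ_ N).inv ≫ M ◁ N ◁ e ≫ ((α_ M N X).inv ≫ σ ▷ X ≫ (α_ N M X).hom ≫ N ◁ g ≫
          (α_ N X M).inv) ≫ s ▷ M := by rw [← h₂, whiskerLeft_comp, Category.assoc]
      _ = 𝟙 _ ⊗≫ ((M ⊗ N) ◁ e ≫ σ ▷ X) ⊗≫ N ◁ g ⊗≫ s ▷ M := by monoidal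
      _ = _ := by rw [whisker_exchange]; monoidal
  exact key (halfBraid P (regular A)) (((forgetCenter A).obj P).2.β N.X).hom N.act η[A]
    (halfBraid P N) N.act_one h

theorem centerBraid_eq_gam (P : Center (RightModule A)) :
    centerBraid P = gam (centerCoact P) μ[𝐇] :=
  Center.ext _ _ ((halfBraid_eq_gam P (regular A)).trans ((gam_f _ _).trans (gam_f _ _).symm))

theorem center_isYetterDrinfeldModule (P : Center (RightModule A)) :
    IsYetterDrinfeldModule (centerAct P) (centerCoact P) where
  action := centerAct_isAction P
  coaction := centerCoact_isCoaction P
  compat := by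
    apply isYetterDrinfeld_of_linear
    rw [← centerBraid_eq_gam]
    apply Center.ext
    simp only [Center.comp_f, Center.whiskerRight_f, actTensor_f]
    exact halfBraid_linear P (regular A)

end HalfBraidings

section Formulas

variable [RigidCategory B] [IsIso (HopfObj.antipode (X := A))]

local notation "𝐊" => mirrorObj (Aᘁ)

/-- The module `(A ⊗ ᵛA, α)` is what the action `pr` becomes on underlying objects, so `unc_gam`
turns into the formula for `ρ`. -/
theorem unc_f {M : Center B} (κ : M ⟶ 𝐇 ⊗ M) : (unc 𝐇 𝐊 κ).f =
    M.1 ◁ ((λ_ Aᘁ).inv ≫ η[A] ▷ Aᘁ) ≫ (gam κ (mirrorAct (RightModule.regularTensor A Aᘁ))).f ≫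
      (β_ Aᘁ A).inv ▷ M.1 ≫ ev A ▷ M.1 ≫ (λ_ M.1).hom := by
  have h : (gam κ (pr 𝐇 𝐊)).f = (gam κ (mirrorAct (RightModule.regularTensor A Aᘁ))).f := by
    rw [gam_f, gam_f, pr, gm]
    simp only [Center.comp_f, Center.whiskerLeft_f, braiding_inv_f, mirror_β_inv,
      Center.associator_inv_f]
    rfl
  rw [← unc_gam, ← h]
  simp only [Center.comp_f, Center.whiskerLeft_f, Center.leftUnitor_inv_f]
  rfl

theorem moduleMap_f {M : Center B} (r : M ⊗ 𝐇 ⟶ M) (κ : M ⟶ 𝐇 ⊗ M) : (moduleMap r κ).f =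
    (α_ M.1 A Aᘁ).inv ≫ r.f ▷ Aᘁ ≫ M.1 ◁ ((λ_ Aᘁ).inv ≫ η[A] ▷ Aᘁ) ≫
      (gam κ (mirrorAct (RightModule.regularTensor A Aᘁ))).f ≫ (β_ Aᘁ A).inv ▷ M.1 ≫
      ev A ▷ M.1 ≫ (λ_ M.1).hom := by
  rw [moduleMap, doubleAct, Center.comp_f, Center.comp_f, dAIso_inv_f, unc_f]
  rfl

theorem moduleMap_center_f (P : Center (RightModule A)) :
    (moduleMap (centerAct P) (centerCoact P)).f = rhoOf A P := by
  rw [moduleMap_f, ← halfBraid_eq_gam]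
  have key : ∀ {M A K : B} (r : M ⊗ A ⟶ M) (e : 𝟙_ B ⟶ A) (g : M ⊗ A ⊗ K ⟶ (A ⊗ K) ⊗ M)
      (b : A ⊗ K ⟶ K ⊗ A) (v : K ⊗ A ⟶ 𝟙_ B), (α_ M A K).inv ≫ r ▷ K ≫
      M ◁ ((λ_ K).inv ≫ e ▷ K) ≫ g ≫ b ▷ M ≫ v ▷ M ≫ (λ_ M).hom =
      𝟙 _ ⊗≫ r ▷ K ⊗≫ M ◁ e ▷ K ⊗≫ g ⊗≫ b ▷ M ⊗≫ v ▷ M ⊗≫ 𝟙 _ := by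
    intros; monoidal
  exact key P.1.act η[A] (gammaAlpha A P) (β_ Aᘁ A).inv (ev A)

theorem actionMap_f {M : Center B} (α : (dA A).obj M ⟶ M) :
    (actionMap α).f = actionOf A M α.f := by
  rw [actionMap, lu]
  simp only [Center.comp_f, Center.rightUnitor_inv_f, dAIso_hom_f]
  have key : ∀ {M A K : B} (e : 𝟙_ B ⟶ K) (a : M ⊗ A ⊗ K ⟶ M), ((ρ_ (M ⊗ A)).inv ≫
      (M ⊗ A) ◁ e) ≫ (α_ M A K).hom ≫ a = 𝟙 _ ⊗≫ (M ⊗ A) ◁ e ⊗≫ a := by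
    intros; monoidal
  exact key (unitDual A) α.f

theorem gam_coactionMap_f {M : Center B} (α : (dA A).obj M ⟶ M) (N : RightModule A) :
    (gam (coactionMap α) (mirrorAct N)).f = gammaOf A M α.f N := by
  have h : gam (coactionMap α) (mirrorAct N) = (ρ_ (M ⊗ mirrorObj N.X)).inv ≫
      (M ⊗ mirrorObj N.X) ◁ η_ 𝐇 𝐊 ≫ (α_ _ 𝐇 𝐊).inv ≫ (α_ M (mirrorObj N.X) 𝐇).hom ▷ 𝐊 ≫
      (β_ M (mirrorObj N.X ⊗ 𝐇)).hom ▷ 𝐊 ≫ (α_ (mirrorObj N.X ⊗ 𝐇) M 𝐊).hom ≫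
      (mirrorAct N ⊗ₘ (ru 𝐇 M ▷ 𝐊 ≫ (dAIso A M).hom ≫ α)) := by
    rw [coactionMap, gam_tr_eq]
  rw [h]
  simp only [Center.comp_f, Center.rightUnitor_inv_f, Center.associator_inv_f, Center.tensor_f,
    Center.whiskerRight_f, dAIso_hom_f, ru]
  have key : ∀ {M N A K : B} (c : 𝟙_ B ⟶ A ⊗ K) (σ : M ⊗ N ⊗ A ⟶ (N ⊗ A) ⊗ M) (e : 𝟙_ B ⟶ A)
      (s : N ⊗ A ⟶ N) (a : M ⊗ A ⊗ K ⟶ M), (ρ_ (M ⊗ N)).inv ≫ (M ⊗ N) ◁ c ≫ (α_ _ A K).inv ≫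
      (α_ M N A).hom ▷ K ≫ σ ▷ K ≫ (α_ (N ⊗ A) M K).hom ≫ (s ⊗ₘ (((ρ_ M).inv ≫ M ◁ e) ▷ K ≫
        (α_ M A K).hom ≫ a)) =
      𝟙 _ ⊗≫ (M ⊗ N) ◁ c ⊗≫ σ ▷ K ⊗≫ (N ⊗ A ⊗ M) ◁ e ▷ K ⊗≫ (s ⊗ₘ a) := by
    intros
    rw [MonoidalCategory.tensorHom_def', MonoidalCategory.tensorHom_def']
    monoidal
  exact key (coev A) (M.2.β (N.X ⊗ A)).hom η[A] N.act α.f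

end Formulas

end CentralDouble

/-! ### Transport of monadicity along an equivalence -/

section Monadicity

variable {C : Type u₁} [Category.{v₁} C] {D : Type u₂} [Category.{v₂} D] {T : Monad C}
  (E : T.Algebra ≌ D)

/-- The forgetful functor of a monad, transported along an equivalence, has a left adjoint. -/
def transportAdj : T.free ⋙ E.functor ⊣ E.inverse ⋙ T.forget := T.adj.comp E.toAdjunction

/-- Naturality of the unit of the equivalence and a triangle identity reduce this to the counit of
the free-forgetful adjunction, which is the structure morphism. -/
theorem transportAdj_counit (Y : D) : (E.unit.app (T.free.obj (E.inverse.obj Y).A)).f ≫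
    (E.inverse ⋙ T.forget).map ((transportAdj E).counit.app Y) = (E.inverse.obj Y).a := by
  have h : E.unit.app (T.free.obj (E.inverse.obj Y).A) ≫
      E.inverse.map ((transportAdj E).counit.app Y) = T.adj.counit.app (E.inverse.obj Y) := by
    have h₁ : (transportAdj E).counit.app Y =
        E.functor.map (T.adj.counit.app (E.inverse.obj Y)) ≫ E.counit.app Y := by
      simp [transportAdj, Adjunction.comp]
    have h₂ := E.unit.naturality (T.adj.counit.app (E.inverse.obj Y))
    refine (congrArg (_ ≫ ·) ((congrArg E.inverse.map h₁).trans (E.inverse.map_comp _ _))).trans ?_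
    exact (Category.assoc _ _ _).symm.trans ((congrArg (· ≫ _) h₂.symm).trans
      ((Category.assoc _ _ _).trans ((congrArg (_ ≫ ·) (E.unit_inverse_comp Y)).trans
        (Category.comp_id _))))
  refine (congrArg Monad.Algebra.Hom.f h).trans ?_
  rw [Monad.adj_counit]

/-- The monad of the transported adjunction. -/
def transportMonadIso : T ≅ (transportAdj E).toMonad :=
  MonadIso.mk (NatIso.ofComponents
      (fun M => T.forget.mapIso (E.unitIso.app (T.free.obj M)))
      (fun f => congrArg Monad.Algebra.Hom.f (E.unit.naturality (T.free.map f))))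
    (fun M => by
      have h : (transportAdj E).unit.app M =
          T.adj.unit.app M ≫ (E.unit.app (T.free.obj M)).f := by
        rw [transportAdj, Adjunction.comp_unit_app]
        rfl
      have e : T.adj.unit.app M = T.η.app M := by rw [Monad.adj_unit]
      exact (congrArg (· ≫ (E.unit.app (T.free.obj M)).f) e.symm).trans h.symm)
    (fun M => by
      have h := transportAdj_counit E (E.functor.obj (T.free.obj M))
      have h' := (E.unit.app (T.free.obj M)).h
      exact h'.symm.trans ((congrArg (_ ≫ ·) h.symm).trans (Category.assoc _ _ _).symm))

/-- The comparison functor of the transported adjunction. -/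
def transportComparison : Monad.comparison (transportAdj E) ⋙
    Monad.algebraFunctorOfMonadHom (transportMonadIso E).hom ≅ E.inverse :=
  NatIso.ofComponents (fun Y => Monad.Algebra.isoMk (Iso.refl (E.inverse.obj Y).A) (by
    refine Eq.trans ?_ (Category.comp_id _).symm
    refine (congrArg (· ≫ _) (T.map_id _)).trans ((Category.id_comp _).trans ?_)
    exact (transportAdj_counit E Y).symm))
    (fun f => by
      ext
      exact (Category.comp_id _).trans (Category.id_comp _).symm)

/-- The forgetful functor of a monad, transported along an equivalence, is monadic. -/
@[reducible]
def transportMonadic : MonadicRightAdjoint (E.inverse ⋙ T.forget) where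
  L := T.free ⋙ E.functor
  adj := transportAdj E
  -- The comparison functor followed by the equivalence between the two categories of algebras is
  -- isomorphic to `E.inverse`, so two out of three applies.
  eqv := by
    have h₁ : (Monad.algebraFunctorOfMonadHom (transportMonadIso E).hom).IsEquivalence :=
      (Monad.algebraEquivOfIsoMonads (transportMonadIso E)).isEquivalence_inverse
    have h₂ : (Monad.comparison (transportAdj E) ⋙
        Monad.algebraFunctorOfMonadHom (transportMonadIso E).hom).IsEquivalence :=
      Functor.isEquivalence_of_iso (transportComparison E).symm
    exact Functor.isEquivalence_of_comp_right _
      (Monad.algebraFunctorOfMonadHom (transportMonadIso E).hom)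

end Monadicity

/-! ### Equality of objects, and the two functors -/

namespace CentralDouble

variable {B : Type u} [Category.{v} B] [MonoidalCategory B] [BraidedCategory B]
  {A : B} [HopfObj A]

open MirrorHopfObj

local notation "𝐇" => mirrorObj A

section Extensionality

theorem halfBraiding_ext {C : Type u₁} [Category.{v₁} C] [MonoidalCategory C] {X : C}
    {b b' : HalfBraiding X} (h : ∀ U, (b.β U).hom = (b'.β U).hom) : b = b' := by
  have e : b.β = b'.β := funext fun U => Iso.ext (h U)
  cases b
  cases b'
  subst e
  rfl

/-- Both objects are given over the same underlying `X`, so equality of objects reduces to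
equalities of morphisms of `B` without transport. -/
theorem center_module_ext {X : B} {r r' : X ⊗ A ⟶ X} {h₁ h₂ h₁' h₂'}
    {c : HalfBraiding (⟨X, r, h₁, h₂⟩ : RightModule A)}
    {c' : HalfBraiding (⟨X, r', h₁', h₂'⟩ : RightModule A)} (hr : r = r')
    (hc : ∀ N : RightModule A, @Eq (X ⊗ N.X ⟶ N.X ⊗ X) (c.β N).hom.hom (c'.β N).hom.hom) :
    (⟨⟨X, r, h₁, h₂⟩, c⟩ : Center (RightModule A)) = ⟨⟨X, r', h₁', h₂'⟩, c'⟩ := by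
  subst hr
  congr 1
  exact halfBraiding_ext fun N => RightModule.hom_ext _ _ (hc N)

theorem center_module_hom_heq {P P' Q Q' : Center (RightModule A)} (hP : P = P') (hQ : Q = Q')
    {f : P ⟶ Q} {g : P' ⟶ Q'} (h : f.f.hom ≍ g.f.hom) : f ≍ g := by
  subst hP hQ
  exact heq_of_eq (Center.ext _ _ (RightModule.hom_ext _ _ (eq_of_heq h)))

theorem algebra_ext {T : Monad (Center B)} {X : B} {b b' : HalfBraiding X}
    {a : T.obj (⟨X, b⟩ : Center B) ⟶ (⟨X, b⟩ : Center B)} {h₁ h₂}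
    {a' : T.obj (⟨X, b'⟩ : Center B) ⟶ (⟨X, b'⟩ : Center B)} {h₁' h₂'}
    (hb : ∀ U, (b.β U).hom = (b'.β U).hom) (ha : a.f ≍ a'.f) :
    (⟨⟨X, b⟩, a, h₁, h₂⟩ : T.Algebra) = ⟨⟨X, b'⟩, a', h₁', h₂'⟩ := by
  obtain rfl := halfBraiding_ext hb
  congr 1
  exact Center.ext _ _ (eq_of_heq ha)

theorem algebra_hom_heq {T : Monad (Center B)} {P P' Q Q' : T.Algebra} (hP : P = P')
    (hQ : Q = Q') {f : P ⟶ Q} {g : P' ⟶ Q'} (h : f.f.f ≍ g.f.f) : f ≍ g := by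
  subst hP hQ
  exact heq_of_eq (Monad.Algebra.Hom.ext (Center.ext _ _ (eq_of_heq h)))

end Extensionality

section FromYetterDrinfeld

variable [IsIso (HopfObj.antipode (X := A))] {M : Center B} {r : M ⊗ mirrorObj A ⟶ M}
  {κ : M ⟶ mirrorObj A ⊗ M}

/-- The half braiding with a module defined by a coaction. -/
def coactBraid (κ : M ⟶ 𝐇 ⊗ M) (N : RightModule A) : M.1 ⊗ N.X ⟶ N.X ⊗ M.1 :=
  (gam κ (mirrorAct N)).f

theorem coactBraid_tensor (hκ : IsCoaction κ) (N N' : RightModule A) :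
    coactBraid κ (N ⊗ N') = (α_ M.1 N.X N'.X).inv ≫ coactBraid κ N ▷ N'.X ≫
      (α_ N.X M.1 N'.X).hom ≫ N.X ◁ coactBraid κ N' ≫ (α_ N.X N'.X M.1).inv := by
  have h : coactBraid κ (N ⊗ N') = (gam κ (actTensor (mirrorAct N) (mirrorAct N'))).f := by
    rw [coactBraid, gam_f, gam_f, actTensor_f]
    rfl
  rw [h, gam_tensor hκ]
  simp only [Center.comp_f, Center.associator_inv_f]
  rfl

theorem coactBraid_nat (κ : M ⟶ 𝐇 ⊗ M) {N N' : RightModule A} (f : N ⟶ N') :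
    M.1 ◁ f.hom ≫ coactBraid κ N' = coactBraid κ N ≫ f.hom ▷ M.1 :=
  congrArg Center.Hom.f (gam_nat κ (s := mirrorAct N) (s' := mirrorAct N') (mirrorMap f.hom)
    (Center.ext _ _ f.comm))

/-- The half braiding of a Yetter-Drinfeld module with a module. -/
def halfBraidIso (h : IsYetterDrinfeldModule r κ) (N : RightModule A) :
    toModule r h.action ⊗ N ≅ N ⊗ toModule r h.action :=
  have := gam_isIso h.coaction (mirrorAct_isAction N)
  RightModule.isoMk ((Center.forget B).mapIso (@asIso (Center B) _ (M ⊗ mirrorObj N.X)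
      (mirrorObj N.X ⊗ M) (gam κ (mirrorAct N)) this)) (by
    have e := congrArg Center.Hom.f (h.compat.linear (mirrorAct_isAction N))
    simp only [Center.comp_f, Center.whiskerRight_f, actTensor_f] at e
    exact e)

/-- The half braiding of a Yetter-Drinfeld module. -/
def halfBraidingOf (h : IsYetterDrinfeldModule r κ) : HalfBraiding (toModule r h.action) where
  β := halfBraidIso h
  monoidal N N' := by
    apply RightModule.hom_ext
    simp only [RightModule.comp_hom, RightModule.whiskerLeft_hom, RightModule.whiskerRight_hom]
    exact coactBraid_tensor h.coaction N N'
  naturality {N N'} f := by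
    apply RightModule.hom_ext
    rw [RightModule.comp_hom, RightModule.comp_hom, RightModule.whiskerLeft_hom,
      RightModule.whiskerRight_hom]
    exact coactBraid_nat κ f

/-- A Yetter-Drinfeld module as an object of the center of the category of modules. -/
def centerOf (h : IsYetterDrinfeldModule r κ) : Center (RightModule A) :=
  ⟨toModule r h.action, halfBraidingOf h⟩

/-- A morphism of Yetter-Drinfeld modules as a morphism of the center. -/
def centerOfHom {M' : Center B} {r' : M' ⊗ 𝐇 ⟶ M'} {κ' : M' ⟶ 𝐇 ⊗ M'}
    (h : IsYetterDrinfeldModule r κ) (h' : IsYetterDrinfeldModule r' κ') (f : M ⟶ M')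
    (hr : r ≫ f = f ▷ 𝐇 ≫ r') (hκ : κ ≫ 𝐇 ◁ f = f ≫ κ') : centerOf h ⟶ centerOf h' where
  f := { hom := f.f, comm := congrArg Center.Hom.f hr }
  comm N := by
    apply RightModule.hom_ext
    rw [RightModule.comp_hom, RightModule.comp_hom, RightModule.whiskerLeft_hom,
      RightModule.whiskerRight_hom]
    exact congrArg Center.Hom.f (gam_whiskerRight (mirrorAct N) hκ)

theorem centerOf_forget (h : IsYetterDrinfeldModule r κ) (U : B) :
    @Eq (M.1 ⊗ U ⟶ U ⊗ M.1) (((forgetCenter A).obj (centerOf h)).2.β U).hom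
      (M.2.β U).hom := by
  have e := congrArg Center.Hom.f (gam_trivial h.coaction (mirrorObj U))
  refine Eq.trans ?_ e
  change coactBraid κ (RightModule.trivialObj A U) = _
  rw [coactBraid, gam_f, gam_f]
  rfl

end FromYetterDrinfeld

section Functors

variable [RigidCategory B] [IsIso (HopfObj.antipode (X := A))]

variable (A)

/-- The functor from modules over the central double to the center of `A`-modules. -/
def toCenter : (monad A).Algebra ⥤ Center (RightModule A) where
  obj P := centerOf (algebra_isYetterDrinfeldModule P)
  map {P Q} f := centerOfHom _ _ f.f (actionMap_comp f.h) (coactionMap_comp f.h)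

theorem forgetCenter_linear {P Q : Center (RightModule A)} (f : P ⟶ Q) :
    centerAct P ≫ (forgetCenter A).map f = (forgetCenter A).map f ▷ 𝐇 ≫ centerAct Q :=
  Center.ext _ _ f.f.comm

theorem forgetCenter_braid {P Q : Center (RightModule A)} (f : P ⟶ Q) :
    centerBraid P ≫ 𝐇 ◁ (forgetCenter A).map f = (forgetCenter A).map f ▷ 𝐇 ≫ centerBraid Q := by
  have h := congrArg RightModule.Hom.hom (f.comm (regular A))
  rw [RightModule.comp_hom, RightModule.comp_hom, RightModule.whiskerLeft_hom,
    RightModule.whiskerRight_hom] at h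
  exact Center.ext _ _ h.symm

theorem forgetCenter_colinear {P Q : Center (RightModule A)} (f : P ⟶ Q) :
    centerCoact P ≫ 𝐇 ◁ (forgetCenter A).map f = (forgetCenter A).map f ≫ centerCoact Q := by
  rw [centerCoact, centerCoact, Category.assoc, forgetCenter_braid]
  rw [← reassoc_of% (ru_nat (H := 𝐇) ((forgetCenter A).map f))]

/-- The functor from the center of `A`-modules to modules over the central double. -/
def ofCenter : Center (RightModule A) ⥤ (monad A).Algebra where
  obj P := algebraOf (center_isYetterDrinfeldModule P)
  map {P Q} f :=
    { f := (forgetCenter A).map f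
      h := moduleMap_comp (forgetCenter_linear A f) (forgetCenter_colinear A f) }

theorem toCenter_ofCenter : ofCenter A ⋙ toCenter A = 𝟭 (Center (RightModule A)) := by
  have h : ∀ P : Center (RightModule A), (toCenter A).obj ((ofCenter A).obj P) = P := by
    intro P
    have hP := center_isYetterDrinfeldModule P
    refine center_module_ext (congrArg Center.Hom.f (actionMap_moduleMap (centerAct P) hP.coaction))
      fun N => ?_
    refine Eq.trans ?_ (halfBraid_eq_gam P N).symm
    exact congrArg (fun k => coactBraid k N) (coactionMap_moduleMap hP.action (centerCoact P))
  exact Functor.hext h fun P Q f => center_module_hom_heq (h P) (h Q) HEq.rfl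

variable {A} in
-- The two structures live over objects of the centre whose half braidings agree only by a proof, so
-- they are compared as morphisms of `B`.
theorem moduleMap_centerOf_f {M : Center B} {r : M ⊗ mirrorObj A ⟶ M} {κ : M ⟶ mirrorObj A ⊗ M}
    (h : IsYetterDrinfeldModule r κ) : @Eq (M.1 ⊗ A ⊗ Aᘁ ⟶ M.1)
      (moduleMap (centerAct (centerOf h)) (centerCoact (centerOf h))).f (moduleMap r κ).f := by
  refine (moduleMap_f _ _).trans (Eq.trans ?_ (moduleMap_f r κ).symm)
  rw [← halfBraid_eq_gam]
  rfl

theorem ofCenter_toCenter : toCenter A ⋙ ofCenter A = 𝟭 (monad A).Algebra := by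
  have h : ∀ P : (monad A).Algebra, (ofCenter A).obj ((toCenter A).obj P) = P := by
    intro P
    have hP := algebra_isYetterDrinfeldModule P
    refine algebra_ext (centerOf_forget hP) (heq_of_eq ?_)
    have e := congrArg Center.Hom.f (moduleMap_algebra P)
    exact (moduleMap_centerOf_f hP).trans e
  exact Functor.hext h fun P Q f => algebra_hom_heq (h P) (h Q) HEq.rfl

end Functors

end CentralDouble

/-! ### The functor `Ψ` is strict monoidal and braided, and `U` is monadic -/

namespace CentralDouble

variable {B : Type u} [Category.{v} B] [MonoidalCategory B] [BraidedCategory B] [RigidCategory B]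
  (A : B) [HopfObj A] [IsIso (HopfObj.antipode (X := A))]

open MirrorHopfObj

section Comparison

variable {A}

theorem actionMap_tensor (P Q : (monad A).Algebra) : actionMap (strMap (P ⊗ Q)) =
    actTensor (actionMap (strMap P)) (actionMap (strMap Q)) :=
  (congrArg actionMap (dAComul_algebra P Q)).trans
    (actionMap_moduleMap _ (tensor_algebra_isYetterDrinfeldModule P Q).coaction)

theorem coactionMap_tensor (P Q : (monad A).Algebra) : coactionMap (strMap (P ⊗ Q)) =
    coactTensor (coactionMap (strMap P)) (coactionMap (strMap Q)) :=
  (congrArg coactionMap (dAComul_algebra P Q)).trans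
    (coactionMap_moduleMap (tensor_algebra_isYetterDrinfeldModule P Q).action _)

theorem coactBraid_coactTensor {M N : Center B} (κ : M ⟶ mirrorObj A ⊗ M)
    (κ' : N ⟶ mirrorObj A ⊗ N) (U : RightModule A) : coactBraid (coactTensor κ κ') U =
      (α_ M.1 N.1 U.X).hom ≫ M.1 ◁ coactBraid κ' U ≫ (α_ M.1 U.X N.1).inv ≫
        coactBraid κ U ▷ N.1 ≫ (α_ U.X M.1 N.1).hom := by
  rw [coactBraid, gam_coactTensor κ κ' (mirrorAct_isAction U)]
  simp only [Center.comp_f, Center.associator_inv_f]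
  rfl

theorem coactBraid_gu (U : RightModule A) :
    coactBraid (gu (mirrorObj A) (𝟙_ (Center B))) U = (λ_ U.X).hom ≫ (ρ_ U.X).inv := by
  rw [coactBraid, gam_gu (mirrorAct_isAction U), braiding_tensorUnit_left, Center.comp_f,
    Center.rightUnitor_inv_f]
  rfl

theorem toCenter_tensor (P Q : (monad A).Algebra) :
    (toCenter A).obj P ⊗ (toCenter A).obj Q = (toCenter A).obj (P ⊗ Q) := by
  refine center_module_ext ?_ fun N => ?_
  · exact (toModule_tensor_act (algebra_isYetterDrinfeldModule P).action
      (algebra_isYetterDrinfeldModule Q).action).trans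
        (congrArg Center.Hom.f (actionMap_tensor P Q)).symm
  -- The half braiding of a tensor product in the centre is the hexagon composite, which is the half
  -- braiding of `coactTensor`.
  · refine (tensor_half_braiding_aux (coactBraid (coactionMap (strMap P)) N)
      (coactBraid (coactionMap (strMap Q)) N)).trans ?_
    exact (coactBraid_coactTensor _ _ N).symm.trans
      (congrArg (fun k => coactBraid k N) (coactionMap_tensor P Q)).symm

theorem toCenter_unit : 𝟙_ (Center (RightModule A)) = (toCenter A).obj (𝟙_ (monad A).Algebra) := by
  refine center_module_ext ?_ fun N => ?_
  · exact (congrArg Center.Hom.f (actionMap_moduleMap (unitAct A)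
      (unit_isYetterDrinfeldModule A).coaction)).symm
  · exact (coactBraid_gu N).symm.trans (congrArg (fun k => coactBraid k N)
      (coactionMap_moduleMap (unit_isYetterDrinfeldModule A).action _)).symm

/-- When both objects have the same underlying object of `B`, this makes the structure morphisms of
`Ψ` identities there, and coherence is checked as if they were identities. -/
theorem eqToHom_hom {P Q : Center (RightModule A)} (h : P = Q) :
    (eqToHom h).f.hom = eqToHom (congrArg (fun R => R.1.X) h) := by
  subst h
  rfl

theorem toCenter_tensor_hom (P Q : (monad A).Algebra) :
    @Eq (P.A.1 ⊗ Q.A.1 ⟶ P.A.1 ⊗ Q.A.1) (eqToHom (toCenter_tensor P Q)).f.hom (𝟙 _) :=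
  eqToHom_hom _

theorem toCenter_unit_hom :
    @Eq (𝟙_ B ⟶ 𝟙_ B) (eqToHom (toCenter_unit (A := A))).f.hom (𝟙 _) :=
  eqToHom_hom _

theorem center_module_whiskerRight {P P' : Center (RightModule A)} (f : P ⟶ P')
    (Q : Center (RightModule A)) : (f ▷ Q).f.hom = f.f.hom ▷ Q.1.X := tensorHom_id _ _

theorem center_module_whiskerLeft (P : Center (RightModule A)) {Q Q' : Center (RightModule A)}
    (f : Q ⟶ Q') : (P ◁ f).f.hom = P.1.X ◁ f.f.hom := id_tensorHom _ _

variable (A)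

/-- The functor to the center of `A`-modules is monoidal, with identities as structure morphisms. -/
def toCenterCoreMonoidal : (toCenter A).CoreMonoidal where
  εIso := eqToIso toCenter_unit
  μIso P Q := eqToIso (toCenter_tensor P Q)
  μIso_hom_natural_left {P P'} f Q := by
    apply Center.ext
    apply RightModule.hom_ext
    simp only [Center.comp_f, RightModule.comp_hom, center_module_whiskerRight, eqToIso.hom]
    rw [toCenter_tensor_hom, toCenter_tensor_hom]
    change f.f.f ▷ Q.A.1 ≫ 𝟙 _ = 𝟙 _ ≫ (f.f ⊗ₘ 𝟙 Q.A).f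
    rw [tensorHom_id, Category.comp_id, Category.id_comp]
    rfl
  μIso_hom_natural_right {P P'} Q f := by
    apply Center.ext
    apply RightModule.hom_ext
    simp only [Center.comp_f, RightModule.comp_hom, center_module_whiskerLeft, eqToIso.hom]
    rw [toCenter_tensor_hom, toCenter_tensor_hom]
    change Q.A.1 ◁ f.f.f ≫ 𝟙 _ = 𝟙 _ ≫ (𝟙 Q.A ⊗ₘ f.f).f
    rw [id_tensorHom, Category.comp_id, Category.id_comp]
    rfl
  associativity P Q R := by
    apply Center.ext
    apply RightModule.hom_ext
    simp only [Center.comp_f, RightModule.comp_hom, center_module_whiskerLeft,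
      center_module_whiskerRight, eqToIso.hom]
    rw [toCenter_tensor_hom, toCenter_tensor_hom, toCenter_tensor_hom, toCenter_tensor_hom]
    change 𝟙 (P.A.1 ⊗ Q.A.1) ▷ R.A.1 ≫ 𝟙 _ ≫ (α_ P.A.1 Q.A.1 R.A.1).hom =
      (α_ P.A.1 Q.A.1 R.A.1).hom ≫ P.A.1 ◁ 𝟙 (Q.A.1 ⊗ R.A.1) ≫ 𝟙 _
    simp
  left_unitality P := by
    apply Center.ext
    apply RightModule.hom_ext
    simp only [Center.comp_f, RightModule.comp_hom, center_module_whiskerRight, eqToIso.hom]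
    rw [toCenter_tensor_hom, toCenter_unit_hom]
    change (λ_ P.A.1).hom = 𝟙 (𝟙_ B) ▷ P.A.1 ≫ 𝟙 _ ≫ (λ_ P.A.1).hom
    simp
  right_unitality P := by
    apply Center.ext
    apply RightModule.hom_ext
    simp only [Center.comp_f, RightModule.comp_hom, center_module_whiskerLeft, eqToIso.hom]
    rw [toCenter_tensor_hom, toCenter_unit_hom]
    change (ρ_ P.A.1).hom = P.A.1 ◁ 𝟙 (𝟙_ B) ≫ 𝟙 _ ≫ (ρ_ P.A.1).hom
    simp

instance toCenterMonoidal : (toCenter A).Monoidal := (toCenterCoreMonoidal A).toMonoidal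

/-- The braiding of modules over the central double. -/
@[reducible]
def algebraBraided : BraidedCategory (monad A).Algebra := (rMatrix A).braidedCategory

attribute [local instance] algebraBraided

theorem toCenter_braiding (P Q : (monad A).Algebra) :
    @Eq (P.A.1 ⊗ Q.A.1 ⟶ Q.A.1 ⊗ P.A.1) ((toCenter A).map (β_ P Q).hom).f.hom
      (β_ ((toCenter A).obj P) ((toCenter A).obj Q)).hom.f.hom :=
  congrArg Center.Hom.f (dAR_comp (strMap P) (strMap Q)) |>.trans (by
    rw [gam_f]
    refine Eq.trans ?_ (gam_f _ _).symm
    rfl)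

instance toCenterBraided : (toCenter A).Braided where
  toMonoidal := toCenterMonoidal A
  braided P Q := by
    apply Center.ext
    apply RightModule.hom_ext
    change (eqToHom (toCenter_tensor P Q)).f.hom ≫ ((toCenter A).map (β_ P Q).hom).f.hom =
      (β_ ((toCenter A).obj P) ((toCenter A).obj Q)).hom.f.hom ≫
        (eqToHom (toCenter_tensor Q P)).f.hom
    rw [toCenter_tensor_hom, toCenter_tensor_hom]
    exact (Category.id_comp _).trans ((toCenter_braiding A P Q).trans (Category.comp_id _).symm)

theorem toCenter_isStrictMonoidal : IsStrictMonoidal (toCenter A) where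
  unit := ⟨toCenter_unit, rfl⟩
  tensor P Q := ⟨toCenter_tensor P Q, rfl⟩

theorem forget_isStrictMonoidal {C : Type u₁} [Category.{v₁} C] [MonoidalCategory C] (T : Monad C)
    [Bimonad T] : IsStrictMonoidal T.forget where
  unit := ⟨rfl, rfl⟩
  tensor _ _ := ⟨rfl, rfl⟩

theorem center_hom_heq {P P' Q Q' : Center B} (hP : P = P') (hQ : Q = Q') {f : P ⟶ Q}
    {g : P' ⟶ Q'} (h : f.f ≍ g.f) : f ≍ g := by
  subst hP hQ
  exact heq_of_eq (Center.ext _ _ (eq_of_heq h))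

theorem center_eqToHom_f {P Q : Center B} (h : P = Q) :
    (eqToHom h).f = eqToHom (congrArg (fun R => R.1) h) := by
  subst h
  rfl

theorem forgetCenter_isStrictMonoidal : IsStrictMonoidal (forgetCenter A) where
  unit :=
    have h : 𝟙_ (Center B) = (forgetCenter A).obj (𝟙_ (Center (RightModule A))) :=
      congrArg (Sigma.mk (𝟙_ B)) (halfBraiding_ext fun _ => rfl)
    ⟨h, Center.ext _ _ (center_eqToHom_f h).symm⟩
  tensor P Q :=
    have h : (forgetCenter A).obj P ⊗ (forgetCenter A).obj Q = (forgetCenter A).obj (P ⊗ Q) :=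
      congrArg (Sigma.mk (P.1.X ⊗ Q.1.X))
        (halfBraiding_ext fun U => (forgetCenter_tensor A P Q U).symm)
    ⟨h, Center.ext _ _ (center_eqToHom_f h).symm⟩

/-- The functor `forgetCenter A` is by definition `ofCenter A` followed by the forgetful functor,
since the inverse of `Ψ` keeps the underlying object of the centre. Hence it is also a transported
forgetful functor in `forgetCenterMonadic`. -/
theorem toCenter_forgetCenter : toCenter A ⋙ forgetCenter A = (monad A).forget :=
  congrArg (· ⋙ (monad A).forget) (ofCenter_toCenter A)

theorem toCenter_forgetCenter_monoidal :
    EqAsMonoidalFunctors (toCenter A ⋙ forgetCenter A) (monad A).forget where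
  functor_eq := toCenter_forgetCenter A
  unit_eq := by
    have h : 𝟙 (𝟙_ B) ≫ (eqToHom (toCenter_unit (A := A))).f.hom = 𝟙 (𝟙_ B) := by
      rw [toCenter_unit_hom]
      exact Category.comp_id _
    apply center_hom_heq rfl (congrArg (fun F => F.obj (𝟙_ _)) (toCenter_forgetCenter A))
    exact heq_of_eq h
  tensor_eq P Q := by
    have h : 𝟙 (P.A.1 ⊗ Q.A.1) ≫ (eqToHom (toCenter_tensor P Q)).f.hom =
        𝟙 (P.A.1 ⊗ Q.A.1) := by
      rw [toCenter_tensor_hom]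
      exact Category.comp_id _
    apply center_hom_heq (congrArg (fun F => F.obj P ⊗ F.obj Q) (toCenter_forgetCenter A))
      (congrArg (fun F => F.obj (P ⊗ Q)) (toCenter_forgetCenter A))
    exact heq_of_eq h

theorem toCenter_obj (P : (monad A).Algebra) : ∃ h₁ h₂ c, (toCenter A).obj P =
      ⟨⟨P.A.1, actionOf A P.A (strMap P).f, h₁, h₂⟩, c⟩ ∧
    ∀ N : RightModule A, (c.β N).hom.hom = gammaOf A P.A (strMap P).f N := by
  -- The half braiding depends on the module, so the action is varied over all morphisms equal to it
  -- before the formula is substituted.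
  have key : ∀ a : P.A.1 ⊗ A ⟶ P.A.1, (actionMap (strMap P)).f = a → ∃ h₁ h₂ c,
      (toCenter A).obj P = ⟨⟨P.A.1, a, h₁, h₂⟩, c⟩ ∧
      ∀ N : RightModule A, (c.β N).hom.hom = gammaOf A P.A (strMap P).f N := by
    rintro _ rfl
    exact ⟨_, _, _, rfl, fun N => gam_coactionMap_f (strMap P) N⟩
  exact key _ (actionMap_f (strMap P))

/-- The equivalence of modules over the central double with the center of `A`-modules. -/
def centerEquiv : (monad A).Algebra ≌ Center (RightModule A) :=
  CategoryTheory.Equivalence.mk (toCenter A) (ofCenter A) (eqToIso (ofCenter_toCenter A).symm)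
    (eqToIso (toCenter_ofCenter A))

/-- The forgetful functor between the centers is monadic. -/
@[reducible]
def forgetCenterMonadic : MonadicRightAdjoint (forgetCenter A) :=
  transportMonadic (centerEquiv A)

end Comparison

end CentralDouble

end

theorem mainTheorem1 {B : Type u} [Category.{v} B] [MonoidalCategory B] [BraidedCategory B]
    [RigidCategory B] (A : B) [HopfObj A] [IsIso (HopfObj.antipode (X := A))] :
    ∃ (S : MonadStructureOn (CentralDouble.dA A)) (_ : Bimonad S.toMonad)
      (_ : Bimonad.IsHopfMonad S.toMonad) (Q : RMatrix S.toMonad),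
      (∀ M : Center B, Center.Hom.f (S.mul.app M) = CentralDouble.mul A M) ∧
      (∀ M : Center B, Center.Hom.f (S.one.app M) = CentralDouble.one A M) ∧
      (∀ M N : Center B,
        Center.Hom.f (Bimonad.comul S.toMonad M N) = CentralDouble.comul A M N) ∧
      Center.Hom.f (Bimonad.counit S.toMonad) = CentralDouble.counit A ∧
      (∀ M N : Center B, Center.Hom.f (Q.R M N) = CentralDouble.R A M N) ∧
      ∃ (Ψ : S.toMonad.Algebra ⥤ Center (RightModule A))
        (Φ : Center (RightModule A) ⥤ S.toMonad.Algebra),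
        -- `Ψ` is given on objects by the formulas for `r` and `γ`, and by `f ↦ f` on morphisms
        (∀ P : S.toMonad.Algebra, ∃ h₁ h₂ γ,
          Ψ.obj P =
            ⟨⟨P.A.1, CentralDouble.actionOf A P.A (Center.Hom.f P.a), h₁, h₂⟩, γ⟩ ∧
          ∀ N : RightModule A,
            (γ.β N).hom.hom = CentralDouble.gammaOf A P.A (Center.Hom.f P.a) N) ∧
        (∀ {P P' : S.toMonad.Algebra} (f : P ⟶ P'), (Ψ.map f).f.hom ≍ f.f.f) ∧
        -- `Φ` is given on objects by the formulas for `σ` and `ρ`, and by `f ↦ f` on morphisms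
        (∀ P : Center (RightModule A), ∃ ρ h₁ h₂,
          Φ.obj P = ⟨(forgetCenter A).obj P, ρ, h₁, h₂⟩ ∧
          Center.Hom.f ρ = CentralDouble.rhoOf A P) ∧
        (∀ {P P' : Center (RightModule A)} (f : P ⟶ P'), (Φ.map f).f.f ≍ f.f.hom) ∧
        -- `Ψ` is an isomorphism of categories with inverse `Φ`
        Ψ ⋙ Φ = 𝟭 S.toMonad.Algebra ∧
        Φ ⋙ Ψ = 𝟭 (Center (RightModule A)) ∧
        -- `Ψ` is braided strict monoidal and commutes with the strict monoidal functors to `Z(B)`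
        (letI : BraidedCategory S.toMonad.Algebra := Q.braidedCategory
         ∃ _ : Ψ.Braided,
          IsStrictMonoidal Ψ ∧
          IsStrictMonoidal S.toMonad.forget ∧
          IsStrictMonoidal (forgetCenter A) ∧
          EqAsMonoidalFunctors (Ψ ⋙ forgetCenter A) S.toMonad.forget) ∧
        Nonempty (MonadicRightAdjoint (forgetCenter A)) := by
  open CentralDouble in
  refine ⟨monadStructure A, bimonad A, isHopfMonad, rMatrix A, dAMul_f A, dAOne_f A, dAComul_f A,
    dACounit_f A, dAR_f A, toCenter A, ofCenter A, fun P => ?_, fun _ => HEq.rfl, fun P => ?_,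
    fun _ => HEq.rfl, ofCenter_toCenter A, toCenter_ofCenter A,
    ⟨toCenterBraided A, toCenter_isStrictMonoidal A, forget_isStrictMonoidal _,
      forgetCenter_isStrictMonoidal A, toCenter_forgetCenter_monoidal A⟩,
    ⟨forgetCenterMonadic A⟩⟩
  · exact toCenter_obj A P
  · exact ⟨_, _, _, rfl, moduleMap_center_f P⟩
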